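/- \textbf{Setting.} Let $d\ge 1$, $\mathbb I^d=[0,1]^d$, $0<p,\theta,q\le\infty$, $r\in\mathbb N$, $x_+=\max(x,0)$, and let $a\in\mathbb R^d$ satisfy $$1/p<a_1<a_2\le\dots\le a_d<r$$ (for $d=1$: $1/p<a_1<r$). Fix $\varepsilon>0$ with $\varepsilon<a_2-a_1$ (any $\varepsilon>0$ if $d=1$). \emph{Besov class.} For $e\subset\{1,\dots,d\}$ let $\Delta_h^{r,e}$ be the composition of the $r$-th forward differences with step $h_i$ in the variables $x_i$, $i\in e$, and $\omega_r^e(f,t)_p=\sup_{|h_i|<t_i,\,i\in e}\|\Delta_h^{r,e}f\|_{L_p(\{x\in\mathbb I^d:\ x_i+rh_i\in[0,1],\ i\in e\})}$. Put $$\|f\|_{B^a_{p,\theta}}=\sum_{e\subset\{1,\dots,d\}}\Big(\int_{\mathbb I^d}\Big\{\omega_r^e(f,t)_p\prod_{i\in e}t_i^{-a_i}\Big\}^\theta\prod_{i\in e}t_i^{-1}\,dt\Big)^{1/\theta}$$ (supremum over $t\in\mathbb I^d$ if $\theta=\infty$), and let $U^a_{p,\theta}$ be the set of continuous functions $f$ on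 $\mathbb I^d$ with $\|f\|_{B^a_{p,\theta}}\le1$. \emph{Optimal recovery.} For a class $W$ of functions on $\mathbb I^d$, $$r_n(W,L_q)=\inf_{x^j,\varphi_j}\ \sup_{f\in W}\Big\|f-\sum_{j=1}^nf(x^j)\varphi_j\Big\|_{L_q(\mathbb I^d)},\qquad \varrho_n(W,L_q)=\inf_{x^j,P}\ \sup_{f\in W}\big\|f-P(f(x^1),\dots,f(x^n))\big\|_{L_q(\mathbb I^d)},$$ over $x^1,\dots,x^n\in\mathbb I^d$, $\varphi_1,\dots,\varphi_n\in L_q(\mathbb I^d)$ and arbitrary maps $P:\mathbb R^n\to L_q(\mathbb I^d)$. \emph{Quasi-interpolation.} Let $M$ be the centered B-spline of order $r$ with integer-spaced knots and support $[-r/2,r/2]$. Let $\mu\ge r/2-1$ be a nonnegative integer and let $\lambda(j)$, $|j|\le\mu$, be an even real sequence such that $Q(f,x)=\sum_{s\in\mathbb Z}\sum_{|j|\le\mu}\lambda(j)f(s-j)M(x-s)$ reproduces all polynomials of degree at most $r-1$. For $k\ge0$ and $f$ on $[0,1]$ let $\bar f_k$ be the extension of $f$ to $\mathbb R$ which, to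 the left (right) of $[0,1]$, is the Lagrange polynomial interpolating $f$ at the first (last) $\min(r,2^k+1)$ of the points $0,2^{-k},\dots,1$. Put $Q_k(f,x)=Q(\bar f_k(2^{-k}\,\cdot),2^kx)$, $Q_{-1}=0$. For $k\in\mathbb Z_+^d$ let $q_k=\prod_{i=1}^d(Q_{k_i}-Q_{k_i-1})$, the $i$-th factor acting in the variable $x_i$. For finite $\Delta\subset\mathbb Z^d_+$ put $$R_\Delta(f)=\sum_{k\in\Delta}q_k(f),\qquad G(\Delta)=\{2^{-k}s=(2^{-k_i}s_i)_{i}:\ k\in\Delta,\ s\in\mathbb Z^d,\ 0\le s_i\le2^{k_i}\}.$$ Let $M^{(r)}_{k,s}(x)=\prod_iM(2^{k_i}x_i-s_i)$ for even $r$ and $M^{(r)}_{k,s}(x)=\prod_iM(2^{k_i}x_i-s_i/2)$ for odd $r$, $s\in\mathbb Z^d$. \emph{Index sets.} Let $A$ be the set of triples $(p,\theta,q)$ with ($p\ge q$, $\theta\le\min(q,1)$) or ($p<q<\infty$, $\theta\le q$) or ($p<q=\infty$, $\theta\le1$). For $\xi\ge0$ let $$\Delta'(\xi)=\{k\in\mathbb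 Z^d_+:\ (a',k)-(1/p-1/q)_+\,(k_1+\dots+k_d)\le\xi\},$$ with $a'=a$ if $(p,\theta,q)\in A$ and $a'=(a_1,a_2-\varepsilon,\dots,a_d-\varepsilon)$ otherwise. For $n\in\mathbb N$ let $\xi_n\ge0$ be a number for which $\Delta'(\xi_n)$ is the largest among the sets $\Delta'(\xi)$, $\xi\ge0$, with $|G(\Delta'(\xi))|\le n$. \textbf{Theorem.} (i) Such a $\xi_n$ exists for every $n\ge2^d$. (ii) $R_{\Delta'(\xi_n)}$ is a linear sampling algorithm on the sparse grid $G(\Delta'(\xi_n))$: there are $N\in\mathbb N$ and functions $\psi_{k,s}$ ($k\in\mathbb Z_+^d$, $0\le s_i\le2^{k_i}$), each a linear combination of at most $N$ of the B-splines $M^{(r)}_{k,s'}$ that do not vanish identically on $\mathbb I^d$, such that whenever $\xi_n$ is as above, $$R_{\Delta'(\xi_n)}(f)=\sum_{k\in\Delta'(\xi_n)}\ \sum_{0\le s_i\le2^{k_i}}f(2^{-k}s)\,\psi_{k,s}\quad\text{on }\mathbb I^d\text{ for all functions }f,$$ and $R_{\Delta'(\xi_n)}(f)$ can be written on $\mathbb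 I^d$ as $\sum_{j=1}^nf(x^j)\varphi_j$ with $\{x^1,\dots,x^n\}=G(\Delta'(\xi_n))$ and $\varphi_j\in L_q(\mathbb I^d)$ independent of $f$. (iii) This algorithm is asymptotically optimal and no logarithmic factor occurs: $$\sup_{f\in U^a_{p,\theta}}\|f-R_{\Delta'(\xi_n)}(f)\|_{L_q(\mathbb I^d)}\ \asymp\ r_n(U^a_{p,\theta},L_q)\ \asymp\ \varrho_n(U^a_{p,\theta},L_q)\ \asymp\ n^{-a_1+(1/p-1/q)_+},$$ with constants independent of $n$; the last two relations hold for all $n\ge1$, the first for all $n$ for which $\xi_n$ exists. -/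

import Mathlib

open MeasureTheory
open scoped ENNReal

noncomputable section

namespace SparseGrid

/-! ### The cube and operators acting coordinate by coordinate -/

/-- The unit cube `[0,1]^d`. -/
def cube (d : ℕ) : Set (Fin d → ℝ) := Set.Icc 0 1

/-- Lebesgue measure on the unit cube. -/
def cubeMeasure (d : ℕ) : Measure (Fin d → ℝ) := volume.restrict (cube d)

/-- The univariate operator `T` applied to `f` as a function of the variable `x i`,
the other variables being held fixed. -/
def coordOp {d : ℕ} (i : Fin d) (T : (ℝ → ℝ) → ℝ → ℝ) (f : (Fin d → ℝ) → ℝ) :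
    (Fin d → ℝ) → ℝ :=
  fun x => T (fun y => f (Function.update x i y)) (x i)

/-- The product `T₁ T₂ ⋯ T_d`, where `T i` acts in the `i`-th variable. -/
def tensorOp {d : ℕ} (T : Fin d → (ℝ → ℝ) → ℝ → ℝ) (f : (Fin d → ℝ) → ℝ) :
    (Fin d → ℝ) → ℝ :=
  (List.finRange d).foldr (fun i g => coordOp i (T i) g) f

/-! ### The Besov space of mixed smoothness -/

/-- The mixed difference of order `r` with step `h i` in each variable `i ∈ e`. -/
def mixedDiff {d : ℕ} (r : ℕ) (e : Finset (Fin d)) (h : Fin d → ℝ) (f : (Fin d → ℝ) → ℝ) :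
    (Fin d → ℝ) → ℝ :=
  tensorOp (fun i g => if i ∈ e then (fwdDiff (h i))^[r] g else g) f

/-- The points of the cube at which the mixed difference only uses points of the cube. -/
def diffDomain {d : ℕ} (r : ℕ) (e : Finset (Fin d)) (h : Fin d → ℝ) : Set (Fin d → ℝ) :=
  {x | x ∈ cube d ∧ ∀ i ∈ e, x i + r * h i ∈ Set.Icc (0 : ℝ) 1}

/-- The mixed modulus of smoothness `ω_r^e(f,t)_p`. -/
def mixedModulus {d : ℕ} (r : ℕ) (p : ℝ≥0∞) (e : Finset (Fin d)) (f : (Fin d → ℝ) → ℝ)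
    (t : Fin d → ℝ) : ℝ≥0∞ :=
  ⨆ (h : Fin d → ℝ) (_ : ∀ i ∈ e, |h i| < t i),
    eLpNorm (mixedDiff r e h f) p (volume.restrict (diffDomain r e h))

/-- `ω_r^e(f,t)_p / ∏_{i ∈ e} t_i^{a_i}`. -/
def modulusRatio {d : ℕ} (r : ℕ) (p : ℝ≥0∞) (a : Fin d → ℝ) (e : Finset (Fin d))
    (f : (Fin d → ℝ) → ℝ) (t : Fin d → ℝ) : ℝ≥0∞ :=
  mixedModulus r p e f t / ENNReal.ofReal (∏ i ∈ e, t i ^ a i)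

/-- The part of the Besov quasi-norm that belongs to the set `e` of variables. -/
def besovSeminorm {d : ℕ} (r : ℕ) (p θ : ℝ≥0∞) (a : Fin d → ℝ) (e : Finset (Fin d))
    (f : (Fin d → ℝ) → ℝ) : ℝ≥0∞ :=
  if θ = ⊤ then ⨆ t ∈ cube d, modulusRatio r p a e f t
  else (∫⁻ t in cube d, modulusRatio r p a e f t ^ θ.toReal *
    ∏ i ∈ e, (ENNReal.ofReal (t i))⁻¹) ^ (1 / θ.toReal)

/-- The quasi-norm of the Besov space `B^a_{p,θ}` of mixed smoothness `a` on the cube. -/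
def besovNorm {d : ℕ} (r : ℕ) (p θ : ℝ≥0∞) (a : Fin d → ℝ) (f : (Fin d → ℝ) → ℝ) : ℝ≥0∞ :=
  ∑ e : Finset (Fin d), besovSeminorm r p θ a e f

/-- The unit ball `U^a_{p,θ}`. The elements are sampled at points, so each class modulo null sets
is represented by its continuous representative. -/
def besovBall {d : ℕ} (r : ℕ) (p θ : ℝ≥0∞) (a : Fin d → ℝ) : Set ((Fin d → ℝ) → ℝ) :=
  {f | ContinuousOn f (cube d) ∧ besovNorm r p θ a f ≤ 1}

/-! ### Optimal sampling recovery -/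

/-- The linear sampling algorithm `L_n(X_n,Φ_n,f) = ∑_j f(x^j) φ_j`. -/
def samplingAlgorithm {d n : ℕ} (X : Fin n → cube d) (Φ : Fin n → (Fin d → ℝ) → ℝ)
    (f : (Fin d → ℝ) → ℝ) : (Fin d → ℝ) → ℝ :=
  fun x => ∑ j, f (X j) * Φ j x

/-- The worst-case error over `W`, in the quasi-norm of `L_q` of the cube, of the method `A`. -/
def worstError {d : ℕ} (W : Set ((Fin d → ℝ) → ℝ)) (q : ℝ≥0∞)
    (A : ((Fin d → ℝ) → ℝ) → (Fin d → ℝ) → ℝ) : ℝ≥0∞ :=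
  ⨆ f ∈ W, eLpNorm (fun x => f x - A f x) q (cubeMeasure d)

/-- `r_n(W, L_q)`: the optimal error of linear sampling algorithms using `n` values. -/
def linearSamplingNumber {d : ℕ} (n : ℕ) (W : Set ((Fin d → ℝ) → ℝ)) (q : ℝ≥0∞) : ℝ≥0∞ :=
  ⨅ (X : Fin n → cube d) (Φ : Fin n → (Fin d → ℝ) → ℝ)
    (_ : ∀ j, MemLp (Φ j) q (cubeMeasure d)), worstError W q (samplingAlgorithm X Φ)

/-- `ϱ_n(W, L_q)`: the optimal error of arbitrary methods `f ↦ P(f(x^1),…,f(x^n))`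
with `P : ℝ^n → L_q`. -/
def samplingNumber {d : ℕ} (n : ℕ) (W : Set ((Fin d → ℝ) → ℝ)) (q : ℝ≥0∞) : ℝ≥0∞ :=
  ⨅ (X : Fin n → cube d) (P : (Fin n → ℝ) → (Fin d → ℝ) → ℝ)
    (_ : ∀ y, MemLp (P y) q (cubeMeasure d)), worstError W q (fun f => P (fun j => f (X j)))

/-! ### B-splines and quasi-interpolation -/

/-- The cardinal B-spline of order `r` with knots `0, 1, …, r`, by the Cox–de Boor recursion. -/
def cardinalBSpline : ℕ → ℝ → ℝ
  | 0, _ => 0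
  | 1, x => if 0 ≤ x ∧ x < 1 then 1 else 0
  | n + 2, x => (x * cardinalBSpline (n + 1) x +
      ((n : ℝ) + 2 - x) * cardinalBSpline (n + 1) (x - 1)) / ((n : ℝ) + 1)

/-- The centered B-spline `M` of order `r`, with support `[-r/2, r/2]`. -/
def centeredBSpline (r : ℕ) (x : ℝ) : ℝ := cardinalBSpline r (x + r / 2)

/-- The `d`-variate B-spline `M^{(r)}_{k,s}`: integer translates of dyadic dilations for even `r`,
half-integer translates for odd `r`. -/
def dilatedBSpline {d : ℕ} (r : ℕ) (k : Fin d → ℕ) (s : Fin d → ℤ) (x : Fin d → ℝ) : ℝ :=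
  ∏ i, if Even r then centeredBSpline r (2 ^ k i * x i - s i)
    else centeredBSpline r (2 ^ k i * x i - s i / 2)

/-- The operator `Q(f,x) = ∑_s Λ(f,s) M(x-s)` with `Λ(f,s) = ∑_{|j| ≤ μ} λ(j) f(s-j)`; for each
`x` only finitely many terms are nonzero. -/
def quasiOp (r μ : ℕ) (lam : ℤ → ℝ) (f : ℝ → ℝ) (x : ℝ) : ℝ :=
  ∑ᶠ s : ℤ, (∑ j ∈ Finset.Icc (-(μ : ℤ)) μ, lam j * f ((s : ℝ) - j)) * centeredBSpline r (x - s)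

/-- `λ` is even, `μ ≥ r/2 - 1`, and the operator `Q` reproduces polynomials of degree at most
`r - 1`. -/
structure IsQuasiInterpolation (r μ : ℕ) (lam : ℤ → ℝ) : Prop where
  le_mu : (r : ℝ) / 2 - 1 ≤ μ
  even : ∀ j : ℤ, |j| ≤ μ → lam (-j) = lam j
  reproduces : ∀ P : Polynomial ℝ, P.degree < r → ∀ x : ℝ,
    quasiOp r μ lam (fun y => P.eval y) x = P.eval x

/-- The Lagrange polynomial interpolating `f` at the first `r` of the points `0, 2^{-k}, …, 1`
(at all of them if there are fewer than `r`). -/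
def leftPoly (r k : ℕ) (f : ℝ → ℝ) : Polynomial ℝ :=
  Lagrange.interpolate (Finset.range (min r (2 ^ k + 1))) (fun j : ℕ => (j : ℝ) / 2 ^ k)
    (fun j : ℕ => f ((j : ℝ) / 2 ^ k))

/-- The Lagrange polynomial interpolating `f` at the last `r` of the points `0, 2^{-k}, …, 1`
(at all of them if there are fewer than `r`). -/
def rightPoly (r k : ℕ) (f : ℝ → ℝ) : Polynomial ℝ :=
  Lagrange.interpolate (Finset.range (min r (2 ^ k + 1))) (fun j : ℕ => 1 - (j : ℝ) / 2 ^ k)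
    (fun j : ℕ => f (1 - (j : ℝ) / 2 ^ k))

/-- The extension of a function on `[0,1]` to the real line by Lagrange polynomials. -/
def extend (r k : ℕ) (f : ℝ → ℝ) (x : ℝ) : ℝ :=
  if x < 0 then (leftPoly r k f).eval x
  else if x ≤ 1 then f x
  else (rightPoly r k f).eval x

/-- The univariate operator `Q_k` of level `k` for functions on `[0,1]`. -/
def levelOp (r μ : ℕ) (lam : ℤ → ℝ) (k : ℕ) (f : ℝ → ℝ) (x : ℝ) : ℝ :=
  quasiOp r μ lam (fun y => extend r k f (y / 2 ^ k)) (2 ^ k * x)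

/-- The univariate operator `Q_k - Q_{k-1}`, with `Q_{-1} = 0`. -/
def levelDiff (r μ : ℕ) (lam : ℤ → ℝ) : ℕ → (ℝ → ℝ) → ℝ → ℝ
  | 0, f, x => levelOp r μ lam 0 f x
  | k + 1, f, x => levelOp r μ lam (k + 1) f x - levelOp r μ lam k f x

/-- The mixed operator `q_k = ∏_i (Q_{k_i} - Q_{k_i - 1})`. -/
def mixedLevelDiff {d : ℕ} (r μ : ℕ) (lam : ℤ → ℝ) (k : Fin d → ℕ) (f : (Fin d → ℝ) → ℝ) :
    (Fin d → ℝ) → ℝ :=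
  tensorOp (fun i => levelDiff r μ lam (k i)) f

/-- The operator `R_Δ(f) = ∑_{k ∈ Δ} q_k(f)`, for a finite set `Δ`. -/
def sparseOp {d : ℕ} (r μ : ℕ) (lam : ℤ → ℝ) (Δ : Set (Fin d → ℕ)) (f : (Fin d → ℝ) → ℝ)
    (x : Fin d → ℝ) : ℝ :=
  ∑ᶠ k ∈ Δ, mixedLevelDiff r μ lam k f x

/-! ### Sparse grids -/

/-- The indices `s` with `0 ≤ s_i ≤ 2^{k_i}`. -/
def gridIndices {d : ℕ} (k : Fin d → ℕ) : Finset (Fin d → ℕ) :=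
  Fintype.piFinset fun i => Finset.range (2 ^ k i + 1)

/-- The point `2^{-k} s`. -/
def gridPoint {d : ℕ} (k s : Fin d → ℕ) : Fin d → ℝ := fun i => (s i : ℝ) / 2 ^ k i

/-- The grid `G(Δ) = {2^{-k} s : k ∈ Δ, 0 ≤ s_i ≤ 2^{k_i}}`. -/
def grid {d : ℕ} (Δ : Set (Fin d → ℕ)) : Set (Fin d → ℝ) :=
  {x | ∃ k ∈ Δ, ∃ s ∈ gridIndices k, x = gridPoint k s}

/-- `(1/p - 1/q)_+`. -/
def gap (p q : ℝ≥0∞) : ℝ := max 0 ((p⁻¹).toReal - (q⁻¹).toReal)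

/-- The set `A` of triples `(p,θ,q)`. -/
def InClassA (p θ q : ℝ≥0∞) : Prop :=
  (q ≤ p ∧ θ ≤ min q 1) ∨ (p < q ∧ q ≠ ⊤ ∧ θ ≤ q) ∨ (p < q ∧ q = ⊤ ∧ θ ≤ 1)

open Classical in
/-- The smoothness vector entering the index set: `a` for triples in `A`, and otherwise
`a(ε) = (a_1, a_2 - ε, …, a_d - ε)`. -/
def gridSmoothness {d : ℕ} [NeZero d] (p θ q : ℝ≥0∞) (a : Fin d → ℝ) (ε : ℝ) (i : Fin d) : ℝ :=
  if InClassA p θ q ∨ i = 0 then a i else a i - ε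

/-- The index set `Δ'(ξ)`. -/
def sparseIndexSet {d : ℕ} [NeZero d] (p θ q : ℝ≥0∞) (a : Fin d → ℝ) (ε ξ : ℝ) :
    Set (Fin d → ℕ) :=
  {k | ∑ i, gridSmoothness p θ q a ε i * k i - gap p q * ∑ i, (k i : ℝ) ≤ ξ}

/-- `ξ ≥ 0` is a level for which `Δ'(ξ)` is the largest of the sets `Δ'(ξ')`, `ξ' ≥ 0`, with
`|G(Δ'(ξ'))| ≤ n`. (The set `Δ'(ξ)` is constant between jumps and includes its jump points, so it
is the set `Δ'(ξ)`, not the number `ξ`, that attains the maximum.) -/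
def IsLargestLevel {d : ℕ} [NeZero d] (p θ q : ℝ≥0∞) (a : Fin d → ℝ) (ε : ℝ) (n : ℕ) (ξ : ℝ) :
    Prop :=
  0 ≤ ξ ∧ (grid (sparseIndexSet p θ q a ε ξ)).encard ≤ n ∧
    ∀ ξ' : ℝ, 0 ≤ ξ' → (grid (sparseIndexSet p θ q a ε ξ')).encard ≤ n →
      sparseIndexSet p θ q a ε ξ' ⊆ sparseIndexSet p θ q a ε ξ

/-- The positive quantity `A` lies between `c · n^s` and `C · n^s`. -/
def HasOrder (c C : ℝ) (n : ℕ) (s : ℝ) (A : ℝ≥0∞) : Prop :=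
  ENNReal.ofReal (c * (n : ℝ) ^ s) ≤ A ∧ A ≤ ENNReal.ofReal (C * (n : ℝ) ^ s)

end SparseGrid

end

noncomputable section

namespace SparseGrid

/-! ### Finite linear functionals and their tensor products -/

/-! The upper bound rests on three facts: the block `q_k f` has small `L_p`-norm, blocks of
different levels add up well in `L_q`, and the index sets contain few points. The lower bound uses
functions of the first variable alone.

Blocks. All operators are, pointwise on the cube, tensor products of finitely supported functionals
(`tensorEval`), so univariate information multiplies. At levels above a fixed `κ`, `Q_k - Q_{k-1}`
is local, has bounded coefficients and kills polynomials of degree less than `r`; hence it is a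
bounded combination of a few differences of order `r` on the grid (`exists_diffFunctional_sum`,
`exists_levelDiffFunctional_eq`). These are point values, while the class controls only
`L_p`-moduli. The bridge is a telescoping expansion: a grid functional is extrapolated from finer
and finer grids, all shifted by one parameter `w`, and consecutive extrapolations differ by
differences of order `r` (`exists_extrapolation_sub_eq`, `exists_scalePart_eq`). Averaging over `w`
turns point values of mixed differences into integrals over disjoint boxes
(`lintegral_halfCube_shift`, `sum_lintegral_shiftTerm_le`). A scale `l` below the grid costs
`2^{|l|/p}`, up to an arbitrarily small power, and `a_1 > 1/p` pays for it. The outcome is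
`exists_weighted_block_le`: the weighted norms `2^{(a,k)} ‖q_k f‖_p` are dominated by weighted
dyadic moduli, smoothed by an exponentially decaying kernel. They are therefore bounded, and
`ℓ_ρ`-summable for every finite `ρ ≥ θ`.

Summation in `L_q`. The blocks are majorized by functions constant on dyadic cells. For these,
passing from `L_p` to `L_q` costs `2^{(1/p-1/q)_+ |k|}` (`eLpNorm_comp_cell_le`). In general norms
are added with exponent `min(q,1)`, but for `p < q < ∞` near-orthogonality of different levels
allows exponent `q` (`exists_lintegral_sum_cell_le`). For triples in `A` the parameter `θ` is small
enough for the relevant summation; otherwise the loss of `ε` in the directions other than the first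
makes a geometric series converge (`exists_bound_tsum_tail`). In both cases the error of `R_{Δ'(ξ)}`
is at most a constant times `2^{-ξ}` (`exists_worstError_sparseOp_le`).

Counting. The first weight `a_1 - (1/p-1/q)_+` is strictly the smallest, so the sum of `2^{|k|}`
over `Δ'(ξ)` is a geometric series of size `2^{ξ/weight}` with no power of `ξ`
(`exists_bound_tsum_index`). The extremal level thus satisfies `2^{-ξ_n} ≲ n^{-a_1+(1/p-1/q)_+}`,
without a logarithm.

Lower bound. Of `2n` slabs orthogonal to the first axis, at least `n` contain no node in their
interior. Bumps in all free slabs (if `q ≤ p`) or in a single one (if `p < q`), scaled into the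
class, vanish at every node. Together with their negatives they fool any method, linear or not
(`eLpNorm_le_worstError`, `exists_le_samplingNumber`). -/

lemma sum_piFinset_support {d : ℕ} (f : (Fin d → ℝ) → ℝ) (L : Fin d → ℝ →₀ ℝ)
    (S : Fin d → Finset ℝ) (hS : ∀ i, (L i).support ⊆ S i) :
    ∑ y ∈ Fintype.piFinset (fun i => (L i).support), (∏ i, L i (y i)) * f y =
      ∑ y ∈ Fintype.piFinset S, (∏ i, L i (y i)) * f y := by
  refine Finset.sum_subset (Fintype.piFinset_subset _ _ hS) ?_
  intro y _ hy
  simp only [Fintype.mem_piFinset, not_forall] at hy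
  obtain ⟨i, hi⟩ := hy
  have h0 : ∏ i, L i (y i) = 0 :=
    Finset.prod_eq_zero (Finset.mem_univ i) (Finsupp.notMem_support_iff.mp hi)
  rw [h0, zero_mul]

/-- The tensor product of the univariate functionals `g ↦ ∑ y, L i y * g y`, applied to `f`. -/
def tensorEval {d : ℕ} (f : (Fin d → ℝ) → ℝ) :
    MultilinearMap ℝ (fun _ : Fin d => ℝ →₀ ℝ) ℝ where
  toFun L := ∑ y ∈ Fintype.piFinset (fun i => (L i).support), (∏ i, L i (y i)) * f y
  map_update_add' {inst} L i u v := by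
    -- The field is quantified over all decidability instances for `Function.update`; fixing the
    -- canonical one keeps the rewrites below well matched.
    have hinst : inst = instDecidableEqFin d := Subsingleton.elim _ _
    subst hinst
    classical
    -- The three sums run over different boxes. They are all extended by zero to the box spanned by
    -- `S`, where only the factor at `i` distinguishes them.
    set S : Fin d → Finset ℝ := fun j => (L j).support ∪ u.support ∪ v.support with hSdef
    have key : ∀ z : ℝ →₀ ℝ, z.support ⊆ u.support ∪ v.support →
        ∀ j, ((Function.update L i z) j).support ⊆ S j := by
      intro z hz j x hx
      by_cases hj : j = i
      · subst hj
        rw [Function.update_self] at hx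
        have := hz hx
        simp only [hSdef, Finset.mem_union] at this ⊢
        tauto
      · rw [Function.update_of_ne hj] at hx
        simp only [hSdef, Finset.mem_union]
        tauto
    rw [sum_piFinset_support f _ S (key _ Finsupp.support_add),
      sum_piFinset_support f _ S (key _ Finset.subset_union_left),
      sum_piFinset_support f _ S (key _ Finset.subset_union_right), ← Finset.sum_add_distrib]
    refine Finset.sum_congr rfl fun y _ => ?_
    have hp : ∀ z : ℝ →₀ ℝ, ∏ j, (Function.update L i z) j (y j) =
        z (y i) * ∏ j ∈ Finset.univ.erase i, L j (y j) := by
      intro z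
      rw [← Finset.mul_prod_erase _ _ (Finset.mem_univ i), Function.update_self]
      congr 1
      refine Finset.prod_congr rfl fun j hj => ?_
      rw [Function.update_of_ne (Finset.ne_of_mem_erase hj)]
    rw [hp, hp, hp, Finsupp.add_apply]
    ring
  map_update_smul' {inst} L i c v := by
    have hinst : inst = instDecidableEqFin d := Subsingleton.elim _ _
    subst hinst
    classical
    set S : Fin d → Finset ℝ := fun j => (L j).support ∪ v.support with hSdef
    have key : ∀ z : ℝ →₀ ℝ, z.support ⊆ v.support →
        ∀ j, ((Function.update L i z) j).support ⊆ S j := by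
      intro z hz j x hx
      by_cases hj : j = i
      · subst hj
        rw [Function.update_self] at hx
        exact Finset.mem_union_right _ (hz hx)
      · rw [Function.update_of_ne hj] at hx
        exact Finset.mem_union_left _ hx
    rw [sum_piFinset_support f _ S (key _ Finsupp.support_smul),
      sum_piFinset_support f _ S (key _ subset_rfl), smul_eq_mul, Finset.mul_sum]
    refine Finset.sum_congr rfl fun y _ => ?_
    have hp : ∀ z : ℝ →₀ ℝ, ∏ j, (Function.update L i z) j (y j) =
        z (y i) * ∏ j ∈ Finset.univ.erase i, L j (y j) := by
      intro z
      rw [← Finset.mul_prod_erase _ _ (Finset.mem_univ i), Function.update_self]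
      congr 1
      refine Finset.prod_congr rfl fun j hj => ?_
      rw [Function.update_of_ne (Finset.ne_of_mem_erase hj)]
    rw [hp, hp, Finsupp.smul_apply, smul_eq_mul]
    ring

lemma tensorEval_single {d : ℕ} (f : (Fin d → ℝ) → ℝ) (x : Fin d → ℝ) :
    tensorEval f (fun i => Finsupp.single (x i) 1) = f x := by
  change ∑ y ∈ Fintype.piFinset (fun i => (Finsupp.single (x i) (1 : ℝ)).support), _ = _
  have : (fun i => (Finsupp.single (x i) (1 : ℝ)).support) = fun i => {x i} := by
    funext i
    exact Finsupp.support_single _ one_ne_zero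
  rw [this, Fintype.piFinset_singleton, Finset.sum_singleton]
  simp

/-- Expansion of a tensor product of combinations of simpler functionals. -/
lemma tensorEval_sum_smul {d : ℕ} {ι : Type*} (f : (Fin d → ℝ) → ℝ) (s : Fin d → Finset ι)
    (c : Fin d → ι → ℝ) (U : Fin d → ι → ℝ →₀ ℝ) :
    tensorEval f (fun i => ∑ j ∈ s i, c i j • U i j) =
      ∑ j ∈ Fintype.piFinset s, (∏ i, c i (j i)) * tensorEval f (fun i => U i (j i)) := by
  classical
  rw [MultilinearMap.map_sum_finset]
  refine Finset.sum_congr rfl fun j _ => ?_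
  rw [MultilinearMap.map_smul_univ, smul_eq_mul]

lemma abs_tensorEval_sum_smul_le {d : ℕ} {ι : Type*} (f : (Fin d → ℝ) → ℝ)
    (s : Fin d → Finset ι) (c : Fin d → ι → ℝ) (U : Fin d → ι → ℝ →₀ ℝ) {C : ℝ}
    (hc : ∀ i, ∀ j ∈ s i, |c i j| ≤ C) :
    |tensorEval f (fun i => ∑ j ∈ s i, c i j • U i j)| ≤
      C ^ d * ∑ j ∈ Fintype.piFinset s, |tensorEval f (fun i => U i (j i))| := by
  rw [tensorEval_sum_smul, Finset.mul_sum]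
  refine (Finset.abs_sum_le_sum_abs _ _).trans (Finset.sum_le_sum fun j hj => ?_)
  rw [abs_mul, Finset.abs_prod]
  refine mul_le_mul_of_nonneg_right ?_ (abs_nonneg _)
  calc ∏ i, |c i (j i)| ≤ ∏ _i : Fin d, C :=
        Finset.prod_le_prod (fun _ _ => abs_nonneg _)
          fun i _ => hc i _ (Fintype.mem_piFinset.mp hj i)
    _ = C ^ d := by simp

lemma tensorEval_sum_single {d : ℕ} {ι : Type*} (f : (Fin d → ℝ) → ℝ) (s : Fin d → Finset ι)
    (c : Fin d → ι → ℝ) (y : Fin d → ι → ℝ) :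
    tensorEval f (fun i => ∑ j ∈ s i, c i j • Finsupp.single (y i j) 1) =
      ∑ j ∈ Fintype.piFinset s, (∏ i, c i (j i)) * f (fun i => y i (j i)) := by
  rw [tensorEval_sum_smul]
  refine Finset.sum_congr rfl fun j _ => ?_
  rw [tensorEval_single f (fun i => y i (j i))]

/-- Linearity in one slot: a functional in the `i`-th variable is applied to the function obtained
by freezing all other slots. This is the inductive step for composing coordinate operators. -/
lemma tensorEval_update_eq {d : ℕ} (f : (Fin d → ℝ) → ℝ) (L : Fin d → ℝ →₀ ℝ) (i : Fin d)
    (u : ℝ →₀ ℝ) :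
    tensorEval f (Function.update L i u) = Finsupp.linearCombination ℝ
      (fun y => tensorEval f (Function.update L i (Finsupp.single y 1))) u := by
  induction u using Finsupp.induction_linear with
  | zero => simp [MultilinearMap.map_update_zero]
  | add u v hu hv => rw [MultilinearMap.map_update_add, map_add, hu, hv]
  | single y c =>
    rw [Finsupp.linearCombination_single, smul_eq_mul,
      show Finsupp.single y c = c • Finsupp.single y (1 : ℝ) by simp,
      MultilinearMap.map_update_smul, smul_eq_mul]

/-- Variables not yet treated carry the point mass at `x i`, and `Nodup` ensures that the slot being
filled is still such a point mass. The set `I` is needed because the spline operators are finite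
functionals only at points of `[0,1]`. -/
lemma foldr_coordOp_eq {d : ℕ} (f : (Fin d → ℝ) → ℝ) (T : Fin d → (ℝ → ℝ) → ℝ → ℝ)
    (L : Fin d → ℝ → ℝ →₀ ℝ) (I : Set ℝ)
    (hT : ∀ i g, ∀ z ∈ I, T i g z = Finsupp.linearCombination ℝ g (L i z))
    (l : List (Fin d)) (hl : l.Nodup) (x : Fin d → ℝ) (hx : ∀ i ∈ l, x i ∈ I) :
    l.foldr (fun i g => coordOp i (T i) g) f x =
      tensorEval f (fun i => if i ∈ l then L i (x i) else Finsupp.single (x i) 1) := by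
  induction l generalizing x with
  | nil => simp [tensorEval_single]
  | cons i l ih =>
    rw [List.nodup_cons] at hl
    rw [List.foldr_cons]
    simp only [coordOp]
    rw [hT _ _ _ (hx i List.mem_cons_self)]
    have h1 : (fun j => if j ∈ i :: l then L j (x j) else Finsupp.single (x j) 1) =
        Function.update (fun j => if j ∈ l then L j (x j) else Finsupp.single (x j) 1) i
          (L i (x i)) := by
      funext j
      by_cases hj : j = i
      · subst hj; simp
      · simp [hj]
    rw [h1, tensorEval_update_eq]
    congr 2
    funext y
    -- The updated coordinate may leave `I`; this is harmless because `i` is no longer in the list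
    -- `l`.
    rw [ih hl.2]
    · congr 1
      funext j
      by_cases hj : j = i
      · subst hj; simp [hl.1]
      · simp [hj]
    · intro j hj
      have hji : j ≠ i := fun h => hl.1 (h ▸ hj)
      rw [Function.update_of_ne hji]
      exact hx j (List.mem_cons_of_mem _ hj)

/-- A product of univariate operators that are pointwise finite functionals is, pointwise, the
tensor product of these functionals. -/
lemma tensorOp_eq_tensorEval {d : ℕ} (f : (Fin d → ℝ) → ℝ) (T : Fin d → (ℝ → ℝ) → ℝ → ℝ)
    (L : Fin d → ℝ → ℝ →₀ ℝ) (I : Set ℝ)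
    (hT : ∀ i g, ∀ z ∈ I, T i g z = Finsupp.linearCombination ℝ g (L i z))
    (x : Fin d → ℝ) (hx : ∀ i, x i ∈ I) :
    tensorOp T f x = tensorEval f (fun i => L i (x i)) := by
  rw [tensorOp, foldr_coordOp_eq f T L I hT _ (List.nodup_finRange d) x fun i _ => hx i]
  simp

/-! ### Difference functionals -/

/-- The functional `g ↦ Δ_h^r g (y)`. -/
def diffFunctional (r : ℕ) (h y : ℝ) : ℝ →₀ ℝ :=
  ∑ j ∈ Finset.range (r + 1), ((-1 : ℝ) ^ (r - j) * r.choose j) • Finsupp.single (y + j * h) 1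

lemma linearCombination_sum_single {ι : Type*} (g : ℝ → ℝ) (s : Finset ι) (c y : ι → ℝ) :
    Finsupp.linearCombination ℝ g (∑ j ∈ s, c j • Finsupp.single (y j) 1) =
      ∑ j ∈ s, c j * g (y j) := by
  simp [map_sum]

lemma linearCombination_diffFunctional (r : ℕ) (h y : ℝ) (g : ℝ → ℝ) :
    Finsupp.linearCombination ℝ g (diffFunctional r h y) = (fwdDiff h)^[r] g y := by
  rw [diffFunctional, linearCombination_sum_single, fwdDiff_iter_eq_sum_shift]
  refine Finset.sum_congr rfl fun j _ => ?_
  simp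

lemma mixedDiff_eq_tensorEval {d : ℕ} (r : ℕ) (e : Finset (Fin d)) (h : Fin d → ℝ)
    (f : (Fin d → ℝ) → ℝ) (x : Fin d → ℝ) :
    mixedDiff r e h f x = tensorEval f
      (fun i => if i ∈ e then diffFunctional r (h i) (x i) else Finsupp.single (x i) 1) := by
  refine tensorOp_eq_tensorEval f _
    (fun i z => if i ∈ e then diffFunctional r (h i) z else Finsupp.single z 1) Set.univ
    (fun i g z _ => ?_) x fun _ => Set.mem_univ _
  by_cases hi : i ∈ e
  · simp [hi, linearCombination_diffFunctional]
  · simp [hi]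

/-! ### Discrete Taylor expansion -/

/-- Newton's forward difference formula with remainder. -/
lemma newton_forward_remainder {M : Type*} [AddCommGroup M] [Module ℝ M] (G : ℕ → M) (r j : ℕ) :
    G j = ∑ k ∈ Finset.range r, (j.choose k : ℝ) • (fwdDiff 1)^[k] G 0 +
      if r = 0 then G j else
        ∑ i ∈ Finset.range j, ((j - 1 - i).choose (r - 1) : ℝ) • (fwdDiff 1)^[r] G i := by
  induction r with
  | zero => simp
  | succ r ih =>
    rw [if_neg (Nat.succ_ne_zero r), Finset.sum_range_succ]
    nth_rewrite 1 [ih]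
    rw [add_assoc]
    congr 1
    simp only [Nat.add_sub_cancel]
    clear ih
    set D : ℕ → M := (fwdDiff 1)^[r] G with hD
    have hD1 : ∀ i, (fwdDiff 1)^[r + 1] G i = D (i + 1) - D i := by
      intro i
      rw [Function.iterate_succ_apply', ← hD]
      rfl
    -- Summation by parts with Pascal's rule trades a difference of order `r + 1` for one of order
    -- `r`, and the boundary term is the next Newton term. For `r = 0` the sum simply telescopes,
    -- which is why that case has its own form.
    have main : ∀ j : ℕ, ∑ i ∈ Finset.range j, ((j - 1 - i).choose r : ℝ) • (D (i + 1) - D i) =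
        (if r = 0 then D j else ∑ i ∈ Finset.range j, ((j - 1 - i).choose (r - 1) : ℝ) • D i)
          - (j.choose r : ℝ) • D 0 := by
      intro j
      rcases Nat.eq_zero_or_pos r with hr | hr
      · subst hr
        simp only [Nat.choose_zero_right, Nat.cast_one, one_smul, if_true]
        exact Finset.sum_range_sub D j
      · obtain ⟨s, rfl⟩ := Nat.exists_eq_succ_of_ne_zero hr.ne'
        simp only [Nat.succ_eq_add_one, Nat.succ_ne_zero, if_false, Nat.add_sub_cancel]
        rcases j with _ | j
        · simp
        simp only [Nat.add_sub_cancel]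
        simp_rw [smul_sub]
        rw [Finset.sum_sub_distrib, Finset.sum_range_succ]
        rw [Finset.sum_range_succ' (fun i => ((j - i).choose (s + 1) : ℝ) • D i)]
        rw [Finset.sum_range_succ' (fun i => ((j - i).choose s : ℝ) • D i)]
        have e1 : ∑ i ∈ Finset.range j, ((j - i).choose (s + 1) : ℝ) • D (i + 1) =
            ∑ i ∈ Finset.range j, ((j - (i + 1)).choose s : ℝ) • D (i + 1) +
            ∑ i ∈ Finset.range j, ((j - (i + 1)).choose (s + 1) : ℝ) • D (i + 1) := by
          rw [← Finset.sum_add_distrib]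
          refine Finset.sum_congr rfl fun i hi => ?_
          have : j - i = (j - (i + 1)) + 1 := by
            have := Finset.mem_range.mp hi
            omega
          rw [this, Nat.choose_succ_succ, ← add_smul]
          push_cast
          rfl
        rw [e1]
        have e2 : ((j + 1).choose (s + 1) : ℝ) = (j.choose s : ℝ) + (j.choose (s + 1) : ℝ) := by
          rw [Nat.choose_succ_succ]; push_cast; rfl
        rw [e2, add_smul]
        simp
        abel
    simp_rw [hD1]
    rw [main j]
    by_cases hr : r = 0
    · subst hr
      simp [hD]
    · simp [hr]

/-- Newton's formula can thereby be applied to the sequence of point masses itself, with values in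
the space of functionals. -/
lemma diffFunctional_eq_fwdDiff (r : ℕ) (h y : ℝ) (i : ℕ) :
    (fwdDiff 1)^[r] (fun j : ℕ => Finsupp.single (y + j * h) (1 : ℝ)) i =
      diffFunctional r h (y + i * h) := by
  rw [fwdDiff_iter_eq_sum_shift, diffFunctional]
  refine Finset.sum_congr rfl fun j _ => ?_
  rw [← Int.cast_smul_eq_zsmul ℝ]
  push_cast
  congr 2
  simp
  ring

/-- A functional on `n` equidistant points that annihilates the polynomials of degree less than
`r` is a combination of differences of order `r`. -/
lemma exists_diffFunctional_sum (r : ℕ) (hr : 0 < r) (n : ℕ) (c : ℕ → ℝ)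
    (hc : ∀ P : Polynomial ℝ, P.degree < r → ∑ j ∈ Finset.range n, c j * P.eval (j : ℝ) = 0)
    (h y : ℝ) {B : ℝ} (hB : ∀ j < n, |c j| ≤ B) :
    ∃ b : ℕ → ℝ, (∀ i, |b i| ≤ n * 2 ^ n * B) ∧
      ∑ j ∈ Finset.range n, c j • Finsupp.single (y + j * h) (1 : ℝ) =
        ∑ i ∈ Finset.range (n - r), b i • diffFunctional r h (y + i * h) := by
  classical
  -- Expand every point mass by Newton's formula. The terms of order below `r` cancel because `c`
  -- kills the polynomials `x choose k`; the remainders, regrouped by their base point `i`, carry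
  -- these weights.
  refine ⟨fun i => ∑ j ∈ Finset.range n, if i < j then c j * ((j - 1 - i).choose (r - 1) : ℝ)
    else 0, ?_, ?_⟩
  · intro i
    refine (Finset.abs_sum_le_sum_abs _ _).trans ?_
    calc _ ≤ ∑ j ∈ Finset.range n, 2 ^ n * B := by
          refine Finset.sum_le_sum fun j hj => ?_
          have hjn := Finset.mem_range.mp hj
          have hB0 : 0 ≤ B := (abs_nonneg _).trans (hB j hjn)
          split_ifs
          · rw [abs_mul, mul_comm]
            refine mul_le_mul ?_ (hB j hjn) (abs_nonneg _) (by positivity)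
            rw [abs_of_nonneg (by positivity)]
            have h1 : (j - 1 - i).choose (r - 1) ≤ 2 ^ (j - 1 - i) := Nat.choose_le_two_pow _ _
            have h2 : 2 ^ (j - 1 - i) ≤ 2 ^ n := Nat.pow_le_pow_right (by norm_num) (by omega)
            exact_mod_cast h1.trans h2
          · rw [abs_zero]; positivity
      _ = n * 2 ^ n * B := by simp [mul_assoc]
  · set G : ℕ → ℝ →₀ ℝ := fun j => Finsupp.single (y + j * h) (1 : ℝ) with hG
    have hGj : ∀ j, G j = ∑ k ∈ Finset.range r, (j.choose k : ℝ) • (fwdDiff 1)^[k] G 0 +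
        ∑ i ∈ Finset.range j, ((j - 1 - i).choose (r - 1) : ℝ) • diffFunctional r h (y + i * h) := by
      intro j
      have := newton_forward_remainder G r j
      rw [if_neg hr.ne'] at this
      simpa only [hG, diffFunctional_eq_fwdDiff] using this
    have hpoly : ∀ k < r, ∑ j ∈ Finset.range n, c j * (j.choose k : ℝ) = 0 := by
      intro k hk
      have h1 := hc (Polynomial.C ((k.factorial : ℝ)⁻¹) * descPochhammer ℝ k) (by
        rw [Polynomial.degree_C_mul (by positivity)]
        rw [Polynomial.degree_eq_natDegree (monic_descPochhammer ℝ k).ne_zero,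
          descPochhammer_natDegree]
        exact_mod_cast hk)
      rw [← h1]
      refine Finset.sum_congr rfl fun j _ => ?_
      rw [Polynomial.eval_mul, Polynomial.eval_C, descPochhammer_eval_eq_descFactorial,
        Nat.descFactorial_eq_factorial_mul_choose]
      push_cast
      field_simp
    calc ∑ j ∈ Finset.range n, c j • G j
        = ∑ k ∈ Finset.range r, (∑ j ∈ Finset.range n, c j * (j.choose k : ℝ)) •
            (fwdDiff 1)^[k] G 0 +
          ∑ j ∈ Finset.range n, c j • ∑ i ∈ Finset.range j,
            ((j - 1 - i).choose (r - 1) : ℝ) • diffFunctional r h (y + i * h) := by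
          simp_rw [Finset.sum_smul]
          rw [Finset.sum_comm, ← Finset.sum_add_distrib]
          refine Finset.sum_congr rfl fun j _ => ?_
          rw [hGj j, smul_add, Finset.smul_sum]
          congr 1
          refine Finset.sum_congr rfl fun k _ => ?_
          rw [smul_smul]
      _ = ∑ j ∈ Finset.range n, c j • ∑ i ∈ Finset.range j,
            ((j - 1 - i).choose (r - 1) : ℝ) • diffFunctional r h (y + i * h) := by
          rw [Finset.sum_eq_zero, zero_add]
          intro k hk
          rw [hpoly k (Finset.mem_range.mp hk), zero_smul]
      _ = _ := by
          simp_rw [Finset.sum_smul]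
          rw [Finset.sum_comm]
          refine Finset.sum_congr rfl fun j hj => ?_
          have hjn := Finset.mem_range.mp hj
          rw [Finset.smul_sum]
          simp_rw [ite_smul, zero_smul, ← smul_smul]
          rw [← Finset.sum_filter]
          symm
          refine Finset.sum_subset ?_ ?_
          · intro i hi
            simp only [Finset.mem_filter, Finset.mem_range] at hi ⊢
            exact hi.2
          · intro i hi hi'
            simp only [Finset.mem_filter, Finset.mem_range, not_and'] at hi hi'
            have := hi' hi
            -- A base point `i ≥ n - r` would involve nodes beyond the last one; its weight vanishes
            -- since `j - 1 - i < r - 1`.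
            rw [Nat.choose_eq_zero_of_lt (by omega)]
            simp

/-! ### B-splines -/

lemma cardinalBSpline_eq_zero (r : ℕ) {x : ℝ} (h : x < 0 ∨ (r : ℝ) ≤ x) :
    cardinalBSpline r x = 0 := by
  induction r using Nat.twoStepInduction generalizing x with
  | zero => rfl
  | one =>
    simp only [cardinalBSpline]
    rw [if_neg]
    push_cast at h
    rcases h with h | h
    · exact fun h' => absurd h'.1 (not_le.mpr h)
    · exact fun h' => absurd h'.2 (not_lt.mpr h)
  | more n _ ih =>
    push_cast at h ih
    rw [cardinalBSpline, ih, ih]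
    · simp
    · rcases h with h | h
      · left; linarith
      · right; linarith
    · rcases h with h | h
      · left; linarith
      · right; linarith

lemma measurable_cardinalBSpline (r : ℕ) : Measurable (cardinalBSpline r) := by
  induction r using Nat.twoStepInduction with
  | zero => exact measurable_const
  | one =>
    have : MeasurableSet {x : ℝ | 0 ≤ x ∧ x < 1} := measurableSet_Ico
    exact Measurable.ite this measurable_const measurable_const
  | more n _ ih =>
    have : cardinalBSpline (n + 2) = fun x => (x * cardinalBSpline (n + 1) x +
      ((n : ℝ) + 2 - x) * cardinalBSpline (n + 1) (x - 1)) / ((n : ℝ) + 1) := by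
      funext x; rw [cardinalBSpline]
    rw [this]
    have h2 : Measurable fun x : ℝ => cardinalBSpline (n + 1) (x - 1) :=
      ih.comp (measurable_id.sub_const 1)
    exact ((measurable_id.mul ih).add ((measurable_const.sub measurable_id).mul h2)).div_const _

lemma exists_bound_cardinalBSpline (r : ℕ) : ∃ C : ℝ, 0 ≤ C ∧ ∀ x, |cardinalBSpline r x| ≤ C := by
  induction r using Nat.twoStepInduction with
  | zero => exact ⟨0, le_rfl, fun x => by simp [cardinalBSpline]⟩
  | one =>
    refine ⟨1, zero_le_one, fun x => ?_⟩
    simp only [cardinalBSpline]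
    split_ifs <;> simp
  | more n _ ih =>
    obtain ⟨C, hC0, hC⟩ := ih
    refine ⟨2 * ((n + 2) * C), by positivity, fun x => ?_⟩
    -- The linear factors of the recursion are bounded on the support only.
    by_cases h : x < 0 ∨ ((n + 2 : ℕ) : ℝ) ≤ x
    · rw [cardinalBSpline_eq_zero _ h, abs_zero]; positivity
    · push Not at h
      push_cast at h
      rw [cardinalBSpline, abs_div, abs_of_nonneg (by positivity : (0 : ℝ) ≤ (n : ℝ) + 1)]
      refine (div_le_self (abs_nonneg _) (by linarith [(Nat.cast_nonneg n : (0 : ℝ) ≤ n)])).trans ?_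
      refine (abs_add_le _ _).trans ?_
      rw [abs_mul, abs_mul, abs_of_nonneg h.1, abs_of_nonneg (by linarith : (0 : ℝ) ≤ n + 2 - x),
        two_mul]
      refine add_le_add ?_ ?_
      · exact mul_le_mul h.2.le (hC _) (abs_nonneg _) (by positivity)
      · exact mul_le_mul (by linarith) (hC _) (abs_nonneg _) (by positivity)

/-! ### Binomial identities and the two-scale relation. -/

lemma sum_choose_succ_mul (m : ℕ) (B : ℕ → ℝ) :
    ∑ j ∈ Finset.range (m + 2), ((m + 1).choose j : ℝ) * B j =
      ∑ j ∈ Finset.range (m + 1), (m.choose j : ℝ) * (B j + B (j + 1)) := by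
  rw [Finset.sum_range_succ']
  have h1 : ∀ j ∈ Finset.range (m + 1), ((m + 1).choose (j + 1) : ℝ) * B (j + 1) =
      (m.choose j : ℝ) * B (j + 1) + (m.choose (j + 1) : ℝ) * B (j + 1) := by
    intro j _
    rw [Nat.choose_succ_succ]; push_cast; ring
  rw [Finset.sum_congr rfl h1, Finset.sum_add_distrib]
  have h2 := Finset.sum_range_succ' (fun j => (m.choose j : ℝ) * B j) (m + 1)
  rw [Finset.sum_range_succ, Nat.choose_succ_self] at h2
  simp only [mul_add, Finset.sum_add_distrib]
  simp only [Nat.choose_zero_right, Nat.cast_one, Nat.cast_zero, zero_mul, add_zero] at h2 ⊢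
  linarith

lemma sum_mul_choose_succ (m : ℕ) (B : ℕ → ℝ) :
    ∑ j ∈ Finset.range (m + 2), (j : ℝ) * ((m + 1).choose j : ℝ) * B j =
      (m + 1) * ∑ j ∈ Finset.range (m + 1), (m.choose j : ℝ) * B (j + 1) := by
  rw [Finset.sum_range_succ', Finset.mul_sum]
  simp only [Nat.cast_zero, zero_mul, add_zero]
  refine Finset.sum_congr rfl fun j _ => ?_
  have := Nat.add_one_mul_choose_eq m j
  have h : ((m : ℝ) + 1) * (m.choose j : ℝ) = ((m + 1).choose (j + 1) : ℝ) * ((j : ℝ) + 1) := by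
    exact_mod_cast this
  push_cast
  rw [← mul_assoc, h]; ring

/-- The algebra of the induction step for the two-scale relation, with `y = 2x` and `A j` the spline
of order `n + 1` at `2x - j`. The left side is the recursion inserted into the fine splines of order
`n + 2`; the right side collects the relations of order `n + 1` at `x` and `x - 1`. -/
lemma bspline_coefficient_identity (n : ℕ) (y : ℝ) (A : ℕ → ℝ) :
    ∑ j ∈ Finset.range (n + 3), ((n + 2).choose j : ℝ) *
        ((y - j) * A j + ((n : ℝ) + 2 - (y - j)) * A (j + 1)) =
      ∑ j ∈ Finset.range (n + 2), ((n + 1).choose j : ℝ) *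
        (y * A j + (2 * n + 4 - y) * A (j + 2)) := by
  rw [sum_choose_succ_mul (n + 1)]
  have e1 := sum_choose_succ_mul n (fun j => A (j + 1))
  have e2 := sum_mul_choose_succ n A
  have e3 := sum_mul_choose_succ n (fun j => A (j + 2))
  have e4 := sum_choose_succ_mul n (fun j => A (j + 2))
  have e5 : ∑ j ∈ Finset.range (n + 1 + 1), ((n + 1).choose j : ℝ) *
        ((y - j) * A j + ((n : ℝ) + 2 - (y - j)) * A (j + 1) +
          ((y - ((j + 1 : ℕ) : ℝ)) * A (j + 1) +
            ((n : ℝ) + 2 - (y - ((j + 1 : ℕ) : ℝ))) * A (j + 1 + 1))) =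
      ∑ j ∈ Finset.range (n + 2), ((n + 1).choose j : ℝ) *
        (y * A j + (2 * n + 4 - y) * A (j + 2)) -
      ∑ j ∈ Finset.range (n + 2), (j : ℝ) * ((n + 1).choose j : ℝ) * A j +
      (n + 1) * ∑ j ∈ Finset.range (n + 2), ((n + 1).choose j : ℝ) * A (j + 1) +
      ∑ j ∈ Finset.range (n + 2), (j : ℝ) * ((n + 1).choose j : ℝ) * A (j + 2) -
      (n + 1) * ∑ j ∈ Finset.range (n + 2), ((n + 1).choose j : ℝ) * A (j + 2) := by
    rw [Finset.mul_sum, Finset.mul_sum, ← Finset.sum_sub_distrib, ← Finset.sum_add_distrib,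
      ← Finset.sum_add_distrib, ← Finset.sum_sub_distrib]
    refine Finset.sum_congr rfl fun j _ => ?_
    push_cast
    ring
  rw [e5, e1, e2, e3, e4]
  simp only [mul_add, Finset.sum_add_distrib]
  ring

/-- The two-scale relation of the cardinal B-splines. -/
lemma cardinalBSpline_two_scale (n : ℕ) (x : ℝ) :
    2 ^ n * cardinalBSpline (n + 1) x = ∑ j ∈ Finset.range (n + 2),
      ((n + 1).choose j : ℝ) * cardinalBSpline (n + 1) (2 * x - j) := by
  induction n generalizing x with
  | zero =>
    simp only [Finset.sum_range_succ, Finset.sum_range_zero, cardinalBSpline]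
    norm_num
    split_ifs <;> first | (norm_num; done) | (exfalso; grind)
  | succ n ih =>
    have hn : ((n : ℝ) + 1) ≠ 0 := by positivity
    have h1 := bspline_coefficient_identity n (2 * x)
      (fun j => cardinalBSpline (n + 1) (2 * x - j))
    have h2 : ∀ j : ℕ, cardinalBSpline (n + 2) (2 * x - j) = ((2 * x - j) *
        cardinalBSpline (n + 1) (2 * x - j) + ((n : ℝ) + 2 - (2 * x - j)) *
          cardinalBSpline (n + 1) (2 * x - ((j + 1 : ℕ) : ℝ))) / ((n : ℝ) + 1) := by
      intro j
      rw [cardinalBSpline]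
      congr 4
      push_cast; ring
    have h3 : ∑ j ∈ Finset.range (n + 1 + 2), ((n + 1 + 1).choose j : ℝ) *
        cardinalBSpline (n + 1 + 1) (2 * x - j) = (∑ j ∈ Finset.range (n + 2),
          ((n + 1).choose j : ℝ) * (2 * x * cardinalBSpline (n + 1) (2 * x - j) +
          (2 * n + 4 - 2 * x) * cardinalBSpline (n + 1) (2 * x - ((j + 2 : ℕ) : ℝ)))) /
            ((n : ℝ) + 1) := by
      rw [← h1, Finset.sum_div]
      refine Finset.sum_congr rfl fun j _ => ?_
      rw [h2 j, mul_div_assoc]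
    rw [h3, cardinalBSpline]
    have h4 := ih x
    have h5 := ih (x - 1)
    have h6 : ∀ j : ℕ, 2 * (x - 1) - (j : ℝ) = 2 * x - ((j + 2 : ℕ) : ℝ) := by
      intro j; push_cast; ring
    simp only [h6] at h5
    simp only [mul_add, Finset.sum_add_distrib]
    have h7 : ∀ (c : ℝ) (D : ℕ → ℝ), ∑ j ∈ Finset.range (n + 2), ((n + 1).choose j : ℝ) *
        (c * D j) = c * ∑ j ∈ Finset.range (n + 2), ((n + 1).choose j : ℝ) * D j := by
      intro c D
      rw [Finset.mul_sum]
      exact Finset.sum_congr rfl fun j _ => by ring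
    rw [h7, h7, ← h4, ← h5]
    field_simp
    ring

lemma centeredBSpline_eq_zero (r : ℕ) {x : ℝ} (h : x < -(r / 2 : ℝ) ∨ (r / 2 : ℝ) ≤ x) :
    centeredBSpline r x = 0 := by
  apply cardinalBSpline_eq_zero
  rcases h with h | h
  · left; linarith
  · right; linarith

lemma measurable_centeredBSpline (r : ℕ) : Measurable (centeredBSpline r) :=
  (measurable_cardinalBSpline r).comp (measurable_id.add_const _)

/-- The univariate B-spline `M^{(r)}_{k,s}`. -/
def dilatedBSpline₁ (r k : ℕ) (s : ℤ) (x : ℝ) : ℝ :=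
  if Even r then centeredBSpline r (2 ^ k * x - s) else centeredBSpline r (2 ^ k * x - s / 2)

lemma dilatedBSpline_eq_prod {d : ℕ} (r : ℕ) (k : Fin d → ℕ) (s : Fin d → ℤ) (x : Fin d → ℝ) :
    dilatedBSpline r k s x = ∏ i, dilatedBSpline₁ r (k i) (s i) (x i) := rfl

lemma measurable_dilatedBSpline₁ (r k : ℕ) (s : ℤ) : Measurable (dilatedBSpline₁ r k s) := by
  unfold dilatedBSpline₁
  split_ifs
  · exact (measurable_centeredBSpline r).comp ((measurable_id.const_mul _).sub_const _)
  · exact (measurable_centeredBSpline r).comp ((measurable_id.const_mul _).sub_const _)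

/-- `g` is a combination of at most `N` of the univariate B-splines of level `k`. -/
def IsSplineCombination (r k N : ℕ) (g : ℝ → ℝ) : Prop :=
  ∃ b : ℤ →₀ ℝ, b.support.card ≤ N ∧ ∀ x, g x = b.sum fun s c => c * dilatedBSpline₁ r k s x

namespace IsSplineCombination

lemma mono {r k N N' : ℕ} {g : ℝ → ℝ} (h : IsSplineCombination r k N g) (hN : N ≤ N') :
    IsSplineCombination r k N' g := by
  obtain ⟨b, hb, h⟩ := h
  exact ⟨b, hb.trans hN, h⟩

lemma dilated (r k : ℕ) (s : ℤ) : IsSplineCombination r k 1 (dilatedBSpline₁ r k s) := by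
  refine ⟨Finsupp.single s 1, ?_, fun x => ?_⟩
  · rw [Finsupp.support_single _ one_ne_zero]; simp
  · simp

lemma zero (r k : ℕ) : IsSplineCombination r k 0 (fun _ => 0) := ⟨0, by simp, by simp⟩

lemma smul {r k N : ℕ} {g : ℝ → ℝ} (c : ℝ) (h : IsSplineCombination r k N g) :
    IsSplineCombination r k N (fun x => c * g x) := by
  obtain ⟨b, hb, h⟩ := h
  refine ⟨c • b, (Finset.card_le_card Finsupp.support_smul).trans hb, fun x => ?_⟩
  simp only [h x]
  rw [Finsupp.sum_smul_index (by simp), Finsupp.mul_sum]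
  simp [mul_assoc]

lemma add {r k N N' : ℕ} {g g' : ℝ → ℝ} (h : IsSplineCombination r k N g)
    (h' : IsSplineCombination r k N' g') :
    IsSplineCombination r k (N + N') (fun x => g x + g' x) := by
  obtain ⟨b, hb, h⟩ := h
  obtain ⟨b', hb', h'⟩ := h'
  refine ⟨b + b', (Finset.card_le_card Finsupp.support_add).trans
    ((Finset.card_union_le _ _).trans (add_le_add hb hb')), fun x => ?_⟩
  simp only [h x, h' x]
  rw [Finsupp.sum_add_index' (by simp) (by intros; ring)]

lemma sum {r k N : ℕ} {ι : Type*} (S : Finset ι) (g : ι → ℝ → ℝ)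
    (h : ∀ i ∈ S, IsSplineCombination r k N (g i)) :
    IsSplineCombination r k (S.card * N) (fun x => ∑ i ∈ S, g i x) := by
  classical
  induction S using Finset.induction_on with
  | empty => simpa using zero r k
  | insert i S hi ih =>
    simp only [Finset.sum_insert hi]
    refine ((h i (Finset.mem_insert_self _ _)).add
      (ih fun j hj => h j (Finset.mem_insert_of_mem hj))).mono ?_
    rw [Finset.card_insert_of_notMem hi]
    exact le_of_eq (by ring)

lemma measurable {r k N : ℕ} {g : ℝ → ℝ} (h : IsSplineCombination r k N g) : Measurable g := by
  obtain ⟨b, _, h⟩ := h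
  have : g = fun x => ∑ s ∈ b.support, b s * dilatedBSpline₁ r k s x := funext h
  rw [this]
  exact Finset.measurable_fun_sum _ fun s _ => (measurable_dilatedBSpline₁ r k s).const_mul _

/-- For odd `r` the family counts half-integer shifts, so an integer shift `s` has index `2 * s`. -/
lemma centered (r k : ℕ) (s : ℤ) :
    IsSplineCombination r k 1 (fun x => centeredBSpline r (2 ^ k * x - s)) := by
  by_cases hr : Even r
  · convert dilated r k s using 1
    funext x; simp [dilatedBSpline₁, hr]
  · convert dilated r k (2 * s) using 1
    funext x; simp [dilatedBSpline₁, hr]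

/-- The recentred two-scale relation has shifts `2s - r/2 + j`. They are integers for even `r` and
half-integers for odd `r`, which is the reason for the two conventions in `dilatedBSpline`. -/
lemma centered_coarse (r : ℕ) (hr : 0 < r) (k : ℕ) (s : ℤ) :
    IsSplineCombination r (k + 1) (r + 1) (fun x => centeredBSpline r (2 ^ k * x - s)) := by
  obtain ⟨n, rfl⟩ := Nat.exists_eq_succ_of_ne_zero hr.ne'
  have key : ∀ x : ℝ, centeredBSpline (n + 1) (2 ^ k * x - s) =
      ∑ j ∈ Finset.range (n + 2), ((2 : ℝ) ^ n)⁻¹ * ((n + 1).choose j : ℝ) *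
        centeredBSpline (n + 1) (2 ^ (k + 1) * x - (2 * s - (n + 1) / 2 + j)) := by
    intro x
    have h := cardinalBSpline_two_scale n (2 ^ k * x - s + ((n + 1 : ℕ) : ℝ) / 2)
    rw [centeredBSpline, ← inv_mul_cancel_left₀ (by positivity : (2 : ℝ) ^ n ≠ 0)
      (cardinalBSpline (n + 1) (2 ^ k * x - s + ((n + 1 : ℕ) : ℝ) / 2)), h, Finset.mul_sum]
    refine Finset.sum_congr rfl fun j _ => ?_
    rw [centeredBSpline, mul_assoc]
    congr 3
    push_cast; ring
  have := sum (r := n + 1) (k := k + 1) (N := 1) (Finset.range (n + 2)) (fun j x =>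
    ((2 : ℝ) ^ n)⁻¹ * ((n + 1).choose j : ℝ) *
        centeredBSpline (n + 1) (2 ^ (k + 1) * x - (2 * s - (n + 1) / 2 + j))) (by
      intro j _
      refine smul _ ?_
      by_cases he : Even (n + 1)
      · obtain ⟨t, ht⟩ := he
        convert dilated (n + 1) (k + 1) (2 * s - t + j) using 1
        funext x
        have ht' : ((n : ℝ) + 1) = t + t := by exact_mod_cast ht
        have he : Even (n + 1) := ⟨t, ht⟩
        rw [dilatedBSpline₁, if_pos he, ht']
        push_cast
        congr 1; ring
      · convert dilated (n + 1) (k + 1) (4 * s - (n + 1) + 2 * j) using 1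
        funext x
        simp only [dilatedBSpline₁, if_neg he]
        push_cast
        congr 1; ring)
  simp only [Nat.succ_eq_add_one]
  convert this using 1
  · simp
  · funext x; exact key x

end IsSplineCombination

/-! ### The operators `Q_k` as finite functionals -/

/-- Every factor `(z - v j) / (v i - v j)` is at most `B`. The bound is invariant under scaling,
hence uniform over the levels; `1 ≤ B` permits counting all of `s`. -/
lemma abs_eval_lagrangeBasis_le (s : Finset ℕ) (v : ℕ → ℝ) (i : ℕ) (z : ℝ) {δ B : ℝ}
    (hδ : 0 < δ) (hB : 1 ≤ B) (hv : ∀ j ∈ s, j ≠ i → δ ≤ |v i - v j|)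
    (hz : ∀ j ∈ s, |z - v j| ≤ B * δ) :
    |(Lagrange.basis s v i).eval z| ≤ B ^ s.card := by
  rw [Lagrange.basis, Polynomial.eval_prod, Finset.abs_prod]
  calc ∏ j ∈ s.erase i, |(Lagrange.basisDivisor (v i) (v j)).eval z|
      ≤ ∏ _j ∈ s.erase i, B := by
        refine Finset.prod_le_prod (fun _ _ => abs_nonneg _) fun j hj => ?_
        have hjs := Finset.mem_of_mem_erase hj
        have h1 := hv j hjs (Finset.ne_of_mem_erase hj)
        have h2 := hz j hjs
        simp only [Lagrange.basisDivisor, Polynomial.eval_mul, Polynomial.eval_C,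
          Polynomial.eval_sub, Polynomial.eval_X]
        rw [abs_mul, abs_inv, inv_mul_le_iff₀ (hδ.trans_le h1)]
        calc |z - v j| ≤ B * δ := h2
          _ ≤ B * |v i - v j| := by gcongr
          _ = |v i - v j| * B := mul_comm _ _
    _ = B ^ (s.erase i).card := by simp
    _ ≤ B ^ s.card := pow_le_pow_right₀ hB (Finset.card_le_card (Finset.erase_subset _ _))

/-- The weight of `g (y / 2^k)` in the value at `t / 2^k` of the extension of `g`. -/
def extCoeff (r k : ℕ) (t : ℤ) (y : ℕ) : ℝ :=
  if t < 0 then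
    if y < min r (2 ^ k + 1) then
      (Lagrange.basis (Finset.range (min r (2 ^ k + 1))) (fun j : ℕ => (j : ℝ) / 2 ^ k) y).eval
        ((t : ℝ) / 2 ^ k)
    else 0
  else if t ≤ 2 ^ k then if (y : ℤ) = t then 1 else 0
  else
    if 2 ^ k - y < min r (2 ^ k + 1) then
      (Lagrange.basis (Finset.range (min r (2 ^ k + 1))) (fun j : ℕ => 1 - (j : ℝ) / 2 ^ k)
        (2 ^ k - y)).eval ((t : ℝ) / 2 ^ k)
    else 0

lemma sum_range_min_eq {r m : ℕ} (F : ℕ → ℝ) :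
    ∑ j ∈ Finset.range (min r (m + 1)), F j =
      ∑ j ∈ Finset.range (m + 1), if j < min r (m + 1) then F j else 0 := by
  rw [← Finset.sum_filter]
  congr 1
  ext j
  simp only [Finset.mem_range, Finset.mem_filter]
  omega

/-- The quasi-interpolant samples the extension at lattice points only, and there the extension is a
combination of grid values. Hence `Q_k g` depends on finitely many values of `g`. -/
lemma extend_lattice (r k : ℕ) (g : ℝ → ℝ) (t : ℤ) :
    extend r k g ((t : ℝ) / 2 ^ k) =
      ∑ y ∈ Finset.range (2 ^ k + 1), extCoeff r k t y * g ((y : ℝ) / 2 ^ k) := by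
  have h2 : (0 : ℝ) < 2 ^ k := by positivity
  unfold extend
  by_cases h0 : t < 0
  · have h0' : (t : ℝ) / 2 ^ k < 0 := div_neg_of_neg_of_pos (by exact_mod_cast h0) h2
    rw [if_pos h0', leftPoly, Lagrange.interpolate_apply, Polynomial.eval_finsetSum,
      sum_range_min_eq]
    refine Finset.sum_congr rfl fun y _ => ?_
    simp only [extCoeff, if_pos h0]
    split_ifs
    · simp [mul_comm]
    · simp
  · have h0' : ¬ (t : ℝ) / 2 ^ k < 0 := not_lt.mpr (div_nonneg (by exact_mod_cast not_lt.mp h0) h2.le)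
    rw [if_neg h0']
    by_cases h1 : t ≤ 2 ^ k
    · have h1' : (t : ℝ) / 2 ^ k ≤ 1 := by
        rw [div_le_one h2]; exact_mod_cast h1
      rw [if_pos h1']
      obtain ⟨n, rfl⟩ := Int.eq_ofNat_of_zero_le (not_lt.mp h0)
      have hn : n ≤ 2 ^ k := by exact_mod_cast h1
      rw [Finset.sum_eq_single n]
      · simp [extCoeff, h1]
      · intro y _ hy
        have hy' : ¬ (y : ℤ) = n := by exact_mod_cast hy
        simp [extCoeff, h1, hy]
      · intro hn'
        exact absurd (Finset.mem_range.mpr (by omega)) hn'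
    · have h1' : ¬ (t : ℝ) / 2 ^ k ≤ 1 := by
        rw [div_le_one h2]; exact_mod_cast h1
      rw [if_neg h1', rightPoly, Lagrange.interpolate_apply, Polynomial.eval_finsetSum,
        sum_range_min_eq, ← Finset.sum_range_reflect]
      refine Finset.sum_congr rfl fun y hy => ?_
      have hy' : y ≤ 2 ^ k := by have := Finset.mem_range.mp hy; omega
      have e1 : 2 ^ k + 1 - 1 - y = 2 ^ k - y := by omega
      simp only [extCoeff, if_neg h0, if_neg h1, e1]
      split_ifs
      · have e2 : (1 : ℝ) - ((2 ^ k - y : ℕ) : ℝ) / 2 ^ k = y / 2 ^ k := by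
          rw [Nat.cast_sub hy']
          push_cast
          field_simp
          ring
        rw [Polynomial.eval_mul, Polynomial.eval_C, e2, mul_comm]
      · simp

lemma abs_natCast_sub_ge_one {i j : ℕ} (h : j ≠ i) : (1 : ℝ) ≤ |(i : ℝ) - j| := by
  have : (1 : ℤ) ≤ |(i : ℤ) - j| := Int.one_le_abs (sub_ne_zero.mpr (by exact_mod_cast h.symm))
  exact_mod_cast this

/-- Splines meeting `[0,1]` use lattice points at most `r + μ` steps outside the interval, and the
interpolation nodes are fewer than `r` steps from the end. The number `2r + μ + 1` bounds these
distances in units of the step. -/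
lemma abs_extCoeff_le (r k μ : ℕ) (t : ℤ) (y : ℕ) (h1 : -((r : ℤ) + μ) ≤ t)
    (h2 : t ≤ 2 ^ k + r + μ) :
    |extCoeff r k t y| ≤ (2 * r + μ + 1 : ℝ) ^ r := by
  have hB : (1 : ℝ) ≤ 2 * r + μ + 1 := by
    have : (0 : ℝ) ≤ 2 * r + μ := by positivity
    linarith
  have hB0 : (0 : ℝ) ≤ (2 * r + μ + 1 : ℝ) ^ r := by positivity
  have hpow : (0 : ℝ) < 2 ^ k := by positivity
  have hcard : (2 * r + μ + 1 : ℝ) ^ (Finset.range (min r (2 ^ k + 1))).card ≤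
      (2 * r + μ + 1 : ℝ) ^ r := by
    rw [Finset.card_range]
    exact pow_le_pow_right₀ hB (min_le_left _ _)
  have h1' : -((r : ℝ) + μ) ≤ t := by exact_mod_cast h1
  have h2' : (t : ℝ) ≤ 2 ^ k + r + μ := by exact_mod_cast h2
  unfold extCoeff
  split_ifs with h3 h4 h5 h6 h7
  · refine (abs_eval_lagrangeBasis_le _ _ _ _ (δ := 1 / 2 ^ k) (by positivity) hB ?_ ?_).trans hcard
    · intro j _ hji
      rw [← sub_div, abs_div, abs_of_pos hpow]
      gcongr
      exact abs_natCast_sub_ge_one hji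
    · intro j hj
      have hjr : j < r := lt_of_lt_of_le (Finset.mem_range.mp hj) (min_le_left _ _)
      have hjr' : (j : ℝ) < r := by exact_mod_cast hjr
      have ht : (t : ℝ) < 0 := by exact_mod_cast h3
      have hj0 : (0 : ℝ) ≤ j := Nat.cast_nonneg j
      rw [← sub_div, abs_div, abs_of_pos hpow, mul_one_div]
      gcongr
      rw [abs_le]
      constructor <;> linarith
  · simpa using hB0
  · simpa using one_le_pow₀ hB
  · simpa using hB0
  · refine (abs_eval_lagrangeBasis_le _ _ _ _ (δ := 1 / 2 ^ k) (by positivity) hB ?_ ?_).trans hcard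
    · intro j _ hji
      have e : (1 : ℝ) - ((2 ^ k - y : ℕ) : ℝ) / 2 ^ k - (1 - j / 2 ^ k) =
        (j - ((2 ^ k - y : ℕ) : ℝ)) / 2 ^ k := by ring
      rw [e, abs_div, abs_of_pos hpow]
      gcongr
      exact abs_natCast_sub_ge_one hji.symm
    · intro j hj
      have hjr : j < r := lt_of_lt_of_le (Finset.mem_range.mp hj) (min_le_left _ _)
      have hjr' : (j : ℝ) < r := by exact_mod_cast hjr
      have ht : (2 : ℝ) ^ k < t := by exact_mod_cast not_le.mp h5
      have hj0 : (0 : ℝ) ≤ j := Nat.cast_nonneg j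
      have e : (t : ℝ) / 2 ^ k - (1 - j / 2 ^ k) = (t - 2 ^ k + j) / 2 ^ k := by
        field_simp
        ring
      rw [e, abs_div, abs_of_pos hpow, mul_one_div]
      gcongr
      rw [abs_le]
      constructor <;> linarith
  · simpa using hB0

/-- The weight of `g (y / 2^k)` in the coefficient of the `s`-th B-spline of `Q_k g`. -/
def splineCoeff (r μ : ℕ) (lam : ℤ → ℝ) (k : ℕ) (s : ℤ) (y : ℕ) : ℝ :=
  if -(r : ℤ) ≤ s ∧ s ≤ 2 ^ k + r then
    ∑ j ∈ Finset.Icc (-(μ : ℤ)) μ, lam j * extCoeff r k (s - j) y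
  else 0

/-- A point outside `[0,1]` is coupled only to the `r` grid points nearest to the end, and the
truncation of `s` keeps it within `r + μ` steps of that end. So the coefficients are local up to the
boundary. -/
lemma splineCoeff_eq_zero (r μ : ℕ) (lam : ℤ → ℝ) (k : ℕ) (s : ℤ) (y : ℕ) (hy : y ≤ 2 ^ k)
    (h : s ∉ Finset.Icc ((y : ℤ) - (2 * r + μ)) (y + (2 * r + μ))) :
    splineCoeff r μ lam k s y = 0 := by
  unfold splineCoeff
  split_ifs with hs
  · refine Finset.sum_eq_zero fun j hj => ?_
    rw [Finset.mem_Icc] at hj h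
    have hy' : (y : ℤ) ≤ 2 ^ k := by exact_mod_cast hy
    have hc : ((2 ^ k - y : ℕ) : ℤ) = 2 ^ k - y := by
      rw [Nat.cast_sub hy]; push_cast; rfl
    have : extCoeff r k (s - j) y = 0 := by
      unfold extCoeff
      split_ifs with h3 h4 h5 h6 h7
      · exfalso
        apply h
        have : y < r := lt_of_lt_of_le h4 (min_le_left _ _)
        constructor <;> omega
      · rfl
      · exfalso
        apply h
        constructor <;> omega
      · rfl
      · exfalso
        apply h
        have h8 : 2 ^ k - y < r := lt_of_lt_of_le h7 (min_le_left _ _)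
        have h9 : ((2 ^ k - y : ℕ) : ℤ) < r := by exact_mod_cast h8
        rw [hc] at h9
        push Not at h5
        constructor <;> linarith [hj.1, hj.2, hs.1, hs.2]
      · rfl
    rw [this, mul_zero]
  · rfl

/-- The weight of `g (y / 2^k)` in `Q_k g`. -/
def levelCoeff (r μ : ℕ) (lam : ℤ → ℝ) (k y : ℕ) (x : ℝ) : ℝ :=
  ∑ s ∈ Finset.Icc ((y : ℤ) - (2 * r + μ)) (y + (2 * r + μ)),
    splineCoeff r μ lam k s y * centeredBSpline r (2 ^ k * x - s)

lemma levelOp_eq_sum (r μ : ℕ) (lam : ℤ → ℝ) (k : ℕ) (g : ℝ → ℝ) {x : ℝ}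
    (hx : x ∈ Set.Icc (0 : ℝ) 1) :
    levelOp r μ lam k g x =
      ∑ y ∈ Finset.range (2 ^ k + 1), g ((y : ℝ) / 2 ^ k) * levelCoeff r μ lam k y x := by
  have h2 : (0 : ℝ) < 2 ^ k := by positivity
  have hsupp : Function.support (fun s : ℤ => (∑ j ∈ Finset.Icc (-(μ : ℤ)) μ,
      lam j * extend r k g (((s : ℝ) - j) / 2 ^ k)) * centeredBSpline r (2 ^ k * x - s)) ⊆
      ((Finset.Icc (-(r : ℤ)) (2 ^ k + r) : Finset ℤ) : Set ℤ) := by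
    intro s hs
    by_contra hns
    apply hs
    have : centeredBSpline r (2 ^ k * x - s) = 0 := by
      apply centeredBSpline_eq_zero
      have hr0 : (0 : ℝ) ≤ r := Nat.cast_nonneg r
      have hx1 : 2 ^ k * x ≤ (2 : ℝ) ^ k := by
        calc (2 : ℝ) ^ k * x ≤ 2 ^ k * 1 := by gcongr; exact hx.2
          _ = 2 ^ k := mul_one _
      have hx0 : 0 ≤ (2 : ℝ) ^ k * x := mul_nonneg h2.le hx.1
      simp only [Finset.coe_Icc, Set.mem_Icc, not_and_or, not_le] at hns
      rcases hns with h | h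
      · right
        have : (s : ℝ) < -r := by exact_mod_cast h
        linarith
      · left
        have : (2 : ℝ) ^ k + r < s := by exact_mod_cast h
        linarith
    simp only [this, mul_zero]
  rw [levelOp, quasiOp, finsum_eq_sum_of_support_subset _ hsupp]
  have hs1 : ∀ s ∈ Finset.Icc (-(r : ℤ)) (2 ^ k + r), (∑ j ∈ Finset.Icc (-(μ : ℤ)) μ,
      lam j * extend r k g (((s : ℝ) - j) / 2 ^ k)) * centeredBSpline r (2 ^ k * x - s) =
      ∑ y ∈ Finset.range (2 ^ k + 1), g ((y : ℝ) / 2 ^ k) *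
        (splineCoeff r μ lam k s y * centeredBSpline r (2 ^ k * x - s)) := by
    intro s hs
    rw [Finset.mem_Icc] at hs
    have : ∀ j : ℤ, extend r k g (((s : ℝ) - j) / 2 ^ k) =
        ∑ y ∈ Finset.range (2 ^ k + 1), extCoeff r k (s - j) y * g ((y : ℝ) / 2 ^ k) := by
      intro j
      have := extend_lattice r k g (s - j)
      push_cast at this
      exact this
    simp_rw [this, splineCoeff, if_pos hs, Finset.mul_sum]
    rw [Finset.sum_comm, Finset.sum_mul]
    refine Finset.sum_congr rfl fun y _ => ?_
    rw [Finset.sum_mul, Finset.sum_mul, Finset.mul_sum]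
    exact Finset.sum_congr rfl fun j _ => by ring
  rw [Finset.sum_congr rfl hs1, Finset.sum_comm]
  refine Finset.sum_congr rfl fun y hy => ?_
  rw [← Finset.mul_sum]
  congr 1
  have hy' : y ≤ 2 ^ k := by have := Finset.mem_range.mp hy; omega
  rw [levelCoeff]
  -- The two ranges of `s` differ only where the coefficient vanishes: outside the first by
  -- locality, outside the second by the truncation in `splineCoeff`.
  refine Finset.sum_congr_of_eq_on_inter ?_ ?_ fun _ _ _ => rfl
  · intro s _ hs
    rw [splineCoeff_eq_zero r μ lam k s y hy' hs, zero_mul]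
  · intro s _ hs
    rw [splineCoeff, if_neg (by rwa [Finset.mem_Icc] at hs), zero_mul]

/-- Uniformity in `s` comes from the truncation: without it the extrapolation weights would grow
with the distance to `[0,1]`. -/
lemma exists_bound_splineCoeff (r μ : ℕ) (lam : ℤ → ℝ) :
    ∃ C : ℝ, 0 ≤ C ∧ ∀ k s y, |splineCoeff r μ lam k s y| ≤ C := by
  refine ⟨∑ j ∈ Finset.Icc (-(μ : ℤ)) μ, |lam j| * (2 * r + μ + 1 : ℝ) ^ r, by positivity, ?_⟩
  intro k s y
  unfold splineCoeff
  split_ifs with hs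
  · refine (Finset.abs_sum_le_sum_abs _ _).trans (Finset.sum_le_sum fun j hj => ?_)
    rw [Finset.mem_Icc] at hj
    rw [abs_mul]
    gcongr
    exact abs_extCoeff_le r k μ _ y (by omega) (by linarith [hj.1, hs.2])
  · rw [abs_zero]; positivity

lemma exists_bound_levelCoeff (r μ : ℕ) (lam : ℤ → ℝ) :
    ∃ C : ℝ, 0 ≤ C ∧ ∀ k y x, |levelCoeff r μ lam k y x| ≤ C := by
  obtain ⟨C₁, hC₁0, hC₁⟩ := exists_bound_splineCoeff r μ lam
  obtain ⟨C₂, hC₂0, hC₂⟩ := exists_bound_cardinalBSpline r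
  refine ⟨(2 * (2 * r + μ) + 1) * (C₁ * C₂), by positivity, fun k y x => ?_⟩
  refine (Finset.abs_sum_le_sum_abs _ _).trans ?_
  calc _ ≤ ∑ _s ∈ Finset.Icc ((y : ℤ) - (2 * r + μ)) (y + (2 * r + μ)), C₁ * C₂ := by
        refine Finset.sum_le_sum fun s _ => ?_
        rw [abs_mul]
        exact mul_le_mul (hC₁ _ _ _) (hC₂ _) (abs_nonneg _) hC₁0
    _ = _ := by
        rw [Finset.sum_const, Int.card_Icc, nsmul_eq_mul]
        congr 1
        have : (y : ℤ) + (2 * r + μ) + 1 - (y - (2 * r + μ)) = ((2 * (2 * r + μ) + 1 : ℕ) : ℤ) := by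
          push_cast; ring
        rw [this, Int.toNat_natCast]
        push_cast; ring

lemma levelCoeff_eq_zero (r μ : ℕ) (lam : ℤ → ℝ) (k y : ℕ) {x : ℝ}
    (h : (3 * r + μ : ℝ) < |(y : ℝ) - 2 ^ k * x|) : levelCoeff r μ lam k y x = 0 := by
  refine Finset.sum_eq_zero fun s hs => ?_
  rw [Finset.mem_Icc] at hs
  have h1 : (y : ℝ) - (2 * r + μ) ≤ s := by exact_mod_cast hs.1
  have h2 : (s : ℝ) ≤ y + (2 * r + μ) := by exact_mod_cast hs.2
  have hr0 : (0 : ℝ) ≤ r := Nat.cast_nonneg r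
  rw [centeredBSpline_eq_zero, mul_zero]
  rcases lt_abs.mp h with h | h
  · left; linarith
  · right; linarith

lemma levelCoeff_isSplineCombination (r μ : ℕ) (lam : ℤ → ℝ) (k y : ℕ) :
    IsSplineCombination r k ((2 * (2 * r + μ) + 1) * 1) (levelCoeff r μ lam k y) := by
  have := IsSplineCombination.sum (r := r) (k := k) (N := 1)
    (Finset.Icc ((y : ℤ) - (2 * r + μ)) (y + (2 * r + μ)))
    (fun s x => splineCoeff r μ lam k s y * centeredBSpline r (2 ^ k * x - s))
    (fun s _ => (IsSplineCombination.centered r k s).smul _)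
  refine this.mono (le_of_eq ?_)
  rw [Int.card_Icc]
  congr 1
  omega

lemma levelCoeff_isSplineCombination_coarse (r : ℕ) (hr : 0 < r) (μ : ℕ) (lam : ℤ → ℝ)
    (k y : ℕ) : IsSplineCombination r (k + 1) ((2 * (2 * r + μ) + 1) * (r + 1))
      (levelCoeff r μ lam k y) := by
  have := IsSplineCombination.sum (r := r) (k := k + 1) (N := r + 1)
    (Finset.Icc ((y : ℤ) - (2 * r + μ)) (y + (2 * r + μ)))
    (fun s x => splineCoeff r μ lam k s y * centeredBSpline r (2 ^ k * x - s))
    (fun s _ => (IsSplineCombination.centered_coarse r hr k s).smul _)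
  refine this.mono (le_of_eq ?_)
  rw [Int.card_Icc]
  congr 1
  omega

lemma extend_polynomial (r k : ℕ) (P : Polynomial ℝ) (hP : P.degree < (min r (2 ^ k + 1) : ℕ))
    (y : ℝ) : extend r k (fun z => P.eval z) y = P.eval y := by
  have h2 : (0 : ℝ) < 2 ^ k := by positivity
  unfold extend
  split_ifs
  · rw [leftPoly, ← Lagrange.eq_interpolate]
    · intro i _ j _ hij
      have := (div_left_inj' h2.ne').mp hij
      exact_mod_cast this
    · rwa [Finset.card_range]
  · rfl
  · rw [rightPoly, ← Lagrange.eq_interpolate]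
    · intro i _ j _ hij
      have := (div_left_inj' h2.ne').mp (sub_right_injective hij)
      exact_mod_cast this
    · rwa [Finset.card_range]

/-- At low levels fewer than `r` nodes are available, so the extension, and with it `Q_k`, is only
guaranteed to preserve degrees below the number of nodes. -/
lemma levelOp_polynomial {r μ : ℕ} {lam : ℤ → ℝ} (hQ : IsQuasiInterpolation r μ lam) (k : ℕ)
    (P : Polynomial ℝ) (hP : P.degree < (min r (2 ^ k + 1) : ℕ)) (x : ℝ) :
    levelOp r μ lam k (fun z => P.eval z) x = P.eval x := by
  have h2 : (0 : ℝ) < 2 ^ k := by positivity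
  have e : ∀ y : ℝ, P.eval (y / 2 ^ k) =
      (P.comp (Polynomial.C ((2 ^ k : ℝ)⁻¹) * Polynomial.X)).eval y := by
    intro y
    rw [Polynomial.eval_comp, Polynomial.eval_mul, Polynomial.eval_C, Polynomial.eval_X,
      div_eq_inv_mul]
  have hdeg : (P.comp (Polynomial.C ((2 ^ k : ℝ)⁻¹) * Polynomial.X)).degree < (r : WithBot ℕ) := by
    by_cases hP0 : P = 0
    · subst hP0
      simp only [Polynomial.zero_comp, Polynomial.degree_zero]
      exact WithBot.bot_lt_coe r
    rw [Polynomial.degree_eq_natDegree hP0] at hP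
    have h3 : P.natDegree < min r (2 ^ k + 1) := by exact_mod_cast hP
    refine lt_of_le_of_lt Polynomial.degree_le_natDegree ?_
    rw [Polynomial.natDegree_comp, Polynomial.natDegree_C_mul_X _ (by positivity), mul_one]
    exact_mod_cast lt_of_lt_of_le h3 (min_le_left _ _)
  rw [levelOp]
  simp_rw [extend_polynomial r k P hP, e]
  rw [hQ.reproduces _ hdeg, ← e]
  congr 1
  field_simp

/-- The weight of `g (y / 2^k)` in `(Q_k - Q_{k-1}) g`. -/
def levelDiffCoeff (r μ : ℕ) (lam : ℤ → ℝ) : ℕ → ℕ → ℝ → ℝ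
  | 0, y, x => levelCoeff r μ lam 0 y x
  | k + 1, y, x => levelCoeff r μ lam (k + 1) y x -
      if Even y then levelCoeff r μ lam k (y / 2) x else 0

/-- The grid of level `k` is the part with even indices of the grid of level `k + 1`. -/
lemma sum_range_even {M : Type*} [AddCommMonoid M] (m : ℕ) (F : ℕ → M) :
    ∑ y ∈ Finset.range (2 * m + 1), (if Even y then F (y / 2) else 0) =
      ∑ y ∈ Finset.range (m + 1), F y := by
  rw [← Finset.sum_filter]
  refine Finset.sum_nbij' (fun y => y / 2) (fun y => 2 * y) ?_ ?_ ?_ ?_ ?_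
  · intro y hy
    simp only [Finset.mem_filter, Finset.mem_range] at hy ⊢
    omega
  · intro y hy
    simp only [Finset.mem_filter, Finset.mem_range] at hy ⊢
    exact ⟨by omega, even_two_mul y⟩
  · intro y hy
    simp only [Finset.mem_filter] at hy
    exact Nat.two_mul_div_two_of_even hy.2
  · intro y _
    simp
  · intro y _
    rfl

lemma levelDiff_eq_sum (r μ : ℕ) (lam : ℤ → ℝ) (k : ℕ) (g : ℝ → ℝ) {x : ℝ}
    (hx : x ∈ Set.Icc (0 : ℝ) 1) :
    levelDiff r μ lam k g x =
      ∑ y ∈ Finset.range (2 ^ k + 1), g ((y : ℝ) / 2 ^ k) * levelDiffCoeff r μ lam k y x := by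
  rcases k with _ | k
  · simpa [levelDiff, levelDiffCoeff] using levelOp_eq_sum r μ lam 0 g hx
  · simp only [levelDiff, levelDiffCoeff, mul_sub, Finset.sum_sub_distrib]
    rw [← levelOp_eq_sum r μ lam (k + 1) g hx, levelOp_eq_sum r μ lam k g hx]
    congr 1
    have := sum_range_even (2 ^ k) (fun y => g ((y : ℝ) / 2 ^ k) * levelCoeff r μ lam k y x)
    rw [← this, show 2 * 2 ^ k = 2 ^ (k + 1) by ring]
    refine Finset.sum_congr rfl fun y _ => ?_
    split_ifs with hy
    · obtain ⟨z, rfl⟩ := hy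
      have : (z + z) / 2 = z := by omega
      rw [this]
      congr 2
      push_cast
      rw [pow_succ]
      field_simp
      ring
    · simp

lemma exists_bound_levelDiffCoeff (r μ : ℕ) (lam : ℤ → ℝ) :
    ∃ C : ℝ, 0 ≤ C ∧ ∀ k y x, |levelDiffCoeff r μ lam k y x| ≤ C := by
  obtain ⟨C, hC0, hC⟩ := exists_bound_levelCoeff r μ lam
  refine ⟨C + C, by positivity, fun k y x => ?_⟩
  rcases k with _ | k
  · exact (hC 0 y x).trans (by linarith)
  · simp only [levelDiffCoeff]
    refine (abs_sub _ _).trans (add_le_add (hC _ _ _) ?_)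
    split_ifs
    · exact hC _ _ _
    · simpa using hC0

/-- The factor 2 arises since distances measured in coarse steps double when measured in steps of
the finer level. -/
lemma levelDiffCoeff_eq_zero (r μ : ℕ) (lam : ℤ → ℝ) (k y : ℕ) {x : ℝ}
    (h : 2 * (3 * r + μ : ℝ) < |(y : ℝ) - 2 ^ k * x|) : levelDiffCoeff r μ lam k y x = 0 := by
  have h0 : (0 : ℝ) ≤ 3 * r + μ := by positivity
  rcases k with _ | k
  · exact levelCoeff_eq_zero r μ lam 0 y (by linarith)
  · simp only [levelDiffCoeff]
    rw [levelCoeff_eq_zero r μ lam (k + 1) y (by linarith)]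
    split_ifs with hy
    · obtain ⟨z, rfl⟩ := hy
      have : (z + z) / 2 = z := by omega
      rw [this, levelCoeff_eq_zero r μ lam k z, sub_zero]
      have e : ((z + z : ℕ) : ℝ) - 2 ^ (k + 1) * x = 2 * ((z : ℝ) - 2 ^ k * x) := by
        push_cast; ring
      rw [e, abs_mul, abs_two] at h
      linarith
    · simp

lemma levelDiffCoeff_isSplineCombination (r : ℕ) (hr : 0 < r) (μ : ℕ) (lam : ℤ → ℝ) (k y : ℕ) :
    IsSplineCombination r k ((2 * (2 * r + μ) + 1) * (r + 2)) (levelDiffCoeff r μ lam k y) := by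
  rcases k with _ | k
  · exact (levelCoeff_isSplineCombination r μ lam 0 y).mono (by gcongr; omega)
  · have h1 := levelCoeff_isSplineCombination r μ lam (k + 1) y
    have h2 := (levelCoeff_isSplineCombination_coarse r hr μ lam k (y / 2)).smul
      (if Even y then -1 else 0)
    convert h1.add h2 using 1
    · ring
    · funext x
      simp only [levelDiffCoeff]
      split_ifs <;> ring

lemma measurable_levelDiffCoeff (r : ℕ) (hr : 0 < r) (μ : ℕ) (lam : ℤ → ℝ) (k y : ℕ) :
    Measurable (levelDiffCoeff r μ lam k y) :=
  (levelDiffCoeff_isSplineCombination r hr μ lam k y).measurable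

/-- The condition `r ≤ 2 ^ k + 1` makes both levels reproduce all degrees below `r`, so their
difference annihilates them. -/
lemma sum_levelDiffCoeff_polynomial {r μ : ℕ} {lam : ℤ → ℝ} (hQ : IsQuasiInterpolation r μ lam)
    (k : ℕ) (hk : r ≤ 2 ^ k + 1) (P : Polynomial ℝ) (hP : P.degree < r) {x : ℝ}
    (hx : x ∈ Set.Icc (0 : ℝ) 1) :
    ∑ y ∈ Finset.range (2 ^ (k + 1) + 1),
      P.eval ((y : ℝ) / 2 ^ (k + 1)) * levelDiffCoeff r μ lam (k + 1) y x = 0 := by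
  rw [← levelDiff_eq_sum r μ lam (k + 1) (fun z => P.eval z) hx]
  have hk' : r ≤ 2 ^ (k + 1) + 1 := by rw [pow_succ]; omega
  simp only [levelDiff]
  rw [levelOp_polynomial hQ _ P (by rwa [min_eq_left hk']),
    levelOp_polynomial hQ _ P (by rwa [min_eq_left hk]), sub_self]

lemma sum_levelCoeff {r μ : ℕ} (hr : 0 < r) {lam : ℤ → ℝ} (hQ : IsQuasiInterpolation r μ lam)
    (k : ℕ) {x : ℝ} (hx : x ∈ Set.Icc (0 : ℝ) 1) :
    ∑ y ∈ Finset.range (2 ^ k + 1), levelCoeff r μ lam k y x = 1 := by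
  have h := levelOp_polynomial hQ k (Polynomial.C 1) (by
    rw [Polynomial.degree_C one_ne_zero]
    exact_mod_cast (lt_min hr (Nat.succ_pos _))) x
  rw [levelOp_eq_sum r μ lam k _ hx] at h
  simpa using h

/-! ### The mixed operators and the linear sampling algorithm -/

lemma mem_cube_iff {d : ℕ} {x : Fin d → ℝ} : x ∈ cube d ↔ ∀ i, x i ∈ Set.Icc (0 : ℝ) 1 := by
  simp only [cube, Set.mem_Icc, Pi.le_def, Pi.zero_apply, Pi.one_apply]
  exact forall_and.symm

lemma measurableSet_cube (d : ℕ) : MeasurableSet (cube d) := measurableSet_Icc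

lemma volume_cube (d : ℕ) : volume (cube d) = 1 := by
  rw [cube, Real.volume_Icc_pi]
  simp

instance isProbabilityMeasure_cubeMeasure (d : ℕ) : IsProbabilityMeasure (cubeMeasure d) :=
  ⟨by rw [cubeMeasure, Measure.restrict_apply_univ, volume_cube]⟩

/-- The functional `g ↦ (Q_k - Q_{k-1}) g (x)`. -/
def levelDiffFunctional (r μ : ℕ) (lam : ℤ → ℝ) (k : ℕ) (x : ℝ) : ℝ →₀ ℝ :=
  ∑ y ∈ Finset.range (2 ^ k + 1), levelDiffCoeff r μ lam k y x • Finsupp.single ((y : ℝ) / 2 ^ k) 1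

lemma levelDiff_eq_linearCombination (r μ : ℕ) (lam : ℤ → ℝ) (k : ℕ) (g : ℝ → ℝ) {x : ℝ}
    (hx : x ∈ Set.Icc (0 : ℝ) 1) :
    levelDiff r μ lam k g x =
      Finsupp.linearCombination ℝ g (levelDiffFunctional r μ lam k x) := by
  rw [levelDiff_eq_sum r μ lam k g hx, levelDiffFunctional, linearCombination_sum_single]
  exact Finset.sum_congr rfl fun _ _ => mul_comm _ _

lemma mixedLevelDiff_eq_tensorEval {d : ℕ} (r μ : ℕ) (lam : ℤ → ℝ) (k : Fin d → ℕ)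
    (f : (Fin d → ℝ) → ℝ) {x : Fin d → ℝ} (hx : x ∈ cube d) :
    mixedLevelDiff r μ lam k f x =
      tensorEval f (fun i => levelDiffFunctional r μ lam (k i) (x i)) :=
  tensorOp_eq_tensorEval f _ (fun i z => levelDiffFunctional r μ lam (k i) z) (Set.Icc 0 1)
    (fun i g _ hz => levelDiff_eq_linearCombination r μ lam (k i) g hz) x (mem_cube_iff.mp hx)

/-- The weight of `f (2^{-k} j)` in `q_k f`. -/
def mixedCoeff {d : ℕ} (r μ : ℕ) (lam : ℤ → ℝ) (k j : Fin d → ℕ) (x : Fin d → ℝ) : ℝ :=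
  ∏ i, levelDiffCoeff r μ lam (k i) (j i) (x i)

lemma mixedLevelDiff_eq_sum {d : ℕ} (r μ : ℕ) (lam : ℤ → ℝ) (k : Fin d → ℕ)
    (f : (Fin d → ℝ) → ℝ) {x : Fin d → ℝ} (hx : x ∈ cube d) :
    mixedLevelDiff r μ lam k f x =
      ∑ j ∈ gridIndices k, f (gridPoint k j) * mixedCoeff r μ lam k j x := by
  rw [mixedLevelDiff_eq_tensorEval r μ lam k f hx]
  simp only [levelDiffFunctional]
  rw [tensorEval_sum_single]
  exact Finset.sum_congr rfl fun _ _ => mul_comm _ _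

lemma measurable_mixedCoeff {d : ℕ} (r : ℕ) (hr : 0 < r) (μ : ℕ) (lam : ℤ → ℝ)
    (k j : Fin d → ℕ) : Measurable (mixedCoeff r μ lam k j) :=
  Finset.measurable_fun_prod _ fun i _ =>
    (measurable_levelDiffCoeff r hr μ lam (k i) (j i)).comp (measurable_pi_apply i)

lemma memLp_mixedCoeff {d : ℕ} (r : ℕ) (hr : 0 < r) (μ : ℕ) (lam : ℤ → ℝ)
    (k j : Fin d → ℕ) (q : ℝ≥0∞) : MemLp (mixedCoeff r μ lam k j) q (cubeMeasure d) := by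
  obtain ⟨C, hC0, hC⟩ := exists_bound_levelDiffCoeff r μ lam
  refine MemLp.of_bound (measurable_mixedCoeff r hr μ lam k j).aestronglyMeasurable (C ^ d)
    (Filter.Eventually.of_forall fun x => ?_)
  rw [Real.norm_eq_abs, mixedCoeff, Finset.abs_prod]
  calc _ ≤ ∏ _i : Fin d, C := Finset.prod_le_prod (fun _ _ => abs_nonneg _) fun i _ => hC _ _ _
    _ = C ^ d := by simp

lemma exists_spline_representation (d r : ℕ) (hr : 0 < r) (μ : ℕ) (lam : ℤ → ℝ) :
    ∃ (N : ℕ) (ψ : (Fin d → ℕ) → (Fin d → ℕ) → (Fin d → ℝ) → ℝ),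
      (∀ k j, ∃ (F : Finset (Fin d → ℤ)) (b : (Fin d → ℤ) → ℝ),
        F.card ≤ N ∧ (∀ s ∈ F, ∃ x ∈ cube d, dilatedBSpline r k s x ≠ 0) ∧
        ψ k j = fun x => ∑ s ∈ F, b s * dilatedBSpline r k s x) ∧
      ∀ k j, ∀ x ∈ cube d, ψ k j x = mixedCoeff r μ lam k j x := by
  classical
  choose b hbN hb using levelDiffCoeff_isSplineCombination r hr μ lam
  set N₁ := (2 * (2 * r + μ) + 1) * (r + 2)
  -- Splines that vanish on `[0,1]` are discarded. This does not change values on the cube, and a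
  -- tensor product of the remaining ones is nonzero at a point assembled coordinate by coordinate.
  let G : ℕ → ℕ → Finset ℤ := fun k y =>
    (b k y).support.filter fun s => ∃ x ∈ Set.Icc (0 : ℝ) 1, dilatedBSpline₁ r k s x ≠ 0
  refine ⟨N₁ ^ d, fun k j x => ∑ s ∈ Fintype.piFinset (fun i => G (k i) (j i)),
    (∏ i, b (k i) (j i) (s i)) * dilatedBSpline r k s x, ?_, ?_⟩
  · intro k j
    refine ⟨Fintype.piFinset (fun i => G (k i) (j i)), fun s => ∏ i, b (k i) (j i) (s i), ?_, ?_,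
      rfl⟩
    · rw [Fintype.card_piFinset]
      calc ∏ i, (G (k i) (j i)).card ≤ ∏ _i : Fin d, N₁ :=
            Finset.prod_le_prod (fun _ _ => Nat.zero_le _) fun i _ =>
              (Finset.card_filter_le _ _).trans (hbN (k i) (j i))
        _ = N₁ ^ d := by simp
    · intro s hs
      have h1 : ∀ i, ∃ x ∈ Set.Icc (0 : ℝ) 1, dilatedBSpline₁ r (k i) (s i) x ≠ 0 := fun i =>
        (Finset.mem_filter.mp (Fintype.mem_piFinset.mp hs i)).2
      choose x hx hx' using h1
      refine ⟨x, mem_cube_iff.mpr hx, ?_⟩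
      rw [dilatedBSpline_eq_prod]
      exact Finset.prod_ne_zero_iff.mpr fun i _ => hx' i
  · intro k j x hx
    have h1 : ∀ i, levelDiffCoeff r μ lam (k i) (j i) (x i) =
        ∑ s ∈ G (k i) (j i), b (k i) (j i) s * dilatedBSpline₁ r (k i) s (x i) := by
      intro i
      rw [hb (k i) (j i) (x i), Finsupp.sum, Finset.sum_filter]
      refine Finset.sum_congr rfl fun s _ => ?_
      split_ifs with h
      · rfl
      · push Not at h
        rw [h (x i) (mem_cube_iff.mp hx i), mul_zero]
    simp only [mixedCoeff]
    rw [Finset.prod_congr rfl fun i _ => h1 i, Finset.prod_univ_sum]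
    refine Finset.sum_congr rfl fun s _ => ?_
    rw [dilatedBSpline_eq_prod, ← Finset.prod_mul_distrib]

lemma gridPoint_mem_cube {d : ℕ} {k j : Fin d → ℕ} (hj : j ∈ gridIndices k) :
    gridPoint k j ∈ cube d := by
  rw [mem_cube_iff]
  intro i
  have h := Finset.mem_range.mp (Fintype.mem_piFinset.mp hj i)
  have h2 : (0 : ℝ) < 2 ^ k i := by positivity
  refine ⟨by unfold gridPoint; positivity, ?_⟩
  rw [gridPoint, div_le_one h2]
  have : j i ≤ 2 ^ k i := by omega
  exact_mod_cast this

/-- Several pairs `(k, s)` may give the same grid point; their weights are collected at one index.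
If the grid has fewer than `n` points, the surplus indices repeat a node and have weight zero. -/
lemma exists_sampling_representation {d : ℕ} (r : ℕ) (hr : 0 < r) (μ : ℕ) (lam : ℤ → ℝ)
    (q : ℝ≥0∞) {Δ : Set (Fin d → ℕ)} (hΔ : Δ.Finite) (hne : Δ.Nonempty) {n : ℕ}
    (hn : (grid Δ).encard ≤ n) :
    ∃ (X : Fin n → cube d) (Φ : Fin n → (Fin d → ℝ) → ℝ),
      Set.range (fun j => (X j : Fin d → ℝ)) = grid Δ ∧
      (∀ j, MemLp (Φ j) q (cubeMeasure d)) ∧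
      ∀ (f : (Fin d → ℝ) → ℝ), ∀ x ∈ cube d,
        sparseOp r μ lam Δ f x = samplingAlgorithm X Φ f x := by
  classical
  obtain ⟨k₀, hk₀⟩ := hne
  have hgfin : (grid Δ).Finite := Set.finite_of_encard_le_coe hn
  have hgne : (grid Δ).Nonempty :=
    ⟨gridPoint k₀ 0, k₀, hk₀, 0, Fintype.mem_piFinset.mpr fun i => by simp, rfl⟩
  have hsub : grid Δ ⊆ cube d := by
    rintro _ ⟨k, _, s, hs, rfl⟩
    exact gridPoint_mem_cube hs
  have hcard : hgfin.toFinset.card ≤ n := by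
    rw [hgfin.encard_eq_coe_toFinset_card] at hn
    exact_mod_cast hn
  obtain ⟨e⟩ : Nonempty (hgfin.toFinset ↪ Fin n) := by
    apply Function.Embedding.nonempty_of_card_le
    simpa using hcard
  have hne' : Nonempty hgfin.toFinset := ⟨⟨hgne.some, by simpa using hgne.some_mem⟩⟩
  let X₀ : Fin n → hgfin.toFinset := Function.invFun e
  have hX₀ : ∀ z, X₀ (e z) = z := Function.leftInverse_invFun e.injective
  let X : Fin n → cube d := fun j => ⟨X₀ j, hsub (hgfin.mem_toFinset.mp (X₀ j).2)⟩
  let idx : (Fin d → ℝ) → Option (Fin n) := fun z =>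
    if h : z ∈ hgfin.toFinset then some (e ⟨z, h⟩) else none
  refine ⟨X, fun j x => ∑ k ∈ hΔ.toFinset, ∑ s ∈ gridIndices k,
    (if idx (gridPoint k s) = some j then 1 else 0) * mixedCoeff r μ lam k s x, ?_, ?_, ?_⟩
  · ext z
    constructor
    · rintro ⟨j, rfl⟩
      exact hgfin.mem_toFinset.mp (X₀ j).2
    · intro hz
      exact ⟨e ⟨z, hgfin.mem_toFinset.mpr hz⟩, by simp [X, hX₀]⟩
  · intro j
    exact memLp_finsetSum _ fun k _ => memLp_finsetSum _ fun s _ =>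
      (memLp_mixedCoeff r hr μ lam k s q).const_mul _
  · intro f x hx
    rw [sparseOp, finsum_mem_eq_finite_toFinset_sum _ hΔ, samplingAlgorithm]
    simp_rw [mixedLevelDiff_eq_sum r μ lam _ f hx, Finset.mul_sum]
    rw [Finset.sum_comm]
    refine Finset.sum_congr rfl fun k hk => ?_
    rw [Finset.sum_comm]
    refine Finset.sum_congr rfl fun s hs => ?_
    have hg : gridPoint k s ∈ hgfin.toFinset :=
      hgfin.mem_toFinset.mpr ⟨k, hΔ.mem_toFinset.mp hk, s, hs, rfl⟩
    have hidx : idx (gridPoint k s) = some (e ⟨_, hg⟩) := by simp only [idx, dif_pos hg]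
    rw [Finset.sum_eq_single (e ⟨_, hg⟩)]
    · simp [hidx, X, hX₀]
    · intro j _ hj
      rw [hidx, if_neg (by simpa using hj.symm)]
      ring
    · simp

/-! ### Geometric sums over multi-indices -/

lemma tsum_indicator_le_of_injOn {α β : Type*} (S : Set α) (φ : α → β) (hφ : Set.InjOn φ S)
    (F : α → ℝ≥0∞) (G : β → ℝ≥0∞) (h : ∀ x ∈ S, F x ≤ G (φ x)) :
    ∑' x, S.indicator F x ≤ ∑' y, G y := by
  rw [← tsum_subtype]
  calc ∑' x : S, F x ≤ ∑' x : S, G (φ x) := ENNReal.tsum_le_tsum fun x => h x x.2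
    _ ≤ ∑' y, G y :=
      ENNReal.tsum_comp_le_tsum_of_injective (f := fun x : S => φ x)
        (fun x y hxy => Subtype.ext (hφ x.2 y.2 hxy)) G

/-- An inequality is all that is needed, and every finite set of multi-indices lies in a box. -/
lemma tsum_pi_prod_le {d : ℕ} (g : Fin d → ℕ → ℝ≥0∞) :
    ∑' l : Fin d → ℕ, ∏ i, g i (l i) ≤ ∏ i, ∑' n, g i n := by
  classical
  rw [ENNReal.tsum_eq_iSup_sum]
  refine iSup_le fun s => ?_
  let t : Fin d → Finset ℕ := fun i => s.image fun l => l i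
  calc ∑ l ∈ s, ∏ i, g i (l i) ≤ ∑ l ∈ Fintype.piFinset t, ∏ i, g i (l i) := by
        refine Finset.sum_le_sum_of_subset fun l hl => ?_
        exact Fintype.mem_piFinset.mpr fun i => Finset.mem_image_of_mem _ hl
    _ = ∏ i, ∑ n ∈ t i, g i n := (Finset.prod_univ_sum t g).symm
    _ ≤ ∏ i, ∑' n, g i n := Finset.prod_le_prod' fun i _ => ENNReal.sum_le_tsum _

lemma two_rpow_ne_zero (x : ℝ) : (2 : ℝ≥0∞) ^ x ≠ 0 := by simp [ENNReal.rpow_eq_zero_iff]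

lemma two_rpow_ne_top (x : ℝ) : (2 : ℝ≥0∞) ^ x ≠ ⊤ := by simp [ENNReal.rpow_eq_top_iff]

lemma two_rpow_add (x y : ℝ) : (2 : ℝ≥0∞) ^ (x + y) = 2 ^ x * 2 ^ y :=
  ENNReal.rpow_add _ _ two_ne_zero ENNReal.ofNat_ne_top

lemma two_rpow_mono {x y : ℝ} (h : x ≤ y) : (2 : ℝ≥0∞) ^ x ≤ 2 ^ y :=
  ENNReal.rpow_le_rpow_of_exponent_le one_le_two h

lemma two_rpow_sum {ι : Type*} (s : Finset ι) (x : ι → ℝ) :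
    (2 : ℝ≥0∞) ^ (∑ i ∈ s, x i) = ∏ i ∈ s, 2 ^ x i := by
  classical
  induction s using Finset.induction_on with
  | empty => simp
  | insert i s hi ih => rw [Finset.sum_insert hi, Finset.prod_insert hi, two_rpow_add, ih]

lemma tsum_two_rpow_ne_top {δ : ℝ} (hδ : 0 < δ) : ∑' n : ℕ, (2 : ℝ≥0∞) ^ (-(δ * n)) ≠ ⊤ := by
  have : ∀ n : ℕ, (2 : ℝ≥0∞) ^ (-(δ * n)) = ((2 : ℝ≥0∞) ^ (-δ)) ^ n := by
    intro n
    rw [← ENNReal.rpow_natCast, ← ENNReal.rpow_mul]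
    congr 1; ring
  simp_rw [this, ENNReal.tsum_geometric]
  rw [ENNReal.inv_ne_top]
  have h1 : (2 : ℝ≥0∞) ^ (-δ) < 1 := by
    rw [ENNReal.rpow_neg, ENNReal.inv_lt_one]
    exact ENNReal.one_lt_rpow ENNReal.one_lt_two hδ
  exact ne_of_gt (tsub_pos_iff_lt.mpr h1)

/-- `|l| = l_1 + ⋯ + l_d`, as a real number. -/
def len {d : ℕ} (l : Fin d → ℕ) : ℝ := ∑ i, (l i : ℝ)

lemma len_nonneg {d : ℕ} (l : Fin d → ℕ) : 0 ≤ len l := by unfold len; positivity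

lemma tsum_two_rpow_len_ne_top (d : ℕ) {δ : ℝ} (hδ : 0 < δ) :
    ∑' l : Fin d → ℕ, (2 : ℝ≥0∞) ^ (-(δ * len l)) ≠ ⊤ := by
  have h : ∀ l : Fin d → ℕ, (2 : ℝ≥0∞) ^ (-(δ * len l)) = ∏ i, (2 : ℝ≥0∞) ^ (-(δ * l i)) := by
    intro l
    rw [← two_rpow_sum, len, Finset.mul_sum, Finset.sum_neg_distrib]
  simp_rw [h]
  refine ne_top_of_le_ne_top ?_ (tsum_pi_prod_le fun _ n => (2 : ℝ≥0∞) ^ (-(δ * n)))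
  exact ENNReal.prod_ne_top fun i _ => tsum_two_rpow_ne_top hδ

/-- The `ℓ_1` distance of two multi-indices. -/
def dist₁ {d : ℕ} (k l : Fin d → ℕ) : ℝ := ∑ i, |(k i : ℝ) - l i|

lemma dist₁_comm {d : ℕ} (k l : Fin d → ℕ) : dist₁ k l = dist₁ l k := by
  simp only [dist₁, abs_sub_comm]

lemma tsum_two_rpow_abs_sub_le (δ : ℝ) (m : ℕ) :
    ∑' n : ℕ, (2 : ℝ≥0∞) ^ (-(δ * |(n : ℝ) - m|)) ≤ 2 * ∑' n : ℕ, (2 : ℝ≥0∞) ^ (-(δ * n)) := by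
  have h1 : ∀ n : ℕ, (2 : ℝ≥0∞) ^ (-(δ * |(n : ℝ) - m|)) ≤
      {n | m ≤ n}.indicator (fun n : ℕ => (2 : ℝ≥0∞) ^ (-(δ * |(n : ℝ) - m|))) n +
      {n | n ≤ m}.indicator (fun n : ℕ => (2 : ℝ≥0∞) ^ (-(δ * |(n : ℝ) - m|))) n := by
    intro n
    rcases le_total m n with h | h
    · rw [Set.indicator_of_mem (show n ∈ {n | m ≤ n} from h)]
      exact le_self_add
    · rw [Set.indicator_of_mem (show n ∈ {n | n ≤ m} from h)]
      exact le_add_self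
  refine (ENNReal.tsum_le_tsum h1).trans ?_
  rw [ENNReal.tsum_add, two_mul]
  refine add_le_add ?_ ?_
  · refine tsum_indicator_le_of_injOn _ (fun n => n - m) ?_ _ _ ?_
    · intro a ha b hb hab
      simp only [Set.mem_ofPred_eq] at ha hb hab
      omega
    · intro n hn
      have hn' : m ≤ n := hn
      rw [Nat.cast_sub hn', abs_of_nonneg (sub_nonneg.mpr (by exact_mod_cast hn'))]
  · refine tsum_indicator_le_of_injOn _ (fun n => m - n) ?_ _ _ ?_
    · intro a ha b hb hab
      simp only [Set.mem_ofPred_eq] at ha hb hab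
      omega
    · intro n hn
      have hn' : n ≤ m := hn
      rw [Nat.cast_sub hn', abs_of_nonpos (sub_nonpos.mpr (by exact_mod_cast hn')), neg_sub]

/-- The sums `∑_k 2^{-δ|k - m|}` are bounded. -/
lemma exists_bound_tsum_dist (d : ℕ) {δ : ℝ} (hδ : 0 < δ) :
    ∃ C : ℝ≥0∞, C ≠ ⊤ ∧ ∀ m : Fin d → ℕ, ∑' k, (2 : ℝ≥0∞) ^ (-(δ * dist₁ k m)) ≤ C := by
  refine ⟨(2 * ∑' n : ℕ, (2 : ℝ≥0∞) ^ (-(δ * n))) ^ d,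
    ENNReal.pow_ne_top (ENNReal.mul_ne_top ENNReal.ofNat_ne_top (tsum_two_rpow_ne_top hδ)), ?_⟩
  intro m
  have h : ∀ k : Fin d → ℕ, (2 : ℝ≥0∞) ^ (-(δ * dist₁ k m)) =
      ∏ i, (2 : ℝ≥0∞) ^ (-(δ * |(k i : ℝ) - m i|)) := by
    intro k
    rw [← two_rpow_sum, dist₁, Finset.mul_sum, Finset.sum_neg_distrib]
  simp_rw [h]
  refine (tsum_pi_prod_le fun i n => (2 : ℝ≥0∞) ^ (-(δ * |(n : ℝ) - m i|))).trans ?_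
  calc _ ≤ ∏ _i : Fin d, (2 * ∑' n : ℕ, (2 : ℝ≥0∞) ^ (-(δ * n))) :=
        Finset.prod_le_prod' fun i _ => tsum_two_rpow_abs_sub_le δ (m i)
    _ = _ := by simp

/-! ### Sums over the index sets -/

lemma sum_eq_zero_add {d : ℕ} [NeZero d] (F : Fin d → ℝ) :
    ∑ i, F i = F 0 + ∑ i ∈ Finset.univ.erase 0, F i :=
  (Finset.add_sum_erase _ _ (Finset.mem_univ 0)).symm

lemma len_update_zero {d : ℕ} [NeZero d] (k : Fin d → ℕ) (n : ℕ) :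
    len (Function.update k 0 n) = n + ∑ i ∈ Finset.univ.erase 0, (k i : ℝ) := by
  rw [len, sum_eq_zero_add, Function.update_self]
  congr 1
  refine Finset.sum_congr rfl fun i hi => ?_
  rw [Function.update_of_ne (Finset.ne_of_mem_erase hi)]

lemma exists_pos_le_of_forall_pos {ι : Type*} (s : Finset ι) (F : ι → ℝ) (h : ∀ i ∈ s, 0 < F i) :
    ∃ δ : ℝ, 0 < δ ∧ δ ≤ 1 ∧ ∀ i ∈ s, δ ≤ F i := by
  classical
  induction s using Finset.induction_on with
  | empty => exact ⟨1, one_pos, le_rfl, by simp⟩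
  | insert j s _ ih =>
    obtain ⟨δ, h0, h1, h2⟩ := ih fun i hi => h i (Finset.mem_insert_of_mem hi)
    refine ⟨min δ (F j), lt_min h0 (h j (Finset.mem_insert_self _ _)), (min_le_left _ _).trans h1,
      fun i hi => ?_⟩
    rcases Finset.mem_insert.mp hi with rfl | hi
    · exact min_le_right _ _
    · exact (min_le_left _ _).trans (h2 i hi)

/-- When the other coordinates are fixed, `F` varies with unit slope in `k 0`, so equal integer
parts force equal `k 0`. The first coordinate may thus be exchanged for the integer part of a slack
variable. -/
lemma injOn_update_floor {d : ℕ} [NeZero d] (S : Set (Fin d → ℕ)) (F : (Fin d → ℕ) → ℝ)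
    (h0 : ∀ k ∈ S, 0 ≤ F k)
    (h1 : ∀ k ∈ S, ∀ l ∈ S, (∀ i, i ≠ 0 → k i = l i) → |F k - F l| = |(k 0 : ℝ) - l 0|) :
    Set.InjOn (fun k => Function.update k 0 ⌊F k⌋₊) S := by
  intro k hk l hl hkl
  have h2 : ∀ i, i ≠ 0 → k i = l i := by
    intro i hi
    have := congrFun hkl i
    simpa [Function.update_of_ne hi] using this
  have h3 : ⌊F k⌋₊ = ⌊F l⌋₊ := by
    have := congrFun hkl 0
    simpa using this
  have h4 := h1 k hk l hl h2
  have h5 : |F k - F l| < 1 := by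
    rw [abs_lt]
    have a1 := Nat.floor_le (h0 k hk)
    have a2 := Nat.lt_floor_add_one (F k)
    have b1 := Nat.floor_le (h0 l hl)
    have b2 := Nat.lt_floor_add_one (F l)
    rw [h3] at a1 a2
    constructor <;> linarith
  rw [h4] at h5
  have h6 : k 0 = l 0 := by
    have : |(k 0 : ℤ) - l 0| < 1 := by exact_mod_cast h5
    have := Int.abs_lt_one_iff.mp this
    omega
  funext i
  by_cases hi : i = 0
  · rw [hi, h6]
  · exact h2 i hi

/-- Replace `k 0` by the integer part `n` of the slack `(ξ - (α,k)) / α 0`. Then `|k|` is at most `ξ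
/ α 0 - n` minus the sum of `(α i / α 0 - 1) k i` over `i ≠ 0`, which decays geometrically in every
variable. With equality `α i = α 0` some directions would not decay and a power of `ξ` would appear.
-/
lemma exists_bound_tsum_index {d : ℕ} [NeZero d] (α : Fin d → ℝ) (h0 : 0 < α 0)
    (hα : ∀ i, i ≠ 0 → α 0 < α i) :
    ∃ C : ℝ≥0∞, C ≠ ⊤ ∧ ∀ ξ : ℝ, ∑' k, {k : Fin d → ℕ | ∑ i, α i * k i ≤ ξ}.indicator
      (fun k => (2 : ℝ≥0∞) ^ len k) k ≤ C * 2 ^ (ξ / α 0) := by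
  obtain ⟨δ, hδ0, hδ1, hδ⟩ := exists_pos_le_of_forall_pos (Finset.univ.erase (0 : Fin d))
    (fun i => α i / α 0 - 1) fun i hi => by
      rw [sub_pos, lt_div_iff₀ h0, one_mul]
      exact hα i (Finset.ne_of_mem_erase hi)
  refine ⟨_, tsum_two_rpow_len_ne_top d hδ0, fun ξ => ?_⟩
  rw [mul_comm, ← ENNReal.tsum_mul_left]
  refine tsum_indicator_le_of_injOn _
    (fun k : Fin d → ℕ => Function.update k 0 ⌊(ξ - ∑ i, α i * k i) / α 0⌋₊) ?_ _ _ ?_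
  · refine injOn_update_floor _ _ (fun k hk => div_nonneg (sub_nonneg.mpr hk) h0.le) ?_
    intro k _ l _ hkl
    have e : ∑ i ∈ Finset.univ.erase 0, α i * (k i : ℝ) =
        ∑ i ∈ Finset.univ.erase 0, α i * (l i : ℝ) :=
      Finset.sum_congr rfl fun i hi => by rw [hkl i (Finset.ne_of_mem_erase hi)]
    rw [sum_eq_zero_add, sum_eq_zero_add, e, ← sub_div, abs_div, abs_of_pos h0]
    rw [show ξ - (α 0 * (k 0 : ℝ) + ∑ i ∈ Finset.univ.erase 0, α i * (l i : ℝ)) -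
      (ξ - (α 0 * (l 0 : ℝ) + ∑ i ∈ Finset.univ.erase 0, α i * (l i : ℝ))) =
      α 0 * ((l 0 : ℝ) - k 0) by ring, abs_mul, abs_of_pos h0, mul_div_cancel_left₀ _ h0.ne',
      abs_sub_comm]
  · intro k hk
    have hk' : ∑ i, α i * (k i : ℝ) ≤ ξ := hk
    rw [← two_rpow_add]
    apply two_rpow_mono
    rw [len_update_zero]
    have hfl := Nat.floor_le (div_nonneg (sub_nonneg.mpr hk') h0.le)
    set n := ⌊(ξ - ∑ i, α i * (k i : ℝ)) / α 0⌋₊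
    have h1 : δ * n ≤ n := by
      have : (0 : ℝ) ≤ n := Nat.cast_nonneg n
      nlinarith
    have h2 : δ * ∑ i ∈ Finset.univ.erase 0, (k i : ℝ) ≤
        ∑ i ∈ Finset.univ.erase 0, (α i / α 0 - 1) * (k i : ℝ) := by
      rw [Finset.mul_sum]
      exact Finset.sum_le_sum fun i hi =>
        mul_le_mul_of_nonneg_right (hδ i hi) (Nat.cast_nonneg _)
    have h3 : len k = (∑ i, α i * (k i : ℝ)) / α 0 -
        ∑ i ∈ Finset.univ.erase 0, (α i / α 0 - 1) * (k i : ℝ) := by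
      rw [len, sum_eq_zero_add, sum_eq_zero_add (fun i => α i * (k i : ℝ))]
      simp only [sub_mul, one_mul, Finset.sum_sub_distrib]
      rw [add_div, mul_div_cancel_left₀ _ h0.ne', Finset.sum_div]
      have : ∑ i ∈ Finset.univ.erase 0, α i / α 0 * (k i : ℝ) =
        ∑ i ∈ Finset.univ.erase 0, α i * (k i : ℝ) / α 0 :=
        Finset.sum_congr rfl fun i _ => by ring
      rw [this]; ring
    rw [sub_div] at hfl
    rw [h3, mul_add]
    linarith

/-- The same substitution with the excess `(α,k) - ξ`: the excess gives decay in the first variable,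
and the additional `ε` gives decay in all others. -/
lemma exists_bound_tsum_tail {d : ℕ} [NeZero d] (α : Fin d → ℝ) (h0 : 0 < α 0) {τ ε : ℝ}
    (hτ : 0 < τ) (hε : 0 < ε) :
    ∃ C : ℝ≥0∞, C ≠ ⊤ ∧ ∀ ξ : ℝ, ∑' k, {k : Fin d → ℕ | ξ < ∑ i, α i * k i}.indicator
      (fun k => (2 : ℝ≥0∞) ^ (-(τ * (∑ i, α i * k i + ε * ∑ i ∈ Finset.univ.erase 0, (k i : ℝ))))) k
        ≤ C * 2 ^ (-(τ * ξ)) := by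
  have hδ0 : 0 < min (τ * α 0) (τ * ε) := lt_min (by positivity) (by positivity)
  refine ⟨_, tsum_two_rpow_len_ne_top d hδ0, fun ξ => ?_⟩
  rw [mul_comm, ← ENNReal.tsum_mul_left]
  refine tsum_indicator_le_of_injOn _
    (fun k : Fin d → ℕ => Function.update k 0 ⌊(∑ i, α i * k i - ξ) / α 0⌋₊) ?_ _ _ ?_
  · refine injOn_update_floor _ _ (fun k hk => div_nonneg (sub_nonneg.mpr (le_of_lt hk)) h0.le) ?_
    intro k _ l _ hkl
    have e : ∑ i ∈ Finset.univ.erase 0, α i * (k i : ℝ) =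
        ∑ i ∈ Finset.univ.erase 0, α i * (l i : ℝ) :=
      Finset.sum_congr rfl fun i hi => by rw [hkl i (Finset.ne_of_mem_erase hi)]
    rw [sum_eq_zero_add, sum_eq_zero_add (fun i => α i * (l i : ℝ)), e, ← sub_div, abs_div,
      abs_of_pos h0]
    rw [show (α 0 * (k 0 : ℝ) + ∑ i ∈ Finset.univ.erase 0, α i * (l i : ℝ)) - ξ -
      ((α 0 * (l 0 : ℝ) + ∑ i ∈ Finset.univ.erase 0, α i * (l i : ℝ)) - ξ) =
      α 0 * ((k 0 : ℝ) - l 0) by ring, abs_mul, abs_of_pos h0, mul_div_cancel_left₀ _ h0.ne']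
  · intro k hk
    have hk' : ξ < ∑ i, α i * (k i : ℝ) := hk
    rw [← two_rpow_add]
    apply two_rpow_mono
    rw [len_update_zero]
    have hfl := Nat.floor_le (div_nonneg (sub_nonneg.mpr hk'.le) h0.le)
    set n := ⌊(∑ i, α i * (k i : ℝ) - ξ) / α 0⌋₊
    rw [le_div_iff₀ h0] at hfl
    set R := ∑ i ∈ Finset.univ.erase 0, (k i : ℝ)
    have hR : 0 ≤ R := by positivity
    have hn : (0 : ℝ) ≤ n := Nat.cast_nonneg n
    have h1 : min (τ * α 0) (τ * ε) * n ≤ τ * α 0 * n :=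
      mul_le_mul_of_nonneg_right (min_le_left _ _) hn
    have h2 : min (τ * α 0) (τ * ε) * R ≤ τ * ε * R :=
      mul_le_mul_of_nonneg_right (min_le_right _ _) hR
    have h3 : τ * (n * α 0) ≤ τ * (∑ i, α i * (k i : ℝ) - ξ) :=
      mul_le_mul_of_nonneg_left hfl hτ.le
    nlinarith

/-! ### The size of sparse grids -/

lemma card_gridIndices_le {d : ℕ} (k : Fin d → ℕ) :
    ((gridIndices k).card : ℝ≥0∞) ≤ 2 ^ d * 2 ^ len k := by
  rw [gridIndices, Fintype.card_piFinset, len, two_rpow_sum]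
  have : (2 : ℝ≥0∞) ^ d = ∏ _i : Fin d, 2 := by simp
  rw [this, ← Finset.prod_mul_distrib]
  push_cast
  refine Finset.prod_le_prod' fun i _ => ?_
  rw [Finset.card_range, ENNReal.rpow_natCast]
  push_cast
  rw [two_mul]
  gcongr
  exact one_le_pow₀ one_le_two

lemma grid_encard_le {d : ℕ} {Δ : Set (Fin d → ℕ)} (hΔ : Δ.Finite) :
    ((grid Δ).encard : ℝ≥0∞) ≤ 2 ^ d * ∑' k, Δ.indicator (fun k => (2 : ℝ≥0∞) ^ len k) k := by
  classical
  have h1 : grid Δ = ((hΔ.toFinset.biUnion fun k => (gridIndices k).image (gridPoint k) :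
      Finset (Fin d → ℝ)) : Set (Fin d → ℝ)) := by
    ext x
    simp only [grid, Set.mem_ofPred_eq, Finset.coe_biUnion, Set.mem_iUnion, Finset.mem_coe,
      Set.Finite.mem_toFinset, Finset.mem_image, exists_prop]
    constructor
    · rintro ⟨k, hk, s, hs, rfl⟩
      exact ⟨k, hk, s, hs, rfl⟩
    · rintro ⟨k, hk, s, hs, rfl⟩
      exact ⟨k, hk, s, hs, rfl⟩
  rw [h1, Set.encard_coe_eq_coe_finsetCard]
  have h2 : (hΔ.toFinset.biUnion fun k => (gridIndices k).image (gridPoint k)).card ≤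
      ∑ k ∈ hΔ.toFinset, (gridIndices k).card :=
    Finset.card_biUnion_le.trans (Finset.sum_le_sum fun k _ => Finset.card_image_le)
  calc (((hΔ.toFinset.biUnion fun k => (gridIndices k).image (gridPoint k)).card : ℕ∞) : ℝ≥0∞)
      = ((hΔ.toFinset.biUnion fun k => (gridIndices k).image (gridPoint k)).card : ℝ≥0∞) := by
        simp
    _ ≤ ∑ k ∈ hΔ.toFinset, ((gridIndices k).card : ℝ≥0∞) := by exact_mod_cast h2
    _ ≤ ∑ k ∈ hΔ.toFinset, 2 ^ d * Δ.indicator (fun k => (2 : ℝ≥0∞) ^ len k) k := by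
        refine Finset.sum_le_sum fun k hk => ?_
        rw [Set.indicator_of_mem (hΔ.mem_toFinset.mp hk)]
        exact card_gridIndices_le k
    _ ≤ ∑' k, 2 ^ d * Δ.indicator (fun k => (2 : ℝ≥0∞) ^ len k) k := ENNReal.sum_le_tsum _
    _ = _ := ENNReal.tsum_mul_left

/-- The weights that define the sets `Δ'(ξ)`. -/
def indexWeight {d : ℕ} [NeZero d] (p θ q : ℝ≥0∞) (a : Fin d → ℝ) (ε : ℝ) (i : Fin d) : ℝ :=
  gridSmoothness p θ q a ε i - gap p q

lemma sparseIndexSet_eq {d : ℕ} [NeZero d] (p θ q : ℝ≥0∞) (a : Fin d → ℝ) (ε ξ : ℝ) :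
    sparseIndexSet p θ q a ε ξ = {k | ∑ i, indexWeight p θ q a ε i * k i ≤ ξ} := by
  ext k
  simp only [sparseIndexSet, indexWeight, Set.mem_ofPred_eq, sub_mul, Finset.sum_sub_distrib,
    Finset.mul_sum]

lemma gap_le (p q : ℝ≥0∞) : gap p q ≤ (p⁻¹).toReal := by
  unfold gap
  refine max_le ENNReal.toReal_nonneg ?_
  linarith [ENNReal.toReal_nonneg (a := q⁻¹)]

lemma gap_nonneg (p q : ℝ≥0∞) : 0 ≤ gap p q := le_max_left _ _

/-! ### Existence and size of the extremal level. -/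

section IndexSets

variable {d : ℕ} [NeZero d] {α : Fin d → ℝ}

lemma weight_zero_le (hα : ∀ i, i ≠ 0 → α 0 < α i) (i : Fin d) : α 0 ≤ α i := by
  by_cases hi : i = 0
  · rw [hi]
  · exact (hα i hi).le

lemma finite_index (h0 : 0 < α 0) (hα : ∀ i, i ≠ 0 → α 0 < α i) (ξ : ℝ) :
    {k : Fin d → ℕ | ∑ i, α i * k i ≤ ξ}.Finite := by
  refine (Set.finite_Iic (fun _ : Fin d => ⌊ξ / α 0⌋₊)).subset fun k hk i => ?_
  apply Nat.le_floor
  rw [le_div_iff₀ h0]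
  have hk' : ∑ i, α i * (k i : ℝ) ≤ ξ := hk
  have h1 : α i * (k i : ℝ) ≤ ∑ i, α i * (k i : ℝ) :=
    Finset.single_le_sum (f := fun i => α i * (k i : ℝ))
      (fun j _ => mul_nonneg (h0.le.trans (weight_zero_le hα j)) (Nat.cast_nonneg _))
      (Finset.mem_univ i)
  have h2 : α 0 * (k i : ℝ) ≤ α i * k i :=
    mul_le_mul_of_nonneg_right (weight_zero_le hα i) (Nat.cast_nonneg _)
  linarith

lemma sum_weight_single (j : ℕ) :
    ∑ i, α i * ((Pi.single 0 j : Fin d → ℕ) i : ℝ) = α 0 * j := by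
  rw [sum_eq_zero_add, Pi.single_eq_same, Finset.sum_eq_zero, add_zero]
  intro i hi
  rw [Pi.single_eq_of_ne (Finset.ne_of_mem_erase hi)]
  simp

/-- A crude count along the first axis, sufficient to see that the levels compatible with `n` points
are bounded. -/
lemma encard_grid_ge {Δ : Set (Fin d → ℕ)} {j : ℕ} (hj : (Pi.single 0 j : Fin d → ℕ) ∈ Δ) :
    (j : ℕ∞) ≤ (grid Δ).encard := by
  have h1 : (fun s : ℕ => gridPoint (Pi.single 0 j : Fin d → ℕ) (Pi.single 0 s)) ''
      (Finset.range (2 ^ j) : Set ℕ) ⊆ grid Δ := by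
    rintro _ ⟨s, hs, rfl⟩
    refine ⟨_, hj, _, Fintype.mem_piFinset.mpr fun i => ?_, rfl⟩
    rw [Finset.coe_range, Set.mem_Iio] at hs
    by_cases hi : i = 0
    · subst hi
      simp only [Pi.single_eq_same, Finset.mem_range]
      omega
    · simp [Pi.single_eq_of_ne hi]
  have h2 : Set.InjOn (fun s : ℕ => gridPoint (Pi.single 0 j : Fin d → ℕ) (Pi.single 0 s))
      (Finset.range (2 ^ j) : Set ℕ) := by
    intro s _ t _ hst
    have := congrFun hst 0
    simp only [gridPoint, Pi.single_eq_same] at this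
    have h3 := (div_left_inj' (by positivity : (2 : ℝ) ^ j ≠ 0)).mp this
    exact_mod_cast h3
  calc (j : ℕ∞) ≤ ((2 ^ j : ℕ) : ℕ∞) := by exact_mod_cast Nat.lt_two_pow_self.le
    _ = ((Finset.range (2 ^ j) : Finset ℕ) : Set ℕ).encard := by
        rw [Set.encard_coe_eq_coe_finsetCard, Finset.card_range]
    _ = _ := (h2.encard_image).symm
    _ ≤ _ := Set.encard_le_encard h1

/-- Compatible levels are bounded, so only finitely many different index sets occur; a maximal one
is the largest because the sets are nested. The threshold `2 ^ d` is the number of corners of the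
cube, the grid of level `ξ = 0`. -/
lemma exists_largest_level (h0 : 0 < α 0) (hα : ∀ i, i ≠ 0 → α 0 < α i) (n : ℕ)
    (hn : 2 ^ d ≤ n) :
    ∃ ξ : ℝ, 0 ≤ ξ ∧ (grid {k : Fin d → ℕ | ∑ i, α i * k i ≤ ξ}).encard ≤ n ∧
      ∀ ξ' : ℝ, 0 ≤ ξ' → (grid {k : Fin d → ℕ | ∑ i, α i * k i ≤ ξ'}).encard ≤ n →
        {k : Fin d → ℕ | ∑ i, α i * k i ≤ ξ'} ⊆ {k : Fin d → ℕ | ∑ i, α i * k i ≤ ξ} := by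
  set D : ℝ → Set (Fin d → ℕ) := fun ξ => {k : Fin d → ℕ | ∑ i, α i * k i ≤ ξ} with hD
  set S : Set ℝ := {ξ | 0 ≤ ξ ∧ (grid (D ξ)).encard ≤ n} with hS
  have hmono : Monotone D := fun ξ ξ' h k hk => le_trans hk h
  have hbound : ∀ ξ ∈ S, D ξ ⊆ D (α 0 * (n + 1)) := by
    rintro ξ ⟨hξ0, hξ⟩
    apply hmono
    have hmem : (Pi.single 0 ⌊ξ / α 0⌋₊ : Fin d → ℕ) ∈ D ξ := by
      change ∑ i, α i * ((Pi.single 0 ⌊ξ / α 0⌋₊ : Fin d → ℕ) i : ℝ) ≤ ξ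
      rw [sum_weight_single, mul_comm, ← le_div_iff₀ h0]
      exact Nat.floor_le (div_nonneg hξ0 h0.le)
    have h1 : ⌊ξ / α 0⌋₊ ≤ n := by exact_mod_cast (encard_grid_ge hmem).trans hξ
    have h2 := Nat.lt_floor_add_one (ξ / α 0)
    have h3 : (⌊ξ / α 0⌋₊ : ℝ) ≤ n := by exact_mod_cast h1
    rw [div_lt_iff₀ h0] at h2
    nlinarith
  have hfin : (D '' S).Finite := by
    refine ((finite_index h0 hα (α 0 * (n + 1))).finite_subsets).subset ?_
    rintro _ ⟨ξ, hξ, rfl⟩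
    exact hbound ξ hξ
  have hzero : D 0 = {0} := by
    ext k
    simp only [hD, Set.mem_ofPred_eq, Set.mem_singleton_iff]
    constructor
    · intro h
      have hnn : ∀ i ∈ Finset.univ, 0 ≤ α i * (k i : ℝ) := fun i _ =>
        mul_nonneg (h0.le.trans (weight_zero_le hα i)) (Nat.cast_nonneg _)
      have h1 := (Finset.sum_eq_zero_iff_of_nonneg hnn).mp
        (le_antisymm h (Finset.sum_nonneg hnn))
      funext i
      have h2 := h1 i (Finset.mem_univ i)
      have h3 : α i ≠ 0 := (h0.trans_le (weight_zero_le hα i)).ne'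
      simpa [h3] using h2
    · rintro rfl
      simp
  have hSne : (0 : ℝ) ∈ S := by
    refine ⟨le_rfl, ?_⟩
    rw [hzero]
    have h1 : grid ({0} : Set (Fin d → ℕ)) ⊆
        ((gridIndices (0 : Fin d → ℕ) : Finset (Fin d → ℕ)) : Set (Fin d → ℕ)).image
          (gridPoint 0) := by
      rintro _ ⟨k, hk, s, hs, rfl⟩
      rw [Set.mem_singleton_iff] at hk
      subst hk
      exact ⟨s, hs, rfl⟩
    refine (Set.encard_le_encard h1).trans ((Set.encard_image_le _ _).trans ?_)
    rw [Set.encard_coe_eq_coe_finsetCard, gridIndices, Fintype.card_piFinset]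
    simp only [Pi.zero_apply, pow_zero, Finset.card_range, Finset.prod_const, Finset.card_univ,
      Fintype.card_fin]
    exact_mod_cast hn
  obtain ⟨_, ⟨ξ, hξ, rfl⟩, hmax⟩ := hfin.exists_maximal ⟨_, Set.mem_image_of_mem D hSne⟩
  refine ⟨ξ, hξ.1, hξ.2, fun ξ' h0' hξ' => ?_⟩
  rcases le_total ξ' ξ with h | h
  · exact hmono h
  · exact hmax ⟨ξ', ⟨h0', hξ'⟩, rfl⟩ (hmono h)

/-- The level `ξ_n` satisfies `2^{-ξ_n} ≲ n^{-α_0}`. -/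
lemma exists_largest_level_bound (h0 : 0 < α 0) (hα : ∀ i, i ≠ 0 → α 0 < α i) :
    ∃ C : ℝ≥0∞, C ≠ ⊤ ∧ ∀ (n : ℕ) (ξ : ℝ), 0 ≤ ξ →
      (∀ ξ' : ℝ, 0 ≤ ξ' → (grid {k : Fin d → ℕ | ∑ i, α i * k i ≤ ξ'}).encard ≤ n →
        {k : Fin d → ℕ | ∑ i, α i * k i ≤ ξ'} ⊆ {k : Fin d → ℕ | ∑ i, α i * k i ≤ ξ}) →
      (n : ℝ≥0∞) ≤ C * 2 ^ (ξ / α 0) := by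
  obtain ⟨C, hC, hCb⟩ := exists_bound_tsum_index α h0 hα
  refine ⟨2 ^ d * C * 2, ENNReal.mul_ne_top (ENNReal.mul_ne_top (by simp) hC)
    ENNReal.ofNat_ne_top, ?_⟩
  intro n ξ hξ hmax
  -- Raising the level by `α 0` admits one more dyadic step in the first direction. The index set
  -- grows strictly, so maximality says that its grid exceeds `n` points.
  have h1 : ¬ (grid {k : Fin d → ℕ | ∑ i, α i * k i ≤ ξ + α 0}).encard ≤ n := by
    intro h
    have h2 := hmax (ξ + α 0) (by linarith) h
    have hmem : (Pi.single 0 (⌊ξ / α 0⌋₊ + 1) : Fin d → ℕ) ∈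
        {k : Fin d → ℕ | ∑ i, α i * k i ≤ ξ + α 0} := by
      rw [Set.mem_ofPred_eq, sum_weight_single]
      have := Nat.floor_le (div_nonneg hξ h0.le)
      rw [le_div_iff₀ h0] at this
      push_cast
      nlinarith
    have h3 := h2 hmem
    rw [Set.mem_ofPred_eq, sum_weight_single] at h3
    have h4 := Nat.lt_floor_add_one (ξ / α 0)
    rw [div_lt_iff₀ h0] at h4
    push_cast at h3
    nlinarith
  rw [not_le] at h1
  have h2 := grid_encard_le (finite_index h0 hα (ξ + α 0))
  calc (n : ℝ≥0∞) ≤ ((grid {k : Fin d → ℕ | ∑ i, α i * k i ≤ ξ + α 0}).encard : ℝ≥0∞) := by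
        have := ENat.toENNReal_le.mpr h1.le
        simpa using this
    _ ≤ 2 ^ d * (C * 2 ^ ((ξ + α 0) / α 0)) := h2.trans (by gcongr; exact hCb _)
    _ = 2 ^ d * C * 2 * 2 ^ (ξ / α 0) := by
        rw [add_div, div_self h0.ne', two_rpow_add, ENNReal.rpow_one]
        ring

end IndexSets

/-! ### Power sums -/

lemma le_rpow_one_div_iff {x y : ℝ≥0∞} {z : ℝ} (hz : 0 < z) : x ≤ y ^ (1 / z) ↔ x ^ z ≤ y := by
  rw [one_div, ENNReal.le_rpow_inv_iff hz]

lemma rpow_one_div_le_iff {x y : ℝ≥0∞} {z : ℝ} (hz : 0 < z) : x ^ (1 / z) ≤ y ↔ x ≤ y ^ z := by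
  rw [one_div, ENNReal.rpow_inv_le_iff hz]

lemma one_le_two_rpow {x : ℝ} (hx : 0 ≤ x) : (1 : ℝ≥0∞) ≤ 2 ^ x := by
  simpa using two_rpow_mono hx

lemma rpow_sum_le_card_mul {ι : Type*} (s : Finset ι) (x : ι → ℝ≥0∞) {p : ℝ} (hp : 0 < p) :
    (∑ i ∈ s, x i) ^ p ≤ (s.card : ℝ≥0∞) ^ p * ∑ i ∈ s, x i ^ p := by
  rcases s.eq_empty_or_nonempty with rfl | hs
  · simp [hp]
  obtain ⟨j, hj, hmax⟩ := s.exists_max_image x hs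
  calc (∑ i ∈ s, x i) ^ p ≤ (s.card * x j) ^ p := by
        gcongr
        calc ∑ i ∈ s, x i ≤ ∑ _i ∈ s, x j := Finset.sum_le_sum hmax
          _ = s.card * x j := by rw [Finset.sum_const, nsmul_eq_mul]
    _ = (s.card : ℝ≥0∞) ^ p * x j ^ p := ENNReal.mul_rpow_of_nonneg _ _ hp.le
    _ ≤ _ := by
        gcongr
        exact Finset.single_le_sum (f := fun i => x i ^ p) (fun _ _ => zero_le) hj

/-- Each `x i` is at most `w i` times the weighted `ℓ_p`-norm. Unlike Hölder's inequality this works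
for all `p > 0`, and the loss in the weights is affordable because they are geometric. -/
lemma rpow_tsum_le_weight {ι : Type*} (x w : ι → ℝ≥0∞) (hw0 : ∀ i, w i ≠ 0) (hw : ∀ i, w i ≠ ⊤)
    {p : ℝ} (hp : 0 < p) :
    (∑' i, x i) ^ p ≤ (∑' i, w i) ^ p * ∑' i, (x i / w i) ^ p := by
  set T := ∑' i, (x i / w i) ^ p with hT
  have h1 : ∀ i, x i ≤ w i * T ^ (1 / p) := by
    intro i
    have h2 : x i / w i ≤ T ^ (1 / p) := by
      rw [le_rpow_one_div_iff hp]
      exact ENNReal.le_tsum i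
    calc x i = w i * (x i / w i) := (ENNReal.mul_div_cancel (hw0 i) (hw i)).symm
      _ ≤ _ := by gcongr
  calc (∑' i, x i) ^ p ≤ ((∑' i, w i) * T ^ (1 / p)) ^ p := by
        gcongr
        rw [← ENNReal.tsum_mul_right]
        exact ENNReal.tsum_le_tsum h1
    _ = _ := by
        rw [ENNReal.mul_rpow_of_nonneg _ _ hp.le, ← ENNReal.rpow_mul, one_div_mul_cancel hp.ne',
          ENNReal.rpow_one]

lemma rpow_tsum_len_le (d : ℕ) {p η : ℝ} (hp : 0 < p) (hη : 0 < η) :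
    ∃ C : ℝ≥0∞, C ≠ ⊤ ∧ ∀ x : (Fin d → ℕ) → ℝ≥0∞,
      (∑' l, x l) ^ p ≤ C * ∑' l, 2 ^ (p * (η * len l)) * x l ^ p := by
  refine ⟨_, ENNReal.rpow_ne_top_of_nonneg hp.le (tsum_two_rpow_len_ne_top d hη), fun x => ?_⟩
  refine (rpow_tsum_le_weight x (fun l => 2 ^ (-(η * len l))) (fun _ => two_rpow_ne_zero _)
    (fun _ => two_rpow_ne_top _) hp).trans (le_of_eq ?_)
  congr 1
  refine tsum_congr fun l => ?_
  rw [div_eq_mul_inv, ← ENNReal.rpow_neg, neg_neg, ENNReal.mul_rpow_of_nonneg _ _ hp.le,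
    ← ENNReal.rpow_mul, mul_comm, mul_comm p]

lemma sum_rpow_le_rpow_sum {ι : Type*} (s : Finset ι) (x : ι → ℝ≥0∞) {p : ℝ} (hp : 1 ≤ p) :
    ∑ i ∈ s, x i ^ p ≤ (∑ i ∈ s, x i) ^ p := by
  classical
  induction s using Finset.induction_on with
  | empty => simp
  | insert i s hi ih =>
    rw [Finset.sum_insert hi, Finset.sum_insert hi]
    exact (add_le_add le_rfl ih).trans (ENNReal.add_rpow_le_rpow_add _ _ hp)

lemma rpow_sum_le_sum_rpow {ι : Type*} (s : Finset ι) (x : ι → ℝ≥0∞) {p : ℝ} (hp0 : 0 < p)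
    (hp : p ≤ 1) : (∑ i ∈ s, x i) ^ p ≤ ∑ i ∈ s, x i ^ p := by
  classical
  induction s using Finset.induction_on with
  | empty => simp [hp0]
  | insert i s hi ih =>
    rw [Finset.sum_insert hi, Finset.sum_insert hi]
    exact (ENNReal.rpow_add_le_add_rpow _ _ hp0.le hp).trans (add_le_add le_rfl ih)

/-! ### Functions that are constant on dyadic cells -/

/-- The index of the dyadic cell of level `k` that contains `x`. -/
def cell {d : ℕ} (k : Fin d → ℕ) (x : Fin d → ℝ) : Fin d → ℕ := fun i => ⌊2 ^ k i * x i⌋₊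

/-- The indices of the cells of level `k` in the unit cube. -/
def cells {d : ℕ} (k : Fin d → ℕ) : Finset (Fin d → ℕ) :=
  Fintype.piFinset fun i => Finset.range (2 ^ k i)

lemma measurable_cell {d : ℕ} (k : Fin d → ℕ) : Measurable (cell k) :=
  measurable_pi_lambda _ fun i =>
    Nat.measurable_floor.comp ((measurable_pi_apply i).const_mul _)

lemma measurable_comp_cell {d : ℕ} (k : Fin d → ℕ) (h : (Fin d → ℕ) → ℝ≥0∞) :
    Measurable fun x => h (cell k x) :=
  (measurable_of_countable h).comp (measurable_cell k)

/-- The half-open unit cube. -/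
def halfCube (d : ℕ) : Set (Fin d → ℝ) := Set.univ.pi fun _ => Set.Ico 0 1

lemma measurableSet_halfCube (d : ℕ) : MeasurableSet (halfCube d) :=
  MeasurableSet.univ_pi fun _ => measurableSet_Ico

lemma cubeMeasure_eq (d : ℕ) : cubeMeasure d = volume.restrict (halfCube d) := by
  rw [cubeMeasure]
  exact (Measure.restrict_congr_set (Measure.univ_pi_Ico_ae_eq_Icc (μ := fun _ : Fin d => volume)
    (f := (0 : Fin d → ℝ)) (g := 1))).symm

lemma ae_mem_halfCube (d : ℕ) : ∀ᵐ x ∂(cubeMeasure d), x ∈ halfCube d := by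
  rw [cubeMeasure_eq]
  exact ae_restrict_mem (measurableSet_halfCube d)

/-- The dyadic cell with index `c`. -/
def cellBox {d : ℕ} (k c : Fin d → ℕ) : Set (Fin d → ℝ) :=
  Set.univ.pi fun i => Set.Ico ((c i : ℝ) / 2 ^ k i) (((c i : ℝ) + 1) / 2 ^ k i)

lemma measurableSet_cellBox {d : ℕ} (k c : Fin d → ℕ) : MeasurableSet (cellBox k c) :=
  MeasurableSet.univ_pi fun _ => measurableSet_Ico

lemma cell_eq_of_mem_cellBox {d : ℕ} {k c : Fin d → ℕ} {x : Fin d → ℝ} (hx : x ∈ cellBox k c) :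
    cell k x = c := by
  funext i
  have h2 : (0 : ℝ) < 2 ^ k i := by positivity
  obtain ⟨h3, h4⟩ := hx i (Set.mem_univ i)
  rw [div_le_iff₀ h2] at h3
  rw [lt_div_iff₀ h2] at h4
  rw [cell, Nat.floor_eq_iff (by nlinarith [(Nat.cast_nonneg (c i) : (0 : ℝ) ≤ c i)])]
  constructor <;> linarith

lemma cell_mem_cells {d : ℕ} {k : Fin d → ℕ} {x : Fin d → ℝ} (hx : x ∈ halfCube d) :
    cell k x ∈ cells k := by
  refine Fintype.mem_piFinset.mpr fun i => Finset.mem_range.mpr ?_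
  have h2 : (0 : ℝ) < 2 ^ k i := by positivity
  obtain ⟨h3, h4⟩ := hx i (Set.mem_univ i)
  rw [cell, Nat.floor_lt (by positivity)]
  push_cast
  nlinarith

lemma mem_cellBox_cell {d : ℕ} {k : Fin d → ℕ} {x : Fin d → ℝ} (hx : ∀ i, 0 ≤ x i) :
    x ∈ cellBox k (cell k x) := by
  intro i _
  have h2 : (0 : ℝ) < 2 ^ k i := by positivity
  constructor
  · rw [div_le_iff₀ h2, mul_comm]
    exact Nat.floor_le (mul_nonneg h2.le (hx i))
  · rw [lt_div_iff₀ h2, mul_comm]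
    exact Nat.lt_floor_add_one _

lemma cellBox_subset_halfCube {d : ℕ} {k c : Fin d → ℕ} (hc : c ∈ cells k) :
    cellBox k c ⊆ halfCube d := by
  intro x hx i _
  have h2 : (0 : ℝ) < 2 ^ k i := by positivity
  obtain ⟨h3, h4⟩ := hx i (Set.mem_univ i)
  have h5 := Finset.mem_range.mp (Fintype.mem_piFinset.mp hc i)
  have h6 : (c i : ℝ) + 1 ≤ 2 ^ k i := by exact_mod_cast h5
  exact ⟨le_trans (by positivity) h3, h4.trans_le ((div_le_one h2).mpr h6)⟩

lemma halfCube_eq_biUnion {d : ℕ} (k : Fin d → ℕ) :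
    halfCube d = ⋃ c ∈ cells k, cellBox k c := by
  ext x
  simp only [Set.mem_iUnion, exists_prop]
  constructor
  · intro hx
    exact ⟨cell k x, cell_mem_cells hx, mem_cellBox_cell fun i => (hx i (Set.mem_univ i)).1⟩
  · rintro ⟨c, hc, hx⟩
    exact cellBox_subset_halfCube hc hx

lemma volume_cellBox {d : ℕ} (k c : Fin d → ℕ) : volume (cellBox k c) = 2 ^ (-len k) := by
  rw [cellBox, Real.volume_pi_Ico, len, ← Finset.sum_neg_distrib, two_rpow_sum]
  refine Finset.prod_congr rfl fun i _ => ?_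
  rw [← sub_div, add_sub_cancel_left, ENNReal.rpow_neg, ENNReal.rpow_natCast,
    ENNReal.ofReal_div_of_pos (by positivity), ENNReal.ofReal_one, one_div,
    ENNReal.ofReal_pow (by norm_num)]
  simp

lemma lintegral_comp_cell {d : ℕ} (k : Fin d → ℕ) (h : (Fin d → ℕ) → ℝ≥0∞) :
    ∫⁻ x, h (cell k x) ∂(cubeMeasure d) = 2 ^ (-len k) * ∑ c ∈ cells k, h c := by
  rw [cubeMeasure_eq, halfCube_eq_biUnion k, lintegral_biUnion_finset, Finset.mul_sum]
  · refine Finset.sum_congr rfl fun c _ => ?_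
    rw [setLIntegral_congr_fun (measurableSet_cellBox k c)
      (g := fun _ => h c) (fun x hx => by simp only [cell_eq_of_mem_cellBox hx]),
      setLIntegral_const, volume_cellBox, mul_comm]
  · intro c _ c' _ hcc'
    refine Set.disjoint_left.mpr fun x hx hx' => hcc' ?_
    rw [← cell_eq_of_mem_cellBox hx, cell_eq_of_mem_cellBox hx']
  · exact fun c _ => measurableSet_cellBox k c

lemma sum_cells_eq {d : ℕ} (k : Fin d → ℕ) (h : (Fin d → ℕ) → ℝ≥0∞) :
    ∑ c ∈ cells k, h c = 2 ^ len k * ∫⁻ x, h (cell k x) ∂(cubeMeasure d) := by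
  rw [lintegral_comp_cell, ← mul_assoc, ← two_rpow_add, add_neg_cancel, ENNReal.rpow_zero, one_mul]

/-- The inequality of different metrics for cell functions, in terms of integrals. -/
lemma lintegral_comp_cell_rpow_le {d : ℕ} (k : Fin d → ℕ) (h : (Fin d → ℕ) → ℝ≥0∞) {p q : ℝ}
    (hp : 0 < p) (hpq : p ≤ q) :
    ∫⁻ x, h (cell k x) ^ q ∂(cubeMeasure d) ≤
      2 ^ ((q / p - 1) * len k) * (∫⁻ x, h (cell k x) ^ p ∂(cubeMeasure d)) ^ (q / p) := by
  have h1 : 1 ≤ q / p := (one_le_div hp).mpr hpq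
  rw [lintegral_comp_cell k fun c => h c ^ q]
  calc 2 ^ (-len k) * ∑ c ∈ cells k, h c ^ q
      = 2 ^ (-len k) * ∑ c ∈ cells k, (h c ^ p) ^ (q / p) := by
        simp_rw [← ENNReal.rpow_mul, mul_div_cancel₀ q hp.ne']
    _ ≤ 2 ^ (-len k) * (∑ c ∈ cells k, h c ^ p) ^ (q / p) := by
        gcongr
        exact sum_rpow_le_rpow_sum _ _ h1
    _ = _ := by
        rw [sum_cells_eq k fun c => h c ^ p, ENNReal.mul_rpow_of_nonneg _ _ (by positivity),
          ← ENNReal.rpow_mul, ← mul_assoc, ← two_rpow_add]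
        congr 2
        ring

lemma ae_comp_cell_rpow_le {d : ℕ} (k : Fin d → ℕ) (h : (Fin d → ℕ) → ℝ≥0∞) (p : ℝ) :
    ∀ᵐ x ∂(cubeMeasure d),
      h (cell k x) ^ p ≤ 2 ^ len k * ∫⁻ x, h (cell k x) ^ p ∂(cubeMeasure d) := by
  filter_upwards [ae_mem_halfCube d] with x hx
  rw [← sum_cells_eq k fun c => h c ^ p]
  exact Finset.single_le_sum (f := fun c => h c ^ p) (fun _ _ => zero_le) (cell_mem_cells hx)

lemma toReal_inv_eq {p : ℝ≥0∞} : (p⁻¹).toReal = 1 / p.toReal := by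
  rw [ENNReal.toReal_inv, one_div]

/-- The inequality of different metrics for cell functions. -/
lemma eLpNorm_comp_cell_le {d : ℕ} (k : Fin d → ℕ) (h : (Fin d → ℕ) → ℝ≥0∞) {p q : ℝ≥0∞}
    (hp : p ≠ 0) (hq : q ≠ 0) :
    eLpNorm (fun x => h (cell k x)) q (cubeMeasure d) ≤
      2 ^ (gap p q * len k) * eLpNorm (fun x => h (cell k x)) p (cubeMeasure d) := by
  rcases le_total q p with hqp | hpq
  · calc _ ≤ 1 * eLpNorm (fun x => h (cell k x)) p (cubeMeasure d) := by
          rw [one_mul]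
          exact eLpNorm_le_eLpNorm_of_exponent_le hqp
            (measurable_comp_cell k h).aestronglyMeasurable
      _ ≤ _ := by
          gcongr
          exact one_le_two_rpow (mul_nonneg (gap_nonneg p q) (len_nonneg k))
  · have hgap : gap p q = (p⁻¹).toReal - (q⁻¹).toReal := by
      refine max_eq_right (sub_nonneg.mpr ?_)
      exact ENNReal.toReal_mono (ENNReal.inv_ne_top.mpr hp) (ENNReal.inv_le_inv.mpr hpq)
    by_cases hpt : p = ⊤
    · have hqt : q = ⊤ := top_le_iff.mp (hpt ▸ hpq)
      subst hpt; subst hqt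
      rw [hgap]; simp
    have hp0 : 0 < p.toReal := ENNReal.toReal_pos hp hpt
    have hpe := eLpNorm_eq_lintegral_rpow_enorm_toReal (μ := cubeMeasure d)
      (f := fun x => h (cell k x)) hp hpt
    simp only [enorm_eq_self] at hpe
    rw [hgap, toReal_inv_eq, toReal_inv_eq, hpe]
    by_cases hqt : q = ⊤
    · subst hqt
      rw [eLpNorm_exponent_top]
      refine essSup_le_of_ae_le _ ?_
      filter_upwards [ae_comp_cell_rpow_le k h p.toReal] with x hx
      rw [enorm_eq_self]
      rw [← le_rpow_one_div_iff hp0,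
        ENNReal.mul_rpow_of_nonneg _ _ (by positivity), ← ENNReal.rpow_mul] at hx
      refine hx.trans (le_of_eq ?_)
      congr 2
      simp [mul_comm]
    · have hq0 : 0 < q.toReal := ENNReal.toReal_pos hq hqt
      have hpq' : p.toReal ≤ q.toReal := ENNReal.toReal_mono hqt hpq
      rw [eLpNorm_eq_lintegral_rpow_enorm_toReal hq hqt]
      simp only [enorm_eq_self]
      rw [rpow_one_div_le_iff hq0]
      refine (lintegral_comp_cell_rpow_le k h hp0 hpq').trans (le_of_eq ?_)
      rw [ENNReal.mul_rpow_of_nonneg _ _ hq0.le, ← ENNReal.rpow_mul, ← ENNReal.rpow_mul]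
      congr 2
      · field_simp
      · field_simp

/-! ### Products of cell functions of different levels -/

lemma cell_eq_div {d : ℕ} {k m : Fin d → ℕ} (hkm : k ≤ m) (x : Fin d → ℝ) :
    cell k x = fun i => cell m x i / 2 ^ (m i - k i) := by
  funext i
  have h := Nat.floor_div_natCast (2 ^ m i * x i) (2 ^ (m i - k i))
  rw [cell, cell, ← h]
  congr 1
  push_cast
  rw [← Nat.add_sub_cancel' (hkm i), pow_add]
  field_simp
  simp

lemma len_sup_add_len_inf {d : ℕ} (k l : Fin d → ℕ) :
    len (k ⊔ l) + len (k ⊓ l) = len k + len l := by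
  simp only [len, ← Finset.sum_add_distrib]
  refine Finset.sum_congr rfl fun i _ => ?_
  rw [Pi.sup_apply, Pi.inf_apply]
  exact_mod_cast max_add_min (k i) (l i)

lemma two_mul_len_inf {d : ℕ} (k l : Fin d → ℕ) :
    2 * len (k ⊓ l) = len k + len l - dist₁ k l := by
  simp only [len, dist₁, ← Finset.sum_add_distrib, ← Finset.sum_sub_distrib, Finset.mul_sum]
  refine Finset.sum_congr rfl fun i _ => ?_
  rw [Pi.inf_apply]
  rcases le_total (k i) (l i) with h | h
  · rw [inf_eq_left.mpr h, abs_of_nonpos (sub_nonpos.mpr (by exact_mod_cast h))]; ring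
  · rw [inf_eq_right.mpr h, abs_of_nonneg (sub_nonneg.mpr (by exact_mod_cast h))]; ring

/-- A cell of the common refinement `k ⊔ l` is determined by the two cells containing it, so the sum
over the refinement is at most the product of the two sums. The power of 2 compares the volumes, via
`|k ⊔ l| + |k ⊓ l| = |k| + |l|`. -/
lemma lintegral_mul_comp_cell_le {d : ℕ} (k l : Fin d → ℕ) (h g : (Fin d → ℕ) → ℝ≥0∞) :
    ∫⁻ x, h (cell k x) * g (cell l x) ∂(cubeMeasure d) ≤ 2 ^ len (k ⊓ l) *
      ((∫⁻ x, h (cell k x) ∂(cubeMeasure d)) * ∫⁻ x, g (cell l x) ∂(cubeMeasure d)) := by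
  classical
  set m := k ⊔ l with hm
  have hk : k ≤ m := le_sup_left
  have hl : l ≤ m := le_sup_right
  let u : (Fin d → ℕ) → (Fin d → ℕ) := fun c i => c i / 2 ^ (m i - k i)
  let v : (Fin d → ℕ) → (Fin d → ℕ) := fun c i => c i / 2 ^ (m i - l i)
  have h1 : ∀ x, h (cell k x) * g (cell l x) = (fun c => h (u c) * g (v c)) (cell m x) := by
    intro x
    simp only [u, v]
    rw [← cell_eq_div hk, ← cell_eq_div hl]
  simp_rw [h1]
  rw [lintegral_comp_cell m fun c => h (u c) * g (v c), lintegral_comp_cell k,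
    lintegral_comp_cell l]
  have hinj : ∀ c ∈ cells m, ∀ c' ∈ cells m, (u c, v c) = (u c', v c') → c = c' := by
    intro c _ c' _ hcc
    rw [Prod.mk.injEq] at hcc
    funext i
    have hu := congrFun hcc.1 i
    have hv := congrFun hcc.2 i
    simp only [u, v, hm, Pi.sup_apply] at hu hv
    rcases le_total (k i) (l i) with hkl | hkl
    · rw [sup_eq_right.mpr hkl, Nat.sub_self, pow_zero, Nat.div_one, Nat.div_one] at hv
      exact hv
    · rw [sup_eq_left.mpr hkl, Nat.sub_self, pow_zero, Nat.div_one, Nat.div_one] at hu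
      exact hu
  have hmaps : ∀ c ∈ cells m, (u c, v c) ∈ cells k ×ˢ cells l := by
    intro c hc
    have hlt : ∀ i, c i < 2 ^ m i := fun i =>
      Finset.mem_range.mp (Fintype.mem_piFinset.mp hc i)
    rw [Finset.mem_product]
    constructor
    · refine Fintype.mem_piFinset.mpr fun i => Finset.mem_range.mpr ?_
      apply Nat.div_lt_of_lt_mul
      rw [← pow_add, Nat.sub_add_cancel (hk i)]
      exact hlt i
    · refine Fintype.mem_piFinset.mpr fun i => Finset.mem_range.mpr ?_
      apply Nat.div_lt_of_lt_mul
      rw [← pow_add, Nat.sub_add_cancel (hl i)]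
      exact hlt i
  have h2 : ∑ c ∈ cells m, h (u c) * g (v c) ≤ (∑ c ∈ cells k, h c) * ∑ c ∈ cells l, g c := by
    rw [Finset.sum_mul_sum, ← Finset.sum_product']
    calc ∑ c ∈ cells m, h (u c) * g (v c)
        = ∑ z ∈ (cells m).image (fun c => (u c, v c)), h z.1 * g z.2 :=
          (Finset.sum_image (f := fun z : (Fin d → ℕ) × (Fin d → ℕ) => h z.1 * g z.2) hinj).symm
      _ ≤ _ := Finset.sum_le_sum_of_subset (Finset.image_subset_iff.mpr hmaps)
  have e : -len m = len (k ⊓ l) + (-len k + -len l) := by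
    have := len_sup_add_len_inf k l
    rw [← hm] at this
    linarith
  rw [e, two_rpow_add, two_rpow_add]
  calc _ ≤ 2 ^ len (k ⊓ l) * (2 ^ (-len k) * 2 ^ (-len l)) *
        ((∑ c ∈ cells k, h c) * ∑ c ∈ cells l, g c) := by gcongr
    _ = _ := by ring

/-- Interpolation between the preceding bound (`u = 1`) and the Cauchy–Schwarz inequality (`u = 2`):
Hölder's inequality for the three functions `(HG)^u`, `H^u`, `G^u` with exponents `t`, `(1-t)/2`,
`(1-t)/2`, where `t = 2/u - 1`. -/
lemma lintegral_mul_comp_cell_le_rpow {d : ℕ} (k l : Fin d → ℕ) (h g : (Fin d → ℕ) → ℝ≥0∞)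
    {u : ℝ} (hu1 : 1 ≤ u) (hu2 : u ≤ 2) :
    ∫⁻ x, h (cell k x) * g (cell l x) ∂(cubeMeasure d) ≤ 2 ^ ((2 / u - 1) * len (k ⊓ l)) *
      ((∫⁻ x, h (cell k x) ^ u ∂(cubeMeasure d)) ^ (1 / u) *
        (∫⁻ x, g (cell l x) ^ u ∂(cubeMeasure d)) ^ (1 / u)) := by
  have hu0 : 0 < u := by linarith
  set t := 2 / u - 1 with ht
  have ht0 : 0 ≤ t := by rw [ht, sub_nonneg, one_le_div hu0]; exact hu2
  have ht1 : t ≤ 1 := by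
    rw [ht, sub_le_iff_le_add, div_le_iff₀ hu0]; linarith
  have hs0 : 0 ≤ (1 - t) / 2 := by linarith
  set H := fun x => h (cell k x) with hH
  set G := fun x => g (cell l x) with hG
  have mH : Measurable H := measurable_comp_cell k h
  have mG : Measurable G := measurable_comp_cell l g
  have hut : u * t + u * ((1 - t) / 2) = 1 := by
    rw [ht]; field_simp; ring
  have key := ENNReal.lintegral_prod_norm_pow_le (μ := cubeMeasure d) (Finset.univ : Finset (Fin 3))
    (f := ![fun x => H x ^ u * G x ^ u, fun x => H x ^ u, fun x => G x ^ u])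
    (by
      intro i _
      fin_cases i
      · exact ((mH.pow_const u).mul (mG.pow_const u)).aemeasurable
      · exact (mH.pow_const u).aemeasurable
      · exact (mG.pow_const u).aemeasurable)
    (p := ![t, (1 - t) / 2, (1 - t) / 2])
    (by simp [Fin.sum_univ_three]; ring)
    (by
      intro i _
      fin_cases i
      · exact ht0
      · exact hs0
      · exact hs0)
  simp only [Fin.prod_univ_three, Matrix.cons_val_zero, Matrix.cons_val_one, Matrix.cons_val] at key
  have hpt : ∀ x, (H x ^ u * G x ^ u) ^ t * (H x ^ u) ^ ((1 - t) / 2) * (G x ^ u) ^ ((1 - t) / 2) =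
      H x * G x := by
    intro x
    rw [ENNReal.mul_rpow_of_nonneg _ _ ht0]
    simp only [← ENNReal.rpow_mul]
    have e1 : ∀ z : ℝ≥0∞, z ^ (u * t) * z ^ (u * ((1 - t) / 2)) = z := by
      intro z
      rw [← ENNReal.rpow_add_of_nonneg _ _ (by positivity) (by positivity), hut, ENNReal.rpow_one]
    calc _ = (H x ^ (u * t) * H x ^ (u * ((1 - t) / 2))) *
          (G x ^ (u * t) * G x ^ (u * ((1 - t) / 2))) := by ring
      _ = _ := by rw [e1, e1]
  simp_rw [hpt] at key
  refine key.trans ?_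
  have hb := lintegral_mul_comp_cell_le k l (fun c => h c ^ u) (fun c => g c ^ u)
  set A := ∫⁻ x, h (cell k x) ^ u ∂(cubeMeasure d)
  set B := ∫⁻ x, g (cell l x) ^ u ∂(cubeMeasure d)
  calc _ ≤ (2 ^ len (k ⊓ l) * (A * B)) ^ t * A ^ ((1 - t) / 2) * B ^ ((1 - t) / 2) := by gcongr
    _ = 2 ^ (t * len (k ⊓ l)) * ((A ^ t * A ^ ((1 - t) / 2)) * (B ^ t * B ^ ((1 - t) / 2))) := by
        rw [ENNReal.mul_rpow_of_nonneg _ _ ht0, ENNReal.mul_rpow_of_nonneg _ _ ht0,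
          ← ENNReal.rpow_mul, mul_comm (len _) t]
        ring
    _ = _ := by
        have e2 : ∀ z : ℝ≥0∞, z ^ t * z ^ ((1 - t) / 2) = z ^ (1 / u) := by
          intro z
          rw [← ENNReal.rpow_add_of_nonneg _ _ ht0 hs0]
          congr 1
          rw [ht]; field_simp; ring
        rw [e2, e2]

/-- One pair of indices dominates. Choose `l` maximizing `x`, then `k` maximizing `2^(η dist₁ k l) x
k`. The whole sum is at most a geometric series times the latter maximum, and `x k ≤ x l` splits `x
k ^ q` into the two half powers. No lower bound on `q` other than positivity is required. -/
lemma rpow_sum_le_double_sum {d : ℕ} {q η : ℝ} (hq : 0 < q) (hη : 0 < η) :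
    ∃ C : ℝ≥0∞, C ≠ ⊤ ∧ ∀ (F : Finset (Fin d → ℕ)) (x : (Fin d → ℕ) → ℝ≥0∞),
      (∑ k ∈ F, x k) ^ q ≤
        C * ∑ k ∈ F, ∑ l ∈ F, 2 ^ (q * (η * dist₁ k l)) * (x k ^ (q / 2) * x l ^ (q / 2)) := by
  obtain ⟨W, hW, hWb⟩ := exists_bound_tsum_dist d hη
  refine ⟨W ^ q, ENNReal.rpow_ne_top_of_nonneg hq.le hW, fun F x => ?_⟩
  rcases F.eq_empty_or_nonempty with rfl | hF
  · simp [hq]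
  obtain ⟨l, hl, hlmax⟩ := F.exists_max_image x hF
  obtain ⟨k, hk, hkmax⟩ := F.exists_max_image (fun k => 2 ^ (η * dist₁ k l) * x k) hF
  have h1 : ∑ j ∈ F, x j ≤ W * (2 ^ (η * dist₁ k l) * x k) := by
    calc ∑ j ∈ F, x j = ∑ j ∈ F, 2 ^ (-(η * dist₁ j l)) * (2 ^ (η * dist₁ j l) * x j) := by
          refine Finset.sum_congr rfl fun j _ => ?_
          rw [← mul_assoc, ← two_rpow_add, neg_add_cancel, ENNReal.rpow_zero, one_mul]
      _ ≤ ∑ j ∈ F, 2 ^ (-(η * dist₁ j l)) * (2 ^ (η * dist₁ k l) * x k) :=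
          Finset.sum_le_sum fun j hj => mul_le_mul_right (hkmax j hj) _
      _ = (∑ j ∈ F, 2 ^ (-(η * dist₁ j l))) * (2 ^ (η * dist₁ k l) * x k) := by
          rw [Finset.sum_mul]
      _ ≤ _ := by
          gcongr
          exact (ENNReal.sum_le_tsum _).trans (hWb l)
  calc (∑ j ∈ F, x j) ^ q ≤ (W * (2 ^ (η * dist₁ k l) * x k)) ^ q := by gcongr
    _ = W ^ q * (2 ^ (q * (η * dist₁ k l)) * (x k ^ (q / 2) * x k ^ (q / 2))) := by
        rw [ENNReal.mul_rpow_of_nonneg _ _ hq.le, ENNReal.mul_rpow_of_nonneg _ _ hq.le,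
          ← ENNReal.rpow_mul, ← ENNReal.rpow_add_of_nonneg _ _ (by positivity) (by positivity),
          add_halves, mul_comm q]
    _ ≤ W ^ q * (2 ^ (q * (η * dist₁ k l)) * (x k ^ (q / 2) * x l ^ (q / 2))) := by
        gcongr
        exact hlmax k hk
    _ ≤ _ := by
        gcongr
        calc _ ≤ ∑ l ∈ F, 2 ^ (q * (η * dist₁ k l)) * (x k ^ (q / 2) * x l ^ (q / 2)) :=
              Finset.single_le_sum (f := fun l => 2 ^ (q * (η * dist₁ k l)) *
                (x k ^ (q / 2) * x l ^ (q / 2))) (fun _ _ => zero_le) hl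
          _ ≤ _ := Finset.single_le_sum (f := fun k => ∑ l ∈ F, 2 ^ (q * (η * dist₁ k l)) *
                (x k ^ (q / 2) * x l ^ (q / 2))) (fun _ _ => zero_le) hk

/-- A sum of cell functions of different levels is, for `p < q < ∞`, controlled in `L_q` by the
`ℓ_q`-sum of their `L_p` quasi-norms. -/
lemma exists_lintegral_sum_cell_le (d : ℕ) {p q : ℝ} (hp : 0 < p) (hpq : p < q) :
    ∃ C : ℝ≥0∞, C ≠ ⊤ ∧ ∀ (F : Finset (Fin d → ℕ)) (h : (Fin d → ℕ) → (Fin d → ℕ) → ℝ≥0∞),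
      ∫⁻ x, (∑ k ∈ F, h k (cell k x)) ^ q ∂(cubeMeasure d) ≤
        C * ∑ k ∈ F, 2 ^ ((q / p - 1) * len k) *
          (∫⁻ x, h k (cell k x) ^ p ∂(cubeMeasure d)) ^ (q / p) := by
  have hq : 0 < q := hp.trans hpq
  -- Pairs are estimated with exponent `u = 2s/q`. Since `s ≥ q/2`, `u ≥ 1`; since `s < q`, `u < 2`,
  -- which leaves a gain `2^{-δ dist₁ k l}` with `δ = 1/u - 1/2`; and `s ≥ p` allows the `L_s`-norms
  -- to be bounded by `L_p`-norms.
  set s := max p (q / 2) with hs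
  have hs0 : 0 < s := lt_max_of_lt_left hp
  have hsq : s < q := max_lt hpq (by linarith)
  set u := 2 * s / q with hu
  have hu1 : 1 ≤ u := by
    rw [hu, one_le_div hq]
    have := le_max_right p (q / 2)
    rw [← hs] at this
    linarith
  have hu2 : u < 2 := by rw [hu, div_lt_iff₀ hq]; linarith
  have hu0 : 0 < u := by linarith
  set δ := 1 / u - 1 / 2 with hδdef
  have hδ : 0 < δ := by
    rw [hδdef, sub_pos]
    exact one_div_lt_one_div_of_lt hu0 hu2
  -- This `η` spends half of the gain `δ` on the double sum; the other half makes the kernel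
  -- summable.
  obtain ⟨C₁, hC₁, hC₁b⟩ := rpow_sum_le_double_sum (d := d) hq (η := δ / (2 * q)) (by positivity)
  obtain ⟨W, hW, hWb⟩ := exists_bound_tsum_dist d (half_pos hδ)
  refine ⟨C₁ * (2 * W), ENNReal.mul_ne_top hC₁ (ENNReal.mul_ne_top ENNReal.ofNat_ne_top hW), ?_⟩
  intro F h
  set β : (Fin d → ℕ) → ℝ≥0∞ := fun k => 2 ^ ((q / (2 * p) - 1 / 2) * len k) *
    (∫⁻ x, h k (cell k x) ^ p ∂(cubeMeasure d)) ^ (q / (2 * p)) with hβ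
  have hβ2 : ∀ k, β k * β k = 2 ^ ((q / p - 1) * len k) *
      (∫⁻ x, h k (cell k x) ^ p ∂(cubeMeasure d)) ^ (q / p) := by
    intro k
    have e1 : q / p = q / (2 * p) + q / (2 * p) := by field_simp; ring
    rw [e1, ENNReal.rpow_add_of_nonneg _ _ (by positivity) (by positivity),
      show (q / (2 * p) + q / (2 * p) - 1) * len k = (q / (2 * p) - 1 / 2) * len k +
        (q / (2 * p) - 1 / 2) * len k by ring, two_rpow_add]
    simp only [hβ]
    ring
  have hpair : ∀ k l, ∫⁻ x, h k (cell k x) ^ (q / 2) * h l (cell l x) ^ (q / 2) ∂(cubeMeasure d) ≤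
      2 ^ (-(δ * dist₁ k l)) * (β k * β l) := by
    intro k l
    have h1 := lintegral_mul_comp_cell_le_rpow k l (fun c => h k c ^ (q / 2))
      (fun c => h l c ^ (q / 2)) hu1 hu2.le
    have h2 : ∀ k, (∫⁻ x, (h k (cell k x) ^ (q / 2)) ^ u ∂(cubeMeasure d)) ^ (1 / u) ≤
        2 ^ (-(δ * len k)) * β k := by
      intro k
      have e1 : q / 2 * u = s := by rw [hu]; field_simp
      simp_rw [← ENNReal.rpow_mul, e1]
      calc _ ≤ (2 ^ ((s / p - 1) * len k) *
            (∫⁻ x, h k (cell k x) ^ p ∂(cubeMeasure d)) ^ (s / p)) ^ (1 / u) := by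
            gcongr
            exact lintegral_comp_cell_rpow_le k (h k) hp (le_max_left _ _)
        _ = 2 ^ (-(δ * len k)) * β k := by
            rw [ENNReal.mul_rpow_of_nonneg _ _ (by positivity), ← ENNReal.rpow_mul,
              ← ENNReal.rpow_mul]
            simp only [hβ]
            rw [← mul_assoc, ← two_rpow_add]
            have e2 : s / p * (1 / u) = q / (2 * p) := by rw [hu]; field_simp
            congr 2
            · rw [hδdef]
              have : (s / p - 1) * len k * (1 / u) = (s / p * (1 / u) - 1 / u) * len k := by ring
              rw [this, e2]
              ring
    refine h1.trans ?_
    calc _ ≤ 2 ^ ((2 / u - 1) * len (k ⊓ l)) *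
          ((2 ^ (-(δ * len k)) * β k) * (2 ^ (-(δ * len l)) * β l)) := by
          gcongr
          · exact h2 k
          · exact h2 l
      _ = (2 ^ ((2 / u - 1) * len (k ⊓ l)) * (2 ^ (-(δ * len k)) * 2 ^ (-(δ * len l)))) *
          (β k * β l) := by ring
      _ = _ := by
          rw [← two_rpow_add, ← two_rpow_add]
          congr 2
          have e3 : 2 / u - 1 = 2 * δ := by rw [hδdef]; ring
          have := two_mul_len_inf k l
          rw [e3, mul_assoc, mul_comm δ, ← mul_assoc, this]
          ring
  have hmeas : ∀ k, Measurable fun x => h k (cell k x) := fun k => measurable_comp_cell k (h k)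
  calc ∫⁻ x, (∑ k ∈ F, h k (cell k x)) ^ q ∂(cubeMeasure d)
      ≤ ∫⁻ x, C₁ * ∑ k ∈ F, ∑ l ∈ F, 2 ^ (q * (δ / (2 * q) * dist₁ k l)) *
          (h k (cell k x) ^ (q / 2) * h l (cell l x) ^ (q / 2)) ∂(cubeMeasure d) :=
        lintegral_mono fun x => hC₁b F fun k => h k (cell k x)
    _ = C₁ * ∑ k ∈ F, ∑ l ∈ F, 2 ^ (q * (δ / (2 * q) * dist₁ k l)) *
          ∫⁻ x, h k (cell k x) ^ (q / 2) * h l (cell l x) ^ (q / 2) ∂(cubeMeasure d) := by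
        have hm2 : ∀ k l, Measurable fun x =>
            h k (cell k x) ^ (q / 2) * h l (cell l x) ^ (q / 2) := fun k l =>
          ((hmeas k).pow_const _).mul ((hmeas l).pow_const _)
        rw [lintegral_const_mul' _ _ hC₁, lintegral_finsetSum]
        · congr 1
          refine Finset.sum_congr rfl fun k _ => ?_
          rw [lintegral_finsetSum]
          · exact Finset.sum_congr rfl fun l _ => lintegral_const_mul' _ _ (two_rpow_ne_top _)
          · exact fun l _ => (hm2 k l).const_mul _
        · exact fun k _ => Finset.measurable_fun_sum _ fun l _ => (hm2 k l).const_mul _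
    _ ≤ C₁ * ∑ k ∈ F, ∑ l ∈ F, 2 ^ (-(δ / 2 * dist₁ k l)) * (β k * β k + β l * β l) := by
        refine mul_le_mul_right (Finset.sum_le_sum fun k _ => Finset.sum_le_sum fun l _ => ?_) _
        calc _ ≤ 2 ^ (q * (δ / (2 * q) * dist₁ k l)) * (2 ^ (-(δ * dist₁ k l)) * (β k * β l)) := by
              gcongr
              exact hpair k l
          _ = 2 ^ (-(δ / 2 * dist₁ k l)) * (β k * β l) := by
              rw [← mul_assoc, ← two_rpow_add]
              congr 2
              field_simp
              ring
          _ ≤ _ := by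
              gcongr
              rcases le_total (β k) (β l) with hkl | hkl
              · exact (mul_le_mul_left hkl (β l)).trans le_add_self
              · exact (mul_le_mul_right hkl (β k)).trans le_self_add
    _ = C₁ * (2 * ∑ k ∈ F, β k * β k * ∑ l ∈ F, 2 ^ (-(δ / 2 * dist₁ l k))) := by
        congr 1
        simp only [mul_add, Finset.sum_add_distrib]
        rw [Finset.sum_comm (f := fun k l => 2 ^ (-(δ / 2 * dist₁ k l)) * (β l * β l)), two_mul]
        congr 1
        · refine Finset.sum_congr rfl fun k _ => ?_
          rw [Finset.mul_sum]
          exact Finset.sum_congr rfl fun l _ => by rw [dist₁_comm, mul_comm]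
        · refine Finset.sum_congr rfl fun k _ => ?_
          rw [Finset.mul_sum]
          exact Finset.sum_congr rfl fun l _ => by rw [mul_comm]
    _ ≤ C₁ * (2 * ∑ k ∈ F, β k * β k * W) := by
        gcongr with k _
        exact (ENNReal.sum_le_tsum _).trans (hWb k)
    _ = _ := by
        rw [← Finset.sum_mul]
        simp_rw [hβ2]
        ring

/-! ### Extrapolation from shifted dyadic grids -/

/-- The weight of the node `v - t + j` in the polynomial extrapolation to `0` from the nodes
`v - t, v - t + 1, …, v - t + r - 1`. -/
def extrapolationCoeff (r t : ℕ) (v : ℝ) (j : ℕ) : ℝ :=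
  (Lagrange.basis (Finset.range r) (fun j : ℕ => v - t + j) j).eval 0

lemma sum_extrapolationCoeff (r t : ℕ) (v : ℝ) (P : Polynomial ℝ) (hP : P.degree < r) :
    ∑ j ∈ Finset.range r, extrapolationCoeff r t v j * P.eval (v - t + j) = P.eval 0 := by
  have hinj : Set.InjOn (fun j : ℕ => v - t + j) (Finset.range r) := by
    intro i _ j _ hij
    have : (i : ℝ) = j := by simpa using hij
    exact_mod_cast this
  have h := Lagrange.eq_interpolate (s := Finset.range r) (v := fun j : ℕ => v - t + j) hinj
    (f := P) (by rwa [Finset.card_range])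
  conv_rhs => rw [h]
  rw [Lagrange.interpolate_apply, Polynomial.eval_finsetSum]
  refine Finset.sum_congr rfl fun j _ => ?_
  rw [Polynomial.eval_mul, Polynomial.eval_C, mul_comm]
  rfl

lemma abs_extrapolationCoeff_le (r t : ℕ) (ht : t ≤ r) {v : ℝ} (hv : v ∈ Set.Ico (0 : ℝ) 1)
    (j : ℕ) : |extrapolationCoeff r t v j| ≤ (2 * r + 1 : ℝ) ^ r := by
  have hr0 : (0 : ℝ) ≤ r := Nat.cast_nonneg r
  refine (abs_eval_lagrangeBasis_le (Finset.range r) _ j 0 (δ := 1) (B := 2 * r + 1) one_pos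
    (by linarith) ?_ ?_).trans (by rw [Finset.card_range])
  · intro i _ hij
    rw [add_sub_add_left_eq_sub]
    exact abs_natCast_sub_ge_one hij
  · intro i hi
    have hi' : (i : ℝ) < r := by exact_mod_cast Finset.mem_range.mp hi
    have ht' : (t : ℝ) ≤ r := by exact_mod_cast ht
    have hi0 : (0 : ℝ) ≤ i := Nat.cast_nonneg i
    have ht0 : (0 : ℝ) ≤ t := Nat.cast_nonneg t
    rw [zero_sub, abs_neg, abs_le]
    constructor <;> linarith [hv.1, hv.2]

/-- Extrapolation to `x` from the nodes `x + h (v - t + j)`, `j < r`. -/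
def extrapolation (r t : ℕ) (v h x : ℝ) : ℝ →₀ ℝ :=
  ∑ j ∈ Finset.range r, extrapolationCoeff r t v j • Finsupp.single (x + h * (v - t + j)) 1

lemma sum_smul_reindex {M : Type*} [AddCommGroup M] [Module ℝ M] (r n : ℕ) (a : ℕ → ℝ)
    (σ : ℕ → ℕ) (hσ : ∀ j < r, σ j < n) (G : ℕ → M) :
    ∑ j ∈ Finset.range r, a j • G (σ j) =
      ∑ m ∈ Finset.range n, (∑ j ∈ Finset.range r, if σ j = m then a j else 0) • G m := by
  simp_rw [Finset.sum_smul, ite_smul, zero_smul]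
  rw [Finset.sum_comm]
  refine Finset.sum_congr rfl fun j hj => ?_
  rw [Finset.sum_ite_eq, if_pos (Finset.mem_range.mpr (hσ j (Finset.mem_range.mp hj)))]

lemma abs_sum_ite_le (r : ℕ) (a : ℕ → ℝ) (σ : ℕ → ℕ) (m : ℕ) {B : ℝ} (ha : ∀ j, |a j| ≤ B) :
    |∑ j ∈ Finset.range r, if σ j = m then a j else 0| ≤ r * B := by
  have hB : 0 ≤ B := (abs_nonneg _).trans (ha 0)
  refine (Finset.abs_sum_le_sum_abs _ _).trans ?_
  calc _ ≤ ∑ _j ∈ Finset.range r, B := by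
        refine Finset.sum_le_sum fun j _ => ?_
        split_ifs
        · exact ha j
        · simpa using hB
    _ = r * B := by simp

/-- Passing to the next finer shifted grid changes the extrapolation by differences of order
`r`. -/
lemma exists_extrapolation_sub_eq (r : ℕ) (hr : 0 < r) (t : ℕ) (ht : t = 0 ∨ t = r) {v : ℝ}
    (hv : v ∈ Set.Ico (0 : ℝ) 1) (h x : ℝ) :
    ∃ b : ℕ → ℝ, (∀ i, |b i| ≤ (2 * r : ℕ) * 2 ^ (2 * r) * (2 * (r * (2 * r + 1 : ℝ) ^ r))) ∧
      extrapolation r t (Int.fract (2 * v)) (h / 2) x - extrapolation r t v h x =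
        ∑ i ∈ Finset.range r, b i •
          diffFunctional r (h / 2) (x + h / 2 * (Int.fract (2 * v) - 2 * t + i)) := by
  set v' := Int.fract (2 * v) with hv'
  have hv'I : v' ∈ Set.Ico (0 : ℝ) 1 := ⟨Int.fract_nonneg _, Int.fract_lt_one _⟩
  have htr : t ≤ r := by rcases ht with h | h <;> omega
  obtain ⟨fl, hfl, hfl1⟩ : ∃ fl : ℕ, 2 * v = v' + fl ∧ fl ≤ 1 := by
    by_cases hlt : 2 * v < 1
    · refine ⟨0, ?_, by norm_num⟩
      rw [hv', Int.fract_eq_self.mpr ⟨by linarith [hv.1], hlt⟩]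
      simp
    · refine ⟨1, ?_, le_rfl⟩
      have : Int.fract (2 * v) = 2 * v - 1 := by
        rw [Int.fract_eq_iff]
        exact ⟨by linarith, by linarith [hv.2], 1, by push_cast; ring⟩
      rw [hv', this]; push_cast; ring
  -- With `y` as origin and `h / 2` as unit, the fine nodes have indices `j + t` and the coarse ones
  -- `fl + 2 * j`, where `fl` is the integer part of `2v`. All of them lie in `0, …, 2r - 1`.
  set y := x + h / 2 * (v' - 2 * t) with hy
  set c : ℕ → ℝ := fun m =>
    (∑ j ∈ Finset.range r, if j + t = m then extrapolationCoeff r t v' j else 0) -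
      ∑ j ∈ Finset.range r, if fl + 2 * j = m then extrapolationCoeff r t v j else 0 with hc
  have hlt1 : ∀ j < r, j + t < 2 * r := by
    intro j hj; omega
  have hlt2 : ∀ j < r, fl + 2 * j < 2 * r := by
    intro j hj; omega
  -- Both extrapolations are exact at `x` for degrees below `r`; in the new coordinate `x` sits at
  -- `2t - v'`.
  have hkill : ∀ P : Polynomial ℝ, P.degree < r →
      ∑ j ∈ Finset.range (2 * r), c j * P.eval (j : ℝ) = 0 := by
    intro P hP
    have e1 := sum_smul_reindex r (2 * r) (fun j => extrapolationCoeff r t v' j) (fun j => j + t)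
      hlt1 (fun m => P.eval (m : ℝ))
    have e2 := sum_smul_reindex r (2 * r) (fun j => extrapolationCoeff r t v j)
      (fun j => fl + 2 * j) hlt2 (fun m => P.eval (m : ℝ))
    simp only [smul_eq_mul] at e1 e2
    simp only [hc, sub_mul, Finset.sum_sub_distrib]
    rw [← e1, ← e2]
    have hdeg : ∀ α β : ℝ, α ≠ 0 →
        (P.comp (Polynomial.C α * Polynomial.X + Polynomial.C β)).degree < (r : WithBot ℕ) := by
      intro α β hα
      by_cases hP0 : P = 0
      · subst hP0
        simp only [Polynomial.zero_comp, Polynomial.degree_zero]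
        exact WithBot.bot_lt_coe r
      rw [Polynomial.degree_eq_natDegree hP0] at hP
      refine lt_of_le_of_lt Polynomial.degree_le_natDegree ?_
      rw [Polynomial.natDegree_comp, Polynomial.natDegree_linear hα, mul_one]
      exact hP
    have f1 := sum_extrapolationCoeff r t v' _ (hdeg 1 (2 * t - v') one_ne_zero)
    have f2 := sum_extrapolationCoeff r t v _ (hdeg 2 (2 * t - v') two_ne_zero)
    simp only [Polynomial.eval_comp, Polynomial.eval_add, Polynomial.eval_mul, Polynomial.eval_C,
      Polynomial.eval_X, mul_zero, zero_add] at f1 f2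
    rw [sub_eq_zero]
    calc _ = P.eval (2 * t - v') := by
          rw [← f1]
          refine Finset.sum_congr rfl fun j _ => ?_
          congr 2
          push_cast; ring
      _ = _ := by
          rw [← f2]
          refine Finset.sum_congr rfl fun j _ => ?_
          congr 2
          push_cast
          linear_combination hfl
  obtain ⟨b, hb, hbe⟩ := exists_diffFunctional_sum r hr (2 * r) c hkill (h / 2) y
    (B := 2 * (r * (2 * r + 1 : ℝ) ^ r)) (by
      intro j _
      simp only [hc]
      refine (abs_sub _ _).trans ?_
      rw [two_mul]
      exact add_le_add
        (abs_sum_ite_le r _ _ _ fun i => abs_extrapolationCoeff_le r t htr hv'I i)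
        (abs_sum_ite_le r _ _ _ fun i => abs_extrapolationCoeff_le r t htr hv i))
  refine ⟨b, hb, ?_⟩
  have e3 : extrapolation r t v' (h / 2) x = ∑ j ∈ Finset.range r,
      extrapolationCoeff r t v' j • Finsupp.single (y + ((j + t : ℕ) : ℝ) * (h / 2)) 1 := by
    rw [extrapolation]
    refine Finset.sum_congr rfl fun j _ => ?_
    congr 2
    rw [hy]; push_cast; ring
  have e4 : extrapolation r t v h x = ∑ j ∈ Finset.range r,
      extrapolationCoeff r t v j • Finsupp.single (y + ((fl + 2 * j : ℕ) : ℝ) * (h / 2)) 1 := by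
    rw [extrapolation]
    refine Finset.sum_congr rfl fun j _ => ?_
    congr 2
    rw [hy]; push_cast
    linear_combination h / 2 * hfl
  rw [e3, e4, sum_smul_reindex r (2 * r) (fun j => extrapolationCoeff r t v' j) (fun j => j + t)
      hlt1 (fun m => Finsupp.single (y + (m : ℝ) * (h / 2)) 1),
    sum_smul_reindex r (2 * r) (fun j => extrapolationCoeff r t v j) (fun j => fl + 2 * j)
      hlt2 (fun m => Finsupp.single (y + (m : ℝ) * (h / 2)) 1), ← Finset.sum_sub_distrib]
  simp_rw [← sub_smul]
  have hbe' : ∑ j ∈ Finset.range (2 * r), c j • Finsupp.single (y + j * (h / 2)) (1 : ℝ) = _ := hbe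
  rw [hbe', show 2 * r - r = r by omega]
  refine Finset.sum_congr rfl fun i _ => ?_
  congr 2
  rw [hy]; ring

/-! ### Grid functionals and their decomposition -/

/-- The functional attached to the `i`-th grid point of level `k`: the difference of order `r`
for large levels and the point value for `k ≤ κ`. -/
def gridFunctional (r κ k i : ℕ) : ℝ →₀ ℝ :=
  if κ < k then diffFunctional r (1 / 2 ^ k) ((i : ℝ) / 2 ^ k) else Finsupp.single ((i : ℝ) / 2 ^ k) 1

/-- The shifts `a / 2^k` of the grid point that occur in `gridFunctional`. -/
def shiftRange (r κ k : ℕ) : Finset ℕ := if κ < k then Finset.range (r + 1) else {0}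

/-- The weights of the shifts that occur in `gridFunctional`. -/
def shiftCoeff (r κ k a : ℕ) : ℝ := if κ < k then (-1 : ℝ) ^ (r - a) * r.choose a else 1

lemma gridFunctional_eq (r κ k i : ℕ) :
    gridFunctional r κ k i = ∑ a ∈ shiftRange r κ k,
      shiftCoeff r κ k a • Finsupp.single ((i : ℝ) / 2 ^ k + a / 2 ^ k) 1 := by
  unfold gridFunctional shiftRange shiftCoeff
  split_ifs
  · rw [diffFunctional]
    exact Finset.sum_congr rfl fun j _ => by rw [mul_one_div]
  · simp

lemma abs_shiftCoeff_le (r κ k a : ℕ) : |shiftCoeff r κ k a| ≤ 2 ^ r := by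
  unfold shiftCoeff
  split_ifs
  · rw [abs_mul, abs_pow, abs_neg, abs_one, one_pow, one_mul, abs_of_nonneg (Nat.cast_nonneg _)]
    exact_mod_cast Nat.choose_le_two_pow r a
  · rw [abs_one]
    exact one_le_pow₀ one_le_two

lemma le_of_mem_shiftRange {r κ k a : ℕ} (ha : a ∈ shiftRange r κ k) : a ≤ r := by
  unfold shiftRange at ha
  split_ifs at ha
  · have := Finset.mem_range.mp ha; omega
  · simp at ha; omega

/-- The indices `i` for which `gridFunctional` only uses points of `[0,1]`. -/
def admissible (r κ k : ℕ) : Finset ℕ :=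
  (Finset.range (2 ^ k + 1)).filter fun i => κ < k → i + r ≤ 2 ^ k

lemma mem_admissible {r κ k i : ℕ} :
    i ∈ admissible r κ k ↔ i ≤ 2 ^ k ∧ (κ < k → i + r ≤ 2 ^ k) := by
  simp only [admissible, Finset.mem_filter, Finset.mem_range, Nat.lt_succ_iff]

lemma add_le_of_mem_shiftRange {r κ k a i : ℕ} (hi : i ∈ admissible r κ k)
    (ha : a ∈ shiftRange r κ k) : i + a ≤ 2 ^ k := by
  rw [mem_admissible] at hi
  unfold shiftRange at ha
  split_ifs at ha with h
  · have := Finset.mem_range.mp ha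
    have := hi.2 h
    omega
  · simp at ha
    omega

/-- The side on which the extrapolation nodes lie. -/
def side (r k i : ℕ) : ℕ := if 2 * i ≤ 2 ^ k then 0 else r

lemma side_eq (r k i : ℕ) : side r k i = 0 ∨ side r k i = r := by
  unfold side; split_ifs <;> simp

/-- The step `2^{-(m + κ)}`. -/
def stepSize (κ m : ℕ) : ℝ := 1 / 2 ^ (m + κ)

lemma stepSize_pos (κ m : ℕ) : 0 < stepSize κ m := by unfold stepSize; positivity

lemma stepSize_succ (κ m : ℕ) : stepSize κ (m + 1) = stepSize κ m / 2 := by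
  unfold stepSize
  rw [show m + 1 + κ = (m + κ) + 1 by ring, pow_succ]
  field_simp

lemma stepSize_le (κ m : ℕ) : stepSize κ m ≤ 1 / 2 ^ κ := by
  unfold stepSize
  exact one_div_le_one_div_of_le (by positivity) (pow_le_pow_right₀ one_le_two (by omega))

/-- The `m`-th dyadic shift of `w`. -/
def dyadicShift (m : ℕ) (w : ℝ) : ℝ := Int.fract (2 ^ m * w)

lemma dyadicShift_mem (m : ℕ) (w : ℝ) : dyadicShift m w ∈ Set.Ico (0 : ℝ) 1 :=
  ⟨Int.fract_nonneg _, Int.fract_lt_one _⟩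

lemma dyadicShift_succ (m : ℕ) (w : ℝ) :
    dyadicShift (m + 1) w = Int.fract (2 * dyadicShift m w) := by
  unfold dyadicShift
  rw [Int.fract_eq_fract]
  refine ⟨2 * ⌊2 ^ m * w⌋, ?_⟩
  rw [Int.fract, pow_succ]
  push_cast
  ring

/-- The approximation of `gridFunctional` by values on the shifted grid of level `m`. -/
def shiftedFunctional (r κ k i m : ℕ) (w : ℝ) : ℝ →₀ ℝ :=
  ∑ a ∈ shiftRange r κ k, shiftCoeff r κ k a •
    extrapolation r (side r k i) (dyadicShift m w) (stepSize κ m) ((i : ℝ) / 2 ^ k + a / 2 ^ k)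

/-- The contribution of the `l`-th scale to `gridFunctional`. -/
def scalePart (r κ k i : ℕ) (w : ℝ) : ℕ → ℝ →₀ ℝ
  | 0 => shiftedFunctional r κ k i (k - κ) w
  | l + 1 => shiftedFunctional r κ k i (k - κ + (l + 1)) w -
      shiftedFunctional r κ k i (k - κ + l) w

lemma sum_scalePart (r κ k i : ℕ) (w : ℝ) (L : ℕ) :
    ∑ l ∈ Finset.range (L + 1), scalePart r κ k i w l =
      shiftedFunctional r κ k i (k - κ + L) w := by
  induction L with
  | zero => simp [scalePart]
  | succ L ih => rw [Finset.sum_range_succ, ih, scalePart]; abel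

/-- The functional of scale `m` at the point `y`. -/
def scaleFunctional (r κ m : ℕ) (y : ℝ) : ℝ →₀ ℝ :=
  if 0 < m then diffFunctional r (stepSize κ m) y else Finsupp.single y 1

/-- The interval `[y, y + h]` and, for `m > 0`, its translate by `r h` lie in `[0,1]`. -/
def Fits (r κ m : ℕ) (y : ℝ) : Prop :=
  0 ≤ y ∧ y + stepSize κ m + (if 0 < m then r * stepSize κ m else 0) ≤ 1

/-- Padding with zero weights makes the index set independent of the starting offset, hence of the
side and the grid point. The later sums over points and scales can then be interchanged. -/
lemma sum_range_smul_eq_sum_Icc {M : Type*} [AddCommGroup M] [Module ℝ M] (r : ℕ) (s₀ : ℤ)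
    (h1 : -(2 * r : ℤ) ≤ s₀) (h2 : s₀ ≤ 0) (c : ℕ → ℝ) (G : ℤ → M) :
    ∑ i ∈ Finset.range r, c i • G (s₀ + i) =
      ∑ s ∈ Finset.Icc (-(2 * r : ℤ)) (2 * r),
        (if s₀ ≤ s ∧ s < s₀ + r then c (s - s₀).toNat else 0) • G s := by
  simp_rw [ite_smul, zero_smul]
  rw [← Finset.sum_filter]
  refine Finset.sum_nbij' (fun i => s₀ + i) (fun s => (s - s₀).toNat) ?_ ?_ ?_ ?_ ?_
  · intro i hi
    have := Finset.mem_range.mp hi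
    simp only [Finset.mem_filter, Finset.mem_Icc]
    omega
  · intro s hs
    simp only [Finset.mem_filter, Finset.mem_Icc] at hs
    rw [Finset.mem_range]
    omega
  · intro i _
    simp
  · intro s hs
    simp only [Finset.mem_filter, Finset.mem_Icc] at hs
    omega
  · intro i _
    simp

/-- Index set for the terms of `scalePart`. -/
def partIndex (r : ℕ) : Finset (ℕ × ℤ) :=
  Finset.range (r + 1) ×ˢ Finset.Icc (-(2 * r : ℤ)) (2 * r)

/-- The offsets, in units of the step, of the terms of `scalePart`. -/
def offset (l : ℕ) (z : ℕ × ℤ) : ℝ := z.1 * 2 ^ l + z.2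

/-- The extrapolation nodes are taken to the right of points in the left half of `[0,1]` and to the
left otherwise. As `6 * r ≤ 2 ^ κ`, a block of `r` steps has length at most `1/6`, which leaves room
for every node and for a further difference of order `r`. Only the weights and the position inside
the box depend on `w`; the corner of the box and the condition `Fits` do not, so `w` can later be
averaged out. -/
lemma exists_scalePart_eq (r : ℕ) (hr : 0 < r) (κ : ℕ) (hκ : 6 * r ≤ 2 ^ κ) :
    ∃ C : ℝ, ∀ k, ∀ i ∈ admissible r κ k, ∀ w l, ∃ β : ℕ × ℤ → ℝ, (∀ z, |β z| ≤ C) ∧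
      (∀ z, β z ≠ 0 → Fits r κ (k - κ + l)
        ((i : ℝ) / 2 ^ k + stepSize κ (k - κ + l) * offset l z)) ∧
      scalePart r κ k i w l = ∑ z ∈ partIndex r, β z • scaleFunctional r κ (k - κ + l)
        ((i : ℝ) / 2 ^ k + stepSize κ (k - κ + l) * (offset l z + dyadicShift (k - κ + l) w)) := by
  set B₁ : ℝ := (2 * r + 1 : ℝ) ^ r with hB₁
  set B₂ : ℝ := (2 * r : ℕ) * 2 ^ (2 * r) * (2 * (r * (2 * r + 1 : ℝ) ^ r)) with hB₂
  have hB₁0 : 0 ≤ B₁ := by positivity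
  have hB₂0 : 0 ≤ B₂ := by positivity
  have hr0 : (0 : ℝ) < r := by exact_mod_cast hr
  have hκ' : (r : ℝ) * (1 / 2 ^ κ) ≤ 1 / 6 := by
    rw [mul_one_div, div_le_iff₀ (by positivity)]
    have : (6 * r : ℝ) ≤ 2 ^ κ := by exact_mod_cast hκ
    linarith
  refine ⟨B₁ + 2 ^ r * B₂, fun k i hi w l => ?_⟩
  have hiad := mem_admissible.mp hi
  have hpk : (0 : ℝ) < 2 ^ k := by positivity
  have hx0 : (0 : ℝ) ≤ (i : ℝ) / 2 ^ k := by positivity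
  have hx1 : (i : ℝ) / 2 ^ k ≤ 1 := by
    rw [div_le_one hpk]; exact_mod_cast hiad.1
  have htle : side r k i ≤ r := by rcases side_eq r k i with h | h <;> omega
  have hside : (side r k i = 0 ∧ (i : ℝ) / 2 ^ k ≤ 1 / 2) ∨
      (side r k i = r ∧ 1 / 2 ≤ (i : ℝ) / 2 ^ k) := by
    unfold side
    split_ifs with h
    · left
      refine ⟨rfl, ?_⟩
      rw [div_le_iff₀ hpk]
      have : (2 * i : ℝ) ≤ 2 ^ k := by exact_mod_cast h
      linarith
    · right
      refine ⟨rfl, ?_⟩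
      rw [le_div_iff₀ hpk]
      have : (2 : ℝ) ^ k < 2 * i := by exact_mod_cast not_le.mp h
      linarith
  have hhigh : κ < k → stepSize κ (k - κ) = 1 / 2 ^ k := by
    intro h
    unfold stepSize
    rw [Nat.sub_add_cancel h.le]
  have hstepl : ∀ l, κ < k → stepSize κ (k - κ + l) * 2 ^ l = 1 / 2 ^ k := by
    intro l h
    unfold stepSize
    rw [show k - κ + l + κ = k + l by omega, pow_add]
    field_simp
  have hshift : ∀ a ∈ shiftRange r κ k, ∀ l, (a : ℝ) / 2 ^ k =
      stepSize κ (k - κ + l) * (a * 2 ^ l) := by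
    intro a ha l
    by_cases h : κ < k
    · rw [mul_left_comm, hstepl l h, mul_one_div]
    · have : a = 0 := by simpa [shiftRange, h] using ha
      simp [this]
  rcases l with _ | l
  · -- the coarsest scale
    set m := k - κ with hm
    set h := stepSize κ m with hh
    have hh0 : 0 < h := stepSize_pos κ m
    have hrh : r * h ≤ 1 / 6 :=
      (mul_le_mul_of_nonneg_left (stepSize_le κ m) hr0.le).trans hκ'
    set v := dyadicShift m w
    set t := side r k i with ht
    -- For `k > κ` the step of the coarsest scale is the grid step, so summing over the shifts `a`
    -- first yields a difference of order `r` at each extrapolation node. For `k ≤ κ` there is only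
    -- the shift zero and point values remain.
    have key : scalePart r κ k i w 0 = ∑ j ∈ Finset.range r, extrapolationCoeff r t v j •
        scaleFunctional r κ m ((i : ℝ) / 2 ^ k + h * ((((-(t : ℤ) + j : ℤ) : ℤ) : ℝ) + v)) := by
      simp only [scalePart, shiftedFunctional, extrapolation, Finset.smul_sum]
      rw [Finset.sum_comm]
      refine Finset.sum_congr rfl fun j _ => ?_
      simp_rw [smul_comm (shiftCoeff r κ k _) (extrapolationCoeff r _ _ j)]
      rw [← Finset.smul_sum]
      congr 1
      unfold scaleFunctional
      by_cases hk : κ < k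
      · have hm0 : 0 < m := by omega
        rw [if_pos hm0, diffFunctional]
        simp only [shiftRange, if_pos hk, shiftCoeff]
        refine Finset.sum_congr rfl fun a _ => ?_
        congr 2
        rw [← hh, hhigh hk]
        push_cast
        ring
      · have hm0 : ¬ 0 < m := by omega
        rw [if_neg hm0]
        simp only [shiftRange, if_neg hk, shiftCoeff, Finset.sum_singleton]
        rw [one_smul]
        congr 1
        push_cast
        ring
    refine ⟨fun z => if z.1 = 0 ∧ -(t : ℤ) ≤ z.2 ∧ z.2 < -(t : ℤ) + r then
      extrapolationCoeff r t v (z.2 - -(t : ℤ)).toNat else 0, ?_, ?_, ?_⟩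
    · intro z
      beta_reduce
      split_ifs
      · refine (abs_extrapolationCoeff_le r t htle (dyadicShift_mem m w) _).trans ?_
        have : (0 : ℝ) ≤ 2 ^ r * B₂ := by positivity
        linarith
      · rw [abs_zero]; positivity
    · intro z hz
      have hz' : z.1 = 0 ∧ -(t : ℤ) ≤ z.2 ∧ z.2 < -(t : ℤ) + r := by
        by_contra hcon
        exact hz (if_neg hcon)
      obtain ⟨hz0, hz1, hz2⟩ := hz'
      have e1 : -(t : ℝ) ≤ z.2 := by exact_mod_cast hz1
      have e2 : (z.2 : ℝ) + 1 ≤ -t + r := by exact_mod_cast hz2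
      simp only [Nat.add_zero, offset, hz0, Nat.cast_zero, zero_mul, zero_add]
      unfold Fits
      rw [← hh]
      have f1 : h * -(t : ℝ) ≤ h * z.2 := mul_le_mul_of_nonneg_left e1 hh0.le
      have f2 : h * ((z.2 : ℝ) + 1) ≤ h * (-t + r) := mul_le_mul_of_nonneg_left e2 hh0.le
      rcases hside with ⟨hs1, hs2⟩ | ⟨hs1, hs2⟩
      · rw [hs1] at f1 f2
        push_cast at f1 f2
        constructor
        · linarith
        · split_ifs
          · linarith
          · linarith
      · rw [hs1] at f1 f2
        constructor
        · linarith
        · split_ifs with hm0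
          · have hk : κ < k := by omega
            have h3 : (i : ℝ) / 2 ^ k + r * h ≤ 1 := by
              rw [hhigh hk, mul_one_div, ← add_div, div_le_one hpk]
              exact_mod_cast hiad.2 hk
            linarith
          · linarith
    · rw [key, sum_range_smul_eq_sum_Icc r (-(t : ℤ)) (by omega) (by omega)
        (fun j => extrapolationCoeff r t v j)
        (fun s => scaleFunctional r κ m ((i : ℝ) / 2 ^ k + h * ((s : ℝ) + v))), partIndex,
        Finset.sum_product]
      symm
      rw [Finset.sum_eq_single 0]
      · refine Finset.sum_congr rfl fun s _ => ?_
        simp [offset]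
        rfl
      · intro a _ ha
        refine Finset.sum_eq_zero fun s _ => ?_
        simp [ha]
      · simp
  · -- finer scales
    set m := k - κ + (l + 1) with hm
    have hm1 : m = k - κ + l + 1 := by omega
    set h := stepSize κ m with hh
    have hh0 : 0 < h := stepSize_pos κ m
    have hrh : r * h ≤ 1 / 6 :=
      (mul_le_mul_of_nonneg_left (stepSize_le κ m) hr0.le).trans hκ'
    have hm0 : 0 < m := by omega
    set v := dyadicShift m w with hv
    set t := side r k i with ht
    choose b hb hbe using fun a : ℕ => exists_extrapolation_sub_eq r hr t (side_eq r k i)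
      (dyadicShift_mem (k - κ + l) w) (stepSize κ (k - κ + l)) ((i : ℝ) / 2 ^ k + a / 2 ^ k)
    simp only [← dyadicShift_succ, ← stepSize_succ, ← hm1, ← hv, ← hh] at hbe
    refine ⟨fun z => if z.1 ∈ shiftRange r κ k ∧ -(2 * t : ℤ) ≤ z.2 ∧ z.2 < -(2 * t : ℤ) + r then
      shiftCoeff r κ k z.1 * b z.1 (z.2 - -(2 * t : ℤ)).toNat else 0, ?_, ?_, ?_⟩
    · intro z
      beta_reduce
      split_ifs
      · rw [abs_mul]
        have := mul_le_mul (abs_shiftCoeff_le r κ k z.1) (hb z.1 (z.2 - -(2 * t : ℤ)).toNat)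
          (abs_nonneg _) (by positivity)
        rw [← hB₂] at this
        linarith
      · rw [abs_zero]; positivity
    · intro z hz
      have hz' : z.1 ∈ shiftRange r κ k ∧ -(2 * t : ℤ) ≤ z.2 ∧ z.2 < -(2 * t : ℤ) + r := by
        by_contra hcon
        exact hz (if_neg hcon)
      obtain ⟨hz0, hz1, hz2⟩ := hz'
      have e1 : -(2 * t : ℝ) ≤ z.2 := by exact_mod_cast hz1
      have e2 : (z.2 : ℝ) + 1 ≤ -(2 * t) + r := by exact_mod_cast hz2
      unfold Fits
      rw [if_pos hm0, ← hh, offset, mul_add, ← hshift z.1 hz0 (l + 1)]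
      have f1 : h * -(2 * t : ℝ) ≤ h * z.2 := mul_le_mul_of_nonneg_left e1 hh0.le
      have f2 : h * ((z.2 : ℝ) + 1) ≤ h * (-(2 * t) + r) := mul_le_mul_of_nonneg_left e2 hh0.le
      have hxa : (i : ℝ) / 2 ^ k + z.1 / 2 ^ k ≤ 1 := by
        rw [← add_div, div_le_one hpk]
        exact_mod_cast add_le_of_mem_shiftRange hi hz0
      have ha0 : (0 : ℝ) ≤ (z.1 : ℝ) / 2 ^ k := by positivity
      have ha1 : (z.1 : ℝ) / 2 ^ k ≤ 1 / 6 := by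
        by_cases hk : κ < k
        · have h5 : (z.1 : ℝ) ≤ r := by exact_mod_cast le_of_mem_shiftRange hz0
          have h6 : (1 : ℝ) / 2 ^ k ≤ 1 / 2 ^ κ :=
            one_div_le_one_div_of_le (by positivity) (pow_le_pow_right₀ one_le_two hk.le)
          calc (z.1 : ℝ) / 2 ^ k = z.1 * (1 / 2 ^ k) := by ring
            _ ≤ r * (1 / 2 ^ κ) := by gcongr
            _ ≤ 1 / 6 := hκ'
        · have : z.1 = 0 := by simpa [shiftRange, hk] using hz0
          simp [this]
      rcases hside with ⟨hs1, hs2⟩ | ⟨hs1, hs2⟩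
      · rw [hs1] at f1 f2
        push_cast at f1 f2
        constructor <;> linarith
      · rw [hs1] at f1 f2
        constructor <;> linarith
    · have hdiff : scalePart r κ k i w (l + 1) = ∑ a ∈ shiftRange r κ k, shiftCoeff r κ k a •
          ∑ j ∈ Finset.range r, b a j • diffFunctional r h
            ((i : ℝ) / 2 ^ k + a / 2 ^ k + h * (v - 2 * t + j)) := by
        simp only [scalePart, shiftedFunctional]
        rw [← Finset.sum_sub_distrib]
        refine Finset.sum_congr rfl fun a _ => ?_
        rw [← smul_sub]
        congr 1
        exact hbe a
      rw [hdiff, partIndex, Finset.sum_product]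
      have hsub : shiftRange r κ k ⊆ Finset.range (r + 1) := fun a ha =>
        Finset.mem_range.mpr (Nat.lt_succ_of_le (le_of_mem_shiftRange ha))
      rw [← Finset.sum_subset hsub]
      · refine Finset.sum_congr rfl fun a ha => ?_
        have e5 : ∑ j ∈ Finset.range r, b a j • diffFunctional r h
            ((i : ℝ) / 2 ^ k + a / 2 ^ k + h * (v - 2 * t + j)) =
            ∑ j ∈ Finset.range r, b a j • (fun s : ℤ => scaleFunctional r κ m
              ((i : ℝ) / 2 ^ k + h * (offset (l + 1) (a, s) + v))) (-(2 * t : ℤ) + j) := by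
          refine Finset.sum_congr rfl fun j _ => ?_
          simp only [scaleFunctional, if_pos hm0, ← hh]
          congr 2
          rw [offset, hshift a ha (l + 1), ← hh]
          push_cast
          ring
        have e6 := sum_range_smul_eq_sum_Icc r (-(2 * t : ℤ)) (by omega) (by omega) (b a)
          (fun s : ℤ => scaleFunctional r κ m
              ((i : ℝ) / 2 ^ k + h * (offset (l + 1) (a, s) + v)))
        rw [e5, e6, Finset.smul_sum]
        refine Finset.sum_congr rfl fun s _ => ?_
        rw [smul_smul]
        congr 1
        simp [ha]
      · intro a _ ha
        refine Finset.sum_eq_zero fun s _ => ?_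
        simp [ha]

/-! ### Random dyadic shifts -/

lemma measurable_dyadicShift (m : ℕ) : Measurable (dyadicShift m) :=
  measurable_fract.comp (measurable_id.const_mul _)

/-- The doubling map: the preimage of a set consists of two disjoint copies contracted by one half,
translates of each other by `1/2`. -/
lemma measurePreserving_fract_two_mul :
    MeasurePreserving (fun w : ℝ => Int.fract (2 * w)) (volume.restrict (Set.Ico 0 1))
      (volume.restrict (Set.Ico 0 1)) := by
  have hm : Measurable (fun w : ℝ => Int.fract (2 * w)) :=
    measurable_fract.comp (measurable_id.const_mul _)
  refine ⟨hm, Measure.ext fun s hs => ?_⟩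
  rw [Measure.map_apply hm hs, Measure.restrict_apply (hm hs), Measure.restrict_apply hs]
  set t := s ∩ Set.Ico (0 : ℝ) 1 with ht
  have htm : MeasurableSet t := hs.inter measurableSet_Ico
  set A : Set ℝ := (fun w => 2 * w) ⁻¹' t with hA
  have hAm : MeasurableSet A := (measurable_id.const_mul _) htm
  have hset : (fun w : ℝ => Int.fract (2 * w)) ⁻¹' s ∩ Set.Ico 0 1 =
      A ∪ (fun w => w + -(1 / 2 : ℝ)) ⁻¹' A := by
    ext w
    simp only [hA, ht, Set.mem_inter_iff, Set.mem_preimage, Set.mem_Ico, Set.mem_union]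
    constructor
    · rintro ⟨h1, h2, h3⟩
      by_cases hw : 2 * w < 1
      · left
        rw [Int.fract_eq_self.mpr ⟨by linarith, hw⟩] at h1
        exact ⟨h1, by linarith, hw⟩
      · right
        have : Int.fract (2 * w) = 2 * (w + -(1 / 2)) := by
          rw [Int.fract_eq_iff]
          refine ⟨by linarith, by linarith, 1, by push_cast; ring⟩
        rw [this] at h1
        exact ⟨h1, by linarith, by linarith⟩
    · rintro (⟨h1, h2, h3⟩ | ⟨h1, h2, h3⟩)
      · rw [Int.fract_eq_self.mpr ⟨h2, h3⟩]
        exact ⟨h1, by linarith, by linarith⟩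
      · have : Int.fract (2 * w) = 2 * (w + -(1 / 2)) := by
          rw [Int.fract_eq_iff]
          refine ⟨by linarith, by linarith, 1, by push_cast; ring⟩
        rw [this]
        exact ⟨h1, by linarith, by linarith⟩
  have hdisj : Disjoint A ((fun w => w + -(1 / 2 : ℝ)) ⁻¹' A) := by
    refine Set.disjoint_left.mpr fun w h1 h2 => ?_
    have h3 := h1.2.2
    have h4 := h2.2.1
    simp only at h3 h4
    linarith
  rw [hset, measure_union hdisj ((measurable_id.add_const _) hAm), measure_preimage_add_right, hA,
    Real.volume_preimage_mul_left two_ne_zero, ← two_mul, ← mul_assoc]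
  rw [abs_of_pos (by norm_num), ENNReal.ofReal_inv_of_pos two_pos, ENNReal.ofReal_ofNat,
    ENNReal.mul_inv_cancel two_ne_zero ENNReal.ofNat_ne_top, one_mul]

lemma measurePreserving_dyadicShift (m : ℕ) :
    MeasurePreserving (dyadicShift m) (volume.restrict (Set.Ico 0 1))
      (volume.restrict (Set.Ico 0 1)) := by
  induction m with
  | zero =>
    refine ⟨measurable_dyadicShift 0, ?_⟩
    have : dyadicShift 0 =ᵐ[volume.restrict (Set.Ico (0 : ℝ) 1)] id := by
      filter_upwards [ae_restrict_mem measurableSet_Ico] with w hw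
      rw [dyadicShift, pow_zero, one_mul, Int.fract_eq_self.mpr hw, id]
    rw [Measure.map_congr this, Measure.map_id]
  | succ m ih =>
    have := measurePreserving_fract_two_mul.comp ih
    convert this using 1
    funext w
    exact dyadicShift_succ m w

lemma measurePreserving_affine (b : ℝ) {h : ℝ} (hh : 0 < h) :
    MeasurePreserving (fun v => b + h * v) (volume.restrict (Set.Ico 0 1))
      (ENNReal.ofReal h⁻¹ • volume.restrict (Set.Ico b (b + h))) := by
  have hm : Measurable (fun v : ℝ => b + h * v) := (measurable_id.const_mul _).const_add _
  refine ⟨hm, Measure.ext fun s hs => ?_⟩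
  rw [Measure.map_apply hm hs, Measure.restrict_apply (hm hs), Measure.smul_apply,
    Measure.restrict_apply hs, smul_eq_mul]
  have hset : (fun v : ℝ => b + h * v) ⁻¹' s ∩ Set.Ico 0 1 =
      (fun v => h * v) ⁻¹' ((fun v => b + v) ⁻¹' (s ∩ Set.Ico b (b + h))) := by
    ext v
    simp only [Set.mem_inter_iff, Set.mem_preimage, Set.mem_Ico]
    refine and_congr_right fun _ => ⟨fun ⟨h1, h2⟩ => ⟨by nlinarith, by nlinarith⟩,
      fun ⟨h1, h2⟩ => ⟨by nlinarith, by nlinarith⟩⟩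
  rw [hset, Real.volume_preimage_mul_left hh.ne', measure_preimage_add,
    abs_of_pos (inv_pos.mpr hh)]

/-- One uniformly distributed `w` provides a uniformly distributed shift at every level, so
averaging a point value over `w` gives the mean over a box. Independence between levels plays no
role. -/
lemma lintegral_halfCube_shift {d : ℕ} (m : Fin d → ℕ) (b h : Fin d → ℝ) (hh : ∀ i, 0 < h i)
    (G : (Fin d → ℝ) → ℝ≥0∞) (hG : Measurable G) :
    ∫⁻ w in halfCube d, G (fun i => b i + h i * dyadicShift (m i) (w i)) =
      (∏ i, ENNReal.ofReal (h i)⁻¹) *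
        ∫⁻ y in Set.univ.pi fun i => Set.Ico (b i) (b i + h i), G y := by
  have hfin : ∀ i, IsFiniteMeasure
      (ENNReal.ofReal (h i)⁻¹ • volume.restrict (Set.Ico (b i) (b i + h i))) := fun i =>
    Measure.smul_finite _ ENNReal.ofReal_ne_top
  have h1 := measurePreserving_pi (fun _ : Fin d => volume.restrict (Set.Ico (0 : ℝ) 1))
    (fun i => ENNReal.ofReal (h i)⁻¹ • volume.restrict (Set.Ico (b i) (b i + h i)))
    fun i => (measurePreserving_affine (b i) (hh i)).comp (measurePreserving_dyadicShift (m i))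
  have h2 : Measure.pi (fun i =>
      ENNReal.ofReal (h i)⁻¹ • volume.restrict (Set.Ico (b i) (b i + h i))) =
      (∏ i, ENNReal.ofReal (h i)⁻¹) •
        volume.restrict (Set.univ.pi fun i => Set.Ico (b i) (b i + h i)) := by
    refine Measure.pi_eq fun s hs => ?_
    rw [volume_pi, Measure.restrict_pi_pi, Measure.smul_apply, Measure.pi_pi, smul_eq_mul,
      ← Finset.prod_mul_distrib]
    rfl
  rw [h2] at h1
  rw [halfCube, volume_pi, Measure.restrict_pi_pi]
  have h3 := h1.lintegral_comp hG
  rw [lintegral_smul_measure, smul_eq_mul, volume_pi] at h3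
  exact h3

/-! ### Approximate identities -/

lemma abs_tensorEval_sub_le {d : ℕ} {ι : Type*} (f : (Fin d → ℝ) → ℝ) (x : Fin d → ℝ)
    (s : Fin d → Finset ι) (c y : Fin d → ι → ℝ) {B δ : ℝ}
    (hsum : ∀ i, ∑ j ∈ s i, c i j = 1) (hB : ∀ i, ∑ j ∈ s i, |c i j| ≤ B) (hδ : 0 ≤ δ)
    (hf : ∀ j : Fin d → ι, (∀ i, j i ∈ s i ∧ c i (j i) ≠ 0) → |f (fun i => y i (j i)) - f x| ≤ δ) :
    |tensorEval f (fun i => ∑ j ∈ s i, c i j • Finsupp.single (y i j) 1) - f x| ≤ B ^ d * δ := by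
  classical
  rw [tensorEval_sum_single]
  have h1 : f x = ∑ j ∈ Fintype.piFinset s, (∏ i, c i (j i)) * f x := by
    rw [← Finset.sum_mul, ← Finset.prod_univ_sum]
    simp [hsum]
  conv_lhs => rw [h1, ← Finset.sum_sub_distrib]
  simp_rw [← mul_sub]
  calc |∑ j ∈ Fintype.piFinset s, (∏ i, c i (j i)) * (f (fun i => y i (j i)) - f x)|
      ≤ ∑ j ∈ Fintype.piFinset s, (∏ i, |c i (j i)|) * δ := by
        refine (Finset.abs_sum_le_sum_abs _ _).trans (Finset.sum_le_sum fun j hj => ?_)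
        rw [abs_mul, Finset.abs_prod]
        by_cases h0 : ∀ i, c i (j i) ≠ 0
        · refine mul_le_mul_of_nonneg_left
            (hf j fun i => ⟨Fintype.mem_piFinset.mp hj i, h0 i⟩)
            (Finset.prod_nonneg fun _ _ => abs_nonneg _)
        · push Not at h0
          obtain ⟨i, hi⟩ := h0
          rw [Finset.prod_eq_zero (Finset.mem_univ i) (by rw [hi, abs_zero]), zero_mul, zero_mul]
    _ = (∏ i, ∑ j ∈ s i, |c i j|) * δ := by
        rw [← Finset.sum_mul, Finset.prod_univ_sum]
    _ ≤ B ^ d * δ := by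
        refine mul_le_mul_of_nonneg_right ?_ hδ
        calc ∏ i, ∑ j ∈ s i, |c i j| ≤ ∏ _i : Fin d, B :=
              Finset.prod_le_prod (fun i _ => Finset.sum_nonneg fun _ _ => abs_nonneg _)
                fun i _ => hB i
          _ = B ^ d := by simp

/-- Functionals of total mass one, of bounded variation and concentrated near `x` approximate the
value at `x` of a continuous function. -/
lemma tendsto_tensorEval {d : ℕ} {ι : Type*} {f : (Fin d → ℝ) → ℝ} (hf : Continuous f)
    (x : Fin d → ℝ) (s : ℕ → Fin d → Finset ι) (c y : ℕ → Fin d → ι → ℝ) {B : ℝ} {δ : ℕ → ℝ}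
    (hsum : ∀ n i, ∑ j ∈ s n i, c n i j = 1) (hB : ∀ n i, ∑ j ∈ s n i, |c n i j| ≤ B)
    (hy : ∀ n i, ∀ j ∈ s n i, c n i j ≠ 0 → |y n i j - x i| ≤ δ n)
    (hδ : Filter.Tendsto δ Filter.atTop (nhds 0)) :
    Filter.Tendsto
      (fun n => tensorEval f (fun i => ∑ j ∈ s n i, c n i j • Finsupp.single (y n i j) 1))
      Filter.atTop (nhds (f x)) := by
  rw [Metric.tendsto_atTop]
  intro ε hε
  have hBd : 0 < |B| ^ d + 1 := by positivity
  obtain ⟨η, hη, hfη⟩ := Metric.continuous_iff.mp hf x (ε / (|B| ^ d + 1)) (by positivity)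
  obtain ⟨N, hN⟩ := (Metric.tendsto_atTop.mp hδ) η hη
  refine ⟨N, fun n hn => ?_⟩
  have hδn : |δ n| < η := by simpa [Real.dist_eq] using hN n hn
  rw [Real.dist_eq]
  have h1 := abs_tensorEval_sub_le f x (s n) (c n) (y n) (B := |B|) (δ := ε / (|B| ^ d + 1))
    (hsum n) (fun i => (hB n i).trans (le_abs_self B)) (by positivity) fun j hj => by
      refine (hfη _ ?_).le
      rw [dist_pi_lt_iff hη]
      intro i
      rw [Real.dist_eq]
      exact ((hy n i (j i) (hj i).1 (hj i).2).trans (le_abs_self _)).trans_lt hδn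
  refine h1.trans_lt ?_
  rw [mul_div_assoc', div_lt_iff₀ hBd]
  nlinarith

/-- The nodes contract to the point as the step tends to zero, while the weights sum to one
(exactness for constants) and stay bounded. -/
lemma tendsto_shiftedFunctional {d : ℕ} {f : (Fin d → ℝ) → ℝ} (hf : Continuous f) (r : ℕ)
    (hr : 0 < r) (κ : ℕ) (k i : Fin d → ℕ) (w : Fin d → ℝ) :
    Filter.Tendsto
      (fun L : ℕ => tensorEval f fun j => shiftedFunctional r κ (k j) (i j) (k j - κ + L) (w j))
      Filter.atTop (nhds (tensorEval f fun j => gridFunctional r κ (k j) (i j))) := by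
  simp_rw [gridFunctional_eq, shiftedFunctional, tensorEval_sum_smul]
  refine tendsto_finsetSum _ fun a _ => Filter.Tendsto.const_mul _ ?_
  have hr0 : (0 : ℝ) ≤ r := Nat.cast_nonneg r
  have hside : ∀ j, side r (k j) (i j) ≤ r := fun j => by
    rcases side_eq r (k j) (i j) with h | h <;> omega
  rw [tensorEval_single f fun j => (i j : ℝ) / 2 ^ k j + a j / 2 ^ k j]
  refine tendsto_tensorEval hf _ (fun _ _ => Finset.range r) _ _
    (B := r * (2 * r + 1 : ℝ) ^ r) (δ := fun L => (1 / 2 : ℝ) ^ L * (2 * r + 1)) ?_ ?_ ?_ ?_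
  · intro L j
    have := sum_extrapolationCoeff r (side r (k j) (i j)) (dyadicShift (k j - κ + L) (w j)) 1
      (by rw [Polynomial.degree_one]; exact_mod_cast hr)
    simpa using this
  · intro L j
    refine (Finset.sum_le_card_nsmul _ _ _ fun m _ =>
      abs_extrapolationCoeff_le r _ (hside j) (dyadicShift_mem _ _) m).trans ?_
    simp
  · intro L j m hm _
    have hm' : (m : ℝ) ≤ r := by exact_mod_cast (Finset.mem_range.mp hm).le
    have hm0 : (0 : ℝ) ≤ m := Nat.cast_nonneg m
    have ht : (side r (k j) (i j) : ℝ) ≤ r := by exact_mod_cast hside j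
    have ht0 : (0 : ℝ) ≤ side r (k j) (i j) := Nat.cast_nonneg _
    have hv := dyadicShift_mem (k j - κ + L) (w j)
    rw [add_sub_cancel_left, abs_mul, abs_of_pos (stepSize_pos _ _)]
    have hstep : stepSize κ (k j - κ + L) ≤ (1 / 2) ^ L := by
      rw [stepSize, one_div_pow]
      exact one_div_le_one_div_of_le (by positivity) (pow_le_pow_right₀ one_le_two (by omega))
    refine mul_le_mul hstep ?_ (abs_nonneg _) (by positivity)
    rw [abs_le]
    constructor <;> linarith [hv.1, hv.2]
  · have := (tendsto_pow_atTop_nhds_zero_of_lt_one (r := (1 / 2 : ℝ)) (by norm_num)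
      (by norm_num)).mul_const (2 * r + 1 : ℝ)
    simpa using this

/-! ### The dyadic moduli of smoothness -/

/-- The directions in which the level is positive. -/
def posSet {d : ℕ} (m : Fin d → ℕ) : Finset (Fin d) := Finset.univ.filter fun i => 0 < m i

lemma mem_posSet {d : ℕ} {m : Fin d → ℕ} {i : Fin d} : i ∈ posSet m ↔ 0 < m i := by
  simp [posSet]

/-- The mixed modulus of smoothness at the dyadic point `2^{-m}`. -/
def dyadicModulus {d : ℕ} (r : ℕ) (p : ℝ≥0∞) (f : (Fin d → ℝ) → ℝ) (m : Fin d → ℕ) : ℝ≥0∞ :=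
  mixedModulus r p (posSet m) f fun i => 1 / 2 ^ m i

lemma tensorEval_scaleFunctional {d : ℕ} (r κ : ℕ) (f : (Fin d → ℝ) → ℝ) (m : Fin d → ℕ)
    (y : Fin d → ℝ) :
    tensorEval f (fun i => scaleFunctional r κ (m i) (y i)) =
      mixedDiff r (posSet m) (fun i => stepSize κ (m i)) f y := by
  rw [mixedDiff_eq_tensorEval]
  congr 1
  funext i
  simp only [scaleFunctional, mem_posSet]

lemma continuous_mixedDiff {d : ℕ} (r : ℕ) (e : Finset (Fin d)) (h : Fin d → ℝ)
    {f : (Fin d → ℝ) → ℝ} (hf : Continuous f) : Continuous (mixedDiff r e h f) := by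
  have h1 : mixedDiff r e h f = fun x => tensorEval f fun i =>
      ∑ j ∈ Finset.range (r + 1),
        (if i ∈ e then (-1 : ℝ) ^ (r - j) * r.choose j else if j = 0 then 1 else 0) •
          Finsupp.single (x i + j * h i) 1 := by
    funext x
    rw [mixedDiff_eq_tensorEval]
    congr 1
    funext i
    split_ifs
    · rfl
    · simp [ite_smul]
  rw [h1]
  simp_rw [tensorEval_sum_single]
  fun_prop

/-- The modulus at `t` admits only steps strictly smaller than `t`; `κ > 0` provides the strictness.
-/
lemma eLpNorm_mixedDiff_le_dyadicModulus {d : ℕ} (r : ℕ) (p : ℝ≥0∞) (f : (Fin d → ℝ) → ℝ)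
    (m : Fin d → ℕ) {κ : ℕ} (hκ : 0 < κ) :
    eLpNorm (mixedDiff r (posSet m) (fun i => stepSize κ (m i)) f) p
      (volume.restrict (diffDomain r (posSet m) fun i => stepSize κ (m i))) ≤
      dyadicModulus r p f m := by
  refine le_iSup₂_of_le (fun i => stepSize κ (m i)) (fun i _ => ?_) le_rfl
  rw [abs_of_pos (stepSize_pos _ _), stepSize]
  exact one_div_lt_one_div_of_lt (by positivity) (pow_lt_pow_right₀ one_lt_two (by omega))

/-! ### Averaging over the shifts -/

/-- The level of the `l`-th scale over the grid level `k`. -/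
def scaleLevel {d : ℕ} (κ : ℕ) (k l : Fin d → ℕ) : Fin d → ℕ := fun j => k j - κ + l j

/-- The corner of the box over which the term with index `z` is averaged. -/
def shiftBase {d : ℕ} (κ : ℕ) (k i l : Fin d → ℕ) (z : Fin d → ℕ × ℤ) : Fin d → ℝ := fun j =>
  (i j : ℝ) / 2 ^ k j + stepSize κ (scaleLevel κ k l j) * offset (l j) (z j)

open Classical in
/-- The terms that bound the contribution of the `l`-th scale. -/
def shiftTerm {d : ℕ} (r κ : ℕ) (f : (Fin d → ℝ) → ℝ) (k i l : Fin d → ℕ) (z : Fin d → ℕ × ℤ)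
    (w : Fin d → ℝ) : ℝ≥0∞ :=
  if ∀ j, Fits r κ (scaleLevel κ k l j) (shiftBase κ k i l z j) then
    ‖mixedDiff r (posSet (scaleLevel κ k l)) (fun j => stepSize κ (scaleLevel κ k l j)) f
      fun j => shiftBase κ k i l z j + stepSize κ (scaleLevel κ k l j) *
        dyadicShift (scaleLevel κ k l j) (w j)‖ₑ
  else 0

lemma measurable_shiftTerm {d : ℕ} (r κ : ℕ) {f : (Fin d → ℝ) → ℝ} (hf : Continuous f)
    (k i l : Fin d → ℕ) (z : Fin d → ℕ × ℤ) : Measurable (shiftTerm r κ f k i l z) := by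
  unfold shiftTerm
  split_ifs
  · refine ((continuous_mixedDiff r _ _ hf).measurable.comp ?_).enorm
    exact measurable_pi_lambda _ fun j =>
      (((measurable_dyadicShift _).comp (measurable_pi_apply j)).const_mul _).const_add _
  · exact measurable_const

/-- Each univariate grid functional is the limit of its partial sums over scales. Expanding the
tensor product of the partial sums and letting `L` tend to infinity bounds its value by all mixed
scales. The estimate holds for every `w`, and terms with boxes that do not fit have coefficient
zero. -/
lemma exists_enorm_gridFunctional_le (d r : ℕ) (hr : 0 < r) (κ : ℕ) (hκ : 6 * r ≤ 2 ^ κ) :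
    ∃ C : ℝ≥0∞, C ≠ ⊤ ∧ ∀ f : (Fin d → ℝ) → ℝ, Continuous f → ∀ k i : Fin d → ℕ,
      (∀ j, i j ∈ admissible r κ (k j)) → ∀ w : Fin d → ℝ,
        ‖tensorEval f fun j => gridFunctional r κ (k j) (i j)‖ₑ ≤
          C * ∑' l, ∑ z ∈ Fintype.piFinset fun _ : Fin d => partIndex r,
            shiftTerm r κ f k i l z w := by
  classical
  obtain ⟨B, hB⟩ := exists_scalePart_eq r hr κ hκ
  refine ⟨ENNReal.ofReal (B ^ d), ENNReal.ofReal_ne_top, fun f hf k i hi w => ?_⟩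
  have hscale : ∀ l : Fin d → ℕ,
      ‖tensorEval f fun j => scalePart r κ (k j) (i j) (w j) (l j)‖ₑ ≤
        ENNReal.ofReal (B ^ d) * ∑ z ∈ Fintype.piFinset fun _ : Fin d => partIndex r,
          shiftTerm r κ f k i l z w := by
    intro l
    choose β hβ hfit heq using fun j => hB (k j) (i j) (hi j) (w j) (l j)
    simp_rw [heq]
    rw [tensorEval_sum_smul, Finset.mul_sum]
    refine (enorm_sum_le _ _).trans (Finset.sum_le_sum fun z _ => ?_)
    rw [enorm_mul]
    by_cases h0 : ∀ j, β j (z j) ≠ 0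
    · have hF : ∀ j, Fits r κ (scaleLevel κ k l j) (shiftBase κ k i l z j) := fun j =>
        hfit j (z j) (h0 j)
      rw [shiftTerm, if_pos hF, ← tensorEval_scaleFunctional]
      refine mul_le_mul' ?_ (le_of_eq ?_)
      · rw [Real.enorm_eq_ofReal_abs, Finset.abs_prod]
        refine ENNReal.ofReal_le_ofReal ?_
        calc ∏ j, |β j (z j)| ≤ ∏ _j : Fin d, B :=
              Finset.prod_le_prod (fun _ _ => abs_nonneg _) fun j _ => hβ j (z j)
          _ = B ^ d := by simp
      · congr 2
        funext j
        rw [shiftBase, scaleLevel]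
        congr 1
        ring
    · push Not at h0
      obtain ⟨j, hj⟩ := h0
      rw [Finset.prod_eq_zero (Finset.mem_univ j) hj, enorm_zero, zero_mul]
      exact zero_le
  refine le_of_tendsto (tendsto_shiftedFunctional hf r hr κ k i w).enorm
    (Filter.Eventually.of_forall fun L => ?_)
  simp_rw [← sum_scalePart]
  rw [MultilinearMap.map_sum_finset, ← ENNReal.tsum_mul_left]
  refine (enorm_sum_le _ _).trans ?_
  refine (Finset.sum_le_sum fun l _ => hscale l).trans ?_
  exact ENNReal.sum_le_tsum _

lemma prod_stepSize_inv {d : ℕ} (κ : ℕ) (m : Fin d → ℕ) :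
    ∏ i, ENNReal.ofReal (stepSize κ (m i))⁻¹ = 2 ^ (len m + d * κ) := by
  have : len m + d * κ = ∑ i, ((m i : ℝ) + κ) := by
    simp [len, Finset.sum_add_distrib]
  rw [this, two_rpow_sum]
  refine Finset.prod_congr rfl fun i _ => ?_
  rw [stepSize, one_div, inv_inv, ENNReal.ofReal_pow (by norm_num), ENNReal.ofReal_ofNat,
    ← ENNReal.rpow_natCast]
  push_cast
  rfl

lemma shiftBox_subset_diffDomain {d : ℕ} {r κ : ℕ} {m : Fin d → ℕ} {b : Fin d → ℝ}
    (hb : ∀ j, Fits r κ (m j) (b j)) :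
    (Set.univ.pi fun j => Set.Ico (b j) (b j + stepSize κ (m j))) ⊆
      diffDomain r (posSet m) fun j => stepSize κ (m j) := by
  intro y hy
  have hr0 : ∀ j, 0 ≤ r * stepSize κ (m j) := fun j =>
    mul_nonneg (Nat.cast_nonneg r) (stepSize_pos _ _).le
  have h1 : ∀ j, 0 ≤ (if 0 < m j then r * stepSize κ (m j) else 0) := fun j => by
    split_ifs
    · exact hr0 j
    · exact le_rfl
  refine ⟨mem_cube_iff.mpr fun j => ?_, fun j hj => ?_⟩
  · have hyj := hy j (Set.mem_univ j)
    have := hb j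
    exact ⟨this.1.trans hyj.1, by linarith [this.2, hyj.2, h1 j]⟩
  · have hyj := hy j (Set.mem_univ j)
    obtain ⟨h2, h3⟩ := hb j
    rw [if_pos (mem_posSet.mp hj)] at h3
    exact ⟨by linarith [hr0 j, hyj.1], by linarith [hyj.2]⟩

/-- For fixed `l` and `z`, the boxes belonging to different grid points are disjoint, because they
are translated by multiples of `2^{-k}` and have sides at most `2^{-k}`. Their integrals therefore
add up to at most one integral over the domain of the difference; the prefactor is the inverse
volume of a box. -/
lemma sum_lintegral_shiftTerm_le {d r κ : ℕ} (hκ : 0 < κ) {p : ℝ≥0∞} (hp0 : p ≠ 0)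
    (hp : p ≠ ⊤) {f : (Fin d → ℝ) → ℝ} (hf : Continuous f) (k l : Fin d → ℕ)
    (z : Fin d → ℕ × ℤ) (S : Finset (Fin d → ℕ)) :
    ∑ i ∈ S, ∫⁻ w in halfCube d, shiftTerm r κ f k i l z w ^ p.toReal ≤
      2 ^ (len (scaleLevel κ k l) + d * κ) *
        dyadicModulus r p f (scaleLevel κ k l) ^ p.toReal := by
  classical
  set m := scaleLevel κ k l with hm
  have hp' : 0 < p.toReal := ENNReal.toReal_pos hp0 hp
  set g := mixedDiff r (posSet m) (fun j => stepSize κ (m j)) f with hg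
  set S' := S.filter fun i => ∀ j, Fits r κ (m j) (shiftBase κ k i l z j) with hS'
  set box : (Fin d → ℕ) → Set (Fin d → ℝ) := fun i =>
    Set.univ.pi fun j => Set.Ico (shiftBase κ k i l z j)
      (shiftBase κ k i l z j + stepSize κ (m j)) with hbox
  have hterm : ∀ i ∈ S, ∫⁻ w in halfCube d, shiftTerm r κ f k i l z w ^ p.toReal =
      if ∀ j, Fits r κ (m j) (shiftBase κ k i l z j) then
        2 ^ (len m + d * κ) * ∫⁻ y in box i, ‖g y‖ₑ ^ p.toReal else 0 := by
    intro i _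
    unfold shiftTerm
    split_ifs with h
    · rw [← prod_stepSize_inv, ← lintegral_halfCube_shift m _ _ (fun j => stepSize_pos κ (m j))
        (fun y => ‖g y‖ₑ ^ p.toReal)
        ((continuous_mixedDiff r _ _ hf).measurable.enorm.pow_const _)]
    · simp [ENNReal.zero_rpow_of_pos hp']
  rw [Finset.sum_congr rfl hterm, ← Finset.sum_filter, ← Finset.mul_sum]
  refine mul_le_mul_right ?_ _
  -- The offset determined by `z` is common to all boxes and cancels.
  have hdisj : Set.PairwiseDisjoint (S' : Set (Fin d → ℕ)) box := by
    intro i _ i' _ hii'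
    refine Set.disjoint_left.mpr fun y hy hy' => hii' ?_
    funext j
    obtain ⟨h1, h2⟩ := hy j (Set.mem_univ j)
    obtain ⟨h3, h4⟩ := hy' j (Set.mem_univ j)
    have hstep : stepSize κ (m j) ≤ 1 / 2 ^ k j := by
      rw [stepSize]
      refine one_div_le_one_div_of_le (by positivity) (pow_le_pow_right₀ one_le_two ?_)
      rw [hm, scaleLevel]
      omega
    have hk : (0 : ℝ) < 2 ^ k j := by positivity
    simp only [shiftBase] at h1 h2 h3 h4
    have h5 : (i j : ℝ) / 2 ^ k j < (i' j : ℝ) / 2 ^ k j + 1 / 2 ^ k j := by linarith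
    have h6 : (i' j : ℝ) / 2 ^ k j < (i j : ℝ) / 2 ^ k j + 1 / 2 ^ k j := by linarith
    rw [← add_div, div_lt_div_iff_of_pos_right hk] at h5 h6
    have h7 : i j < i' j + 1 := by exact_mod_cast h5
    have h8 : i' j < i j + 1 := by exact_mod_cast h6
    omega
  calc ∑ i ∈ S', ∫⁻ y in box i, ‖g y‖ₑ ^ p.toReal
      = ∫⁻ y in ⋃ i ∈ S', box i, ‖g y‖ₑ ^ p.toReal := by
        rw [lintegral_biUnion_finset hdisj fun i _ => MeasurableSet.univ_pi fun _ => measurableSet_Ico]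
    _ ≤ ∫⁻ y in diffDomain r (posSet m) fun j => stepSize κ (m j), ‖g y‖ₑ ^ p.toReal := by
        refine lintegral_mono_set (Set.iUnion₂_subset fun i hi => ?_)
        exact shiftBox_subset_diffDomain (Finset.mem_filter.mp hi).2
    _ ≤ dyadicModulus r p f m ^ p.toReal := by
        rw [← rpow_one_div_le_iff hp', ← eLpNorm_eq_lintegral_rpow_enorm_toReal hp0 hp]
        exact eLpNorm_mixedDiff_le_dyadicModulus r p f m hκ

lemma len_scaleLevel_le {d : ℕ} (κ : ℕ) (k l : Fin d → ℕ) :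
    len (scaleLevel κ k l) ≤ len k + len l := by
  rw [len, len, len, ← Finset.sum_add_distrib]
  refine Finset.sum_le_sum fun j _ => ?_
  have : scaleLevel κ k l j ≤ k j + l j := by rw [scaleLevel]; omega
  exact_mod_cast this

/-- The grid functionals in the discrete `L_p`-norm, in terms of the dyadic moduli. -/
lemma exists_sum_gridFunctional_rpow_le (d r : ℕ) (hr : 0 < r) (κ : ℕ) (hκ : 6 * r ≤ 2 ^ κ)
    {p : ℝ≥0∞} (hp0 : p ≠ 0) (hp : p ≠ ⊤) {η : ℝ} (hη : 0 < η) :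
    ∃ C : ℝ≥0∞, C ≠ ⊤ ∧ ∀ f : (Fin d → ℝ) → ℝ, Continuous f → ∀ k : Fin d → ℕ,
      2 ^ (-len k) * ∑ i ∈ Fintype.piFinset fun j => admissible r κ (k j),
          ‖tensorEval f fun j => gridFunctional r κ (k j) (i j)‖ₑ ^ p.toReal ≤
        C * ∑' l, 2 ^ ((p.toReal * η + 1) * len l) *
          dyadicModulus r p f (scaleLevel κ k l) ^ p.toReal := by
  classical
  have hp' : 0 < p.toReal := ENNReal.toReal_pos hp0 hp
  have hκ0 : 0 < κ := by
    rcases Nat.eq_zero_or_pos κ with rfl | h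
    · norm_num at hκ; omega
    · exact h
  obtain ⟨C₁, hC₁, h₁⟩ := exists_enorm_gridFunctional_le d r hr κ hκ
  obtain ⟨C₂, hC₂, h₂⟩ := rpow_tsum_len_le d hp' hη
  set Z := Fintype.piFinset fun _ : Fin d => partIndex r with hZ
  set C₃ : ℝ≥0∞ := C₁ ^ p.toReal * (C₂ * (Z.card : ℝ≥0∞) ^ p.toReal) with hC₃
  refine ⟨C₃ * (Z.card * 2 ^ ((d : ℝ) * κ)), ?_, fun f hf k => ?_⟩
  · refine ENNReal.mul_ne_top (ENNReal.mul_ne_top (ENNReal.rpow_ne_top_of_nonneg hp'.le hC₁)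
      (ENNReal.mul_ne_top hC₂ (ENNReal.rpow_ne_top_of_nonneg hp'.le (ENNReal.natCast_ne_top _))))
      (ENNReal.mul_ne_top (ENNReal.natCast_ne_top _) (two_rpow_ne_top _))
  have hpt : ∀ i ∈ Fintype.piFinset fun j => admissible r κ (k j), ∀ w : Fin d → ℝ,
      ‖tensorEval f fun j => gridFunctional r κ (k j) (i j)‖ₑ ^ p.toReal ≤
        C₃ * ∑' l, 2 ^ (p.toReal * (η * len l)) * ∑ z ∈ Z, shiftTerm r κ f k i l z w ^ p.toReal := by
    intro i hi w
    calc _ ≤ (C₁ * ∑' l, ∑ z ∈ Z, shiftTerm r κ f k i l z w) ^ p.toReal := by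
          gcongr
          exact h₁ f hf k i (fun j => Fintype.mem_piFinset.mp hi j) w
      _ ≤ C₁ ^ p.toReal * (C₂ * ∑' l, 2 ^ (p.toReal * (η * len l)) *
            (∑ z ∈ Z, shiftTerm r κ f k i l z w) ^ p.toReal) := by
          rw [ENNReal.mul_rpow_of_nonneg _ _ hp'.le]
          exact mul_le_mul_right (h₂ _) _
      _ ≤ C₁ ^ p.toReal * (C₂ * ∑' l, 2 ^ (p.toReal * (η * len l)) *
            ((Z.card : ℝ≥0∞) ^ p.toReal * ∑ z ∈ Z, shiftTerm r κ f k i l z w ^ p.toReal)) := by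
          refine mul_le_mul_right (mul_le_mul_right (ENNReal.tsum_le_tsum fun l =>
            mul_le_mul_right (rpow_sum_le_card_mul _ _ hp') _) _) _
      _ = _ := by
          rw [hC₃]
          simp_rw [mul_left_comm _ ((Z.card : ℝ≥0∞) ^ p.toReal)]
          rw [ENNReal.tsum_mul_left]
          ring
  have hvol : volume (halfCube d) = 1 := by
    have := (isProbabilityMeasure_cubeMeasure (d := d)).measure_univ
    rwa [cubeMeasure_eq, Measure.restrict_apply_univ] at this
  -- The left side does not depend on `w`, so it equals its own average over the unit cube.
  have hint : ∀ i ∈ Fintype.piFinset fun j => admissible r κ (k j),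
      ‖tensorEval f fun j => gridFunctional r κ (k j) (i j)‖ₑ ^ p.toReal ≤
        C₃ * ∑' l, 2 ^ (p.toReal * (η * len l)) *
          ∑ z ∈ Z, ∫⁻ w in halfCube d, shiftTerm r κ f k i l z w ^ p.toReal := by
    intro i hi
    have hmeas : ∀ l z, Measurable fun w => shiftTerm r κ f k i l z w ^ p.toReal := fun l z =>
      (measurable_shiftTerm r κ hf k i l z).pow_const _
    calc _ = ∫⁻ _w in halfCube d,
            ‖tensorEval f fun j => gridFunctional r κ (k j) (i j)‖ₑ ^ p.toReal := by
          rw [setLIntegral_const, hvol, mul_one]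
      _ ≤ ∫⁻ w in halfCube d, C₃ * ∑' l, 2 ^ (p.toReal * (η * len l)) *
            ∑ z ∈ Z, shiftTerm r κ f k i l z w ^ p.toReal :=
          lintegral_mono fun w => hpt i hi w
      _ = _ := by
          rw [lintegral_const_mul, lintegral_tsum]
          · congr 2
            funext l
            rw [lintegral_const_mul, lintegral_finsetSum]
            · exact fun z _ => hmeas l z
            · exact Finset.measurable_fun_sum _ fun z _ => hmeas l z
          · intro l
            exact ((Finset.measurable_fun_sum _ fun z _ => hmeas l z).const_mul _).aemeasurable
          · exact Measurable.tsum fun l =>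
              (Finset.measurable_fun_sum _ fun z _ => hmeas l z).const_mul _
  calc 2 ^ (-len k) * ∑ i ∈ Fintype.piFinset fun j => admissible r κ (k j),
          ‖tensorEval f fun j => gridFunctional r κ (k j) (i j)‖ₑ ^ p.toReal
      ≤ 2 ^ (-len k) * ∑ i ∈ Fintype.piFinset fun j => admissible r κ (k j),
          (C₃ * ∑' l, 2 ^ (p.toReal * (η * len l)) *
            ∑ z ∈ Z, ∫⁻ w in halfCube d, shiftTerm r κ f k i l z w ^ p.toReal) :=
        mul_le_mul_right (Finset.sum_le_sum hint) _
    _ = C₃ * ∑' l, 2 ^ (-len k) * (2 ^ (p.toReal * (η * len l)) *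
          ∑ z ∈ Z, ∑ i ∈ Fintype.piFinset fun j => admissible r κ (k j),
            ∫⁻ w in halfCube d, shiftTerm r κ f k i l z w ^ p.toReal) := by
        rw [← Finset.mul_sum, mul_left_comm, ← Summable.tsum_finsetSum
          (fun _ _ => ENNReal.summable), ENNReal.tsum_mul_left]
        congr 3
        funext l
        rw [← Finset.mul_sum, Finset.sum_comm]
    _ ≤ C₃ * ∑' l, (Z.card * 2 ^ ((d : ℝ) * κ)) * (2 ^ ((p.toReal * η + 1) * len l) *
          dyadicModulus r p f (scaleLevel κ k l) ^ p.toReal) := by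
        refine mul_le_mul_right (ENNReal.tsum_le_tsum fun l => ?_) _
        set ω := dyadicModulus r p f (scaleLevel κ k l) ^ p.toReal
        calc _ ≤ 2 ^ (-len k) * (2 ^ (p.toReal * (η * len l)) *
              ∑ z ∈ Z, 2 ^ (len (scaleLevel κ k l) + d * κ) * ω) := by
              refine mul_le_mul_right (mul_le_mul_right (Finset.sum_le_sum fun z _ => ?_) _) _
              exact sum_lintegral_shiftTerm_le hκ0 hp0 hp hf k l z _
          _ ≤ 2 ^ (-len k) * (2 ^ (p.toReal * (η * len l)) *
              ∑ z ∈ Z, 2 ^ (len k + len l + d * κ) * ω) := by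
              refine mul_le_mul_right (mul_le_mul_right (Finset.sum_le_sum fun z _ => ?_) _) _
              refine mul_le_mul_left (two_rpow_mono ?_) _
              linarith [len_scaleLevel_le κ k l]
          _ = Z.card * (2 ^ (-len k) * 2 ^ (p.toReal * (η * len l)) *
                2 ^ (len k + len l + d * κ)) * ω := by
              rw [Finset.sum_const, nsmul_eq_mul]
              ring
          _ = _ := by
              rw [← two_rpow_add, ← two_rpow_add]
              rw [show -len k + p.toReal * (η * len l) + (len k + len l + d * κ) =
                d * κ + (p.toReal * η + 1) * len l by ring, two_rpow_add]
              ring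
    _ = _ := by
        rw [ENNReal.tsum_mul_left]
        ring

/-- The grid functionals in the maximum norm. -/
lemma enorm_gridFunctional_le_dyadicModulus_top {d r κ : ℕ} (hκ : 6 * r ≤ 2 ^ κ) (hr : 0 < r)
    {f : (Fin d → ℝ) → ℝ} (hf : Continuous f) (k i : Fin d → ℕ)
    (hi : ∀ j, i j ∈ admissible r κ (k j)) :
    ‖tensorEval f fun j => gridFunctional r κ (k j) (i j)‖ₑ ≤
      dyadicModulus r ⊤ f (fun j => k j - κ) := by
  have hκ0 : 0 < κ := by
    rcases Nat.eq_zero_or_pos κ with rfl | h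
    · norm_num at hκ; omega
    · exact h
  set m : Fin d → ℕ := fun j => k j - κ with hm
  set x : Fin d → ℝ := fun j => (i j : ℝ) / 2 ^ k j with hx
  set g := mixedDiff r (posSet m) (fun j => stepSize κ (m j)) f with hg
  have hstep : ∀ j, κ < k j → stepSize κ (m j) = 1 / 2 ^ k j := by
    intro j hj
    rw [stepSize, hm]
    simp only
    rw [Nat.sub_add_cancel hj.le]
  have h1 : tensorEval f (fun j => gridFunctional r κ (k j) (i j)) = g x := by
    rw [hg, ← tensorEval_scaleFunctional]
    congr 1
    funext j
    unfold gridFunctional scaleFunctional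
    by_cases hj : κ < k j
    · rw [if_pos hj, if_pos (by simp only [hm]; omega), hstep j hj]
    · rw [if_neg hj, if_neg (by simp only [hm]; omega)]
  rw [h1]
  refine le_trans ?_ (eLpNorm_mixedDiff_le_dyadicModulus r ⊤ f m hκ0)
  rw [eLpNorm_exponent_top]
  set D := diffDomain r (posSet m) fun j => stepSize κ (m j) with hD
  set u : Fin d → ℝ := fun j => if 0 < m j then 1 - r * stepSize κ (m j) else 1 with hu
  have hr0 : (0 : ℝ) < r := by exact_mod_cast hr
  have hrs : ∀ j, r * stepSize κ (m j) ≤ 1 / 6 := fun j => by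
    refine (mul_le_mul_of_nonneg_left (stepSize_le κ (m j)) hr0.le).trans ?_
    rw [mul_one_div, div_le_iff₀ (by positivity)]
    have : (6 * r : ℝ) ≤ 2 ^ κ := by exact_mod_cast hκ
    linarith
  have hrs0 : ∀ j, 0 < r * stepSize κ (m j) := fun j => mul_pos hr0 (stepSize_pos _ _)
  have hu0 : ∀ j, 0 < u j := fun j => by
    simp only [hu]
    split_ifs
    · linarith [hrs j]
    · exact one_pos
  have hDu : Set.Icc 0 u ⊆ D := by
    intro y hy
    have hy1 : ∀ j, 0 ≤ y j := fun j => hy.1 j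
    have hy2 : ∀ j, y j ≤ u j := fun j => hy.2 j
    refine ⟨mem_cube_iff.mpr fun j => ⟨hy1 j, (hy2 j).trans ?_⟩, fun j hj => ?_⟩
    · simp only [hu]
      split_ifs
      · linarith [hrs0 j]
      · exact le_rfl
    · have := hy2 j
      simp only [hu, if_pos (mem_posSet.mp hj)] at this
      exact ⟨by linarith [hy1 j, hrs0 j], by linarith⟩
  have hxu : x ∈ Set.Icc 0 u := by
    refine ⟨fun j => by simp only [hx, Pi.zero_apply]; positivity, fun j => ?_⟩
    have hk : (0 : ℝ) < 2 ^ k j := by positivity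
    obtain ⟨h2, h3⟩ := mem_admissible.mp (hi j)
    simp only [hu, hx]
    by_cases hj : κ < k j
    · rw [if_pos (by simp only [hm]; omega), hstep j hj]
      rw [le_sub_iff_add_le, mul_one_div, ← add_div, div_le_one hk]
      exact_mod_cast h3 hj
    · rw [if_neg (by simp only [hm]; omega), div_le_one hk]
      exact_mod_cast h2
  have hgc : Continuous fun y => ‖g y‖ₑ := (continuous_mixedDiff r _ _ hf).enorm
  by_contra hlt
  push Not at hlt
  set V := {y | eLpNormEssSup g (volume.restrict D) < ‖g y‖ₑ} with hV
  have hVo : IsOpen V := isOpen_lt continuous_const hgc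
  have hint : (interior (Set.Icc 0 u)).Nonempty := by
    rw [← Set.pi_univ_Icc, interior_pi_set Set.finite_univ]
    refine ⟨fun j => u j / 2, fun j _ => ?_⟩
    beta_reduce
    rw [interior_Icc]
    exact ⟨by have := hu0 j; simp only [Pi.zero_apply]; linarith, by linarith [hu0 j]⟩
  -- The point `x` may lie on the boundary, where an essential supremum gives no direct information.
  -- It is a limit of interior points of a nondegenerate box in the domain, so a violation at `x`
  -- would persist on an open set of positive measure.
  have hcl : x ∈ closure (interior (Set.Icc 0 u)) := by
    rw [(convex_Icc (𝕜 := ℝ) (0 : Fin d → ℝ) u).closure_interior_eq_closure_of_nonempty_interior hint]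
    exact subset_closure hxu
  obtain ⟨y, hyV, hyI⟩ := mem_closure_iff.mp hcl V hVo hlt
  have hpos : 0 < volume (V ∩ interior (Set.Icc 0 u)) :=
    (hVo.inter isOpen_interior).measure_pos volume ⟨y, hyV, hyI⟩
  have hae : ∀ᵐ y ∂(volume.restrict D), ‖g y‖ₑ ≤ eLpNormEssSup g (volume.restrict D) :=
    enorm_ae_le_eLpNormEssSup _ _
  have hnull : volume.restrict D V = 0 := by
    rw [ae_iff] at hae
    simpa only [not_le] using hae
  rw [Measure.restrict_apply hVo.measurableSet] at hnull
  refine hpos.ne' (measure_mono_null ?_ hnull)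
  exact Set.inter_subset_inter_right _ (interior_subset.trans hDu)

/-! ### The blocks `q_k f` in terms of the grid functionals -/

/-- The admissible grid indices close to the cell with index `c`. -/
def window (r κ W k c : ℕ) : Finset ℕ :=
  (admissible r κ k).filter fun i => i ≤ c + W ∧ c ≤ i + W

lemma mem_window {r κ W k c i : ℕ} :
    i ∈ window r κ W k c ↔ i ∈ admissible r κ k ∧ i ≤ c + W ∧ c ≤ i + W := by
  simp [window]

lemma card_window_le (r κ W k c : ℕ) : (window r κ W k c).card ≤ 2 * W + 1 := by
  have : window r κ W k c ⊆ Finset.Icc (c - W) (c + W) := by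
    intro i hi
    have := (mem_window.mp hi).2
    rw [Finset.mem_Icc]
    omega
  refine (Finset.card_le_card this).trans ?_
  rw [Nat.card_Icc]
  omega

lemma sum_range_eq_sum_range_add {M : Type*} [AddCommMonoid M] (F : ℕ → M) {lo hi N : ℕ}
    (hN : hi ≤ N) (h0 : ∀ y, y < N → F y ≠ 0 → lo ≤ y ∧ y < hi) :
    ∑ y ∈ Finset.range N, F y = ∑ j ∈ Finset.range (hi - lo), F (lo + j) := by
  rw [← Finset.sum_Ico_eq_sum_range]
  symm
  refine Finset.sum_subset ?_ ?_
  · intro y hy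
    rw [Finset.mem_Ico] at hy
    rw [Finset.mem_range]
    omega
  · intro y hy hy'
    by_contra hF
    exact hy' (Finset.mem_Ico.mpr (h0 y (Finset.mem_range.mp hy) hF))

/-- Above `κ` both operators reproduce degrees below `r`, so the functional kills them. Being
supported on at most `2W + 1` consecutive grid points near `x`, it is a bounded combination of
differences of order `r` on those points. The window is clipped to the grid, so no difference leaves
`[0,1]`. For `k ≤ κ` the point values themselves are used. -/
lemma exists_levelDiffFunctional_eq {r μ : ℕ} (hr : 0 < r) {lam : ℤ → ℝ}
    (hQ : IsQuasiInterpolation r μ lam) {κ : ℕ} (hκ : 6 * r ≤ 2 ^ κ) :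
    ∃ (C : ℝ) (W : ℕ), ∀ k, ∀ x ∈ Set.Icc (0 : ℝ) 1, ∃ b : ℕ → ℝ, (∀ i, |b i| ≤ C) ∧
      levelDiffFunctional r μ lam k x =
        ∑ i ∈ window r κ W k ⌊2 ^ k * x⌋₊, b i • gridFunctional r κ k i := by
  obtain ⟨B, hB0, hB⟩ := exists_bound_levelDiffCoeff r μ lam
  set W : ℕ := 2 * (3 * r + μ) + 1 with hW
  have hbig : B ≤ (2 * W + 1 : ℕ) * 2 ^ (2 * W + 1) * B := by
    have h1 : (1 : ℝ) ≤ (2 * W + 1 : ℕ) := by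
      push_cast
      have : (0 : ℝ) ≤ W := Nat.cast_nonneg W
      linarith
    have h2 : (1 : ℝ) ≤ 2 ^ (2 * W + 1) := one_le_pow₀ one_le_two
    nlinarith [mul_le_mul h1 h2 zero_le_one (by linarith)]
  refine ⟨(2 * W + 1 : ℕ) * 2 ^ (2 * W + 1) * B, W, fun k x hx => ?_⟩
  set c := ⌊2 ^ k * x⌋₊ with hc
  have h2k : (0 : ℝ) < 2 ^ k := by positivity
  have hc1 : (c : ℝ) ≤ 2 ^ k * x := Nat.floor_le (mul_nonneg h2k.le hx.1)
  have hc2 : 2 ^ k * x < c + 1 := Nat.lt_floor_add_one _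
  have hck : c ≤ 2 ^ k := by
    have : (c : ℝ) ≤ 2 ^ k := hc1.trans (by nlinarith [hx.2])
    exact_mod_cast this
  have hzero : ∀ y : ℕ, levelDiffCoeff r μ lam k y x ≠ 0 → y ≤ c + W ∧ c ≤ y + W := by
    intro y hy
    by_contra hcon
    refine hy (levelDiffCoeff_eq_zero r μ lam k y ?_)
    have hWr : (W : ℝ) = 2 * (3 * r + μ) + 1 := by rw [hW]; push_cast; ring
    by_cases h1 : y ≤ c + W
    · have h3 : y + W + 1 ≤ c := by omega
      have h4 : (y : ℝ) + W + 1 ≤ c := by exact_mod_cast h3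
      rw [lt_abs]; right; linarith
    · have h3 : c + W + 1 ≤ y := by omega
      have h4 : (c : ℝ) + W + 1 ≤ y := by exact_mod_cast h3
      rw [lt_abs]; left; linarith
  by_cases hk : κ < k
  · set lo := c - W with hlo
    set hi := min (2 ^ k) (c + W) + 1 with hhi
    set n := hi - lo with hn
    have hhiN : hi ≤ 2 ^ k + 1 := by omega
    have hnW : n ≤ 2 * W + 1 := by omega
    have hrange : ∀ y, y < 2 ^ k + 1 → levelDiffCoeff r μ lam k y x ≠ 0 → lo ≤ y ∧ y < hi := by
      intro y hy hy0
      have := hzero y hy0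
      omega
    obtain ⟨k₁, rfl⟩ : ∃ k₁, k = k₁ + 1 := ⟨k - 1, by omega⟩
    have hrk : r ≤ 2 ^ k₁ + 1 := by
      have : 2 ^ κ ≤ 2 ^ k₁ := Nat.pow_le_pow_right two_pos (by omega)
      omega
    obtain ⟨b, hb, hbe⟩ := exists_diffFunctional_sum r hr n
      (fun j => levelDiffCoeff r μ lam (k₁ + 1) (lo + j) x) (by
        intro P hP
        set P' := P.comp (Polynomial.C (2 ^ (k₁ + 1) : ℝ) * Polynomial.X - Polynomial.C (lo : ℝ))
          with hP'
        have hdeg : P'.degree < r := by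
          rcases eq_or_ne P 0 with rfl | hP0
          · rw [hP', Polynomial.zero_comp, Polynomial.degree_zero]
            exact WithBot.bot_lt_coe r
          · have h1 : P.natDegree < r := (Polynomial.natDegree_lt_iff_degree_lt hP0).mpr hP
            refine Polynomial.degree_le_natDegree.trans_lt ?_
            have h2 : P'.natDegree ≤ P.natDegree := by
              refine Polynomial.natDegree_comp_le.trans ?_
              calc _ ≤ P.natDegree * 1 := by
                    refine Nat.mul_le_mul_left _ ?_
                    compute_degree
                _ = _ := mul_one _
            exact_mod_cast h2.trans_lt h1
        have h := sum_levelDiffCoeff_polynomial hQ k₁ hrk P' hdeg hx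
        rw [sum_range_eq_sum_range_add _ hhiN] at h
        · rw [← h]
          refine Finset.sum_congr rfl fun j _ => ?_
          rw [mul_comm, hP', Polynomial.eval_comp]
          congr 2
          simp only [Polynomial.eval_sub, Polynomial.eval_mul, Polynomial.eval_C,
            Polynomial.eval_X]
          push_cast
          field_simp
          ring
        · intro y hy hy0
          exact hrange y hy (right_ne_zero_of_mul hy0))
      (1 / 2 ^ (k₁ + 1)) ((lo : ℝ) / 2 ^ (k₁ + 1)) (fun j _ => hB _ _ _)
    refine ⟨fun i => if lo ≤ i ∧ i < lo + (n - r) then b (i - lo) else 0, ?_, ?_⟩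
    · intro i
      beta_reduce
      split_ifs
      · refine (hb _).trans ?_
        have h1 : (n : ℝ) ≤ (2 * W + 1 : ℕ) := by exact_mod_cast hnW
        have h2 : (2 : ℝ) ^ n ≤ 2 ^ (2 * W + 1) := pow_le_pow_right₀ one_le_two hnW
        gcongr
      · rw [abs_zero]; positivity
    · rw [levelDiffFunctional, sum_range_eq_sum_range_add _ hhiN]
      · have e1 : ∀ j ∈ Finset.range (hi - lo),
            levelDiffCoeff r μ lam (k₁ + 1) (lo + j) x •
              Finsupp.single (((lo + j : ℕ) : ℝ) / 2 ^ (k₁ + 1)) (1 : ℝ) =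
            levelDiffCoeff r μ lam (k₁ + 1) (lo + j) x •
              Finsupp.single ((lo : ℝ) / 2 ^ (k₁ + 1) + j * (1 / 2 ^ (k₁ + 1))) (1 : ℝ) := by
          intro j _
          congr 2
          push_cast
          ring
        rw [Finset.sum_congr rfl e1, hbe]
        simp_rw [ite_smul, zero_smul]
        rw [← Finset.sum_filter]
        refine Finset.sum_nbij' (fun j => lo + j) (fun i => i - lo) ?_ ?_ ?_ ?_ ?_
        · intro j hj
          have := Finset.mem_range.mp hj
          simp only [Finset.mem_filter, mem_window, mem_admissible]
          omega
        · intro i hi'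
          simp only [Finset.mem_filter] at hi'
          rw [Finset.mem_range]
          omega
        · intro j _; simp
        · intro i hi'
          simp only [Finset.mem_filter] at hi'
          omega
        · intro j _
          rw [gridFunctional, if_pos hk, Nat.add_sub_cancel_left]
          congr 2
          push_cast
          ring
      · intro y hy hy0
        exact hrange y hy (left_ne_zero_of_smul hy0)
  · refine ⟨fun i => levelDiffCoeff r μ lam k i x, fun i => (hB _ _ _).trans hbig, ?_⟩
    rw [levelDiffFunctional]
    symm
    simp only [gridFunctional, if_neg hk]
    refine Finset.sum_subset ?_ ?_
    · intro i hi
      have := (mem_admissible.mp (mem_window.mp hi).1).1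
      rw [Finset.mem_range]
      omega
    · intro y hy hyw
      rw [Finset.mem_range] at hy
      have : levelDiffCoeff r μ lam k y x = 0 := by
        by_contra h0
        refine hyw (mem_window.mpr ⟨mem_admissible.mpr ⟨by omega, fun h => absurd h hk⟩, hzero y h0⟩)
      rw [this, zero_smul]

/-- The cell function that dominates the block `q_k f`. -/
def blockMajorant {d : ℕ} (r κ W : ℕ) (f : (Fin d → ℝ) → ℝ) (k c : Fin d → ℕ) : ℝ≥0∞ :=
  ∑ i ∈ Fintype.piFinset fun j => window r κ W (k j) (c j),
    ‖tensorEval f fun j => gridFunctional r κ (k j) (i j)‖ₑ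

lemma exists_enorm_mixedLevelDiff_le (d : ℕ) {r μ : ℕ} (hr : 0 < r) {lam : ℤ → ℝ}
    (hQ : IsQuasiInterpolation r μ lam) {κ : ℕ} (hκ : 6 * r ≤ 2 ^ κ) :
    ∃ (C : ℝ≥0∞) (W : ℕ), C ≠ ⊤ ∧ ∀ (f : (Fin d → ℝ) → ℝ) (k : Fin d → ℕ), ∀ x ∈ cube d,
      ‖mixedLevelDiff r μ lam k f x‖ₑ ≤ C * blockMajorant r κ W f k (cell k x) := by
  obtain ⟨B, W, hB⟩ := exists_levelDiffFunctional_eq hr hQ hκ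
  refine ⟨ENNReal.ofReal (B ^ d), W, ENNReal.ofReal_ne_top, fun f k x hx => ?_⟩
  choose b hb hbe using fun j => hB (k j) (x j) (mem_cube_iff.mp hx j)
  rw [mixedLevelDiff_eq_tensorEval r μ lam k f hx]
  simp_rw [hbe]
  have h2 := abs_tensorEval_sum_smul_le f (fun j => window r κ W (k j) ⌊2 ^ k j * x j⌋₊) b
    (fun j i => gridFunctional r κ (k j) i) (C := B) fun j i _ => hb j i
  rw [Real.enorm_eq_ofReal_abs]
  refine (ENNReal.ofReal_le_ofReal h2).trans (le_of_eq ?_)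
  rw [ENNReal.ofReal_mul' (Finset.sum_nonneg fun _ _ => abs_nonneg _),
    ENNReal.ofReal_sum_of_nonneg fun _ _ => abs_nonneg _, blockMajorant]
  simp_rw [Real.enorm_eq_ofReal_abs]
  rfl

/-- Bounded overlap: a window has at most `(2W+1)^d` indices, and an index belongs to at most that
many windows. -/
lemma lintegral_blockMajorant_rpow_le {d : ℕ} (r κ W : ℕ) (f : (Fin d → ℝ) → ℝ) (k : Fin d → ℕ)
    {p : ℝ} (hp : 0 < p) :
    ∫⁻ x, blockMajorant r κ W f k (cell k x) ^ p ∂(cubeMeasure d) ≤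
      ((2 * W + 1 : ℕ) ^ d : ℝ≥0∞) ^ p * (2 * W + 1 : ℕ) ^ d * (2 ^ (-len k) *
        ∑ i ∈ Fintype.piFinset fun j => admissible r κ (k j),
          ‖tensorEval f fun j => gridFunctional r κ (k j) (i j)‖ₑ ^ p) := by
  classical
  rw [lintegral_comp_cell k fun c => blockMajorant r κ W f k c ^ p]
  set T : (Fin d → ℕ) → ℝ≥0∞ := fun i =>
    ‖tensorEval f fun j => gridFunctional r κ (k j) (i j)‖ₑ with hT
  have hcard : ∀ c : Fin d → ℕ,
      ((Fintype.piFinset fun j => window r κ W (k j) (c j)).card : ℝ≥0∞) ≤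
        (2 * W + 1 : ℕ) ^ d := by
    intro c
    rw [Fintype.card_piFinset]
    calc ((∏ j, (window r κ W (k j) (c j)).card : ℕ) : ℝ≥0∞)
        ≤ ((∏ _j : Fin d, (2 * W + 1) : ℕ) : ℝ≥0∞) := by
          exact_mod_cast Finset.prod_le_prod' fun j _ => card_window_le r κ W (k j) (c j)
      _ = _ := by simp
  have h1 : ∀ c ∈ cells k, blockMajorant r κ W f k c ^ p ≤ ((2 * W + 1 : ℕ) ^ d : ℝ≥0∞) ^ p *
      ∑ i ∈ Fintype.piFinset fun j => window r κ W (k j) (c j), T i ^ p := by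
    intro c _
    refine (rpow_sum_le_card_mul _ _ hp).trans ?_
    exact mul_le_mul_left (ENNReal.rpow_le_rpow (hcard c) hp.le) _
  have h2 : ∑ c ∈ cells k, ∑ i ∈ Fintype.piFinset fun j => window r κ W (k j) (c j), T i ^ p ≤
      (2 * W + 1 : ℕ) ^ d * ∑ i ∈ Fintype.piFinset fun j => admissible r κ (k j), T i ^ p := by
    calc _ = ∑ c ∈ cells k, ∑ i ∈ Fintype.piFinset fun j => admissible r κ (k j),
          (if ∀ j, i j ≤ c j + W ∧ c j ≤ i j + W then T i ^ p else 0) := by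
          refine Finset.sum_congr rfl fun c _ => ?_
          rw [← Finset.sum_filter]
          refine Finset.sum_congr ?_ fun _ _ => rfl
          ext i
          simp only [Fintype.mem_piFinset, mem_window, Finset.mem_filter, forall_and]
      _ = ∑ i ∈ Fintype.piFinset fun j => admissible r κ (k j),
          ∑ c ∈ cells k, (if ∀ j, i j ≤ c j + W ∧ c j ≤ i j + W then T i ^ p else 0) :=
          Finset.sum_comm
      _ ≤ ∑ i ∈ Fintype.piFinset fun j => admissible r κ (k j),
          (2 * W + 1 : ℕ) ^ d * T i ^ p := by
          refine Finset.sum_le_sum fun i _ => ?_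
          rw [← Finset.sum_filter, Finset.sum_const, nsmul_eq_mul]
          refine mul_le_mul_left ?_ _
          have hsub : (cells k).filter (fun c => ∀ j, i j ≤ c j + W ∧ c j ≤ i j + W) ⊆
              Fintype.piFinset fun j => Finset.Icc (i j - W) (i j + W) := by
            intro c hc
            rw [Fintype.mem_piFinset]
            intro j
            have := (Finset.mem_filter.mp hc).2 j
            rw [Finset.mem_Icc]
            omega
          have h3 := Finset.card_le_card hsub
          rw [Fintype.card_piFinset] at h3
          have h4 : ∏ j, (Finset.Icc (i j - W) (i j + W)).card ≤ (2 * W + 1) ^ d := by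
            calc _ ≤ ∏ _j : Fin d, (2 * W + 1) := by
                  refine Finset.prod_le_prod' fun j _ => ?_
                  rw [Nat.card_Icc]
                  omega
              _ = _ := by simp
          exact_mod_cast h3.trans h4
      _ = _ := by rw [Finset.mul_sum]
  calc 2 ^ (-len k) * ∑ c ∈ cells k, blockMajorant r κ W f k c ^ p
      ≤ 2 ^ (-len k) * ∑ c ∈ cells k, (((2 * W + 1 : ℕ) ^ d : ℝ≥0∞) ^ p *
          ∑ i ∈ Fintype.piFinset fun j => window r κ W (k j) (c j), T i ^ p) :=
        mul_le_mul_right (Finset.sum_le_sum h1) _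
    _ ≤ 2 ^ (-len k) * (((2 * W + 1 : ℕ) ^ d : ℝ≥0∞) ^ p * ((2 * W + 1 : ℕ) ^ d *
          ∑ i ∈ Fintype.piFinset fun j => admissible r κ (k j), T i ^ p)) := by
        rw [← Finset.mul_sum]
        exact mul_le_mul_right (mul_le_mul_right h2 _) _
    _ = _ := by ring

/-- The block majorants in `L_p`, in terms of the dyadic moduli. -/
lemma exists_eLpNorm_blockMajorant_le (d r : ℕ) (hr : 0 < r) (κ : ℕ) (hκ : 6 * r ≤ 2 ^ κ) (W : ℕ)
    {p : ℝ≥0∞} (hp0 : p ≠ 0) {β : ℝ} (hβ : (p⁻¹).toReal < β) :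
    ∃ C : ℝ≥0∞, C ≠ ⊤ ∧ ∀ f : (Fin d → ℝ) → ℝ, Continuous f → ∀ k : Fin d → ℕ,
      eLpNorm (fun x => blockMajorant r κ W f k (cell k x)) p (cubeMeasure d) ≤
        C * ⨆ l, 2 ^ (β * len l) * dyadicModulus r p f (scaleLevel κ k l) := by
  by_cases hp : p = ⊤
  · subst hp
    refine ⟨((2 * W + 1 : ℕ) ^ d : ℝ≥0∞), ENNReal.pow_ne_top (ENNReal.natCast_ne_top _),
      fun f hf k => ?_⟩
    have h0 : dyadicModulus r ⊤ f (fun j => k j - κ) ≤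
        ⨆ l, 2 ^ (β * len l) * dyadicModulus r ⊤ f (scaleLevel κ k l) := by
      refine le_iSup_of_le 0 ?_
      have e1 : len (0 : Fin d → ℕ) = 0 := by simp [len]
      have e2 : scaleLevel κ k (0 : Fin d → ℕ) = fun j => k j - κ := by
        funext j; simp [scaleLevel]
      rw [e1, e2, mul_zero, ENNReal.rpow_zero, one_mul]
    rw [eLpNorm_exponent_top]
    refine eLpNormEssSup_le_of_ae_enorm_bound (Filter.Eventually.of_forall fun x => ?_)
    rw [enorm_eq_self, blockMajorant]
    refine (Finset.sum_le_card_nsmul _ _ _ fun i hi =>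
      (enorm_gridFunctional_le_dyadicModulus_top hκ hr hf k i fun j =>
        (mem_window.mp (Fintype.mem_piFinset.mp hi j)).1).trans h0).trans ?_
    rw [nsmul_eq_mul]
    refine mul_le_mul_left ?_ _
    rw [Fintype.card_piFinset]
    calc ((∏ j, (window r κ W (k j) (cell k x j)).card : ℕ) : ℝ≥0∞)
        ≤ ((∏ _j : Fin d, (2 * W + 1) : ℕ) : ℝ≥0∞) := by
          exact_mod_cast Finset.prod_le_prod' fun j _ => card_window_le r κ W (k j) _
      _ = _ := by simp
  · have hp' : 0 < p.toReal := ENNReal.toReal_pos hp0 hp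
    set P := p.toReal with hP
    rw [toReal_inv_eq, ← hP] at hβ
    -- Half of the room between `β` and `1/p`. Then `P η + 1 = P β - P η`, and the factor `2^{-P η
    -- |l|}` left over makes the sum over `l` converge.
    set η := (β - 1 / P) / 2 with hη
    have hη0 : 0 < η := by rw [hη]; linarith
    obtain ⟨C₁, hC₁, h₁⟩ := exists_sum_gridFunctional_rpow_le d r hr κ hκ hp0 hp hη0
    set K : ℝ≥0∞ := ((2 * W + 1 : ℕ) ^ d : ℝ≥0∞) ^ P * (2 * W + 1 : ℕ) ^ d with hK
    have hKt : K ≠ ⊤ := ENNReal.mul_ne_top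
      (ENNReal.rpow_ne_top_of_nonneg hp'.le (ENNReal.pow_ne_top (ENNReal.natCast_ne_top _)))
      (ENNReal.pow_ne_top (ENNReal.natCast_ne_top _))
    set T : ℝ≥0∞ := ∑' l : Fin d → ℕ, 2 ^ (-(P * η * len l)) with hT
    have hTt : T ≠ ⊤ := tsum_two_rpow_len_ne_top d (mul_pos hp' hη0)
    refine ⟨(K * C₁ * T) ^ (1 / P), ENNReal.rpow_ne_top_of_nonneg (by positivity)
      (ENNReal.mul_ne_top (ENNReal.mul_ne_top hKt hC₁) hTt), fun f hf k => ?_⟩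
    set S := ⨆ l, 2 ^ (β * len l) * dyadicModulus r p f (scaleLevel κ k l) with hS
    rw [eLpNorm_eq_lintegral_rpow_enorm_toReal hp0 hp, rpow_one_div_le_iff hp',
      ENNReal.mul_rpow_of_nonneg _ _ hp'.le, ← ENNReal.rpow_mul, one_div_mul_cancel hp'.ne',
      ENNReal.rpow_one]
    simp_rw [enorm_eq_self]
    refine (lintegral_blockMajorant_rpow_le r κ W f k hp').trans ?_
    calc K * (2 ^ (-len k) * ∑ i ∈ Fintype.piFinset fun j => admissible r κ (k j),
          ‖tensorEval f fun j => gridFunctional r κ (k j) (i j)‖ₑ ^ P)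
        ≤ K * (C₁ * ∑' l, 2 ^ ((P * η + 1) * len l) *
          dyadicModulus r p f (scaleLevel κ k l) ^ P) := mul_le_mul_right (h₁ f hf k) _
      _ ≤ K * (C₁ * ∑' l : Fin d → ℕ, 2 ^ (-(P * η * len l)) * S ^ P) := by
          refine mul_le_mul_right (mul_le_mul_right (ENNReal.tsum_le_tsum fun l => ?_) _) _
          have h2 : 2 ^ (β * len l) * dyadicModulus r p f (scaleLevel κ k l) ≤ S :=
            le_iSup (fun l => 2 ^ (β * len l) * dyadicModulus r p f (scaleLevel κ k l)) l
          have h3 := ENNReal.rpow_le_rpow h2 hp'.le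
          rw [ENNReal.mul_rpow_of_nonneg _ _ hp'.le, ← ENNReal.rpow_mul] at h3
          refine le_trans (le_of_eq ?_) (mul_le_mul_right h3 _)
          rw [← mul_assoc, ← two_rpow_add]
          congr 2
          rw [hη]
          field_simp
          ring
      _ = _ := by
          rw [ENNReal.tsum_mul_right]
          ring

/-! ### The Besov norm and the dyadic moduli -/

/-- The weighted length `(a, m)`. -/
def wsum {d : ℕ} (a : Fin d → ℝ) (m : Fin d → ℕ) : ℝ := ∑ i, a i * m i

lemma wsum_eq_sum_posSet {d : ℕ} (a : Fin d → ℝ) (m : Fin d → ℕ) :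
    wsum a m = ∑ i ∈ posSet m, a i * m i := by
  rw [wsum]
  symm
  refine Finset.sum_subset (Finset.subset_univ _) fun i _ hi => ?_
  rw [mem_posSet, Nat.pos_iff_ne_zero, not_not] at hi
  rw [hi, Nat.cast_zero, mul_zero]

lemma ofReal_two_rpow (x : ℝ) : ENNReal.ofReal ((2 : ℝ) ^ x) = 2 ^ x := by
  rw [← ENNReal.ofReal_rpow_of_pos two_pos, ENNReal.ofReal_ofNat]

lemma mixedModulus_mono {d : ℕ} (r : ℕ) (p : ℝ≥0∞) (e : Finset (Fin d)) (f : (Fin d → ℝ) → ℝ)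
    {s t : Fin d → ℝ} (hst : ∀ i ∈ e, s i ≤ t i) :
    mixedModulus r p e f s ≤ mixedModulus r p e f t :=
  iSup₂_le fun h hh => le_iSup₂_of_le h (fun i hi => (hh i hi).trans_le (hst i hi)) le_rfl

lemma dyadicModulus_le_of_theta_top {d : ℕ} (r : ℕ) (p : ℝ≥0∞) (a : Fin d → ℝ)
    {f : (Fin d → ℝ) → ℝ} (hf : besovNorm r p ⊤ a f ≤ 1) (m : Fin d → ℕ) :
    2 ^ wsum a m * dyadicModulus r p f m ≤ 1 := by
  have h1 : besovSeminorm r p ⊤ a (posSet m) f ≤ 1 :=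
    (Finset.single_le_sum (f := fun e => besovSeminorm r p ⊤ a e f) (fun _ _ => zero_le)
      (Finset.mem_univ _)).trans hf
  rw [besovSeminorm, if_pos rfl] at h1
  have ht : (fun i => 1 / 2 ^ m i : Fin d → ℝ) ∈ cube d := by
    refine mem_cube_iff.mpr fun i => ⟨by positivity, ?_⟩
    rw [div_le_one (by positivity)]
    exact one_le_pow₀ one_le_two
  have h2 := (le_iSup₂ (f := fun t (_ : t ∈ cube d) => modulusRatio r p a (posSet m) f t)
    _ ht).trans h1
  refine le_trans (le_of_eq ?_) h2
  have h3 : ∏ i ∈ posSet m, ((1 : ℝ) / 2 ^ m i) ^ a i = 2 ^ (-wsum a m) := by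
    rw [wsum_eq_sum_posSet, ← Finset.sum_neg_distrib, Real.rpow_sum_of_pos two_pos]
    refine Finset.prod_congr rfl fun i _ => ?_
    rw [one_div, ← Real.rpow_natCast, ← Real.rpow_neg two_pos.le, ← Real.rpow_mul two_pos.le]
    congr 1
    ring
  rw [modulusRatio, h3, ofReal_two_rpow, ENNReal.div_eq_inv_mul, ENNReal.rpow_neg, inv_inv]
  rfl

open Classical in
/-- The dyadic box of the parameters `t` that belongs to the level `m`. -/
def dyadicBox {d : ℕ} (m : Fin d → ℕ) : Set (Fin d → ℝ) :=
  Set.univ.pi fun i => if 0 < m i then Set.Ico ((1 : ℝ) / 2 ^ m i) (2 / 2 ^ m i)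
    else Set.Ico 0 1

lemma measurableSet_dyadicBox {d : ℕ} (m : Fin d → ℕ) : MeasurableSet (dyadicBox m) := by
  refine MeasurableSet.univ_pi fun i => ?_
  split_ifs <;> exact measurableSet_Ico

lemma volume_dyadicBox {d : ℕ} (m : Fin d → ℕ) : volume (dyadicBox m) = 2 ^ (-len m) := by
  rw [dyadicBox, volume_pi_pi, len, ← Finset.sum_neg_distrib, two_rpow_sum]
  refine Finset.prod_congr rfl fun i _ => ?_
  split_ifs with h
  · rw [Real.volume_Ico, ← sub_div, ENNReal.rpow_neg, ENNReal.rpow_natCast,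
      show (2 : ℝ) - 1 = 1 by norm_num, one_div, ENNReal.ofReal_inv_of_pos (by positivity),
      ENNReal.ofReal_pow (by norm_num), ENNReal.ofReal_ofNat]
  · have : m i = 0 := by omega
    simp [this]

lemma two_div_two_pow_le_one {n : ℕ} (hn : 0 < n) : (2 : ℝ) / 2 ^ n ≤ 1 := by
  rw [div_le_one (by positivity)]
  calc (2 : ℝ) = 2 ^ 1 := (pow_one 2).symm
    _ ≤ 2 ^ n := pow_le_pow_right₀ one_le_two hn

lemma dyadicBox_subset_cube {d : ℕ} (m : Fin d → ℕ) : dyadicBox m ⊆ cube d := by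
  intro t ht
  refine mem_cube_iff.mpr fun i => ?_
  have := ht i (Set.mem_univ i)
  beta_reduce at this
  split_ifs at this with h
  · have h2 := two_div_two_pow_le_one h
    have h3 : (0 : ℝ) ≤ 1 / 2 ^ m i := by positivity
    exact ⟨h3.trans this.1, this.2.le.trans h2⟩
  · exact ⟨this.1, this.2.le⟩

/-- Levels with different positive directions belong to different parts of the Besov norm, so boxes
need to be disjoint only within one such class; directions of level zero all share the full
interval. -/
lemma disjoint_dyadicBox {d : ℕ} {m m' : Fin d → ℕ} (h : posSet m = posSet m') (hne : m ≠ m') :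
    Disjoint (dyadicBox m) (dyadicBox m') := by
  refine Set.disjoint_left.mpr fun t ht ht' => hne ?_
  funext i
  have hpos : 0 < m i ↔ 0 < m' i := by rw [← mem_posSet, h, mem_posSet]
  have h1 := ht i (Set.mem_univ i)
  have h2 := ht' i (Set.mem_univ i)
  beta_reduce at h1 h2
  by_cases hm : 0 < m i
  · rw [if_pos hm] at h1
    rw [if_pos (hpos.mp hm)] at h2
    have key : ∀ u v : ℕ, (1 : ℝ) / 2 ^ u < 2 / 2 ^ v → v < u + 1 := by
      intro u v huv
      rw [div_lt_div_iff₀ (by positivity) (by positivity), one_mul, ← pow_succ'] at huv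
      exact (pow_lt_pow_iff_right₀ one_lt_two).mp huv
    have h3 := key _ _ (h1.1.trans_lt h2.2)
    have h4 := key _ _ (h2.1.trans_lt h1.2)
    omega
  · omega

/-- On the box, `t i ≥ 2^{-m i}` in the positive directions, so monotonicity bounds the modulus
below by the dyadic one, while `t i < 2 · 2^{-m i}` controls the weights. The factors `1 / t i`
compensate for the volume `2^{-|m|}`, and the constant collects the factors 2. -/
lemma dyadicModulus_rpow_le_setLIntegral {d : ℕ} (r : ℕ) (p : ℝ≥0∞) {a : Fin d → ℝ}
    (ha : ∀ i, 0 ≤ a i) (f : (Fin d → ℝ) → ℝ) {θ : ℝ} (hθ : 0 < θ) (m : Fin d → ℕ) :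
    (2 ^ wsum a m * dyadicModulus r p f m) ^ θ ≤ 2 ^ (θ * ∑ i, a i + d) *
      ∫⁻ t in dyadicBox m, modulusRatio r p a (posSet m) f t ^ θ *
        ∏ i ∈ posSet m, (ENNReal.ofReal (t i))⁻¹ := by
  classical
  set ω := dyadicModulus r p f m with hω
  set s := ∑ i, a i with hs
  have hpt : ∀ t ∈ dyadicBox m, (2 ^ (wsum a m - s) * ω) ^ θ * 2 ^ (len m - d) ≤
      modulusRatio r p a (posSet m) f t ^ θ * ∏ i ∈ posSet m, (ENNReal.ofReal (t i))⁻¹ := by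
    intro t ht
    have ht' : ∀ i ∈ posSet m, 1 / 2 ^ m i ≤ t i ∧ t i < 2 / 2 ^ m i := by
      intro i hi
      have := ht i (Set.mem_univ i)
      beta_reduce at this
      rwa [if_pos (mem_posSet.mp hi)] at this
    have hrew : ∀ i, (2 : ℝ) / 2 ^ m i = 2 ^ (1 - (m i : ℝ)) := by
      intro i
      rw [Real.rpow_sub two_pos, Real.rpow_one, Real.rpow_natCast]
    refine mul_le_mul' (ENNReal.rpow_le_rpow ?_ hθ.le) ?_
    · rw [modulusRatio, ENNReal.div_eq_inv_mul]
      refine mul_le_mul' ?_ (mixedModulus_mono r p _ f fun i hi => (ht' i hi).1)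
      rw [ENNReal.le_inv_iff_le_inv, ← ENNReal.rpow_neg, ← ofReal_two_rpow]
      refine ENNReal.ofReal_le_ofReal ?_
      calc ∏ i ∈ posSet m, t i ^ a i ≤ ∏ i ∈ posSet m, (2 : ℝ) ^ ((1 - (m i : ℝ)) * a i) := by
            refine Finset.prod_le_prod (fun i hi => ?_) fun i hi => ?_
            · exact Real.rpow_nonneg (le_trans (by positivity) (ht' i hi).1) _
            · rw [Real.rpow_mul two_pos.le, ← hrew i]
              exact Real.rpow_le_rpow (le_trans (by positivity) (ht' i hi).1)
                (ht' i hi).2.le (ha i)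
        _ = 2 ^ (∑ i ∈ posSet m, (1 - (m i : ℝ)) * a i) := by
            rw [Real.rpow_sum_of_pos two_pos]
        _ ≤ 2 ^ (-(wsum a m - s)) := by
            refine Real.rpow_le_rpow_of_exponent_le one_le_two ?_
            rw [wsum_eq_sum_posSet]
            have h5 : ∑ i ∈ posSet m, a i ≤ s :=
              Finset.sum_le_sum_of_subset_of_nonneg (Finset.subset_univ _) fun i _ _ => ha i
            have h6 : ∑ i ∈ posSet m, (1 - (m i : ℝ)) * a i =
                ∑ i ∈ posSet m, a i - ∑ i ∈ posSet m, a i * m i := by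
              rw [← Finset.sum_sub_distrib]
              exact Finset.sum_congr rfl fun i _ => by ring
            rw [h6]
            linarith
    · have h1 : len m - d ≤ ∑ i ∈ posSet m, ((m i : ℝ) - 1) := by
        have h2 : len m - d = ∑ i, ((m i : ℝ) - 1) := by
          simp [len, Finset.sum_sub_distrib]
        rw [h2, ← Finset.sum_add_sum_compl (posSet m)]
        have h3 : ∑ i ∈ (posSet m)ᶜ, ((m i : ℝ) - 1) ≤ 0 := by
          refine Finset.sum_nonpos fun i hi => ?_
          rw [Finset.mem_compl, mem_posSet, Nat.pos_iff_ne_zero, not_not] at hi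
          rw [hi]
          norm_num
        linarith
      refine (two_rpow_mono h1).trans ?_
      rw [two_rpow_sum]
      refine Finset.prod_le_prod' fun i hi => ?_
      rw [ENNReal.le_inv_iff_le_inv, ← ENNReal.rpow_neg, ← ofReal_two_rpow, neg_sub, ← hrew i]
      exact ENNReal.ofReal_le_ofReal (ht' i hi).2.le
  have hint := setLIntegral_mono' (μ := volume) (measurableSet_dyadicBox m) hpt
  rw [setLIntegral_const, volume_dyadicBox] at hint
  refine le_trans (le_of_eq ?_) (mul_le_mul_right hint _)
  rw [ENNReal.mul_rpow_of_nonneg _ _ hθ.le, ENNReal.mul_rpow_of_nonneg _ _ hθ.le,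
    ← ENNReal.rpow_mul, ← ENNReal.rpow_mul]
  calc 2 ^ (wsum a m * θ) * ω ^ θ
      = (2 ^ (θ * s + d) * 2 ^ ((wsum a m - s) * θ) * 2 ^ (len m - d) * 2 ^ (-len m)) * ω ^ θ := by
        rw [← two_rpow_add, ← two_rpow_add, ← two_rpow_add]
        congr 2
        ring
    _ = _ := by ring

/-- For each set of directions, the boxes of the corresponding levels are disjoint parts of the
cube, so the sum is dominated by the integral that defines the seminorm. -/
lemma tsum_dyadicModulus_le {d : ℕ} (r : ℕ) (p : ℝ≥0∞) {a : Fin d → ℝ} (ha : ∀ i, 0 ≤ a i)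
    {f : (Fin d → ℝ) → ℝ} {θ : ℝ≥0∞} (hθ0 : θ ≠ 0) (hθ : θ ≠ ⊤)
    (hf : besovNorm r p θ a f ≤ 1) :
    ∑' m, (2 ^ wsum a m * dyadicModulus r p f m) ^ θ.toReal ≤
      (Fintype.card (Finset (Fin d)) : ℝ≥0∞) * 2 ^ (θ.toReal * ∑ i, a i + d) := by
  classical
  have hθ' : 0 < θ.toReal := ENNReal.toReal_pos hθ0 hθ
  set K : ℝ≥0∞ := 2 ^ (θ.toReal * ∑ i, a i + d) with hK
  set b : (Fin d → ℕ) → ℝ≥0∞ := fun m => (2 ^ wsum a m * dyadicModulus r p f m) ^ θ.toReal with hb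
  have he : ∀ e : Finset (Fin d), ∑' m : {m : Fin d → ℕ // posSet m = e}, b m ≤ K := by
    intro e
    have h1 : besovSeminorm r p θ a e f ≤ 1 :=
      (Finset.single_le_sum (f := fun e => besovSeminorm r p θ a e f) (fun _ _ => zero_le)
        (Finset.mem_univ _)).trans hf
    rw [besovSeminorm, if_neg hθ, rpow_one_div_le_iff hθ', ENNReal.one_rpow] at h1
    set F : (Fin d → ℝ) → ℝ≥0∞ := fun t => modulusRatio r p a e f t ^ θ.toReal *
      ∏ i ∈ e, (ENNReal.ofReal (t i))⁻¹ with hF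
    calc ∑' m : {m : Fin d → ℕ // posSet m = e}, b m
        ≤ ∑' m : {m : Fin d → ℕ // posSet m = e}, K * ∫⁻ t in dyadicBox m.1, F t := by
          refine ENNReal.tsum_le_tsum fun m => ?_
          have := dyadicModulus_rpow_le_setLIntegral r p ha f hθ' m.1
          rw [m.2] at this
          exact this
      _ = K * ∫⁻ t in ⋃ m : {m : Fin d → ℕ // posSet m = e}, dyadicBox m.1, F t := by
          rw [ENNReal.tsum_mul_left, lintegral_iUnion]
          · exact fun m => measurableSet_dyadicBox m.1
          · intro m m' hmm'
            exact disjoint_dyadicBox (m.2.trans m'.2.symm) fun h => hmm' (Subtype.ext h)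
      _ ≤ K * 1 := by
          refine mul_le_mul_right (le_trans (lintegral_mono_set ?_) h1) _
          exact Set.iUnion_subset fun m => dyadicBox_subset_cube m.1
      _ = K := mul_one K
  calc ∑' m, b m = ∑' m, ∑ e : Finset (Fin d), (if posSet m = e then b m else 0) := by
        simp
    _ = ∑ e : Finset (Fin d), ∑' m, (if posSet m = e then b m else 0) := by
        rw [Summable.tsum_finsetSum fun _ _ => ENNReal.summable]
    _ = ∑ e : Finset (Fin d), ∑' m : {m : Fin d → ℕ // posSet m = e}, b m := by
        refine Finset.sum_congr rfl fun e _ => ?_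
        refine Eq.trans ?_ (tsum_subtype {m : Fin d → ℕ | posSet m = e} b).symm
        exact tsum_congr fun m => by simp [Set.indicator_apply]
    _ ≤ ∑ _e : Finset (Fin d), K := Finset.sum_le_sum fun e _ => he e
    _ = _ := by rw [Finset.sum_const, nsmul_eq_mul, Finset.card_univ]

lemma exists_dyadicModulus_le {d : ℕ} (r : ℕ) (p : ℝ≥0∞) {a : Fin d → ℝ} (ha : ∀ i, 0 ≤ a i)
    {θ : ℝ≥0∞} (hθ0 : θ ≠ 0) :
    ∃ C : ℝ≥0∞, C ≠ ⊤ ∧ ∀ f : (Fin d → ℝ) → ℝ, besovNorm r p θ a f ≤ 1 →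
      ∀ m, 2 ^ wsum a m * dyadicModulus r p f m ≤ C := by
  by_cases hθ : θ = ⊤
  · subst hθ
    exact ⟨1, ENNReal.one_ne_top, fun f hf m => dyadicModulus_le_of_theta_top r p a hf m⟩
  · have hθ' : 0 < θ.toReal := ENNReal.toReal_pos hθ0 hθ
    refine ⟨((Fintype.card (Finset (Fin d)) : ℝ≥0∞) * 2 ^ (θ.toReal * ∑ i, a i + d)) ^
      (1 / θ.toReal), ENNReal.rpow_ne_top_of_nonneg (by positivity)
        (ENNReal.mul_ne_top (ENNReal.natCast_ne_top _) (two_rpow_ne_top _)), fun f hf m => ?_⟩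
    rw [le_rpow_one_div_iff hθ']
    exact (ENNReal.le_tsum m).trans (tsum_dyadicModulus_le r p ha hθ0 hθ hf)

/-- The embedding of `ℓ_θ` into `ℓ_ρ`: the surplus power `ρ - θ` is absorbed by the uniform bound on
the terms. -/
lemma exists_tsum_dyadicModulus_le {d : ℕ} (r : ℕ) (p : ℝ≥0∞) {a : Fin d → ℝ}
    (ha : ∀ i, 0 ≤ a i) {θ : ℝ≥0∞} (hθ0 : θ ≠ 0) {ρ : ℝ} (hθρ : θ ≤ ENNReal.ofReal ρ) :
    ∃ C : ℝ≥0∞, C ≠ ⊤ ∧ ∀ f : (Fin d → ℝ) → ℝ, besovNorm r p θ a f ≤ 1 →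
      ∑' m, (2 ^ wsum a m * dyadicModulus r p f m) ^ ρ ≤ C := by
  have hθ : θ ≠ ⊤ := ne_top_of_le_ne_top ENNReal.ofReal_ne_top hθρ
  have hθ' : 0 < θ.toReal := ENNReal.toReal_pos hθ0 hθ
  have hρ : θ.toReal ≤ ρ := by
    have hρ0 : 0 ≤ ρ := by
      by_contra h
      rw [ENNReal.ofReal_of_nonpos (by linarith)] at hθρ
      exact hθ0 (le_antisymm hθρ zero_le)
    have := ENNReal.toReal_mono ENNReal.ofReal_ne_top hθρ
    rwa [ENNReal.toReal_ofReal hρ0] at this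
  obtain ⟨C, hC, h⟩ := exists_dyadicModulus_le (θ := θ) r p ha hθ0
  refine ⟨C ^ (ρ - θ.toReal) * ((Fintype.card (Finset (Fin d)) : ℝ≥0∞) *
    2 ^ (θ.toReal * ∑ i, a i + d)), ENNReal.mul_ne_top
      (ENNReal.rpow_ne_top_of_nonneg (by linarith) hC)
      (ENNReal.mul_ne_top (ENNReal.natCast_ne_top _) (two_rpow_ne_top _)), fun f hf => ?_⟩
  refine le_trans ?_ (mul_le_mul_right (tsum_dyadicModulus_le r p ha hθ0 hθ hf) _)
  rw [← ENNReal.tsum_mul_left]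
  refine ENNReal.tsum_le_tsum fun m => ?_
  calc (2 ^ wsum a m * dyadicModulus r p f m) ^ ρ
      = (2 ^ wsum a m * dyadicModulus r p f m) ^ (ρ - θ.toReal) *
          (2 ^ wsum a m * dyadicModulus r p f m) ^ θ.toReal := by
        rw [← ENNReal.rpow_add_of_nonneg _ _ (by linarith) hθ'.le, sub_add_cancel]
    _ ≤ _ := mul_le_mul_left (ENNReal.rpow_le_rpow (h f hf m) (by linarith)) _

/-! ### The blocks of a function in the Besov ball -/

/-- The weighted `L_p`-norms of the blocks are dominated by smoothed weighted moduli. -/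
lemma exists_weighted_block_le {d : ℕ} [NeZero d] (r : ℕ) (hr : 0 < r) (κ : ℕ)
    (hκ : 6 * r ≤ 2 ^ κ) (W : ℕ) {p : ℝ≥0∞} (hp0 : p ≠ 0) {a : Fin d → ℝ}
    (ha₀ : (p⁻¹).toReal < a 0) (ha : ∀ i, a 0 ≤ a i) :
    ∃ (C : ℝ≥0∞) (γ : ℝ), C ≠ ⊤ ∧ 0 < γ ∧ ∀ f : (Fin d → ℝ) → ℝ, Continuous f → ∀ k : Fin d → ℕ,
      2 ^ wsum a k * eLpNorm (fun x => blockMajorant r κ W f k (cell k x)) p (cubeMeasure d) ≤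
        C * ⨆ m, 2 ^ (-(γ * dist₁ k m)) * (2 ^ wsum a m * dyadicModulus r p f m) := by
  -- The midpoint between `1/p` and `a 0`: the lower half of the room pays for summing the scales,
  -- the upper half, `γ`, becomes the decay of the kernel.
  set β := ((p⁻¹).toReal + a 0) / 2 with hβ
  set γ := a 0 - β with hγ
  have hγ0 : 0 < γ := by rw [hγ, hβ]; linarith
  have hβ1 : (p⁻¹).toReal < β := by rw [hβ]; linarith
  have hβ0 : 0 ≤ β := ENNReal.toReal_nonneg.trans hβ1.le
  obtain ⟨C, hC, h⟩ := exists_eLpNorm_blockMajorant_le d r hr κ hκ W hp0 hβ1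
  -- The level of a scale is `k - κ + l` with truncated subtraction, so it deviates from `k + l` by
  -- at most `κ` in each coordinate; `E` collects the resulting losses.
  set E : ℝ := κ * ∑ i, a i + γ * (d * κ) with hE
  refine ⟨C * 2 ^ E, γ, ENNReal.mul_ne_top hC (two_rpow_ne_top _), hγ0, fun f hf k => ?_⟩
  refine (mul_le_mul_right (h f hf k) _).trans ?_
  rw [mul_left_comm, mul_assoc]
  refine mul_le_mul_right ?_ _
  rw [ENNReal.mul_iSup]
  refine iSup_le fun l => ?_
  set m := scaleLevel κ k l with hm
  refine le_trans ?_ (mul_le_mul_right (le_iSup (fun m => 2 ^ (-(γ * dist₁ k m)) *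
    (2 ^ wsum a m * dyadicModulus r p f m)) m) _)
  rw [← mul_assoc, ← mul_assoc, ← mul_assoc, ← two_rpow_add, ← two_rpow_add, ← two_rpow_add]
  refine mul_le_mul_left (two_rpow_mono ?_) _
  rw [wsum, len, wsum, hE, dist₁, Finset.mul_sum, Finset.mul_sum, Finset.mul_sum,
    show γ * (d * κ) = ∑ _i : Fin d, γ * κ by simp; ring, ← Finset.sum_neg_distrib,
    ← Finset.sum_add_distrib, ← Finset.sum_add_distrib, ← Finset.sum_add_distrib,
    ← Finset.sum_add_distrib]
  refine Finset.sum_le_sum fun i _ => ?_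
  have hai : γ ≤ a i - β := by linarith [ha i]
  have hm1 : (k i : ℝ) - κ + l i ≤ m i := by
    have : k i + l i ≤ m i + κ := by rw [hm, scaleLevel]; omega
    have : (k i : ℝ) + l i ≤ m i + κ := by exact_mod_cast this
    linarith
  have hm2 : (m i : ℝ) ≤ k i + l i := by
    have : m i ≤ k i + l i := by rw [hm, scaleLevel]; omega
    exact_mod_cast this
  have hl0 : (0 : ℝ) ≤ l i := Nat.cast_nonneg _
  have hκ0 : (0 : ℝ) ≤ κ := Nat.cast_nonneg _
  have habs : |(k i : ℝ) - m i| ≤ κ + l i := by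
    rw [abs_le]
    constructor <;> linarith
  have h1 : a i * k i - a i * m i ≤ a i * (κ - l i) := by
    rw [← mul_sub]
    exact mul_le_mul_of_nonneg_left (by linarith) (by linarith)
  have h2 : γ * |(k i : ℝ) - m i| ≤ γ * (κ + l i) := mul_le_mul_of_nonneg_left habs hγ0.le
  have h3 : γ * l i ≤ (a i - β) * l i := mul_le_mul_of_nonneg_right hai hl0
  linarith

lemma exists_weighted_block_bound {d : ℕ} [NeZero d] (r : ℕ) (hr : 0 < r) (κ : ℕ)
    (hκ : 6 * r ≤ 2 ^ κ) (W : ℕ) {p θ : ℝ≥0∞} (hp0 : p ≠ 0) (hθ0 : θ ≠ 0) {a : Fin d → ℝ}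
    (ha₀ : (p⁻¹).toReal < a 0) (ha : ∀ i, a 0 ≤ a i) :
    ∃ C : ℝ≥0∞, C ≠ ⊤ ∧ ∀ f : (Fin d → ℝ) → ℝ, Continuous f → besovNorm r p θ a f ≤ 1 →
      ∀ k : Fin d → ℕ, 2 ^ wsum a k *
        eLpNorm (fun x => blockMajorant r κ W f k (cell k x)) p (cubeMeasure d) ≤ C := by
  have ha' : ∀ i, 0 ≤ a i := fun i => ENNReal.toReal_nonneg.trans (ha₀.le.trans (ha i))
  obtain ⟨C₁, γ, hC₁, hγ, h₁⟩ := exists_weighted_block_le r hr κ hκ W hp0 ha₀ ha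
  obtain ⟨C₂, hC₂, h₂⟩ := exists_dyadicModulus_le r p ha' hθ0
  refine ⟨C₁ * C₂, ENNReal.mul_ne_top hC₁ hC₂, fun f hf hfb k => (h₁ f hf k).trans ?_⟩
  refine mul_le_mul_right (iSup_le fun m => ?_) _
  have h0 : 0 ≤ dist₁ k m := Finset.sum_nonneg fun _ _ => abs_nonneg _
  calc 2 ^ (-(γ * dist₁ k m)) * (2 ^ wsum a m * dyadicModulus r p f m) ≤ 1 * C₂ := by
        refine mul_le_mul' ?_ (h₂ f hfb m)
        simpa using two_rpow_mono (x := -(γ * dist₁ k m)) (y := 0) (by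
          have := mul_nonneg hγ.le h0; linarith)
    _ = C₂ := one_mul _

/-- Bound the `ρ`-th power of the supremum by a sum and interchange the summations; the kernel has
uniformly bounded sums in `k`. This needs only `ρ > 0`. -/
lemma exists_tsum_weighted_block_le {d : ℕ} [NeZero d] (r : ℕ) (hr : 0 < r) (κ : ℕ)
    (hκ : 6 * r ≤ 2 ^ κ) (W : ℕ) {p θ : ℝ≥0∞} (hp0 : p ≠ 0) (hθ0 : θ ≠ 0) {a : Fin d → ℝ}
    (ha₀ : (p⁻¹).toReal < a 0) (ha : ∀ i, a 0 ≤ a i) {ρ : ℝ} (hρ : 0 < ρ)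
    (hθρ : θ ≤ ENNReal.ofReal ρ) :
    ∃ C : ℝ≥0∞, C ≠ ⊤ ∧ ∀ f : (Fin d → ℝ) → ℝ, Continuous f → besovNorm r p θ a f ≤ 1 →
      ∑' k : Fin d → ℕ, (2 ^ wsum a k *
        eLpNorm (fun x => blockMajorant r κ W f k (cell k x)) p (cubeMeasure d)) ^ ρ ≤ C := by
  have ha' : ∀ i, 0 ≤ a i := fun i => ENNReal.toReal_nonneg.trans (ha₀.le.trans (ha i))
  obtain ⟨C₁, γ, hC₁, hγ, h₁⟩ := exists_weighted_block_le r hr κ hκ W hp0 ha₀ ha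
  obtain ⟨C₂, hC₂, h₂⟩ := exists_tsum_dyadicModulus_le r p ha' hθ0 hθρ
  obtain ⟨C₃, hC₃, h₃⟩ := exists_bound_tsum_dist d (mul_pos hγ hρ)
  refine ⟨C₁ ^ ρ * (C₃ * C₂), ENNReal.mul_ne_top (ENNReal.rpow_ne_top_of_nonneg hρ.le hC₁)
    (ENNReal.mul_ne_top hC₃ hC₂), fun f hf hfb => ?_⟩
  set b : (Fin d → ℕ) → ℝ≥0∞ := fun m => 2 ^ wsum a m * dyadicModulus r p f m with hb
  calc _ ≤ ∑' k : Fin d → ℕ, C₁ ^ ρ * ∑' m, 2 ^ (-(γ * ρ * dist₁ k m)) * b m ^ ρ := by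
        refine ENNReal.tsum_le_tsum fun k => ?_
        refine (ENNReal.rpow_le_rpow (h₁ f hf k) hρ.le).trans ?_
        rw [ENNReal.mul_rpow_of_nonneg _ _ hρ.le]
        refine mul_le_mul_right ?_ _
        rw [← le_rpow_one_div_iff hρ]
        refine iSup_le fun m => ?_
        rw [le_rpow_one_div_iff hρ]
        refine le_trans (le_of_eq ?_) (ENNReal.le_tsum m)
        rw [ENNReal.mul_rpow_of_nonneg _ _ hρ.le, ← ENNReal.rpow_mul]
        congr 2
        ring
    _ = C₁ ^ ρ * ∑' m, (∑' k : Fin d → ℕ, 2 ^ (-(γ * ρ * dist₁ k m))) * b m ^ ρ := by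
        rw [ENNReal.tsum_mul_left, ENNReal.tsum_comm]
        simp_rw [ENNReal.tsum_mul_right]
    _ ≤ C₁ ^ ρ * ∑' m, C₃ * b m ^ ρ := by
        refine mul_le_mul_right (ENNReal.tsum_le_tsum fun m => mul_le_mul_left (h₃ m) _) _
    _ ≤ _ := by
        rw [ENNReal.tsum_mul_left]
        exact mul_le_mul_right (mul_le_mul_right (h₂ f hfb) _) _

/-! ### Convergence of the block expansion -/

/-- The functional `g ↦ Q_k g (x)`. -/
def levelFunctional (r μ : ℕ) (lam : ℤ → ℝ) (k : ℕ) (x : ℝ) : ℝ →₀ ℝ :=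
  ∑ y ∈ Finset.range (2 ^ k + 1), levelCoeff r μ lam k y x • Finsupp.single ((y : ℝ) / 2 ^ k) 1

lemma levelDiffFunctional_succ (r μ : ℕ) (lam : ℤ → ℝ) (k : ℕ) (x : ℝ) :
    levelDiffFunctional r μ lam (k + 1) x =
      levelFunctional r μ lam (k + 1) x - levelFunctional r μ lam k x := by
  rw [levelDiffFunctional, levelFunctional, levelFunctional,
    ← sum_range_even (2 ^ k) fun y => levelCoeff r μ lam k y x • Finsupp.single ((y : ℝ) / 2 ^ k) 1,
    show 2 * 2 ^ k = 2 ^ (k + 1) by ring, ← Finset.sum_sub_distrib]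
  refine Finset.sum_congr rfl fun y _ => ?_
  rw [levelDiffCoeff, sub_smul]
  congr 1
  split_ifs with hy
  · obtain ⟨z, rfl⟩ := hy
    have : (z + z) / 2 = z := by omega
    rw [this]
    congr 2
    push_cast
    rw [pow_succ]
    field_simp
    ring
  · rw [zero_smul]

lemma sum_levelDiffFunctional (r μ : ℕ) (lam : ℤ → ℝ) (K : ℕ) (x : ℝ) :
    ∑ k ∈ Finset.range (K + 1), levelDiffFunctional r μ lam k x = levelFunctional r μ lam K x := by
  induction K with
  | zero => simp [levelDiffFunctional, levelFunctional, levelDiffCoeff]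
  | succ K ih => rw [Finset.sum_range_succ, ih, levelDiffFunctional_succ]; abel

lemma exists_sum_abs_levelCoeff_le (r μ : ℕ) (lam : ℤ → ℝ) :
    ∃ B : ℝ, ∀ k, ∀ x ∈ Set.Icc (0 : ℝ) 1,
      ∑ y ∈ Finset.range (2 ^ k + 1), |levelCoeff r μ lam k y x| ≤ B := by
  obtain ⟨C, hC0, hC⟩ := exists_bound_levelCoeff r μ lam
  set W : ℕ := 3 * r + μ + 1 with hW
  refine ⟨(2 * W + 1 : ℕ) * C, fun k x hx => ?_⟩
  set c := ⌊2 ^ k * x⌋₊ with hc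
  have h2k : (0 : ℝ) < 2 ^ k := by positivity
  have hc1 : (c : ℝ) ≤ 2 ^ k * x := Nat.floor_le (mul_nonneg h2k.le hx.1)
  have hc2 : 2 ^ k * x < c + 1 := Nat.lt_floor_add_one _
  have hWr : (W : ℝ) = 3 * r + μ + 1 := by rw [hW]; push_cast; ring
  calc ∑ y ∈ Finset.range (2 ^ k + 1), |levelCoeff r μ lam k y x|
      ≤ ∑ y ∈ Finset.Icc (c - W) (c + W), |levelCoeff r μ lam k y x| := by
        rw [← Finset.sum_filter_ne_zero]
        refine Finset.sum_le_sum_of_subset_of_nonneg (fun y hy' => ?_) fun _ _ _ => abs_nonneg _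
        have hy := (Finset.mem_filter.mp hy').2
        by_contra hcon
        refine hy (abs_eq_zero.mpr (levelCoeff_eq_zero r μ lam k y ?_))
        rw [Finset.mem_Icc] at hcon
        by_cases h1 : y ≤ c + W
        · have h3 : y + W + 1 ≤ c := by omega
          have h4 : (y : ℝ) + W + 1 ≤ c := by exact_mod_cast h3
          rw [lt_abs]; right; linarith
        · have h3 : c + W + 1 ≤ y := by omega
          have h4 : (c : ℝ) + W + 1 ≤ y := by exact_mod_cast h3
          rw [lt_abs]; left; linarith
    _ ≤ (Finset.Icc (c - W) (c + W)).card • C := Finset.sum_le_card_nsmul _ _ _ fun y _ => hC k y x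
    _ ≤ (2 * W + 1 : ℕ) * C := by
        rw [nsmul_eq_mul]
        refine mul_le_mul_of_nonneg_right ?_ hC0
        have : (Finset.Icc (c - W) (c + W)).card ≤ 2 * W + 1 := by
          rw [Nat.card_Icc]
          omega
        exact_mod_cast this

/-- The block expansion converges to `f` at every point of the cube. -/
lemma tendsto_sum_mixedLevelDiff {d : ℕ} {r μ : ℕ} (hr : 0 < r) {lam : ℤ → ℝ}
    (hQ : IsQuasiInterpolation r μ lam) {f : (Fin d → ℝ) → ℝ} (hf : Continuous f)
    {x : Fin d → ℝ} (hx : x ∈ cube d) :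
    Filter.Tendsto (fun K : ℕ => ∑ k ∈ Fintype.piFinset fun _ : Fin d => Finset.range (K + 1),
      mixedLevelDiff r μ lam k f x) Filter.atTop (nhds (f x)) := by
  classical
  have hx' := mem_cube_iff.mp hx
  have h1 : ∀ K : ℕ, ∑ k ∈ Fintype.piFinset fun _ : Fin d => Finset.range (K + 1),
      mixedLevelDiff r μ lam k f x =
        tensorEval f fun i => levelFunctional r μ lam K (x i) := by
    intro K
    simp_rw [← sum_levelDiffFunctional]
    rw [MultilinearMap.map_sum_finset]
    exact Finset.sum_congr rfl fun k _ => mixedLevelDiff_eq_tensorEval r μ lam k f hx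
  simp_rw [h1, levelFunctional]
  obtain ⟨B, hB⟩ := exists_sum_abs_levelCoeff_le r μ lam
  refine tendsto_tensorEval hf x (fun K _ => Finset.range (2 ^ K + 1)) _ _ (B := B)
    (δ := fun K => (1 / 2 : ℝ) ^ K * (3 * r + μ)) (fun K i => sum_levelCoeff hr hQ K (hx' i))
    (fun K i => hB K _ (hx' i)) ?_ ?_
  · intro K i y _ hy
    have h2 : (0 : ℝ) < 2 ^ K := by positivity
    by_contra hcon
    refine hy (levelCoeff_eq_zero r μ lam K y ?_)
    push Not at hcon
    have h3 : |(y : ℝ) - 2 ^ K * x i| = 2 ^ K * |(y : ℝ) / 2 ^ K - x i| := by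
      rw [← abs_of_pos h2, ← abs_mul, abs_of_pos h2]
      congr 1
      field_simp
    rw [h3]
    calc (3 * r + μ : ℝ) = 2 ^ K * ((1 / 2 : ℝ) ^ K * (3 * r + μ)) := by
          rw [one_div_pow]
          field_simp
      _ < _ := mul_lt_mul_of_pos_left hcon h2
  · have := (tendsto_pow_atTop_nhds_zero_of_lt_one (r := (1 / 2 : ℝ)) (by norm_num)
      (by norm_num)).mul_const (3 * r + μ : ℝ)
    simpa using this

lemma aestronglyMeasurable_mixedLevelDiff {d : ℕ} {r : ℕ} (hr : 0 < r) (μ : ℕ) (lam : ℤ → ℝ)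
    (k : Fin d → ℕ) (f : (Fin d → ℝ) → ℝ) :
    AEStronglyMeasurable (mixedLevelDiff r μ lam k f) (cubeMeasure d) := by
  have h : Measurable fun x => ∑ j ∈ gridIndices k, f (gridPoint k j) * mixedCoeff r μ lam k j x :=
    Finset.measurable_fun_sum _ fun j _ => (measurable_mixedCoeff r hr μ lam k j).const_mul _
  refine h.aestronglyMeasurable.congr ?_
  filter_upwards [ae_restrict_mem (measurableSet_cube d)] with x hx
  exact (mixedLevelDiff_eq_sum r μ lam k f hx).symm

/-- The error of a sparse grid operator is controlled by the partial sums over the complement of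
the index set. -/
lemma eLpNorm_sub_sparseOp_le {d : ℕ} {r μ : ℕ} (hr : 0 < r) {lam : ℤ → ℝ}
    (hQ : IsQuasiInterpolation r μ lam) {f : (Fin d → ℝ) → ℝ} (hf : Continuous f)
    {Δ : Set (Fin d → ℕ)} (hΔ : Δ.Finite) (q : ℝ≥0∞) {E : ℝ≥0∞}
    (hE : ∀ F : Finset (Fin d → ℕ), (∀ k ∈ F, k ∉ Δ) →
      eLpNorm (fun x => ∑ k ∈ F, mixedLevelDiff r μ lam k f x) q (cubeMeasure d) ≤ E) :
    eLpNorm (fun x => f x - sparseOp r μ lam Δ f x) q (cubeMeasure d) ≤ E := by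
  classical
  set D := hΔ.toFinset with hD
  set box : ℕ → Finset (Fin d → ℕ) := fun K =>
    Fintype.piFinset fun _ : Fin d => Finset.range (K + 1) with hbox
  obtain ⟨K₀, hK₀⟩ : ∃ K₀, ∀ K ≥ K₀, D ⊆ box K := by
    refine ⟨D.sup fun k => ∑ i, k i, fun K hK k hk => ?_⟩
    rw [hbox, Fintype.mem_piFinset]
    intro i
    have h1 : k i ≤ ∑ i, k i := Finset.single_le_sum (fun _ _ => Nat.zero_le _) (Finset.mem_univ i)
    have h2 : ∑ i, k i ≤ D.sup fun k => ∑ i, k i :=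
      Finset.le_sup (f := fun k : Fin d → ℕ => ∑ i, k i) hk
    rw [Finset.mem_range]
    omega
  have hsp : ∀ x, sparseOp r μ lam Δ f x = ∑ k ∈ D, mixedLevelDiff r μ lam k f x := by
    intro x
    rw [sparseOp, finsum_mem_eq_finite_toFinset_sum _ hΔ]
  have hlim : ∀ᵐ x ∂(cubeMeasure d), Filter.Tendsto
      (fun K => ∑ k ∈ box (K + K₀) \ D, mixedLevelDiff r μ lam k f x) Filter.atTop
      (nhds (f x - sparseOp r μ lam Δ f x)) := by
    filter_upwards [ae_restrict_mem (measurableSet_cube d)] with x hx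
    have h1 := ((tendsto_sum_mixedLevelDiff hr hQ hf hx).sub_const
      (sparseOp r μ lam Δ f x)).comp (Filter.tendsto_add_atTop_nat K₀)
    refine h1.congr fun K => ?_
    rw [Function.comp_apply, hsp, ← Finset.sum_sdiff (hK₀ (K + K₀) (by omega)),
      add_sub_cancel_right]
  -- Fatou's lemma, which holds for quasi-norms as well: no convergence in `L_q` is assumed, only
  -- pointwise convergence and a uniform bound for the partial sums over boxes minus `Δ`.
  refine Lp.eLpNorm_le_of_ae_tendsto (Filter.Eventually.of_forall fun K => hE _ fun k hk => ?_)
    (fun K => Finset.aestronglyMeasurable_fun_sum _ fun k _ =>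
      aestronglyMeasurable_mixedLevelDiff hr μ lam k f) hlim
  · rw [Finset.mem_sdiff, hD, Set.Finite.mem_toFinset] at hk
    exact hk.2

/-! ### Norms of sums of cell functions -/

/-- The exponent for which the `L_q`-quasi-norm satisfies the triangle inequality. -/
def triangleExponent (q : ℝ≥0∞) : ℝ := (min q 1).toReal

lemma triangleExponent_pos {q : ℝ≥0∞} (hq : q ≠ 0) : 0 < triangleExponent q :=
  ENNReal.toReal_pos (by simp [hq]) (ne_top_of_le_ne_top ENNReal.one_ne_top (min_le_right _ _))

lemma ofReal_triangleExponent (q : ℝ≥0∞) : ENNReal.ofReal (triangleExponent q) = min q 1 :=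
  ENNReal.ofReal_toReal (ne_top_of_le_ne_top ENNReal.one_ne_top (min_le_right _ _))

lemma eLpNorm_sum_rpow_le {α ι : Type*} [MeasurableSpace α] {μ : Measure α} (F : Finset ι)
    (g : ι → α → ℝ≥0∞) (hg : ∀ k ∈ F, Measurable (g k)) {q : ℝ≥0∞} (hq : q ≠ 0) :
    eLpNorm (fun x => ∑ k ∈ F, g k x) q μ ^ triangleExponent q ≤
      ∑ k ∈ F, eLpNorm (g k) q μ ^ triangleExponent q := by
  rcases le_total 1 q with h1 | h1
  · rw [triangleExponent, min_eq_right h1, ENNReal.toReal_one]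
    simp_rw [ENNReal.rpow_one]
    have := eLpNorm_sum_le (fun k hk => (hg k hk).aestronglyMeasurable) h1 (s := F) (μ := μ)
    rwa [show (∑ k ∈ F, g k) = fun x => ∑ k ∈ F, g k x by funext x; simp] at this
  · have hqt : q ≠ ⊤ := ne_top_of_le_ne_top ENNReal.one_ne_top h1
    have hq' : 0 < q.toReal := ENNReal.toReal_pos hq hqt
    have hq1 : q.toReal ≤ 1 := by
      simpa using ENNReal.toReal_mono ENNReal.one_ne_top h1
    rw [triangleExponent, min_eq_left h1]
    simp_rw [eLpNorm_eq_lintegral_rpow_enorm_toReal hq hqt, ← ENNReal.rpow_mul,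
      one_div_mul_cancel hq'.ne', ENNReal.rpow_one, enorm_eq_self]
    rw [← lintegral_finsetSum' _ fun k hk => ((hg k hk).pow_const _).aemeasurable]
    exact lintegral_mono fun x => rpow_sum_le_sum_rpow F _ hq' hq1

/-- Sums of cell functions in `L_q` for `p < q < ∞`. -/
lemma exists_eLpNorm_sum_cell_rpow_le (d : ℕ) {p q : ℝ≥0∞} (hp : p ≠ 0) (hpq : p < q)
    (hq : q ≠ ⊤) :
    ∃ C : ℝ≥0∞, C ≠ ⊤ ∧ ∀ (F : Finset (Fin d → ℕ)) (h : (Fin d → ℕ) → (Fin d → ℕ) → ℝ≥0∞),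
      eLpNorm (fun x => ∑ k ∈ F, h k (cell k x)) q (cubeMeasure d) ^ q.toReal ≤
        C * ∑ k ∈ F, (2 ^ (gap p q * len k) *
          eLpNorm (fun x => h k (cell k x)) p (cubeMeasure d)) ^ q.toReal := by
  have hpt : p ≠ ⊤ := ne_top_of_lt hpq
  have hp' : 0 < p.toReal := ENNReal.toReal_pos hp hpt
  have hpq' : p.toReal < q.toReal := ENNReal.toReal_strict_mono hq hpq
  have hq' : 0 < q.toReal := hp'.trans hpq'
  have hq0 : q ≠ 0 := (bot_le.trans_lt hpq).ne'
  obtain ⟨C, hC, h⟩ := exists_lintegral_sum_cell_le d hp' hpq'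
  refine ⟨C, hC, fun F g => ?_⟩
  rw [eLpNorm_eq_lintegral_rpow_enorm_toReal hq0 hq, ← ENNReal.rpow_mul,
    one_div_mul_cancel hq'.ne', ENNReal.rpow_one]
  simp_rw [enorm_eq_self]
  refine (h F g).trans (le_of_eq ?_)
  congr 1
  refine Finset.sum_congr rfl fun k _ => ?_
  have hgap : gap p q = 1 / p.toReal - 1 / q.toReal := by
    rw [gap, toReal_inv_eq, toReal_inv_eq, max_eq_right]
    have := one_div_le_one_div_of_le hp' hpq'.le
    linarith
  rw [eLpNorm_eq_lintegral_rpow_enorm_toReal hp hpt, ENNReal.mul_rpow_of_nonneg _ _ hq'.le,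
    ← ENNReal.rpow_mul, ← ENNReal.rpow_mul, hgap]
  simp_rw [enorm_eq_self]
  congr 2
  · field_simp
  · field_simp

/-! ### The upper bound -/

lemma indexWeight_zero {d : ℕ} [NeZero d] (p θ q : ℝ≥0∞) (a : Fin d → ℝ) (ε : ℝ) :
    indexWeight p θ q a ε 0 = a 0 - gap p q := by
  rw [indexWeight, gridSmoothness, if_pos (Or.inr rfl)]

lemma indexWeight_zero_pos {d : ℕ} [NeZero d] {p : ℝ≥0∞} (θ q : ℝ≥0∞) {a : Fin d → ℝ} (ε : ℝ)
    (ha₀ : (p⁻¹).toReal < a 0) : 0 < indexWeight p θ q a ε 0 := by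
  rw [indexWeight_zero]
  linarith [gap_le p q]

lemma indexWeight_zero_lt {d : ℕ} [NeZero d] (p θ q : ℝ≥0∞) {a : Fin d → ℝ} {ε : ℝ}
    (hε : 0 < ε) (hε' : ∀ i, i ≠ 0 → ε < a i - a 0) (i : Fin d) (hi : i ≠ 0) :
    indexWeight p θ q a ε 0 < indexWeight p θ q a ε i := by
  rw [indexWeight_zero, indexWeight, gridSmoothness]
  have := hε' i hi
  split_ifs <;> linarith

lemma sum_indexWeight_of_inClassA {d : ℕ} [NeZero d] {p θ q : ℝ≥0∞} (hA : InClassA p θ q)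
    (a : Fin d → ℝ) (ε : ℝ) (k : Fin d → ℕ) :
    ∑ i, indexWeight p θ q a ε i * k i = wsum a k - gap p q * len k := by
  rw [wsum, len, Finset.mul_sum, ← Finset.sum_sub_distrib]
  refine Finset.sum_congr rfl fun i _ => ?_
  rw [indexWeight, gridSmoothness, if_pos (Or.inl hA)]
  ring

lemma sum_indexWeight_of_not_inClassA {d : ℕ} [NeZero d] {p θ q : ℝ≥0∞}
    (hA : ¬ InClassA p θ q) (a : Fin d → ℝ) (ε : ℝ) (k : Fin d → ℕ) :
    ∑ i, indexWeight p θ q a ε i * k i + ε * ∑ i ∈ Finset.univ.erase 0, (k i : ℝ) =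
      wsum a k - gap p q * len k := by
  have h1 : ∑ i, indexWeight p θ q a ε i * k i = indexWeight p θ q a ε 0 * k 0 +
      ∑ i ∈ Finset.univ.erase 0, indexWeight p θ q a ε i * k i :=
    (Finset.add_sum_erase _ _ (Finset.mem_univ 0)).symm
  have h2 : wsum a k = a 0 * k 0 + ∑ i ∈ Finset.univ.erase 0, a i * k i :=
    (Finset.add_sum_erase _ _ (Finset.mem_univ 0)).symm
  have h3 : len k = k 0 + ∑ i ∈ Finset.univ.erase 0, (k i : ℝ) :=
    (Finset.add_sum_erase _ _ (Finset.mem_univ 0)).symm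
  have h4 : ∑ i ∈ Finset.univ.erase 0, indexWeight p θ q a ε i * k i =
      ∑ i ∈ Finset.univ.erase 0, a i * k i - ε * ∑ i ∈ Finset.univ.erase 0, (k i : ℝ) -
        gap p q * ∑ i ∈ Finset.univ.erase 0, (k i : ℝ) := by
    rw [Finset.mul_sum, Finset.mul_sum, ← Finset.sum_sub_distrib, ← Finset.sum_sub_distrib]
    refine Finset.sum_congr rfl fun i hi => ?_
    have hi0 : i ≠ 0 := Finset.ne_of_mem_erase hi
    rw [indexWeight, gridSmoothness, if_neg (by simp [hA, hi0])]
    ring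
  rw [h1, h2, h3, h4, indexWeight_zero]
  ring

lemma le_mul_two_rpow_neg_of_rpow_le {N C : ℝ≥0∞} {τ ξ : ℝ} (hτ : 0 < τ)
    (h : N ^ τ ≤ C * 2 ^ (-(τ * ξ))) : N ≤ C ^ (1 / τ) * 2 ^ (-ξ) := by
  rw [← le_rpow_one_div_iff hτ] at h
  refine h.trans (le_of_eq ?_)
  rw [ENNReal.mul_rpow_of_nonneg _ _ (by positivity), ← ENNReal.rpow_mul]
  congr 2
  field_simp

/-- Write `2^{gap |k|} N k` as `2^{-((a,k) - gap |k|)}` times the weighted norm `2^{(a,k)} N k`. In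
the class `A` the exponent is exactly the quantity that exceeds `ξ`, and the weighted norms are
summable: with exponent `q` if `p < q < ∞`, and with `min(q,1)` in the remaining cases. Outside `A`
the weighted norms are merely bounded, but the exponent exceeds the index weight by `ε` times the
other coordinates, so a geometric tail remains. -/
lemma exists_eLpNorm_sum_block_le {d : ℕ} [NeZero d] (r : ℕ) (hr : 0 < r) (κ : ℕ)
    (hκ : 6 * r ≤ 2 ^ κ) (W : ℕ) {p θ q : ℝ≥0∞} (hp0 : p ≠ 0) (hθ0 : θ ≠ 0) (hq0 : q ≠ 0)
    {a : Fin d → ℝ} (ha₀ : (p⁻¹).toReal < a 0) (ha : ∀ i, a 0 ≤ a i) {ε : ℝ} (hε : 0 < ε) :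
    ∃ C : ℝ≥0∞, C ≠ ⊤ ∧ ∀ f : (Fin d → ℝ) → ℝ, Continuous f → besovNorm r p θ a f ≤ 1 →
      ∀ (ξ : ℝ) (F : Finset (Fin d → ℕ)), (∀ k ∈ F, ξ < ∑ i, indexWeight p θ q a ε i * k i) →
        eLpNorm (fun x => ∑ k ∈ F, blockMajorant r κ W f k (cell k x)) q (cubeMeasure d) ≤
          C * 2 ^ (-ξ) := by
  classical
  set N : ((Fin d → ℝ) → ℝ) → (Fin d → ℕ) → ℝ≥0∞ := fun f k =>
    eLpNorm (fun x => blockMajorant r κ W f k (cell k x)) p (cubeMeasure d) with hN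
  have hresc : ∀ f k, 2 ^ (gap p q * len k) * N f k =
      2 ^ (-(wsum a k - gap p q * len k)) * (2 ^ wsum a k * N f k) := by
    intro f k
    rw [← mul_assoc, ← two_rpow_add]
    congr 2
    ring
  -- The generic route: the quasi-triangle inequality followed by the change of metric, block by
  -- block.
  have htri : ∀ f (F : Finset (Fin d → ℕ)),
      eLpNorm (fun x => ∑ k ∈ F, blockMajorant r κ W f k (cell k x)) q (cubeMeasure d) ^
        triangleExponent q ≤ ∑ k ∈ F, (2 ^ (gap p q * len k) * N f k) ^ triangleExponent q := by
    intro f F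
    refine (eLpNorm_sum_rpow_le F (fun k x => blockMajorant r κ W f k (cell k x))
      (fun k _ => measurable_comp_cell k _) hq0).trans (Finset.sum_le_sum fun k _ => ?_)
    exact ENNReal.rpow_le_rpow (eLpNorm_comp_cell_le k _ hp0 hq0) (triangleExponent_pos hq0).le
  have hτ := triangleExponent_pos hq0
  set τ := triangleExponent q with hτdef
  by_cases hA : InClassA p θ q
  · have hterm : ∀ f k (ξ : ℝ), ξ < ∑ i, indexWeight p θ q a ε i * k i → ∀ ρ : ℝ, 0 < ρ →
        (2 ^ (gap p q * len k) * N f k) ^ ρ ≤ 2 ^ (-(ρ * ξ)) * (2 ^ wsum a k * N f k) ^ ρ := by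
      intro f k ξ hk ρ hρ
      rw [hresc, ENNReal.mul_rpow_of_nonneg _ _ hρ.le, ← ENNReal.rpow_mul]
      refine mul_le_mul_left (two_rpow_mono ?_) _
      rw [sum_indexWeight_of_inClassA hA] at hk
      nlinarith
    have hfin : ∀ f (ξ : ℝ) (F : Finset (Fin d → ℕ)),
        (∀ k ∈ F, ξ < ∑ i, indexWeight p θ q a ε i * k i) → ∀ ρ : ℝ, 0 < ρ →
        ∑ k ∈ F, (2 ^ (gap p q * len k) * N f k) ^ ρ ≤
          (∑' k, (2 ^ wsum a k * N f k) ^ ρ) * 2 ^ (-(ρ * ξ)) := by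
      intro f ξ F hF ρ hρ
      refine (Finset.sum_le_sum fun k hk => hterm f k ξ (hF k hk) ρ hρ).trans ?_
      rw [← Finset.mul_sum, mul_comm]
      exact mul_le_mul_left (ENNReal.sum_le_tsum F) _
    by_cases hA2 : p < q ∧ q ≠ ⊤ ∧ θ ≤ q
    · obtain ⟨hpq, hqt, hθq⟩ := hA2
      have hq' : 0 < q.toReal := ENNReal.toReal_pos hq0 hqt
      obtain ⟨C₁, hC₁, h₁⟩ := exists_tsum_weighted_block_le r hr κ hκ W hp0 hθ0 ha₀ ha hq'
        (by rwa [ENNReal.ofReal_toReal hqt])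
      obtain ⟨C₂, hC₂, h₂⟩ := exists_eLpNorm_sum_cell_rpow_le d hp0 hpq hqt
      refine ⟨(C₂ * C₁) ^ (1 / q.toReal), ENNReal.rpow_ne_top_of_nonneg (by positivity)
        (ENNReal.mul_ne_top hC₂ hC₁), fun f hf hfb ξ F hF => ?_⟩
      refine le_mul_two_rpow_neg_of_rpow_le hq' ((h₂ F (blockMajorant r κ W f)).trans ?_)
      rw [mul_assoc]
      refine mul_le_mul_right ((hfin f ξ F hF _ hq').trans ?_) _
      exact mul_le_mul_left (h₁ f hf hfb) _
    · have hθτ : θ ≤ ENNReal.ofReal τ := by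
        rw [hτdef, ofReal_triangleExponent]
        rcases hA with ⟨_, h⟩ | h | ⟨_, h, h'⟩
        · exact h
        · exact absurd h hA2
        · rw [h, min_eq_right le_top]; exact h'
      obtain ⟨C₁, hC₁, h₁⟩ := exists_tsum_weighted_block_le r hr κ hκ W hp0 hθ0 ha₀ ha hτ hθτ
      refine ⟨C₁ ^ (1 / τ), ENNReal.rpow_ne_top_of_nonneg (by positivity) hC₁,
        fun f hf hfb ξ F hF => ?_⟩
      refine le_mul_two_rpow_neg_of_rpow_le hτ ((htri f F).trans ((hfin f ξ F hF _ hτ).trans ?_))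
      exact mul_le_mul_left (h₁ f hf hfb) _
  · obtain ⟨C₁, hC₁, h₁⟩ := exists_weighted_block_bound r hr κ hκ W hp0 hθ0 ha₀ ha
    obtain ⟨C₂, hC₂, h₂⟩ := exists_bound_tsum_tail (indexWeight p θ q a ε)
      (indexWeight_zero_pos θ q ε ha₀) hτ hε
    refine ⟨(C₁ ^ τ * C₂) ^ (1 / τ), ENNReal.rpow_ne_top_of_nonneg (by positivity)
      (ENNReal.mul_ne_top (ENNReal.rpow_ne_top_of_nonneg hτ.le hC₁) hC₂),
      fun f hf hfb ξ F hF => ?_⟩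
    refine le_mul_two_rpow_neg_of_rpow_le hτ ((htri f F).trans ?_)
    rw [mul_assoc]
    refine le_trans ?_ (mul_le_mul_right (h₂ ξ) _)
    rw [← ENNReal.tsum_mul_left]
    refine le_trans (Finset.sum_le_sum fun k hk => ?_) (ENNReal.sum_le_tsum F)
    rw [Set.indicator_of_mem (show k ∈ {k : Fin d → ℕ | ξ < ∑ i, indexWeight p θ q a ε i * k i}
      from hF k hk), hresc, ENNReal.mul_rpow_of_nonneg _ _ hτ.le, ← ENNReal.rpow_mul,
      sum_indexWeight_of_not_inClassA hA, mul_comm]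
    refine mul_le_mul' (ENNReal.rpow_le_rpow (h₁ f hf hfb k) hτ.le) (le_of_eq ?_)
    congr 1
    ring

/-! ### Reduction to functions continuous on the whole space -/

/-- The projection onto the cube. -/
def clamp {d : ℕ} (x : Fin d → ℝ) : Fin d → ℝ := fun i => max 0 (min 1 (x i))

lemma continuous_clamp {d : ℕ} : Continuous (clamp (d := d)) := by
  unfold clamp
  fun_prop

lemma clamp_mem_cube {d : ℕ} (x : Fin d → ℝ) : clamp x ∈ cube d :=
  mem_cube_iff.mpr fun _ => ⟨le_max_left _ _, max_le zero_le_one (min_le_left _ _)⟩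

lemma clamp_eq_self {d : ℕ} {x : Fin d → ℝ} (hx : x ∈ cube d) : clamp x = x := by
  funext i
  obtain ⟨h0, h1⟩ := mem_cube_iff.mp hx i
  rw [clamp, min_eq_right h1, max_eq_right h0]

/-- Every node `x i + j h i` with `j ≤ r` lies between `x i` and `x i + r h i`, for either sign of
`h i`. So on its domain the difference sees the cube only. -/
lemma mixedDiff_congr_of_eqOn_cube {d r : ℕ} {e : Finset (Fin d)} {h : Fin d → ℝ}
    {f g : (Fin d → ℝ) → ℝ} (hfg : Set.EqOn f g (cube d)) {x : Fin d → ℝ}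
    (hx : x ∈ diffDomain r e h) : mixedDiff r e h f x = mixedDiff r e h g x := by
  have key : ∀ f : (Fin d → ℝ) → ℝ, mixedDiff r e h f x =
      ∑ j ∈ Fintype.piFinset fun _ : Fin d => Finset.range (r + 1),
        (∏ i, if i ∈ e then (-1 : ℝ) ^ (r - j i) * r.choose (j i) else if j i = 0 then 1 else 0) *
          f fun i => if i ∈ e then x i + j i * h i else x i := by
    intro f
    rw [mixedDiff_eq_tensorEval, ← tensorEval_sum_single f (fun _ => Finset.range (r + 1))
      (fun i j => if i ∈ e then (-1 : ℝ) ^ (r - j) * r.choose j else if j = 0 then 1 else 0)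
      (fun i j => if i ∈ e then x i + j * h i else x i)]
    congr 1
    funext i
    split_ifs
    · rfl
    · simp [ite_smul]
  rw [key, key]
  refine Finset.sum_congr rfl fun j hj => ?_
  congr 1
  refine hfg (mem_cube_iff.mpr fun i => ?_)
  obtain ⟨h1, h2⟩ := mem_cube_iff.mp hx.1 i
  split_ifs with hi
  · obtain ⟨h3, h4⟩ := hx.2 i hi
    have hjr : j i ≤ r := by
      have := Finset.mem_range.mp (Fintype.mem_piFinset.mp hj i)
      omega
    have hjr' : (j i : ℝ) ≤ r := by exact_mod_cast hjr
    have hj0 : (0 : ℝ) ≤ j i := Nat.cast_nonneg _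
    rcases le_total 0 (h i) with hh | hh
    · exact ⟨by positivity, by nlinarith⟩
    · exact ⟨by nlinarith, by nlinarith⟩
  · exact ⟨h1, h2⟩

lemma measurableSet_diffDomain {d : ℕ} (r : ℕ) (e : Finset (Fin d)) (h : Fin d → ℝ) :
    MeasurableSet (diffDomain r e h) := by
  have : diffDomain r e h = cube d ∩ ⋂ i ∈ e, (fun x : Fin d → ℝ => x i + r * h i) ⁻¹' Set.Icc 0 1 := by
    ext x
    simp [diffDomain]
  rw [this]
  refine (measurableSet_cube d).inter (Finset.measurableSet_biInter _ fun i _ => ?_)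
  exact ((measurable_pi_apply i).add_const _) measurableSet_Icc

lemma besovNorm_congr_of_eqOn_cube {d : ℕ} (r : ℕ) (p θ : ℝ≥0∞) (a : Fin d → ℝ)
    {f g : (Fin d → ℝ) → ℝ} (hfg : Set.EqOn f g (cube d)) :
    besovNorm r p θ a f = besovNorm r p θ a g := by
  have h1 : ∀ e t, mixedModulus r p e f t = mixedModulus r p e g t := by
    intro e t
    unfold mixedModulus
    refine iSup_congr fun h => iSup_congr fun _ => eLpNorm_congr_ae ?_
    filter_upwards [ae_restrict_mem (measurableSet_diffDomain r e h)] with x hx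
    exact mixedDiff_congr_of_eqOn_cube hfg hx
  simp only [besovNorm, besovSeminorm, modulusRatio, h1]

lemma sparseOp_congr_of_eqOn_cube {d : ℕ} (r μ : ℕ) (lam : ℤ → ℝ) (Δ : Set (Fin d → ℕ))
    {f g : (Fin d → ℝ) → ℝ} (hfg : Set.EqOn f g (cube d)) {x : Fin d → ℝ} (hx : x ∈ cube d) :
    sparseOp r μ lam Δ f x = sparseOp r μ lam Δ g x := by
  unfold sparseOp
  refine finsum_congr fun k => finsum_congr fun _ => ?_
  rw [mixedLevelDiff_eq_sum r μ lam k f hx, mixedLevelDiff_eq_sum r μ lam k g hx]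
  exact Finset.sum_congr rfl fun j hj => by rw [hfg (gridPoint_mem_cube hj)]

/-- The error bound for the sparse grid operators over the Besov ball. -/
theorem exists_worstError_sparseOp_le {d : ℕ} [NeZero d] {r : ℕ} (hr : 0 < r) {p θ q : ℝ≥0∞}
    (hp0 : p ≠ 0) (hθ0 : θ ≠ 0) (hq0 : q ≠ 0) {a : Fin d → ℝ} (ha₀ : (p⁻¹).toReal < a 0)
    (ha : ∀ i, a 0 ≤ a i) {μ : ℕ} {lam : ℤ → ℝ} (hQ : IsQuasiInterpolation r μ lam) {ε : ℝ}
    (hε : 0 < ε) (hε' : ∀ i, i ≠ 0 → ε < a i - a 0) :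
    ∃ C : ℝ≥0∞, C ≠ ⊤ ∧ ∀ ξ : ℝ, worstError (besovBall r p θ a) q
      (sparseOp r μ lam (sparseIndexSet p θ q a ε ξ)) ≤ C * 2 ^ (-ξ) := by
  obtain ⟨κ, hκ⟩ : ∃ κ, 6 * r ≤ 2 ^ κ := ⟨6 * r, Nat.lt_two_pow_self.le⟩
  obtain ⟨C₁, W, hC₁, h₁⟩ := exists_enorm_mixedLevelDiff_le d hr hQ hκ
  obtain ⟨C₂, hC₂, h₂⟩ := exists_eLpNorm_sum_block_le r hr κ hκ W hp0 hθ0 hq0 ha₀ ha hε (q := q)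
  refine ⟨C₁ * C₂, ENNReal.mul_ne_top hC₁ hC₂, fun ξ => ?_⟩
  rw [sparseIndexSet_eq]
  set Δ := {k : Fin d → ℕ | ∑ i, indexWeight p θ q a ε i * k i ≤ ξ} with hΔ
  have hΔf : Δ.Finite := finite_index (indexWeight_zero_pos θ q ε ha₀)
    (indexWeight_zero_lt p θ q hε hε') ξ
  refine iSup₂_le fun f hf => ?_
  -- Members of the class are continuous only on the cube, whereas the preceding estimates assume
  -- global continuity. Composing with the projection changes neither the Besov norm nor the
  -- operator there.
  set g : (Fin d → ℝ) → ℝ := fun x => f (clamp x) with hg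
  have hgc : Continuous g := hf.1.comp_continuous continuous_clamp clamp_mem_cube
  have hfg : Set.EqOn f g (cube d) := fun x hx => by rw [hg]; simp only; rw [clamp_eq_self hx]
  have hgb : besovNorm r p θ a g ≤ 1 := by
    rw [← besovNorm_congr_of_eqOn_cube r p θ a hfg]
    exact hf.2
  have hcongr : eLpNorm (fun x => f x - sparseOp r μ lam Δ f x) q (cubeMeasure d) =
      eLpNorm (fun x => g x - sparseOp r μ lam Δ g x) q (cubeMeasure d) := by
    refine eLpNorm_congr_ae ?_
    filter_upwards [ae_restrict_mem (measurableSet_cube d)] with x hx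
    rw [hfg hx, sparseOp_congr_of_eqOn_cube r μ lam Δ hfg hx]
  rw [hcongr]
  refine eLpNorm_sub_sparseOp_le hr hQ hgc hΔf q fun F hF => ?_
  calc eLpNorm (fun x => ∑ k ∈ F, mixedLevelDiff r μ lam k g x) q (cubeMeasure d)
      ≤ eLpNorm (fun x => C₁ * ∑ k ∈ F, blockMajorant r κ W g k (cell k x)) q
          (cubeMeasure d) := by
        refine eLpNorm_mono_enorm_ae ?_
        filter_upwards [ae_restrict_mem (measurableSet_cube d)] with x hx
        rw [enorm_eq_self, Finset.mul_sum]
        exact (enorm_sum_le _ _).trans (Finset.sum_le_sum fun k _ => h₁ g k x hx)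
    _ ≤ C₁ * eLpNorm (fun x => ∑ k ∈ F, blockMajorant r κ W g k (cell k x)) q
          (cubeMeasure d) := by
        lift C₁ to NNReal using hC₁
        refine eLpNorm_le_nnreal_smul_eLpNorm_of_ae_le_mul' ?_ q
        exact Filter.Eventually.of_forall fun x => by simp only [enorm_eq_self]; exact le_rfl
    _ ≤ C₁ * C₂ * 2 ^ (-ξ) := by
        rw [mul_assoc]
        refine mul_le_mul_right (h₂ g hgc hgb ξ F fun k hk => ?_) _
        exact not_le.mp (hF k hk)

/-! ### Differences of smooth functions -/

lemma fwdDiff_iter_real (r : ℕ) (s : ℝ) (ψ : ℝ → ℝ) (v : ℝ) :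
    (fwdDiff s)^[r] ψ v =
      ∑ k ∈ Finset.range (r + 1), ((-1 : ℝ) ^ (r - k) * r.choose k) * ψ (v + k * s) := by
  rw [fwdDiff_iter_eq_sum_shift]
  refine Finset.sum_congr rfl fun k _ => ?_
  simp

lemma sum_abs_fwdDiff_coeff (r : ℕ) :
    ∑ k ∈ Finset.range (r + 1), |(-1 : ℝ) ^ (r - k) * r.choose k| = 2 ^ r := by
  simp_rw [abs_mul, abs_pow, abs_neg, abs_one, one_pow, one_mul, Nat.abs_cast]
  exact_mod_cast Nat.sum_range_choose r

/-- Differences commute with differentiation, so the mean value inequality trades one difference for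
one derivative and a factor `|s|`. Compact support bounds the last derivative. -/
lemma exists_abs_fwdDiff_iter_le (r : ℕ) : ∀ ψ : ℝ → ℝ, ContDiff ℝ (⊤ : ℕ∞) ψ →
    HasCompactSupport ψ → ∃ K : ℝ, ∀ s v, |(fwdDiff s)^[r] ψ v| ≤ K * |s| ^ r := by
  induction r with
  | zero =>
    intro ψ hψ hc
    obtain ⟨K, hK⟩ := hψ.continuous.bounded_above_of_compact_support hc
    exact ⟨K, fun s v => by simpa using hK v⟩
  | succ r ih =>
    intro ψ hψ hc
    have hψ' : ContDiff ℝ (⊤ : ℕ∞) (deriv ψ) :=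
      ((contDiff_infty_iff_deriv).mp hψ).2
    have hdiff : Differentiable ℝ ψ := ((contDiff_infty_iff_deriv).mp hψ).1
    obtain ⟨K, hK⟩ := ih (deriv ψ) hψ' hc.deriv
    refine ⟨K, fun s v => ?_⟩
    have hder : ∀ x, HasDerivAt ((fwdDiff s)^[r] ψ) ((fwdDiff s)^[r] (deriv ψ) x) x := by
      intro x
      have e : (fwdDiff s)^[r] ψ = fun v => ∑ k ∈ Finset.range (r + 1),
          ((-1 : ℝ) ^ (r - k) * r.choose k) * ψ (v + k * s) := by
        funext v
        exact fwdDiff_iter_real r s ψ v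
      rw [e, fwdDiff_iter_real]
      refine HasDerivAt.fun_sum fun k _ => HasDerivAt.const_mul _ ?_
      exact (hdiff (x + k * s)).hasDerivAt.comp_add_const x (k * s)
    rw [Function.iterate_succ_apply', fwdDiff]
    have h := Convex.norm_image_sub_le_of_norm_hasDerivWithin_le (s := Set.univ) (x := v)
      (y := v + s) (fun x _ => (hder x).hasDerivWithinAt) (fun x _ => hK s x) convex_univ
      (Set.mem_univ _) (Set.mem_univ _)
    rw [add_sub_cancel_left, Real.norm_eq_abs, Real.norm_eq_abs] at h
    rw [pow_succ, ← mul_assoc]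
    exact h

/-! ### Sums of shifted bumps -/

/-- A smooth bump with support `(0,1)` that equals one on `[1/4,3/4]`. -/
def bump : ContDiffBump (1 / 2 : ℝ) where
  rIn := 1 / 4
  rOut := 1 / 2
  rIn_pos := by norm_num
  rIn_lt_rOut := by norm_num

lemma bump_ne_zero_iff (v : ℝ) : bump v ≠ 0 ↔ 0 < v ∧ v < 1 := by
  have : v ∈ Function.support bump ↔ v ∈ Metric.ball (1 / 2 : ℝ) (1 / 2) := by
    rw [bump.support_eq]; rfl
  rw [Function.mem_support, Metric.mem_ball, Real.dist_eq, abs_lt] at this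
  rw [this]
  constructor <;> rintro ⟨h1, h2⟩ <;> constructor <;> linarith

lemma bump_eq_one {v : ℝ} (h1 : 1 / 4 ≤ v) (h2 : v ≤ 3 / 4) : bump v = 1 := by
  refine bump.one_of_mem_closedBall ?_
  rw [Metric.mem_closedBall, Real.dist_eq, abs_le]
  change -(1 / 4 : ℝ) ≤ _ ∧ _ ≤ (1 / 4 : ℝ)
  constructor <;> linarith

/-- The sum of the bumps in the cells `[i/N,(i+1)/N]`, `i ∈ S`. -/
def bumpSum (N : ℕ) (S : Finset ℕ) (x : ℝ) : ℝ := ∑ i ∈ S, bump (N * x - i)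

lemma continuous_bumpSum (N : ℕ) (S : Finset ℕ) : Continuous (bumpSum N S) := by
  unfold bumpSum
  refine continuous_finsetSum _ fun i _ => ?_
  exact bump.continuous.comp (by fun_prop)

lemma bumpSum_eq_of_mem {N : ℕ} {S : Finset ℕ} {x : ℝ} {i : ℕ} (hi : i ∈ S)
    (h1 : (i : ℝ) ≤ N * x) (h2 : N * x ≤ i + 1) : bumpSum N S x = bump (N * x - i) := by
  refine Finset.sum_eq_single_of_mem i hi fun j _ hj => ?_
  by_contra h
  obtain ⟨h3, h4⟩ := (bump_ne_zero_iff _).mp h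
  have h5 : (j : ℝ) < i + 1 := by linarith
  have h6 : (i : ℝ) < j + 1 := by linarith
  have h7 : j < i + 1 := by exact_mod_cast h5
  have h8 : i < j + 1 := by exact_mod_cast h6
  omega

lemma exists_of_bumpSum_ne_zero {N : ℕ} {S : Finset ℕ} {x : ℝ} (h : bumpSum N S x ≠ 0) :
    ∃ i ∈ S, (i : ℝ) < N * x ∧ N * x < i + 1 := by
  obtain ⟨i, hi, hne⟩ := Finset.exists_ne_zero_of_sum_ne_zero h
  obtain ⟨h1, h2⟩ := (bump_ne_zero_iff _).mp hne
  exact ⟨i, hi, by linarith, by linarith⟩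

lemma abs_bumpSum_le (N : ℕ) (S : Finset ℕ) (x : ℝ) : |bumpSum N S x| ≤ 1 := by
  by_cases h : bumpSum N S x = 0
  · rw [h, abs_zero]; exact zero_le_one
  · obtain ⟨i, hi, h1, h2⟩ := exists_of_bumpSum_ne_zero h
    rw [bumpSum_eq_of_mem hi h1.le h2.le, abs_of_nonneg bump.nonneg]
    exact bump.le_one

lemma card_le_of_forall_lt {T : Finset ℕ} {y : ℝ} {L : ℕ}
    (h : ∀ i ∈ T, y < i ∧ (i : ℝ) < y + L) : T.card ≤ L + 1 := by
  rcases T.eq_empty_or_nonempty with rfl | hT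
  · simp
  · set m := T.min' hT
    have hm := h m (T.min'_mem hT)
    have hsub : T ⊆ Finset.Icc m (m + L) := by
      intro i hi
      have h1 := T.min'_le i hi
      have h2 : (i : ℝ) < m + L := by linarith [(h i hi).2, hm.1]
      have h3 : i < m + L := by exact_mod_cast h2
      exact Finset.mem_Icc.mpr ⟨h1, h3.le⟩
    refine (Finset.card_le_card hsub).trans ?_
    rw [Nat.card_Icc]
    omega

/-- For `N |h| ≤ 1` at most `2r + 2` bumps are seen from a given point, and each contributes by
smoothness. For longer steps the trivial bound `2 ^ r` suffices. Thus `K` depends neither on `N` nor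
on the choice of cells. -/
lemma exists_abs_fwdDiff_bumpSum_le (r : ℕ) :
    ∃ K : ℝ, 0 < K ∧ ∀ (N : ℕ) (S : Finset ℕ) (h x : ℝ),
      |(fwdDiff h)^[r] (bumpSum N S) x| ≤ K * min 1 ((N * |h|) ^ r) := by
  obtain ⟨K, hK⟩ := exists_abs_fwdDiff_iter_le r bump bump.contDiff bump.hasCompactSupport
  have hK0 : 0 ≤ K := by
    have := (abs_nonneg _).trans (hK 1 0)
    simpa using this
  refine ⟨2 ^ r + (2 * r + 2) * K, by positivity, fun N S h x => ?_⟩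
  have hr0 : (0 : ℝ) ≤ r := Nat.cast_nonneg r
  have hN0 : (0 : ℝ) ≤ N * |h| := by positivity
  have hK2 : 0 ≤ (2 * r + 2) * K := by positivity
  rcases le_total (N * |h|) 1 with hh | hh
  · rw [min_eq_right (pow_le_one₀ hN0 hh)]
    have e1 : (fwdDiff h)^[r] (bumpSum N S) x =
        ∑ i ∈ S, (fwdDiff (N * h))^[r] bump (N * x - i) := by
      simp_rw [fwdDiff_iter_real, bumpSum, Finset.mul_sum]
      rw [Finset.sum_comm]
      refine Finset.sum_congr rfl fun i _ => Finset.sum_congr rfl fun k _ => ?_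
      congr 2
      ring
    rw [e1]
    set T := S.filter fun i : ℕ => (fwdDiff (N * h))^[r] bump (N * x - i) ≠ 0 with hT
    have hcard : T.card ≤ (2 * r + 1) + 1 := by
      refine card_le_of_forall_lt (y := N * x - r - 1) fun i hi => ?_
      have hne := (Finset.mem_filter.mp hi).2
      rw [fwdDiff_iter_real] at hne
      obtain ⟨k, hk, hne⟩ := Finset.exists_ne_zero_of_sum_ne_zero hne
      obtain ⟨h1, h2⟩ := (bump_ne_zero_iff _).mp (right_ne_zero_of_mul hne)
      have hkr : (k : ℝ) ≤ r := by
        exact_mod_cast Nat.lt_succ_iff.mp (Finset.mem_range.mp hk)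
      have hk0 : (0 : ℝ) ≤ k := Nat.cast_nonneg k
      have habs : |(k : ℝ) * (N * h)| ≤ r := by
        rw [abs_mul, abs_mul, Nat.abs_cast, Nat.abs_cast]
        calc (k : ℝ) * (N * |h|) ≤ r * 1 := mul_le_mul hkr hh hN0 hr0
          _ = r := mul_one _
      obtain ⟨h3, h4⟩ := abs_le.mp habs
      push_cast
      constructor <;> linarith
    rw [← Finset.sum_filter_ne_zero, ← hT]
    calc |∑ i ∈ T, (fwdDiff (N * h))^[r] bump (N * x - i)|
        ≤ ∑ i ∈ T, |(fwdDiff (N * h))^[r] bump (N * x - i)| := Finset.abs_sum_le_sum_abs _ _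
      _ ≤ T.card • (K * |N * h| ^ r) := Finset.sum_le_card_nsmul _ _ _ fun i _ => hK _ _
      _ = T.card * (K * (N * |h|) ^ r) := by rw [nsmul_eq_mul, abs_mul, Nat.abs_cast]
      _ ≤ (2 * r + 2) * (K * (N * |h|) ^ r) := by
          refine mul_le_mul_of_nonneg_right ?_ (by positivity)
          exact_mod_cast hcard
      _ ≤ _ := by
          rw [← mul_assoc]
          refine mul_le_mul_of_nonneg_right ?_ (by positivity)
          have : (0 : ℝ) < 2 ^ r := by positivity
          linarith
  · rw [min_eq_left (one_le_pow₀ hh), mul_one, fwdDiff_iter_real]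
    calc _ ≤ ∑ k ∈ Finset.range (r + 1), |(-1 : ℝ) ^ (r - k) * r.choose k| := by
          refine (Finset.abs_sum_le_sum_abs _ _).trans (Finset.sum_le_sum fun k _ => ?_)
          rw [abs_mul]
          exact mul_le_of_le_one_right (abs_nonneg _) (abs_bumpSum_le N S _)
      _ = 2 ^ r := sum_abs_fwdDiff_coeff r
      _ ≤ _ := by linarith

/-- The points at which a difference of the bump sum can be nonzero. -/
def diffSupport (r N : ℕ) (S : Finset ℕ) (h : ℝ) : Set ℝ :=
  ⋃ k ∈ Finset.range (r + 1), ⋃ i ∈ S, Set.Ioo ((i : ℝ) / N - k * h) (((i : ℝ) + 1) / N - k * h)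

lemma measurableSet_diffSupport (r N : ℕ) (S : Finset ℕ) (h : ℝ) :
    MeasurableSet (diffSupport r N S h) :=
  Finset.measurableSet_biUnion _ fun _ _ => Finset.measurableSet_biUnion _ fun _ _ =>
    measurableSet_Ioo

lemma mem_diffSupport {r N : ℕ} (hN : 0 < N) {S : Finset ℕ} {h x : ℝ}
    (hx : (fwdDiff h)^[r] (bumpSum N S) x ≠ 0) : x ∈ diffSupport r N S h := by
  rw [fwdDiff_iter_real] at hx
  obtain ⟨k, hk, hne⟩ := Finset.exists_ne_zero_of_sum_ne_zero hx
  obtain ⟨i, hi, h1, h2⟩ := exists_of_bumpSum_ne_zero (right_ne_zero_of_mul hne)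
  have hN' : (0 : ℝ) < N := by exact_mod_cast hN
  refine Set.mem_biUnion hk (Set.mem_biUnion hi ⟨?_, ?_⟩)
  · rw [sub_lt_iff_lt_add, div_lt_iff₀ hN', mul_comm]
    exact h1
  · rw [lt_sub_iff_add_lt, lt_div_iff₀ hN', mul_comm]
    exact h2

/-- The measure is kept in terms of `S.card / N` so that the resulting norm bound is sharp for a
single bump as well as for many. -/
lemma volume_diffSupport_le {r N : ℕ} (S : Finset ℕ) (h : ℝ) :
    volume (diffSupport r N S h) ≤ ENNReal.ofReal ((r + 1) * (S.card / N)) := by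
  have h1 : ∀ k : ℕ, volume (⋃ i ∈ S, Set.Ioo ((i : ℝ) / N - k * h) (((i : ℝ) + 1) / N - k * h)) ≤
      S.card * ENNReal.ofReal (1 / N) := by
    intro k
    refine (measure_biUnion_finset_le _ _).trans (le_of_eq ?_)
    have : ∀ i ∈ S, volume (Set.Ioo ((i : ℝ) / N - k * h) (((i : ℝ) + 1) / N - k * h)) =
        ENNReal.ofReal (1 / N) := by
      intro i _
      rw [Real.volume_Ioo]
      congr 1
      ring
    rw [Finset.sum_congr rfl this, Finset.sum_const, nsmul_eq_mul]
  refine (measure_biUnion_finset_le _ _).trans ?_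
  refine (Finset.sum_le_card_nsmul _ _ _ fun k _ => h1 k).trans (le_of_eq ?_)
  rw [Finset.card_range, nsmul_eq_mul, ← ENNReal.ofReal_natCast, ← ENNReal.ofReal_natCast,
    ← ENNReal.ofReal_mul (by positivity), ← ENNReal.ofReal_mul (by positivity)]
  congr 1
  push_cast
  ring

/-- The set on which the bump sum equals one. -/
def plateau (N : ℕ) (S : Finset ℕ) : Set ℝ :=
  ⋃ i ∈ S, Set.Icc (((i : ℝ) + 1 / 4) / N) (((i : ℝ) + 3 / 4) / N)

lemma measurableSet_plateau (N : ℕ) (S : Finset ℕ) : MeasurableSet (plateau N S) :=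
  Finset.measurableSet_biUnion _ fun _ _ => measurableSet_Icc

lemma bumpSum_eq_one {N : ℕ} (hN : 0 < N) {S : Finset ℕ} {x : ℝ} (hx : x ∈ plateau N S) :
    bumpSum N S x = 1 := by
  obtain ⟨i, hi, h1, h2⟩ := Set.mem_iUnion₂.mp hx
  have hN' : (0 : ℝ) < N := by exact_mod_cast hN
  rw [div_le_iff₀ hN', mul_comm] at h1
  rw [le_div_iff₀ hN', mul_comm] at h2
  rw [bumpSum_eq_of_mem hi (by linarith) (by linarith)]
  exact bump_eq_one (by linarith) (by linarith)

lemma plateau_subset {N : ℕ} (hN : 0 < N) {S : Finset ℕ} (hS : ∀ i ∈ S, i < N) :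
    plateau N S ⊆ Set.Icc 0 1 := by
  intro x hx
  obtain ⟨i, hi, h1, h2⟩ := Set.mem_iUnion₂.mp hx
  have hN' : (0 : ℝ) < N := by exact_mod_cast hN
  have hi' : (i : ℝ) + 1 ≤ N := by exact_mod_cast hS i hi
  refine ⟨le_trans (by positivity) h1, h2.trans ?_⟩
  rw [div_le_one hN']
  linarith

lemma volume_plateau {N : ℕ} (hN : 0 < N) (S : Finset ℕ) :
    volume (plateau N S) = ENNReal.ofReal (S.card / N / 2) := by
  have hN' : (0 : ℝ) < N := by exact_mod_cast hN
  rw [plateau, measure_biUnion_finset]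
  · have : ∀ i ∈ S, volume (Set.Icc (((i : ℝ) + 1 / 4) / N) (((i : ℝ) + 3 / 4) / N)) =
        ENNReal.ofReal (1 / N / 2) := by
      intro i _
      rw [Real.volume_Icc]
      congr 1
      ring
    rw [Finset.sum_congr rfl this, Finset.sum_const, nsmul_eq_mul, ← ENNReal.ofReal_natCast,
      ← ENNReal.ofReal_mul (by positivity)]
    congr 1
    ring
  · intro i _ j _ hij
    refine Set.disjoint_left.mpr fun x hx hy => hij ?_
    have h1 := hx.1.trans hy.2
    have h2 := hy.1.trans hx.2
    rw [div_le_div_iff_of_pos_right hN'] at h1 h2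
    have h3 : (i : ℝ) < j + 1 := by linarith
    have h4 : (j : ℝ) < i + 1 := by linarith
    have h5 : i < j + 1 := by exact_mod_cast h3
    have h6 : j < i + 1 := by exact_mod_cast h4
    omega
  · exact fun _ _ => measurableSet_Icc

/-! ### Functions of the first variable -/

lemma tensorEval_prod {d : ℕ} (g : Fin d → ℝ → ℝ) (L : Fin d → ℝ →₀ ℝ) :
    tensorEval (fun y => ∏ i, g i (y i)) L = ∏ i, Finsupp.linearCombination ℝ (g i) (L i) := by
  change ∑ y ∈ Fintype.piFinset (fun i => (L i).support), (∏ i, L i (y i)) * ∏ i, g i (y i) = _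
  simp_rw [← Finset.prod_mul_distrib]
  exact (Finset.prod_univ_sum (fun i => (L i).support) (fun i z => L i z * g i z)).symm

/-- A function of the first variable is constant in the others, and differences of positive order
kill constants. Only `e = ∅` and `e = {0}` contribute to its Besov norm. -/
lemma mixedDiff_ridge {d : ℕ} [NeZero d] {r : ℕ} (hr : 0 < r) (e : Finset (Fin d))
    (h : Fin d → ℝ) (g : ℝ → ℝ) (x : Fin d → ℝ) :
    mixedDiff r e h (fun y => g (y 0)) x =
      (if 0 ∈ e then (fwdDiff (h 0))^[r] g (x 0) else g (x 0)) *
        ∏ i ∈ Finset.univ.erase 0, if i ∈ e then 0 else 1 := by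
  have h1 : (fun y : Fin d → ℝ => g (y 0)) =
      fun y => ∏ i, (if i = 0 then g else fun _ => 1) (y i) := by
    funext y
    rw [← Finset.mul_prod_erase _ _ (Finset.mem_univ 0), if_pos rfl,
      Finset.prod_eq_one fun i hi => by rw [if_neg (Finset.ne_of_mem_erase hi)], mul_one]
  rw [mixedDiff_eq_tensorEval, h1, tensorEval_prod,
    ← Finset.mul_prod_erase _ _ (Finset.mem_univ 0)]
  congr 1
  · rw [if_pos rfl]
    split_ifs
    · exact linearCombination_diffFunctional r _ _ g
    · simp
  · refine Finset.prod_congr rfl fun i hi => ?_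
    rw [if_neg (Finset.ne_of_mem_erase hi)]
    split_ifs
    · rw [linearCombination_diffFunctional]
      obtain ⟨r', rfl⟩ : ∃ r', r = r' + 1 := ⟨r - 1, by omega⟩
      rw [Function.iterate_succ_apply, fwdDiff_const]
      have : ∀ n : ℕ, (fwdDiff (h i))^[n] (fun _ => (0 : ℝ)) = fun _ => 0 := by
        intro n
        induction n with
        | zero => rfl
        | succ n ih => rw [Function.iterate_succ_apply, fwdDiff_const]; exact ih
      rw [this]
    · simp

lemma measurePreserving_eval_cube (d : ℕ) [NeZero d] :
    MeasurePreserving (fun x : Fin d → ℝ => x 0) (cubeMeasure d)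
      (volume.restrict (Set.Icc 0 1)) := by
  have hprob : IsProbabilityMeasure (volume.restrict (Set.Icc (0 : ℝ) 1)) :=
    ⟨by rw [Measure.restrict_apply_univ, Real.volume_Icc]; simp⟩
  have h := measurePreserving_eval (fun _ : Fin d => volume.restrict (Set.Icc (0 : ℝ) 1)) 0
  rw [← Measure.restrict_pi_pi, ← volume_pi, Set.pi_univ_Icc] at h
  exact h

lemma eLpNorm_ridge_le {d : ℕ} [NeZero d] {u : ℝ → ℝ} {B : Set ℝ} (hB : MeasurableSet B) {c : ℝ}
    (hu : ∀ x, |u x| ≤ c) (hu0 : ∀ x, u x ≠ 0 → x ∈ B) (p : ℝ≥0∞) :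
    eLpNorm (fun x : Fin d → ℝ => u (x 0)) p (cubeMeasure d) ≤
      ENNReal.ofReal c * volume B ^ (1 / p.toReal) := by
  have hc0 : 0 ≤ c := (abs_nonneg _).trans (hu 0)
  have hev := measurePreserving_eval_cube d
  calc eLpNorm (fun x : Fin d → ℝ => u (x 0)) p (cubeMeasure d)
      ≤ eLpNorm (((fun x : Fin d → ℝ => x 0) ⁻¹' B).indicator fun _ => c) p (cubeMeasure d) := by
        refine eLpNorm_mono fun x => ?_
        by_cases hx : u (x 0) = 0
        · rw [hx, norm_zero]; exact norm_nonneg _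
        · rw [Set.indicator_of_mem (show x ∈ (fun x : Fin d → ℝ => x 0) ⁻¹' B from hu0 _ hx), Real.norm_eq_abs, Real.norm_eq_abs,
            abs_of_nonneg hc0]
          exact hu _
    _ ≤ ‖c‖ₑ * cubeMeasure d ((fun x : Fin d → ℝ => x 0) ⁻¹' B) ^ (1 / p.toReal) :=
        eLpNorm_indicator_const_le _ _
    _ ≤ ENNReal.ofReal c * volume B ^ (1 / p.toReal) := by
        rw [Real.enorm_eq_ofReal hc0]
        refine mul_le_mul_right (ENNReal.rpow_le_rpow ?_ (by positivity)) _
        rw [hev.measure_preimage hB.nullMeasurableSet]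
        exact Measure.restrict_apply_le _ _

/-! ### The Besov norm of a sum of bumps -/

lemma mixedDiff_singleton_bumpSum {d : ℕ} [NeZero d] {r : ℕ} (hr : 0 < r) (N : ℕ)
    (S : Finset ℕ) (A : ℝ) (h : Fin d → ℝ) :
    mixedDiff r {0} h (fun x : Fin d → ℝ => A * bumpSum N S (x 0)) =
      fun x => A * (fwdDiff (h 0))^[r] (bumpSum N S) (x 0) := by
  funext x
  rw [mixedDiff_ridge hr {0} h (fun z => A * bumpSum N S z), if_pos (Finset.mem_singleton_self 0),
    Finset.prod_eq_one fun i hi => by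
      rw [if_neg (by rw [Finset.mem_singleton]; exact Finset.ne_of_mem_erase hi)], mul_one]
  simp only [fwdDiff_iter_real, Finset.mul_sum]
  exact Finset.sum_congr rfl fun k _ => by ring

lemma eLpNorm_mixedDiff_bumpSum_le {d : ℕ} [NeZero d] {r : ℕ} (hr : 0 < r) {K : ℝ} (hK0 : 0 ≤ K)
    {N : ℕ} (hN : 0 < N) {S : Finset ℕ} {h : Fin d → ℝ}
    (hK : ∀ x, |(fwdDiff (h 0))^[r] (bumpSum N S) x| ≤ K * min 1 ((N * |h 0|) ^ r))
    (p : ℝ≥0∞) (A : ℝ) :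
    eLpNorm (mixedDiff r {0} h fun x => A * bumpSum N S (x 0)) p
        (volume.restrict (diffDomain r {0} h)) ≤
        ENNReal.ofReal (K * min 1 ((N * |h 0|) ^ r) * (|A| * (S.card / N : ℝ) ^ (1 / p.toReal)) *
          (r + 1 : ℝ) ^ (1 / p.toReal)) := by
  have hmin : (0 : ℝ) ≤ min 1 ((N * |h 0|) ^ r) := le_min zero_le_one (by positivity)
  rw [mixedDiff_singleton_bumpSum hr]
  refine (eLpNorm_mono_measure _ (Measure.restrict_mono (fun x hx => hx.1) le_rfl)).trans ?_
  refine (eLpNorm_ridge_le (u := fun z => A * (fwdDiff (h 0))^[r] (bumpSum N S) z)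
    (measurableSet_diffSupport r N S (h 0))
    (c := |A| * (K * min 1 ((N * |h 0|) ^ r))) (fun x => ?_) (fun x hx => ?_) p).trans ?_
  · rw [abs_mul]
    exact mul_le_mul_of_nonneg_left (hK x) (abs_nonneg _)
  · exact mem_diffSupport hN (right_ne_zero_of_mul hx)
  · refine (mul_le_mul_right (ENNReal.rpow_le_rpow (volume_diffSupport_le S (h 0))
      (by positivity)) _).trans (le_of_eq ?_)
    rw [ENNReal.ofReal_rpow_of_nonneg (by positivity) (by positivity),
      ← ENNReal.ofReal_mul (by positivity), Real.mul_rpow (by positivity) (by positivity)]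
    congr 1
    ring

lemma eLpNorm_bumpSum_le {d : ℕ} [NeZero d] (p : ℝ≥0∞) {N : ℕ} (hN : 0 < N) (S : Finset ℕ)
    (A : ℝ) : eLpNorm (fun x : Fin d → ℝ => A * bumpSum N S (x 0)) p (cubeMeasure d) ≤
      ENNReal.ofReal (|A| * (S.card / N) ^ (1 / p.toReal)) := by
  refine (eLpNorm_ridge_le (u := fun z => A * bumpSum N S z) (measurableSet_diffSupport 0 N S 0)
    (c := |A|) (fun x => ?_) (fun x hx => ?_) p).trans ?_
  · rw [abs_mul]
    exact mul_le_of_le_one_right (abs_nonneg _) (abs_bumpSum_le N S x)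
  · exact mem_diffSupport hN (h := 0) (right_ne_zero_of_mul hx)
  · refine (mul_le_mul_right (ENNReal.rpow_le_rpow (volume_diffSupport_le S 0)
      (by positivity)) _).trans (le_of_eq ?_)
    rw [ENNReal.ofReal_rpow_of_nonneg (by positivity) (by positivity),
      ← ENNReal.ofReal_mul (by positivity)]
    congr 2
    simp

lemma lintegral_Ioc_rpow {σ b : ℝ} (hσ : 0 < σ) (hb : 0 < b) :
    ∫⁻ t in Set.Ioc 0 b, ENNReal.ofReal (t ^ (σ - 1)) = ENNReal.ofReal (b ^ σ / σ) := by
  have hint : IntegrableOn (fun t : ℝ => t ^ (σ - 1)) (Set.Ioc 0 b) :=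
    (intervalIntegral.intervalIntegrable_rpow' (a := 0) (b := b) (by linarith)).1
  rw [← ofReal_integral_eq_lintegral_ofReal hint]
  · rw [← intervalIntegral.integral_of_le hb.le, integral_rpow (Or.inl (by linarith)),
      sub_add_cancel, Real.zero_rpow hσ.ne', sub_zero]
  · filter_upwards [ae_restrict_mem measurableSet_Ioc] with t ht
    exact Real.rpow_nonneg ht.1.le _

lemma lintegral_Ioi_rpow {σ b : ℝ} (hσ : 0 < σ) (hb : 0 < b) :
    ∫⁻ t in Set.Ioi b, ENNReal.ofReal (t ^ (-σ - 1)) = ENNReal.ofReal (b ^ (-σ) / σ) := by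
  have hint := integrableOn_Ioi_rpow_of_lt (a := -σ - 1) (by linarith) hb
  rw [← ofReal_integral_eq_lintegral_ofReal hint]
  · rw [integral_Ioi_rpow_of_lt (by linarith) hb, sub_add_cancel, neg_div_neg_eq]
  · filter_upwards [ae_restrict_mem measurableSet_Ioi] with t ht
    exact Real.rpow_nonneg (hb.trans ht).le _

/-- The scale-invariant weight that dominates the integrand of the Besov seminorm of a bump sum. -/
def scaleWeight (σ₁ σ₂ : ℝ) (N : ℕ) (t : ℝ) : ℝ≥0∞ :=
  (Set.Ioc 0 (1 / N : ℝ)).indicator (fun t => ENNReal.ofReal ((N : ℝ) ^ σ₁ * t ^ (σ₁ - 1))) t +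
    (Set.Ioi (1 / N : ℝ)).indicator (fun t => ENNReal.ofReal ((N : ℝ) ^ (-σ₂) * t ^ (-σ₂ - 1))) t

lemma measurable_scaleWeight (σ₁ σ₂ : ℝ) (N : ℕ) : Measurable (scaleWeight σ₁ σ₂ N) := by
  unfold scaleWeight
  refine Measurable.add (Measurable.indicator ?_ measurableSet_Ioc)
    (Measurable.indicator ?_ measurableSet_Ioi)
  · exact ((measurable_id.pow_const _).const_mul _).ennreal_ofReal
  · exact ((measurable_id.pow_const _).const_mul _).ennreal_ofReal

lemma lintegral_scaleWeight {σ₁ σ₂ : ℝ} (h₁ : 0 < σ₁) (h₂ : 0 < σ₂) {N : ℕ} (hN : 0 < N) :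
    ∫⁻ t, scaleWeight σ₁ σ₂ N t = ENNReal.ofReal (1 / σ₁ + 1 / σ₂) := by
  have hN' : (0 : ℝ) < N := by exact_mod_cast hN
  have hb : (0 : ℝ) < 1 / N := by positivity
  unfold scaleWeight
  rw [lintegral_add_left, lintegral_indicator measurableSet_Ioc,
    lintegral_indicator measurableSet_Ioi]
  · have hm : ∀ w : ℝ, Measurable fun t : ℝ => ENNReal.ofReal (t ^ w) :=
      fun w => (measurable_id.pow_const w).ennreal_ofReal
    simp_rw [ENNReal.ofReal_mul (Real.rpow_nonneg hN'.le _)]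
    rw [lintegral_const_mul _ (hm _), lintegral_const_mul _ (hm _),
      lintegral_Ioc_rpow h₁ hb, lintegral_Ioi_rpow h₂ hb,
      ← ENNReal.ofReal_mul (by positivity), ← ENNReal.ofReal_mul (by positivity),
      ← ENNReal.ofReal_add (by positivity) (by positivity)]
    congr 1
    have e1 : (N : ℝ) ^ σ₁ * (1 / N) ^ σ₁ = 1 := by
      rw [← Real.mul_rpow hN'.le hb.le, mul_one_div_cancel hN'.ne', Real.one_rpow]
    have e2 : (N : ℝ) ^ (-σ₂) * (1 / N) ^ (-σ₂) = 1 := by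
      rw [← Real.mul_rpow hN'.le hb.le, mul_one_div_cancel hN'.ne', Real.one_rpow]
    rw [mul_div_assoc', mul_div_assoc', e1, e2]
  · exact Measurable.indicator ((measurable_id.pow_const _).const_mul _).ennreal_ofReal
      measurableSet_Ioc

/-- In the variable `u = N t` the bound on the integrand is independent of `N`, and its integral
against `du/u` converges at zero because `α < ϱ` and at infinity because `0 < α`. The summand 1 in
the constant covers `θ = ∞`. -/
lemma besovSeminorm_le_of_modulusRatio_le {d : ℕ} [NeZero d] {r : ℕ} {p θ : ℝ≥0∞} (hθ : θ ≠ 0)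
    {a : Fin d → ℝ} {α ϱ : ℝ} (hα : 0 < α) (hϱ : α < ϱ) {f : (Fin d → ℝ) → ℝ} {D : ℝ}
    (hD : 0 ≤ D) {N : ℕ} (hN : 0 < N)
    (h0 : ∀ t ∈ cube d, t 0 = 0 → modulusRatio r p a {0} f t = 0)
    (h1 : ∀ t ∈ cube d, 0 < t 0 → modulusRatio r p a {0} f t ≤
      ENNReal.ofReal (D * min ((N * t 0) ^ (ϱ - α)) ((N * t 0) ^ (-α)))) :
    besovSeminorm r p θ a {0} f ≤ ENNReal.ofReal D *
      (1 + ENNReal.ofReal (1 / ((ϱ - α) * θ.toReal) + 1 / (α * θ.toReal)) ^ (1 / θ.toReal)) := by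
  have hN' : (0 : ℝ) < N := by exact_mod_cast hN
  have hϱα : 0 < ϱ - α := by linarith
  unfold besovSeminorm
  split_ifs with hθt
  · refine iSup₂_le fun t ht => ?_
    have hle : ENNReal.ofReal D ≤ ENNReal.ofReal D *
        (1 + ENNReal.ofReal (1 / ((ϱ - α) * θ.toReal) + 1 / (α * θ.toReal)) ^ (1 / θ.toReal)) := by
      refine le_trans (le_of_eq (mul_one _).symm) (mul_le_mul_right ?_ _)
      exact le_self_add
    rcases (mem_cube_iff.mp ht 0).1.eq_or_lt with ht0 | ht0
    · rw [h0 t ht ht0.symm]; exact zero_le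
    · refine (h1 t ht ht0).trans (le_trans (ENNReal.ofReal_le_ofReal ?_) hle)
      refine mul_le_of_le_one_right hD ?_
      have hu : 0 < N * t 0 := mul_pos hN' ht0
      rcases le_total (N * t 0) 1 with h | h
      · exact (min_le_left _ _).trans (Real.rpow_le_one hu.le h hϱα.le)
      · exact (min_le_right _ _).trans (Real.rpow_le_one_of_one_le_of_nonpos h (by linarith))
  · have hθ' : 0 < θ.toReal := ENNReal.toReal_pos hθ hθt
    set ϑ := θ.toReal with hϑ
    have hpt : ∀ t ∈ cube d, modulusRatio r p a {0} f t ^ ϑ *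
        ∏ i ∈ ({0} : Finset (Fin d)), (ENNReal.ofReal (t i))⁻¹ ≤
        ENNReal.ofReal D ^ ϑ * scaleWeight ((ϱ - α) * ϑ) (α * ϑ) N (t 0) := by
      intro t ht
      rw [Finset.prod_singleton]
      rcases (mem_cube_iff.mp ht 0).1.eq_or_lt with ht0 | ht0
      · rw [h0 t ht ht0.symm, ENNReal.zero_rpow_of_pos hθ', zero_mul]
        exact zero_le
      · have hu : 0 < N * t 0 := mul_pos hN' ht0
        -- Either entry of the minimum may be used: `w = ϱ - α` up to the scale `1 / N`, and `w =
        -- -α` beyond it.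
        have key : ∀ w : ℝ, min ((N * t 0) ^ (ϱ - α)) ((N * t 0) ^ (-α)) ≤ (N * t 0) ^ w →
            modulusRatio r p a {0} f t ^ ϑ * (ENNReal.ofReal (t 0))⁻¹ ≤
              ENNReal.ofReal D ^ ϑ *
                ENNReal.ofReal ((N : ℝ) ^ (w * ϑ) * t 0 ^ (w * ϑ - 1)) := by
          intro w hw
          have h2 : modulusRatio r p a {0} f t ≤
              ENNReal.ofReal D * ENNReal.ofReal ((N * t 0) ^ w) := by
            refine (h1 t ht ht0).trans ?_
            rw [← ENNReal.ofReal_mul hD]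
            exact ENNReal.ofReal_le_ofReal (mul_le_mul_of_nonneg_left hw hD)
          refine (mul_le_mul_left (ENNReal.rpow_le_rpow h2 hθ'.le) _).trans (le_of_eq ?_)
          have e : ENNReal.ofReal ((N * t 0) ^ w) ^ ϑ = ENNReal.ofReal (((N * t 0) ^ w) ^ ϑ) :=
            ENNReal.ofReal_rpow_of_nonneg (by positivity) hθ'.le
          rw [ENNReal.mul_rpow_of_nonneg _ _ hθ'.le, mul_assoc, e,
            ← ENNReal.ofReal_inv_of_pos ht0, ← ENNReal.ofReal_mul (by positivity),
            ← Real.rpow_mul hu.le, Real.mul_rpow hN'.le ht0.le, Real.rpow_sub_one ht0.ne']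
          congr 2
          ring
        unfold scaleWeight
        rcases le_or_gt (t 0) (1 / N) with h | h
        · rw [Set.indicator_of_mem (show t 0 ∈ Set.Ioc (0 : ℝ) (1 / N) from ⟨ht0, h⟩)]
          refine (key (ϱ - α) (min_le_left _ _)).trans (mul_le_mul_right le_self_add _)
        · rw [Set.indicator_of_mem (show t 0 ∈ Set.Ioi (1 / N : ℝ) from h)]
          refine (key (-α) (min_le_right _ _)).trans (mul_le_mul_right ?_ _)
          rw [neg_mul]
          exact le_add_self
    rw [rpow_one_div_le_iff hθ']
    calc ∫⁻ t in cube d, modulusRatio r p a {0} f t ^ ϑ *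
          ∏ i ∈ ({0} : Finset (Fin d)), (ENNReal.ofReal (t i))⁻¹
        ≤ ∫⁻ t in cube d, ENNReal.ofReal D ^ ϑ *
            scaleWeight ((ϱ - α) * ϑ) (α * ϑ) N (t 0) :=
          setLIntegral_mono' (measurableSet_cube d) hpt
      _ = ENNReal.ofReal D ^ ϑ * ∫⁻ u in Set.Icc 0 1,
            scaleWeight ((ϱ - α) * ϑ) (α * ϑ) N u := by
          have hw := measurable_scaleWeight ((ϱ - α) * ϑ) (α * ϑ) N
          rw [← (measurePreserving_eval_cube d).lintegral_comp hw, lintegral_const_mul]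
          · rfl
          · exact hw.comp (measurable_pi_apply 0)
      _ ≤ ENNReal.ofReal D ^ ϑ * ENNReal.ofReal (1 / ((ϱ - α) * ϑ) + 1 / (α * ϑ)) := by
          rw [← lintegral_scaleWeight (mul_pos hϱα hθ') (mul_pos hα hθ') hN]
          exact mul_le_mul_right (setLIntegral_le_lintegral _ _) _
      _ ≤ _ := by
          rw [ENNReal.mul_rpow_of_nonneg _ _ hθ'.le]
          refine mul_le_mul_right ?_ _
          calc ENNReal.ofReal (1 / ((ϱ - α) * ϑ) + 1 / (α * ϑ))
              = (ENNReal.ofReal (1 / ((ϱ - α) * ϑ) + 1 / (α * ϑ)) ^ (1 / ϑ)) ^ ϑ := by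
                rw [← ENNReal.rpow_mul, one_div_mul_cancel hθ'.ne', ENNReal.rpow_one]
            _ ≤ _ := ENNReal.rpow_le_rpow le_add_self hθ'.le

lemma besovSeminorm_ridge_eq_zero {d : ℕ} [NeZero d] {r : ℕ} (hr : 0 < r) (p : ℝ≥0∞) {θ : ℝ≥0∞}
    (hθ : θ ≠ 0) (a : Fin d → ℝ) {e : Finset (Fin d)} {i : Fin d} (hi : i ∈ e) (hi0 : i ≠ 0)
    (g : ℝ → ℝ) : besovSeminorm r p θ a e (fun x => g (x 0)) = 0 := by
  have h1 : ∀ h, mixedDiff r e h (fun x : Fin d → ℝ => g (x 0)) = 0 := by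
    intro h
    funext x
    rw [mixedDiff_ridge hr, Finset.prod_eq_zero (f := fun i => if i ∈ e then (0 : ℝ) else 1) (Finset.mem_erase.mpr ⟨hi0, Finset.mem_univ i⟩)
      (if_pos hi), mul_zero]
    rfl
  have h2 : ∀ t, modulusRatio r p a e (fun x => g (x 0)) t = 0 := by
    intro t
    unfold modulusRatio mixedModulus
    simp_rw [h1, eLpNorm_zero]
    simp
  unfold besovSeminorm
  split_ifs with hθt
  · simp [h2]
  · have hθ' : 0 < θ.toReal := ENNReal.toReal_pos hθ hθt
    simp [h2, ENNReal.zero_rpow_of_pos hθ', hθ']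

lemma besovSeminorm_empty_le {d : ℕ} [NeZero d] {r : ℕ} (hr : 0 < r) (p : ℝ≥0∞) {θ : ℝ≥0∞}
    (hθ : θ ≠ 0) (a : Fin d → ℝ) (g : ℝ → ℝ) :
    besovSeminorm r p θ a ∅ (fun x => g (x 0)) ≤
      eLpNorm (fun x : Fin d → ℝ => g (x 0)) p (cubeMeasure d) := by
  have h1 : ∀ h, mixedDiff r ∅ h (fun x : Fin d → ℝ => g (x 0)) = fun x => g (x 0) := by
    intro h
    funext x
    rw [mixedDiff_ridge hr]
    simp
  have h2 : ∀ t, modulusRatio r p a ∅ (fun x => g (x 0)) t ≤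
      eLpNorm (fun x : Fin d → ℝ => g (x 0)) p (cubeMeasure d) := by
    intro t
    unfold modulusRatio mixedModulus
    rw [Finset.prod_empty, ENNReal.ofReal_one, div_one]
    refine iSup₂_le fun h _ => ?_
    rw [h1]
    exact eLpNorm_mono_measure _ (Measure.restrict_mono (fun x hx => hx.1) le_rfl)
  unfold besovSeminorm
  split_ifs with hθt
  · exact iSup₂_le fun t _ => h2 t
  · have hθ' : 0 < θ.toReal := ENNReal.toReal_pos hθ hθt
    have := isProbabilityMeasure_cubeMeasure d
    rw [rpow_one_div_le_iff hθ']
    calc _ ≤ ∫⁻ _, eLpNorm (fun x : Fin d → ℝ => g (x 0)) p (cubeMeasure d) ^ θ.toReal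
            ∂cubeMeasure d := by
          refine lintegral_mono fun t => ?_
          rw [Finset.prod_empty, mul_one]
          exact ENNReal.rpow_le_rpow (h2 t) hθ'.le
      _ = _ := by rw [lintegral_const, measure_univ, mul_one]

lemma besovSeminorm_singleton_bumpSum_le {d : ℕ} [NeZero d] {r : ℕ} (hr : 0 < r) (p : ℝ≥0∞)
    {θ : ℝ≥0∞} (hθ : θ ≠ 0) {a : Fin d → ℝ} (ha0 : 0 < a 0) (har : a 0 < r) {K : ℝ} (hK0 : 0 ≤ K)
    {N : ℕ} (hN : 0 < N) {S : Finset ℕ}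
    (hK : ∀ h x, |(fwdDiff h)^[r] (bumpSum N S) x| ≤ K * min 1 ((N * |h|) ^ r))
    {A c : ℝ} (hc : 0 ≤ c) (hA : |A| * (S.card / N : ℝ) ^ (1 / p.toReal) ≤ c * (N : ℝ) ^ (-a 0)) :
    besovSeminorm r p θ a {0} (fun x => A * bumpSum N S (x 0)) ≤
      ENNReal.ofReal (K * c * (r + 1 : ℝ) ^ (1 / p.toReal)) *
      (1 + ENNReal.ofReal (1 / ((r - a 0) * θ.toReal) + 1 / (a 0 * θ.toReal)) ^
        (1 / θ.toReal)) := by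
  have hN' : (0 : ℝ) < N := by exact_mod_cast hN
  refine besovSeminorm_le_of_modulusRatio_le hθ ha0 har (by positivity) hN (fun t _ ht0 => ?_)
    (fun t _ ht0 => ?_)
  · have : mixedModulus r p {0} (fun x : Fin d → ℝ => A * bumpSum N S (x 0)) t = 0 := by
      refine le_antisymm (iSup₂_le fun h hh => ?_) zero_le
      have := hh 0 (Finset.mem_singleton_self 0)
      rw [ht0] at this
      exact absurd this (not_lt.mpr (abs_nonneg _))
    rw [modulusRatio, this, ENNReal.zero_div]
  · have hu : 0 < N * t 0 := mul_pos hN' ht0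
    have hta : 0 < t 0 ^ a 0 := Real.rpow_pos_of_pos ht0 _
    rw [modulusRatio, Finset.prod_singleton]
    refine ENNReal.div_le_of_le_mul ?_
    rw [← ENNReal.ofReal_mul (by positivity)]
    refine iSup₂_le fun h hh => ?_
    have hh0 := hh 0 (Finset.mem_singleton_self 0)
    refine (eLpNorm_mixedDiff_bumpSum_le hr hK0 hN (hK (h 0)) p A).trans
      (ENNReal.ofReal_le_ofReal ?_)
    have hmin : min 1 ((N * |h 0|) ^ r) ≤ min 1 ((N * t 0) ^ r) := by
      gcongr
    have hmin0 : (0 : ℝ) ≤ min 1 ((N * |h 0|) ^ r) := le_min zero_le_one (by positivity)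
    have hmin1 : (0 : ℝ) ≤ min 1 ((N * t 0) ^ r) := le_min zero_le_one (by positivity)
    have hid : min ((N * t 0) ^ ((r : ℝ) - a 0)) ((N * t 0) ^ (-a 0)) * t 0 ^ a 0 =
        (N : ℝ) ^ (-a 0) * min 1 ((N * t 0) ^ r) := by
      have e1 : (N * t 0) ^ (-a 0) * t 0 ^ a 0 = (N : ℝ) ^ (-a 0) := by
        rw [Real.mul_rpow hN'.le ht0.le, mul_assoc, ← Real.rpow_add ht0, neg_add_cancel,
          Real.rpow_zero, mul_one]
      have e2 : (N * t 0) ^ ((r : ℝ) - a 0) = (N * t 0) ^ r * (N * t 0) ^ (-a 0) := by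
        rw [sub_eq_add_neg, Real.rpow_add hu, Real.rpow_natCast]
      rw [e2, ← one_mul ((N * t 0) ^ (-a 0)), ← mul_assoc, mul_one,
        ← min_mul_of_nonneg _ _ (Real.rpow_nonneg hu.le _), min_comm, mul_assoc, e1, mul_comm]
    calc K * min 1 ((N * |h 0|) ^ r) * (|A| * (S.card / N : ℝ) ^ (1 / p.toReal)) *
          (r + 1 : ℝ) ^ (1 / p.toReal)
        ≤ K * min 1 ((N * t 0) ^ r) * (c * (N : ℝ) ^ (-a 0)) * (r + 1 : ℝ) ^ (1 / p.toReal) := by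
          gcongr
      _ = K * c * (r + 1 : ℝ) ^ (1 / p.toReal) *
          ((N : ℝ) ^ (-a 0) * min 1 ((N * t 0) ^ r)) := by ring
      _ = _ := by rw [← hid]; ring

lemma exists_besovNorm_bumpSum_le_one {d : ℕ} [NeZero d] {r : ℕ} (hr : 0 < r) (p : ℝ≥0∞)
    {θ : ℝ≥0∞} (hθ : θ ≠ 0) {a : Fin d → ℝ} (ha0 : 0 < a 0) (har : a 0 < r) :
    ∃ c : ℝ, 0 < c ∧ ∀ N : ℕ, 0 < N → ∀ (S : Finset ℕ) (A : ℝ),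
      |A| * (S.card / N : ℝ) ^ (1 / p.toReal) ≤ c * (N : ℝ) ^ (-a 0) →
      besovNorm r p θ a (fun x => A * bumpSum N S (x 0)) ≤ 1 := by
  obtain ⟨K, hK0, hK⟩ := exists_abs_fwdDiff_bumpSum_le r
  set Q : ℝ≥0∞ := 1 + ENNReal.ofReal (1 / ((r - a 0) * θ.toReal) + 1 / (a 0 * θ.toReal)) ^
        (1 / θ.toReal) with hQ
  have hQt : Q ≠ ⊤ := by
    refine ENNReal.add_ne_top.mpr ⟨ENNReal.one_ne_top, ?_⟩
    exact ENNReal.rpow_ne_top_of_nonneg (by positivity) ENNReal.ofReal_ne_top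
  set R : ℝ := (r + 1 : ℝ) ^ (1 / p.toReal)
  have hR : 0 < R := by positivity
  have hQ0 : 0 ≤ Q.toReal := ENNReal.toReal_nonneg
  -- The first factor gives each of the `2 ^ d` sets `e` an equal share of the unit norm; the second
  -- compensates for the constant of the seminorm with `e = {0}`.
  refine ⟨(2 ^ d)⁻¹ * (1 + K * R * Q.toReal)⁻¹, by positivity, fun N hN S A hA => ?_⟩
  have hN1 : (1 : ℝ) ≤ N := by exact_mod_cast hN
  set c : ℝ := (2 ^ d)⁻¹ * (1 + K * R * Q.toReal)⁻¹ with hc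
  have hc0 : 0 ≤ c := by positivity
  have hcle : c ≤ (2 ^ d)⁻¹ := by
    refine mul_le_of_le_one_right (by positivity) (inv_le_one_of_one_le₀ ?_)
    have : 0 ≤ K * R * Q.toReal := by positivity
    linarith
  have hcle' : K * c * R * Q.toReal ≤ (2 ^ d)⁻¹ := by
    have : K * c * R * Q.toReal = (2 ^ d)⁻¹ * (K * R * Q.toReal / (1 + K * R * Q.toReal)) := by
      rw [hc]; ring
    rw [this]
    refine mul_le_of_le_one_right (by positivity) ?_
    have : 0 ≤ K * R * Q.toReal := by positivity
    rw [div_le_one (by linarith)]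
    linarith
  have hpiece : ∀ e ∈ (Finset.univ : Finset (Finset (Fin d))),
      besovSeminorm r p θ a e (fun x => A * bumpSum N S (x 0)) ≤ (2 ^ d : ℝ≥0∞)⁻¹ := by
    intro e _
    have htwo : ENNReal.ofReal ((2 : ℝ) ^ d)⁻¹ = (2 ^ d : ℝ≥0∞)⁻¹ := by
      rw [ENNReal.ofReal_inv_of_pos (by positivity), ENNReal.ofReal_pow (by norm_num)]
      norm_num
    rw [← htwo]
    by_cases h1 : ∃ i ∈ e, i ≠ 0
    · obtain ⟨i, hi, hi0⟩ := h1
      rw [besovSeminorm_ridge_eq_zero hr p hθ a hi hi0 (fun z => A * bumpSum N S z)]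
      exact zero_le
    · push Not at h1
      rcases Finset.subset_singleton_iff.mp
        (fun i hi => Finset.mem_singleton.mpr (h1 i hi) : e ⊆ {0}) with rfl | rfl
      · refine (besovSeminorm_empty_le hr p hθ a (fun z => A * bumpSum N S z)).trans ?_
        refine (eLpNorm_bumpSum_le p hN S A).trans (ENNReal.ofReal_le_ofReal ?_)
        refine hA.trans ((mul_le_of_le_one_right hc0 ?_).trans hcle)
        exact Real.rpow_le_one_of_one_le_of_nonpos hN1 (by linarith)
      · refine (besovSeminorm_singleton_bumpSum_le hr p hθ ha0 har hK0.le hN (hK N S) hc0 hA).trans ?_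
        rw [← hQ, ← ENNReal.ofReal_toReal hQt, ← ENNReal.ofReal_mul (by positivity)]
        exact ENNReal.ofReal_le_ofReal hcle'
  refine (Finset.sum_le_card_nsmul _ _ _ hpiece).trans (le_of_eq ?_)
  rw [Finset.card_univ, Fintype.card_finset, Fintype.card_fin, nsmul_eq_mul]
  push_cast
  exact ENNReal.mul_inv_cancel (by simp) (by simp)

/-! ### The lower bound -/

lemma le_eLpNorm_bumpSum {d : ℕ} [NeZero d] {q : ℝ≥0∞} (hq : q ≠ 0) {N : ℕ} (hN : 0 < N)
    {S : Finset ℕ} (hS : ∀ i ∈ S, i < N) (hne : S.Nonempty) {A : ℝ} (hA : 0 ≤ A) :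
    ENNReal.ofReal (A * (S.card / N / 2 : ℝ) ^ (1 / q.toReal)) ≤
      eLpNorm (fun x : Fin d → ℝ => A * bumpSum N S (x 0)) q (cubeMeasure d) := by
  have hN' : (0 : ℝ) < N := by exact_mod_cast hN
  have hcard : (0 : ℝ) < S.card := by exact_mod_cast hne.card_pos
  have hev := measurePreserving_eval_cube d
  have hm := measurableSet_plateau N S
  have hvol : cubeMeasure d ((fun x : Fin d → ℝ => x 0) ⁻¹' plateau N S) =
      ENNReal.ofReal (S.card / N / 2) := by
    rw [hev.measure_preimage hm.nullMeasurableSet, Measure.restrict_apply hm,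
      Set.inter_eq_left.mpr (plateau_subset hN hS), volume_plateau hN]
  have hvol0 : cubeMeasure d ((fun x : Fin d → ℝ => x 0) ⁻¹' plateau N S) ≠ 0 := by
    rw [hvol]
    exact (ENNReal.ofReal_pos.mpr (by positivity)).ne'
  have h := eLpNorm_indicator_const' (c := A) (p := q) (hev.measurable hm) hvol0 hq
  rw [hvol, Real.enorm_eq_ofReal hA, ENNReal.ofReal_rpow_of_nonneg (by positivity) (by positivity),
    ← ENNReal.ofReal_mul hA] at h
  rw [← h]
  refine eLpNorm_mono fun x => ?_
  by_cases hx : x ∈ (fun x : Fin d → ℝ => x 0) ⁻¹' plateau N S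
  · rw [Set.indicator_of_mem hx, bumpSum_eq_one hN hx, mul_one]
  · rw [Set.indicator_of_notMem hx, norm_zero]
    exact norm_nonneg _

/-- At most `n` of the `2n` cells contain a node, and bumps vanish outside the open cells. -/
lemma exists_free_cells {n : ℕ} (y : Fin n → ℝ) : ∃ S : Finset ℕ, n ≤ S.card ∧
    S.card ≤ 2 * n ∧ (∀ i ∈ S, i < 2 * n) ∧ ∀ T ⊆ S, ∀ j, bumpSum (2 * n) T (y j) = 0 := by
  classical
  set B : Finset ℕ := Finset.univ.image fun j => ⌊((2 * n : ℕ) : ℝ) * y j⌋₊ with hB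
  have hBc : B.card ≤ n := Finset.card_image_le.trans (by simp)
  refine ⟨Finset.range (2 * n) \ B, ?_, ?_, fun i hi => ?_, fun T hT j => ?_⟩
  · have := Finset.le_card_sdiff B (Finset.range (2 * n))
    rw [Finset.card_range] at this
    omega
  · exact (Finset.card_le_card Finset.sdiff_subset).trans (by simp)
  · exact Finset.mem_range.mp (Finset.mem_sdiff.mp hi).1
  · by_contra hne
    obtain ⟨i, hi, h1, h2⟩ := exists_of_bumpSum_ne_zero hne
    refine (Finset.mem_sdiff.mp (hT hi)).2 (Finset.mem_image.mpr ⟨j, Finset.mem_univ j, ?_⟩)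
    rw [Nat.floor_eq_iff ((Nat.cast_nonneg i).trans h1.le)]
    exact ⟨h1.le, h2⟩

/-- For `q ≤ p` all free cells are used: they fill a fixed proportion of the interval, so the norms
for `p` and `q` are comparable. For `p < q` a single cell is best, because concentration raises the
ratio of the `L_q`-norm to the `L_p`-norm to the order `n^{1/p-1/q}`. -/
lemma exists_fooling_amplitude {p q : ℝ≥0∞} (hp : p ≠ 0) (hq : q ≠ 0) (α : ℝ) {c : ℝ}
    (hc : 0 < c) : ∃ c' : ℝ, 0 < c' ∧ ∀ n : ℕ, 1 ≤ n → ∀ S₀ : Finset ℕ, n ≤ S₀.card →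
      S₀.card ≤ 2 * n → ∃ S ⊆ S₀, S.Nonempty ∧ ∃ A : ℝ, 0 ≤ A ∧
        A * (S.card / (2 * n : ℕ) : ℝ) ^ (1 / p.toReal) ≤ c * ((2 * n : ℕ) : ℝ) ^ (-α) ∧
        c' * (n : ℝ) ^ (-α + gap p q) ≤ A * (S.card / (2 * n : ℕ) / 2 : ℝ) ^ (1 / q.toReal) := by
  rcases le_or_gt q p with hqp | hpq
  · have hgap : gap p q = 0 := by
      refine max_eq_left (sub_nonpos.mpr ?_)
      exact ENNReal.toReal_mono (ENNReal.inv_ne_top.mpr hq) (ENNReal.inv_le_inv.mpr hqp)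
    refine ⟨c * 2 ^ (-α) * (1 / 4) ^ (1 / q.toReal), by positivity,
      fun n hn S₀ h1 h2 => ⟨S₀, le_rfl, ?_, c * ((2 * n : ℕ) : ℝ) ^ (-α), by positivity, ?_, ?_⟩⟩
    · exact Finset.card_pos.mp (by omega)
    · refine mul_le_of_le_one_right (by positivity) (Real.rpow_le_one (by positivity) ?_
        (by positivity))
      have : (S₀.card : ℝ) ≤ (2 * n : ℕ) := by exact_mod_cast h2
      exact div_le_one_of_le₀ this (by positivity)
    · have hn' : (0 : ℝ) < n := by exact_mod_cast hn
      have h1' : (n : ℝ) ≤ S₀.card := by exact_mod_cast h1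
      have hle : (1 / 4 : ℝ) ≤ S₀.card / (2 * n : ℕ) / 2 := by
        push_cast
        rw [div_div, le_div_iff₀ (by positivity)]
        linarith
      rw [hgap, add_zero]
      calc c * 2 ^ (-α) * (1 / 4) ^ (1 / q.toReal) * (n : ℝ) ^ (-α)
          = c * ((2 * n : ℕ) : ℝ) ^ (-α) * (1 / 4) ^ (1 / q.toReal) := by
            push_cast
            rw [Real.mul_rpow (by norm_num) hn'.le]
            ring
        _ ≤ _ := by gcongr
  · have hgap : gap p q = 1 / p.toReal - 1 / q.toReal := by
      rw [gap, max_eq_right, toReal_inv_eq, toReal_inv_eq]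
      refine sub_nonneg.mpr (ENNReal.toReal_mono (ENNReal.inv_ne_top.mpr hp)
        (ENNReal.inv_le_inv.mpr hpq.le))
    refine ⟨c * (1 / 2) ^ (1 / q.toReal) * 2 ^ (-α + gap p q), by positivity,
      fun n hn S₀ h1 h2 => ?_⟩
    have hn' : (0 : ℝ) < n := by exact_mod_cast hn
    have hN' : (0 : ℝ) < (2 * n : ℕ) := by positivity
    obtain ⟨i, hi⟩ := Finset.card_pos.mp (show 0 < S₀.card by omega)
    refine ⟨{i}, Finset.singleton_subset_iff.mpr hi, Finset.singleton_nonempty i,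
      c * ((2 * n : ℕ) : ℝ) ^ (-α + 1 / p.toReal), by positivity, le_of_eq ?_, le_of_eq ?_⟩
    · rw [Finset.card_singleton, Nat.cast_one, one_div ((2 * n : ℕ) : ℝ), Real.inv_rpow hN'.le,
        ← Real.rpow_neg hN'.le, mul_assoc, ← Real.rpow_add hN']
      congr 2
      ring
    · have e1 : (((1 : ℕ) : ℝ) / (2 * n : ℕ) / 2) ^ (1 / q.toReal) =
          ((2 * n : ℕ) : ℝ) ^ (-(1 / q.toReal)) * (1 / 2) ^ (1 / q.toReal) := by
        rw [Real.rpow_neg hN'.le, ← Real.inv_rpow hN'.le, ← Real.mul_rpow (by positivity)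
          (by norm_num)]
        congr 1
        push_cast
        ring
      rw [Finset.card_singleton, e1]
      calc c * (1 / 2) ^ (1 / q.toReal) * 2 ^ (-α + gap p q) * (n : ℝ) ^ (-α + gap p q)
          = c * (1 / 2) ^ (1 / q.toReal) * ((2 * n : ℕ) : ℝ) ^ (-α + gap p q) := by
            push_cast
            rw [Real.mul_rpow (by norm_num) hn'.le]
            ring
        _ = c * (1 / 2) ^ (1 / q.toReal) * (((2 * n : ℕ) : ℝ) ^ (-α + 1 / p.toReal) *
            ((2 * n : ℕ) : ℝ) ^ (-(1 / q.toReal))) := by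
            rw [← Real.rpow_add hN', hgap]
            congr 2
            ring
        _ = _ := by ring

/-- The functions `f` and `-f` have the same data, so the method returns the same `P 0` for both,
and `2f` is the difference of the two errors. The quasi-triangle inequality costs `LpAddConst`. -/
lemma eLpNorm_le_worstError {d n : ℕ} {W : Set ((Fin d → ℝ) → ℝ)} {q : ℝ≥0∞}
    {X : Fin n → cube d} {P : (Fin n → ℝ) → (Fin d → ℝ) → ℝ}
    (hP : ∀ y, MemLp (P y) q (cubeMeasure d)) {f : (Fin d → ℝ) → ℝ}
    (hf : AEStronglyMeasurable f (cubeMeasure d)) (hfW : f ∈ W) (hfW' : (fun x => -f x) ∈ W)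
    (hX : ∀ j, f (X j) = 0) :
    eLpNorm f q (cubeMeasure d) ≤
      ENNReal.LpAddConst q * worstError W q (fun f => P (fun j => f (X j))) := by
  have h1 : eLpNorm (fun x => f x - P 0 x) q (cubeMeasure d) ≤
      worstError W q (fun f => P (fun j => f (X j))) := by
    refine le_trans (le_of_eq ?_) (le_iSup₂ (f := fun f (_ : f ∈ W) =>
      eLpNorm (fun x => f x - P (fun j => f (X j)) x) q (cubeMeasure d)) f hfW)
    have : (fun j => f (X j)) = 0 := funext hX
    simp only [this]
  have h2 : eLpNorm (fun x => -f x - P 0 x) q (cubeMeasure d) ≤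
      worstError W q (fun f => P (fun j => f (X j))) := by
    refine le_trans (le_of_eq ?_) (le_iSup₂ (f := fun f (_ : f ∈ W) =>
      eLpNorm (fun x => f x - P (fun j => f (X j)) x) q (cubeMeasure d)) _ hfW')
    have : (fun j => -f (X j)) = 0 := funext fun j => by rw [hX j, neg_zero]; rfl
    simp only [this]
  have h3 := eLpNorm_sub_le' (p := q) (hf.sub (hP 0).1) (hf.neg.sub (hP 0).1)
  have h4 : (f - P 0 - (-f - P 0)) = (2 : ℝ) • f := by
    funext x
    simp only [Pi.sub_apply, Pi.neg_apply, Pi.smul_apply, smul_eq_mul]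
    ring
  rw [h4, eLpNorm_const_smul] at h3
  have h5 : ‖(2 : ℝ)‖ₑ = 2 := by
    rw [Real.enorm_eq_ofReal (by norm_num)]; norm_num
  rw [h5] at h3
  have h6 : 2 * eLpNorm f q (cubeMeasure d) ≤
      2 * (ENNReal.LpAddConst q * worstError W q (fun f => P (fun j => f (X j)))) := by
    refine h3.trans ((mul_le_mul_right (add_le_add h1 h2) _).trans (le_of_eq ?_))
    ring
  exact (ENNReal.mul_le_mul_iff_right (by norm_num) (by norm_num)).mp h6

theorem exists_le_samplingNumber {d : ℕ} [NeZero d] {r : ℕ} (hr : 0 < r) {p θ q : ℝ≥0∞}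
    (hp : p ≠ 0) (hθ : θ ≠ 0) (hq : q ≠ 0) {a : Fin d → ℝ} (ha0 : 0 < a 0) (har : a 0 < r) :
    ∃ c : ℝ, 0 < c ∧ ∀ n : ℕ, 1 ≤ n →
      ENNReal.ofReal (c * (n : ℝ) ^ (-a 0 + gap p q)) ≤
        samplingNumber n (besovBall r p θ a) q := by
  obtain ⟨c₀, hc₀, hball⟩ := exists_besovNorm_bumpSum_le_one hr p hθ ha0 har
  obtain ⟨c₁, hc₁, hamp⟩ := exists_fooling_amplitude hp hq (a 0) hc₀
  have hL0 : 0 < (ENNReal.LpAddConst q).toReal := by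
    refine ENNReal.toReal_pos ?_ (ENNReal.LpAddConst_lt_top q).ne
    unfold ENNReal.LpAddConst
    split_ifs
    · exact (ENNReal.rpow_pos (by norm_num) (by norm_num)).ne'
    · exact one_ne_zero
  refine ⟨(ENNReal.LpAddConst q).toReal⁻¹ * c₁, by positivity, fun n hn => ?_⟩
  have hN : 0 < 2 * n := by omega
  refine le_iInf fun X => le_iInf fun P => le_iInf fun hP => ?_
  obtain ⟨S₀, h1, h2, h3, h4⟩ := exists_free_cells fun j => (X j : Fin d → ℝ) 0
  obtain ⟨S, hS, hne, A, hA, hA1, hA2⟩ := hamp n hn S₀ h1 h2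
  have hcont : ∀ B : ℝ, Continuous fun x : Fin d → ℝ => B * bumpSum (2 * n) S (x 0) := fun B =>
    continuous_const.mul ((continuous_bumpSum _ _).comp (continuous_apply 0))
  have hmem : ∀ B : ℝ, |B| = A →
      (fun x : Fin d → ℝ => B * bumpSum (2 * n) S (x 0)) ∈ besovBall r p θ a := fun B hB =>
    ⟨(hcont B).continuousOn, hball _ hN S B (by rw [hB]; exact hA1)⟩
  have hmain := eLpNorm_le_worstError (W := besovBall r p θ a) (X := X) hP
    (f := fun x => A * bumpSum (2 * n) S (x 0)) (hcont A).aestronglyMeasurable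
    (hmem A (abs_of_nonneg hA))
    (by
      have := hmem (-A) (by rw [abs_neg, abs_of_nonneg hA])
      simpa only [neg_mul] using this)
    (fun j => by rw [h4 S hS j, mul_zero])
  have hlow := (ENNReal.ofReal_le_ofReal hA2).trans
    (le_eLpNorm_bumpSum (d := d) hq hN (fun i hi => h3 i (hS hi)) hne hA)
  have := hlow.trans hmain
  rw [mul_assoc, ENNReal.ofReal_mul (by positivity), ENNReal.ofReal_inv_of_pos hL0,
    ENNReal.ofReal_toReal (ENNReal.LpAddConst_lt_top q).ne]
  rw [ENNReal.inv_mul_le_iff _ (ENNReal.LpAddConst_lt_top q).ne]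
  · exact this
  · exact fun h => by simp [h] at hL0

/-! ### Comparison of the error quantities -/

lemma worstError_congr {d : ℕ} (W : Set ((Fin d → ℝ) → ℝ)) (q : ℝ≥0∞)
    {A B : ((Fin d → ℝ) → ℝ) → (Fin d → ℝ) → ℝ} (h : ∀ f, ∀ x ∈ cube d, A f x = B f x) :
    worstError W q A = worstError W q B := by
  refine iSup_congr fun f => iSup_congr fun _ => eLpNorm_congr_ae ?_
  filter_upwards [ae_restrict_mem (measurableSet_cube d)] with x hx
  rw [h f x hx]

lemma samplingNumber_le_worstError {d n : ℕ} (W : Set ((Fin d → ℝ) → ℝ)) {q : ℝ≥0∞}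
    (X : Fin n → cube d) {Φ : Fin n → (Fin d → ℝ) → ℝ}
    (hΦ : ∀ j, MemLp (Φ j) q (cubeMeasure d)) :
    samplingNumber n W q ≤ worstError W q (samplingAlgorithm X Φ) := by
  have hP : ∀ y : Fin n → ℝ, MemLp (fun x => ∑ j, y j * Φ j x) q (cubeMeasure d) := fun y =>
    memLp_finsetSum _ fun j _ => (hΦ j).const_mul (y j)
  unfold samplingNumber
  exact iInf_le_of_le X (iInf_le_of_le (fun y x => ∑ j, y j * Φ j x) (iInf_le_of_le hP le_rfl))

lemma samplingNumber_le_linearSamplingNumber {d : ℕ} (n : ℕ) (W : Set ((Fin d → ℝ) → ℝ))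
    (q : ℝ≥0∞) : samplingNumber n W q ≤ linearSamplingNumber n W q :=
  le_iInf fun X => le_iInf fun _ => le_iInf fun hΦ => samplingNumber_le_worstError W X hΦ

lemma linearSamplingNumber_le_worstError {d n : ℕ} (W : Set ((Fin d → ℝ) → ℝ)) {q : ℝ≥0∞}
    (X : Fin n → cube d) {Φ : Fin n → (Fin d → ℝ) → ℝ}
    (hΦ : ∀ j, MemLp (Φ j) q (cubeMeasure d)) :
    linearSamplingNumber n W q ≤ worstError W q (samplingAlgorithm X Φ) :=
  (iInf_le _ X).trans ((iInf_le _ Φ).trans (iInf_le _ hΦ))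

lemma linearSamplingNumber_le_worstError_zero {d n : ℕ} (W : Set ((Fin d → ℝ) → ℝ)) (q : ℝ≥0∞) :
    linearSamplingNumber n W q ≤ worstError W q fun _ _ => 0 := by
  have hmem : (0 : Fin d → ℝ) ∈ cube d := mem_cube_iff.mpr fun i => by simp
  refine (linearSamplingNumber_le_worstError W (fun _ : Fin n => ⟨0, hmem⟩)
    (Φ := fun _ _ => 0) fun j => MemLp.zero).trans (le_of_eq ?_)
  exact worstError_congr W q fun f x _ => by simp [samplingAlgorithm]

/-! ### The extremal levels and the resulting rate. -/

section Levels

variable {d : ℕ} [NeZero d] {p θ q : ℝ≥0∞} {a : Fin d → ℝ} {ε : ℝ}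

lemma zero_mem_sparseIndexSet {ξ : ℝ} (hξ : 0 ≤ ξ) :
    (0 : Fin d → ℕ) ∈ sparseIndexSet p θ q a ε ξ := by
  rw [sparseIndexSet_eq]
  change ∑ i, indexWeight p θ q a ε i * (((0 : Fin d → ℕ) i : ℕ) : ℝ) ≤ ξ
  simpa using hξ

lemma sparseIndexSet_finite (ha₀ : (p⁻¹).toReal < a 0) (hε : 0 < ε)
    (hε' : ∀ i, i ≠ 0 → ε < a i - a 0) (ξ : ℝ) : (sparseIndexSet p θ q a ε ξ).Finite := by
  rw [sparseIndexSet_eq]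
  exact finite_index (indexWeight_zero_pos θ q ε ha₀) (indexWeight_zero_lt p θ q hε hε') ξ

lemma sparseIndexSet_eq_empty (ha₀ : (p⁻¹).toReal < a 0) (hε : 0 < ε)
    (hε' : ∀ i, i ≠ 0 → ε < a i - a 0) {ξ : ℝ} (hξ : ξ < 0) :
    sparseIndexSet p θ q a ε ξ = ∅ := by
  rw [sparseIndexSet_eq, Set.eq_empty_iff_forall_notMem]
  intro k hk
  refine absurd (hξ.trans_le (Finset.sum_nonneg fun i _ => ?_)) (not_lt.mpr hk)
  exact mul_nonneg ((indexWeight_zero_pos θ q ε ha₀).le.trans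
    (weight_zero_le (indexWeight_zero_lt p θ q hε hε') i)) (Nat.cast_nonneg _)

lemma IsLargestLevel.one_le {n : ℕ} {ξ : ℝ} (h : IsLargestLevel p θ q a ε n ξ) : 1 ≤ n := by
  by_contra hn
  have hn0 : n = 0 := by omega
  have h2 := h.2.1
  rw [hn0, Nat.cast_zero, nonpos_iff_eq_zero, Set.encard_eq_zero] at h2
  have : gridPoint (0 : Fin d → ℕ) 0 ∈ grid (sparseIndexSet p θ q a ε ξ) :=
    ⟨0, zero_mem_sparseIndexSet h.1, 0, Fintype.mem_piFinset.mpr fun i => by simp, rfl⟩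
  rw [h2] at this
  exact this

lemma exists_isLargestLevel (θ q : ℝ≥0∞) (ha₀ : (p⁻¹).toReal < a 0) (hε : 0 < ε)
    (hε' : ∀ i, i ≠ 0 → ε < a i - a 0) {n : ℕ} (hn : 2 ^ d ≤ n) :
    ∃ ξ, IsLargestLevel p θ q a ε n ξ := by
  unfold IsLargestLevel
  simp_rw [sparseIndexSet_eq]
  exact exists_largest_level (indexWeight_zero_pos θ q ε ha₀) (indexWeight_zero_lt p θ q hε hε')
    n hn

/-- Inverts `n ≲ 2^{ξ/α}` for the first weight `α = a 0 - gap p q`; this weight is the same inside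
and outside the class `A`, because `ε` is subtracted only from the other components. -/
lemma exists_two_rpow_neg_level_le (θ q : ℝ≥0∞) (ha₀ : (p⁻¹).toReal < a 0) (hε : 0 < ε)
    (hε' : ∀ i, i ≠ 0 → ε < a i - a 0) :
    ∃ C : ℝ≥0∞, C ≠ ⊤ ∧ ∀ (n : ℕ) (ξ : ℝ), IsLargestLevel p θ q a ε n ξ →
      (2 : ℝ≥0∞) ^ (-ξ) ≤ C * (n : ℝ≥0∞) ^ (-a 0 + gap p q) := by
  have h0 := indexWeight_zero_pos θ q ε ha₀
  obtain ⟨C, hC, hCb⟩ := exists_largest_level_bound h0 (indexWeight_zero_lt p θ q hε hε')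
  set α := indexWeight p θ q a ε 0 with hα
  refine ⟨C ^ α, ENNReal.rpow_ne_top_of_nonneg h0.le hC, fun n ξ h => ?_⟩
  have hn0 : (n : ℝ≥0∞) ≠ 0 := by
    have := h.one_le
    exact_mod_cast (by omega : n ≠ 0)
  have hb := hCb n ξ h.1 (by simpa only [sparseIndexSet_eq] using h.2.2)
  have hb' : (n : ℝ≥0∞) ^ α ≤ C ^ α * 2 ^ ξ := by
    refine (ENNReal.rpow_le_rpow hb h0.le).trans (le_of_eq ?_)
    rw [ENNReal.mul_rpow_of_nonneg _ _ h0.le, ← ENNReal.rpow_mul, div_mul_cancel₀ _ h0.ne']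
  have hexp : -a 0 + gap p q = -α := by rw [hα, indexWeight_zero]; ring
  rw [hexp]
  calc (2 : ℝ≥0∞) ^ (-ξ) = (n : ℝ≥0∞) ^ α * (n : ℝ≥0∞) ^ (-α) * 2 ^ (-ξ) := by
        rw [← ENNReal.rpow_add _ _ hn0 (ENNReal.natCast_ne_top n), add_neg_cancel,
          ENNReal.rpow_zero, one_mul]
    _ ≤ C ^ α * 2 ^ ξ * (n : ℝ≥0∞) ^ (-α) * 2 ^ (-ξ) := by gcongr
    _ = C ^ α * (n : ℝ≥0∞) ^ (-α) * (2 ^ ξ * 2 ^ (-ξ)) := by ring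
    _ = C ^ α * (n : ℝ≥0∞) ^ (-α) := by
        rw [← ENNReal.rpow_add _ _ (by norm_num) (by norm_num), add_neg_cancel,
          ENNReal.rpow_zero, mul_one]

lemma natCast_rpow_eq_ofReal {n : ℕ} (hn : 1 ≤ n) (s : ℝ) :
    (n : ℝ≥0∞) ^ s = ENNReal.ofReal ((n : ℝ) ^ s) := by
  have hn' : (0 : ℝ) < n := by exact_mod_cast hn
  rw [← ENNReal.ofReal_natCast, ENNReal.ofReal_rpow_of_pos hn']

lemma exists_sparseOp_and_linearSamplingNumber_le {r : ℕ} (hr : 0 < r) (hp : p ≠ 0) (hθ : θ ≠ 0)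
    (hq : q ≠ 0) (ha₀ : (p⁻¹).toReal < a 0) (ha : ∀ i, a 0 ≤ a i) {μ : ℕ} {lam : ℤ → ℝ}
    (hQ : IsQuasiInterpolation r μ lam) (hε : 0 < ε) (hε' : ∀ i, i ≠ 0 → ε < a i - a 0) :
    ∃ C : ℝ, 0 < C ∧
      (∀ (n : ℕ) (ξ : ℝ), IsLargestLevel p θ q a ε n ξ →
        worstError (besovBall r p θ a) q (sparseOp r μ lam (sparseIndexSet p θ q a ε ξ)) ≤
          ENNReal.ofReal (C * (n : ℝ) ^ (-a 0 + gap p q))) ∧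
      ∀ n : ℕ, 1 ≤ n → linearSamplingNumber n (besovBall r p θ a) q ≤
        ENNReal.ofReal (C * (n : ℝ) ^ (-a 0 + gap p q)) := by
  obtain ⟨C₁, hC₁, h₁⟩ := exists_worstError_sparseOp_le hr hp hθ hq ha₀ ha hQ hε hε'
  obtain ⟨C₂, hC₂, h₂⟩ := exists_two_rpow_neg_level_le θ q ha₀ hε hε'
  have hexp : -a 0 + gap p q ≤ 0 := by linarith [gap_le p q]
  set s := -a 0 + gap p q with hs
  -- The first term serves `n ≥ 2 ^ d`, the second the finitely many smaller `n`, where `n ^ s ≥ (2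
  -- ^ d) ^ s`; the last makes `D` positive.
  set D : ℝ≥0∞ := C₁ * C₂ + C₁ * 2 ^ (-(-1 : ℝ)) * ((2 ^ d : ℕ) : ℝ≥0∞) ^ (-s) + 1 with hD
  have hDt : D ≠ ⊤ := by
    refine ENNReal.add_ne_top.mpr ⟨ENNReal.add_ne_top.mpr ⟨ENNReal.mul_ne_top hC₁ hC₂,
      ENNReal.mul_ne_top (ENNReal.mul_ne_top hC₁ ?_) ?_⟩, ENNReal.one_ne_top⟩
    · exact ENNReal.rpow_ne_top_of_nonneg (by norm_num) (by norm_num)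
    · exact ENNReal.rpow_ne_top_of_nonneg (by linarith) (ENNReal.natCast_ne_top _)
  have hD0 : 0 < D.toReal := ENNReal.toReal_pos (by rw [hD]; simp) hDt
  have hconv : ∀ n : ℕ, 1 ≤ n → ENNReal.ofReal (D.toReal * (n : ℝ) ^ s) = D * (n : ℝ≥0∞) ^ s := by
    intro n hn
    rw [ENNReal.ofReal_mul hD0.le, ENNReal.ofReal_toReal hDt, natCast_rpow_eq_ofReal hn]
  have hup : ∀ (n : ℕ) (ξ : ℝ), IsLargestLevel p θ q a ε n ξ →
      worstError (besovBall r p θ a) q (sparseOp r μ lam (sparseIndexSet p θ q a ε ξ)) ≤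
        ENNReal.ofReal (D.toReal * (n : ℝ) ^ s) := by
    intro n ξ h
    rw [hconv n h.one_le]
    refine (h₁ ξ).trans ((mul_le_mul_right (h₂ n ξ h) _).trans ?_)
    rw [← mul_assoc]
    refine mul_le_mul_left ?_ _
    rw [hD, add_assoc]
    exact le_self_add
  refine ⟨D.toReal, hD0, hup, fun n hn => ?_⟩
  rcases le_or_gt (2 ^ d) n with hnd | hnd
  · obtain ⟨ξ, hξ⟩ := exists_isLargestLevel θ q ha₀ hε hε' hnd
    obtain ⟨X, Φ, -, hΦ, hX⟩ := exists_sampling_representation r hr μ lam q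
      (sparseIndexSet_finite ha₀ hε hε' ξ) ⟨0, zero_mem_sparseIndexSet hξ.1⟩ hξ.2.1
    refine (linearSamplingNumber_le_worstError _ X hΦ).trans ?_
    rw [← worstError_congr _ q hX]
    exact hup n ξ hξ
  · rw [hconv n hn]
    refine (linearSamplingNumber_le_worstError_zero _ q).trans ?_
    -- The index set of level `-1` is empty, so the general error bound yields the boundedness of
    -- the class in `L_q`. For small `n` the zero algorithm is good enough.
    have h := h₁ (-1)
    rw [sparseIndexSet_eq_empty ha₀ hε hε' (by norm_num), worstError_congr (B := fun _ _ => 0) _ q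
      fun f x _ => by simp [sparseOp]] at h
    refine h.trans ?_
    have hone : (1 : ℝ≥0∞) ≤ ((2 ^ d : ℕ) : ℝ≥0∞) ^ (-s) * (n : ℝ≥0∞) ^ s := by
      have hle : ((2 ^ d : ℕ) : ℝ≥0∞) ^ s ≤ (n : ℝ≥0∞) ^ s := by
        rw [← neg_neg s, ENNReal.rpow_neg, ENNReal.rpow_neg _ (-s)]
        exact ENNReal.inv_le_inv.mpr (ENNReal.rpow_le_rpow (by exact_mod_cast hnd.le)
          (by linarith))
      refine le_trans (le_of_eq ?_) (mul_le_mul_right hle _)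
      rw [← ENNReal.rpow_add _ _ (by simp) (ENNReal.natCast_ne_top _), neg_add_cancel,
        ENNReal.rpow_zero]
    calc C₁ * 2 ^ (-(-1 : ℝ))
        ≤ C₁ * 2 ^ (-(-1 : ℝ)) * (((2 ^ d : ℕ) : ℝ≥0∞) ^ (-s) * (n : ℝ≥0∞) ^ s) :=
          le_mul_of_one_le_right' hone
      _ = C₁ * 2 ^ (-(-1 : ℝ)) * ((2 ^ d : ℕ) : ℝ≥0∞) ^ (-s) * (n : ℝ≥0∞) ^ s := by
          rw [← mul_assoc]
      _ ≤ D * (n : ℝ≥0∞) ^ s := by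
          refine mul_le_mul_left ?_ _
          rw [hD, add_right_comm]
          exact le_add_self

end Levels

end SparseGrid

end

/-! ### Assembly of the three assertions. -/

open SparseGrid in
theorem mainTheorem2 {d : ℕ} [NeZero d] (p θ q : ℝ≥0∞) (hp : p ≠ 0) (hθ : θ ≠ 0) (hq : q ≠ 0)
    (r : ℕ) (a : Fin d → ℝ) (ha₀ : (p⁻¹).toReal < a 0) (ha₁ : ∀ i, i ≠ 0 → a 0 < a i)
    (ha_mono : Monotone a) (har : ∀ i, a i < r)
    (μ : ℕ) (lam : ℤ → ℝ) (hQ : IsQuasiInterpolation r μ lam)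
    (ε : ℝ) (hε : 0 < ε) (hε' : ∀ i, i ≠ 0 → ε < a i - a 0) :
    -- the level `ξ_n` exists as soon as `n` is at least the size `2^d` of the smallest grid
    (∀ n : ℕ, 2 ^ d ≤ n → ∃ ξ, IsLargestLevel p θ q a ε n ξ) ∧
    -- `R_{Δ'(ξ_n)}` is a linear sampling algorithm on the grid `G(Δ'(ξ_n))`
    (∃ (N : ℕ) (ψ : (Fin d → ℕ) → (Fin d → ℕ) → (Fin d → ℝ) → ℝ),
      (∀ k, ∀ j ∈ gridIndices k, ∃ (F : Finset (Fin d → ℤ)) (b : (Fin d → ℤ) → ℝ),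
        F.card ≤ N ∧ (∀ s ∈ F, ∃ x ∈ cube d, dilatedBSpline r k s x ≠ 0) ∧
        ψ k j = fun x => ∑ s ∈ F, b s * dilatedBSpline r k s x) ∧
      ∀ (n : ℕ) (ξ : ℝ), IsLargestLevel p θ q a ε n ξ →
        (∀ (f : (Fin d → ℝ) → ℝ), ∀ x ∈ cube d,
          sparseOp r μ lam (sparseIndexSet p θ q a ε ξ) f x =
            ∑ᶠ k ∈ sparseIndexSet p θ q a ε ξ,
              ∑ j ∈ gridIndices k, f (gridPoint k j) * ψ k j x) ∧
        ∃ (X : Fin n → cube d) (Φ : Fin n → (Fin d → ℝ) → ℝ),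
          Set.range (fun j => (X j : Fin d → ℝ)) = grid (sparseIndexSet p θ q a ε ξ) ∧
          (∀ j, MemLp (Φ j) q (cubeMeasure d)) ∧
          ∀ (f : (Fin d → ℝ) → ℝ), ∀ x ∈ cube d,
            sparseOp r μ lam (sparseIndexSet p θ q a ε ξ) f x = samplingAlgorithm X Φ f x) ∧
    -- the asymptotic orders
    ∃ c C : ℝ, 0 < c ∧ 0 < C ∧
      (∀ n : ℕ, 1 ≤ n →
        HasOrder c C n (-a 0 + gap p q) (linearSamplingNumber n (besovBall r p θ a) q) ∧
        HasOrder c C n (-a 0 + gap p q) (samplingNumber n (besovBall r p θ a) q)) ∧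
      ∀ (n : ℕ) (ξ : ℝ), IsLargestLevel p θ q a ε n ξ →
        HasOrder c C n (-a 0 + gap p q)
          (worstError (besovBall r p θ a) q
            (sparseOp r μ lam (sparseIndexSet p θ q a ε ξ))) := by
  have ha0 : 0 < a 0 := ENNReal.toReal_nonneg.trans_lt ha₀
  have hr : 0 < r := by exact_mod_cast ha0.trans (har 0)
  have ha : ∀ i, a 0 ≤ a i := weight_zero_le ha₁
  have hfin := sparseIndexSet_finite (θ := θ) (q := q) ha₀ hε hε'
  have hrep : ∀ (n : ℕ) (ξ : ℝ), IsLargestLevel p θ q a ε n ξ → _ := fun n ξ h =>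
    exists_sampling_representation r hr μ lam q (hfin ξ) ⟨0, zero_mem_sparseIndexSet h.1⟩ h.2.1
  refine ⟨fun n hn => exists_isLargestLevel θ q ha₀ hε hε' hn, ?_, ?_⟩
  · obtain ⟨N, ψ, hψ, hψc⟩ := exists_spline_representation d r hr μ lam
    refine ⟨N, ψ, fun k j _ => hψ k j, fun n ξ h => ⟨fun f x hx => ?_, hrep n ξ h⟩⟩
    refine finsum_mem_congr rfl fun k _ => ?_
    rw [mixedLevelDiff_eq_sum r μ lam k f hx]
    exact Finset.sum_congr rfl fun j _ => by rw [hψc k j x hx]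
  · obtain ⟨c, hc, hlow⟩ := exists_le_samplingNumber hr hp hθ hq ha0 (har 0)
    obtain ⟨C, hC, hup, hlin⟩ :=
      exists_sparseOp_and_linearSamplingNumber_le hr hp hθ hq ha₀ ha hQ hε hε'
    have hle := fun n => samplingNumber_le_linearSamplingNumber n (besovBall r p θ a) q
    refine ⟨c, C, hc, hC, fun n hn => ⟨⟨(hlow n hn).trans (hle n), hlin n hn⟩,
      ⟨hlow n hn, (hle n).trans (hlin n hn)⟩⟩, fun n ξ h => ⟨?_, hup n ξ h⟩⟩
    -- On the cube the sparse grid operator is a sampling method with `n` nodes, so it competes in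
    -- the infimum defining `samplingNumber` and inherits its lower bound.
    obtain ⟨X, Φ, -, hΦ, hX⟩ := hrep n ξ h
    rw [worstError_congr _ q hX]
    exact (hlow n h.one_le).trans (samplingNumber_le_worstError _ X hΦ)
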